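/- **Theorem 4.3 (Error estimate for step 2).** Let $\lambda,L_1,L_2,T>0$ and let $u$ be a solution of $$u_t+u(u_x+u_y)-\lambda\Delta u=0\quad\text{on }\mathbb R^2\times(0,T],\qquad u(x,y,0)=u_0(x,y),$$ that is $L_1$-periodic in $x$ and $L_2$-periodic in $y$. Assume $u\in C^{4,2}$, i.e. all derivatives of $u$ in $(x,y)$ of total order at most $4$ and all derivatives in $t$ of order at most $2$ exist and are continuous on $\mathbb R^2\times[0,T]$. Fix integers $k_h,k_\tau\ge 1$ (the step-size ratios). Then there is a constant $C>0$, independent of the step sizes, such that the following holds for all positive integers $M_1,M_2,N$ and all $h_c$ with $L_1=h_cM_1$, $L_2=h_cM_2$. Put $\tau_c=T/N$, $h_f=h_c/k_h$, $\tau_f=\tau_c/k_\tau$. *Notation.* Mesh functions are indexed by $\mathbb Z^2$; on the coarse grid they have periods $M_1$ and $M_2$ in the two indices, on the fine grid $k_hM_1$ and $k_hM_2$. With $h=h_c$ put $\hat\delta_xv_{ab}=\frac{v_{a+1,b}-v_{a-1,b}}{2h}$, $\delta_{xx}v_{ab}=\frac{v_{a+1,b}-2v_{ab}+v_{a-1,b}}{h^2}$,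 $\psi_x(z,v)=\frac13\big(z\,\hat\delta_xv+\hat\delta_x(zv)\big)$, define $\hat\delta_y,\delta_{yy},\psi_y$ likewise in the second index, and let $\psi_h=\psi_x+\psi_y$. For a sequence of time levels, $v^{r-\frac12}=\frac12(v^r+v^{r-1})$ and $\delta_tv^{r-\frac12}=(v^r-v^{r-1})/\tau_c$. *Coarse solution.* Let periodic mesh functions $u_c^r,v_c^r,w_c^r$ $(0\le r\le N)$ satisfy, at all coarse points, $(u_c)^0_{pq}=u_0(ph_c,qh_c)$, and $$\delta_tu_c^{r-\frac12}+\psi_h(u_c^{r-\frac12},u_c^{r-\frac12})-\tfrac{h_c^2}{2}\big[\psi_x(v_c^{r-\frac12},u_c^{r-\frac12})+\psi_y(w_c^{r-\frac12},u_c^{r-\frac12})\big]=\lambda\,(v_c^{r-\frac12}+w_c^{r-\frac12}),\quad 1\le r\le N,$$ $$v_c^r=\delta_{xx}u_c^r-\tfrac{h_c^2}{12}\delta_{xx}v_c^r,\qquad w_c^r=\delta_{yy}u_c^r-\tfrac{h_c^2}{12}\delta_{yy}w_c^r,\quad 0\le r\le N.$$ *Rough fine solution.* Let the periodic fine mesh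 functions $u_f^n$ $(0\le n\le k_\tau N)$ be obtained from $u_c$ by linear interpolation in time, $$(u_f)^{rk_\tau}_{pk_h,qk_h}=(u_c)^r_{pq},\qquad (u_f)^{(r-1)k_\tau+s}_{pk_h,qk_h}=\Big(1-\frac s{k_\tau}\Big)(u_c)^{r-1}_{pq}+\frac s{k_\tau}(u_c)^r_{pq}\quad(1\le r\le N,\ 1\le s\le k_\tau-1),$$ the first for $0\le r\le N$, and then by tensor-product cubic Lagrange interpolation in space: for $0\le p<M_1$, $0\le q<M_2$, $0\le l,m\le k_h-1$, with $x_i=ih_f$, $y_j=jh_f$, $$(u_f)^n_{pk_h+l,\,qk_h+m}=\sum_{i=0}^3\sum_{j=0}^3(u_f)^n_{(p+i)k_h,(q+j)k_h}\,\mu_i(x_{pk_h+l})\,\omega_j(y_{qk_h+m}),$$ $$\mu_i(x)=\prod_{\substack{0\le s\le3\\ s\ne i}}\frac{x-x_{(p+s)k_h}}{x_{(p+i)k_h}-x_{(p+s)k_h}},\qquad \omega_j(y)=\prod_{\substack{0\le s\le3\\ s\ne j}}\frac{y-y_{(q+s)k_h}}{y_{(q+j)k_h}-y_{(q+s)k_h}}.$$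 *Conclusion.* The error $(e_f)^n_{ij}=u(ih_f,jh_f,n\tau_f)-(u_f)^n_{ij}$ satisfies $$\|e_f^n\|:=\Big(h_f^2\sum_{i=1}^{k_hM_1}\sum_{j=1}^{k_hM_2}|(e_f)^n_{ij}|^2\Big)^{1/2}\le C(\tau_f^2+h_f^4),\qquad 0\le n\le k_\tau N.$$ -/

import Mathlib

noncomputable section

namespace TwoGrid

/-! ## The continuous problem -/

/-- `u` has the regularity `C^{4,2}` on `ℝ² × [0,T]`: all spatial derivatives (in `(x,y)`) up to
total order `4` and all time derivatives up to order `2` (one-sided at `t = 0` and `t = T`) exist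
and are continuous in `(x,y,t)` on `ℝ² × [0,T]`. -/
structure IsC42 (T : ℝ) (u : ℝ → ℝ → ℝ → ℝ) : Prop where
  space_contDiff : ∀ t ∈ Set.Icc 0 T, ContDiff ℝ 4 (fun z : ℝ × ℝ => u z.1 z.2 t)
  space_continuousOn : ∀ k : ℕ, k ≤ 4 →
    ContinuousOn
      (fun q : (ℝ × ℝ) × ℝ => iteratedFDeriv ℝ k (fun z : ℝ × ℝ => u z.1 z.2 q.2) q.1)
      (Set.univ ×ˢ Set.Icc 0 T)
  time_contDiffOn : ∀ x y : ℝ, ContDiffOn ℝ 2 (fun t => u x y t) (Set.Icc 0 T)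
  time_continuousOn : ∀ j : ℕ, j ≤ 2 →
    ContinuousOn
      (fun q : (ℝ × ℝ) × ℝ =>
        iteratedDerivWithin j (fun t => u q.1.1 q.1.2 t) (Set.Icc 0 T) q.2)
      (Set.univ ×ˢ Set.Icc 0 T)

/-- `u` solves the two-dimensional viscous Burgers equation
`u_t + u (u_x + u_y) - lam Δu = 0` on `ℝ² × (0,T]`, with initial value `u0` and periods
`L1` in `x` and `L2` in `y`. -/
structure IsBurgersSolution (lam L1 L2 T : ℝ) (u0 : ℝ → ℝ → ℝ) (u : ℝ → ℝ → ℝ → ℝ) : Prop where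
  equation : ∀ x y t : ℝ, 0 < t → t ≤ T →
    derivWithin (fun s => u x y s) (Set.Icc 0 T) t
      + u x y t * (deriv (fun ξ => u ξ y t) x + deriv (fun η => u x η t) y)
      - lam * (iteratedDeriv 2 (fun ξ => u ξ y t) x + iteratedDeriv 2 (fun η => u x η t) y) = 0
  initial : ∀ x y : ℝ, u x y 0 = u0 x y
  periodic_x : ∀ x y t : ℝ, 0 < t → t ≤ T → u (x + L1) y t = u x y t
  periodic_y : ∀ x y t : ℝ, 0 < t → t ≤ T → u x (y + L2) t = u x y t

/-! ## Mesh functions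

A mesh function is a function of two integer indices, extended periodically with `M1` points per
period in the first index and `M2` in the second. -/

/-- Membership in the space of periodic mesh functions. -/
def IsPeriodicMesh (M1 M2 : ℕ) (v : ℤ → ℤ → ℝ) : Prop :=
  (∀ a b : ℤ, v (a + M1) b = v a b) ∧ (∀ a b : ℤ, v a (b + M2) = v a b)

/-- The discrete inner product `h² ∑_{a=1}^{M1} ∑_{b=1}^{M2} u_{ab} v_{ab}`. -/
def meshInner (h : ℝ) (M1 M2 : ℕ) (u v : ℤ → ℤ → ℝ) : ℝ :=
  h ^ 2 * ∑ a ∈ Finset.Icc 1 M1, ∑ b ∈ Finset.Icc 1 M2, u (a : ℤ) (b : ℤ) * v (a : ℤ) (b : ℤ)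

/-- The discrete `L²` norm. -/
def meshNorm (h : ℝ) (M1 M2 : ℕ) (v : ℤ → ℤ → ℝ) : ℝ :=
  Real.sqrt (meshInner h M1 M2 v v)

/-- Centred first differences in `x` and `y`. -/
def dhatX (h : ℝ) (v : ℤ → ℤ → ℝ) (a b : ℤ) : ℝ := (v (a + 1) b - v (a - 1) b) / (2 * h)

def dhatY (h : ℝ) (v : ℤ → ℤ → ℝ) (a b : ℤ) : ℝ := (v a (b + 1) - v a (b - 1)) / (2 * h)

/-- Second differences in `x` and `y`. -/
def dxx (h : ℝ) (v : ℤ → ℤ → ℝ) (a b : ℤ) : ℝ :=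
  ((v (a + 1) b - v a b) / h - (v a b - v (a - 1) b) / h) / h

def dyy (h : ℝ) (v : ℤ → ℤ → ℝ) (a b : ℤ) : ℝ :=
  ((v a (b + 1) - v a b) / h - (v a b - v a (b - 1)) / h) / h

/-- `ψ_x(u,v) = (u δ̂_x v + δ̂_x (u v)) / 3`. -/
def psiX (h : ℝ) (u v : ℤ → ℤ → ℝ) (a b : ℤ) : ℝ :=
  (1 / 3) * (u a b * dhatX h v a b + dhatX h (fun i j => u i j * v i j) a b)

/-- `ψ_y(u,v) = (u δ̂_y v + δ̂_y (u v)) / 3`. -/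
def psiY (h : ℝ) (u v : ℤ → ℤ → ℝ) (a b : ℤ) : ℝ :=
  (1 / 3) * (u a b * dhatY h v a b + dhatY h (fun i j => u i j * v i j) a b)

/-- `ψ_h(u,v) = (u δ̂_h v + δ̂_h (u v)) / 3` with `δ̂_h = δ̂_x + δ̂_y`. -/
def psiH (h : ℝ) (u v : ℤ → ℤ → ℝ) (a b : ℤ) : ℝ :=
  (1 / 3) * (u a b * (dhatX h v a b + dhatY h v a b)
    + (dhatX h (fun i j => u i j * v i j) a b + dhatY h (fun i j => u i j * v i j) a b))

/-- The mean of the time levels `r` and `r + 1`. -/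
def halfLevel (v : ℕ → ℤ → ℤ → ℝ) (r : ℕ) (a b : ℤ) : ℝ := (v (r + 1) a b + v r a b) / 2

/-- The difference quotient in time between the levels `r` and `r + 1`. -/
def dtHalf (τ : ℝ) (v : ℕ → ℤ → ℤ → ℝ) (r : ℕ) (a b : ℤ) : ℝ := (v (r + 1) a b - v r a b) / τ

/-! ## Coarse grid: the nonlinear compact difference scheme -/

/-- `(u, v, w)` solves the nonlinear compact difference scheme with space step `h`, time step `τ`,
`M1 × M2` points per period and the time levels `0, …, N`. -/
structure IsCompactSchemeSolution (lam h τ : ℝ) (M1 M2 N : ℕ) (u0 : ℝ → ℝ → ℝ)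
    (u v w : ℕ → ℤ → ℤ → ℝ) : Prop where
  equation : ∀ r : ℕ, r < N → ∀ p q : ℤ, 1 ≤ p → p ≤ M1 → 1 ≤ q → q ≤ M2 →
    dtHalf τ u r p q + psiH h (halfLevel u r) (halfLevel u r) p q
      - h ^ 2 / 2 * (psiX h (halfLevel v r) (halfLevel u r) p q
          + psiY h (halfLevel w r) (halfLevel u r) p q)
      = lam * (halfLevel v r p q + halfLevel w r p q)
  v_eq : ∀ r : ℕ, r ≤ N → ∀ p q : ℤ, 1 ≤ p → p ≤ M1 → 1 ≤ q → q ≤ M2 →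
    v r p q = dxx h (u r) p q - h ^ 2 / 12 * dxx h (v r) p q
  w_eq : ∀ r : ℕ, r ≤ N → ∀ p q : ℤ, 1 ≤ p → p ≤ M1 → 1 ≤ q → q ≤ M2 →
    w r p q = dyy h (u r) p q - h ^ 2 / 12 * dyy h (w r) p q
  initial : ∀ p q : ℤ, 1 ≤ p → p ≤ M1 → 1 ≤ q → q ≤ M2 →
    u 0 p q = u0 (p * h) (q * h)
  periodic : ∀ r : ℕ, r ≤ N →
    IsPeriodicMesh M1 M2 (u r) ∧ IsPeriodicMesh M1 M2 (v r) ∧ IsPeriodicMesh M1 M2 (w r)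

/-! ## Interpolation to the fine grid -/

/-- The cubic Lagrange basis function, evaluated at `x`, that belongs to the node
`x_{(p+i) kh} = (p+i) kh h` among the four nodes `x_{(p+s) kh}`, `s = 0, 1, 2, 3`
(`h` is the fine space step). -/
def lagrangeCubic (h : ℝ) (kh : ℕ) (p : ℤ) (i : ℕ) (x : ℝ) : ℝ :=
  ∏ s ∈ (Finset.range 4).erase i,
    (x - ((p : ℝ) + s) * kh * h) / (((p : ℝ) + i) * kh * h - ((p : ℝ) + s) * kh * h)

/-- `uf` is the rough fine-grid function obtained from the coarse-grid function `uc`: at the coarse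
space nodes by linear interpolation in time, then at all fine space nodes by tensor-product cubic
Lagrange interpolation. Here `h` is the fine space step and `kh`, `kt` are the step-size ratios. -/
structure IsRoughFineSolution (h : ℝ) (M1 M2 N kh kt : ℕ)
    (uc uf : ℕ → ℤ → ℤ → ℝ) : Prop where
  node : ∀ r : ℕ, r ≤ N → ∀ p q : ℤ, 0 ≤ p → p ≤ M1 → 0 ≤ q → q ≤ M2 →
    uf (r * kt) (p * kh) (q * kh) = uc r p q
  time_interp : ∀ r : ℕ, r < N → ∀ s : ℕ, 1 ≤ s → s < kt →
    ∀ p q : ℤ, 0 ≤ p → p ≤ M1 → 0 ≤ q → q ≤ M2 →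
    uf (r * kt + s) (p * kh) (q * kh)
      = (1 - (s : ℝ) / kt) * uc r p q + (s : ℝ) / kt * uc (r + 1) p q
  space_interp : ∀ n : ℕ, n ≤ kt * N → ∀ p q : ℤ, 0 ≤ p → p < M1 → 0 ≤ q → q < M2 →
    ∀ l m : ℕ, l < kh → m < kh →
    uf n (p * kh + l) (q * kh + m)
      = ∑ i ∈ Finset.range 4, ∑ j ∈ Finset.range 4,
          uf n ((p + i) * kh) ((q + j) * kh)
            * lagrangeCubic h kh p i (((p * kh + l : ℤ) : ℝ) * h)
            * lagrangeCubic h kh q j (((q * kh + m : ℤ) : ℝ) * h)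
  periodic : ∀ n : ℕ, n ≤ kt * N → IsPeriodicMesh (kh * M1) (kh * M2) (uf n)

end TwoGrid

end

namespace TwoGrid

open MeasureTheory

/-! ## Directional averages -/

/-! The obstacle is regularity. A Taylor expansion of the truncation error of the coarse scheme
calls for about six derivatives in space and three in time, whereas only four and two are available.
The solution `u` is therefore never inserted into the scheme. A comparison function S_x S_y u takes
its place, with S = (1 - sd/12) ∘ hat (`smooth`): an average against the piecewise linear hat on
[-h, h], followed by an approximate inverse of the compact average 1 + sd/12. Since S = id + O(h^4)
(`Chain4.abs_cB_hat_sub_le`), the replacement costs nothing. Hat averages of second and first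
derivatives are exactly second differences and backward differences of segment averages, so
integrating the equation over one time step gives an exact discrete equation
(`Flow.comparison_time_difference`).

Compared with the scheme, this equation has three errors (`Flow.comparison_step`,
`Flow.cA_auxV_div`): the difference of a flux remainder divided by h, a source remainder, and a
defect σ inside the compact second difference. The two remainders are pointwise O(τ^2 + h^4). In the
energy balance (`scheme_error_step`) the flux difference is summed by parts and absorbed by
diffusion. The skew symmetry of ψ removes every term in which the numerical solution transports the
error, so no bound on the numerical solution is needed. The defect σ enters only through its
discrete H^1 seminorm.

That seminorm amounts to h^4 ∂_x^5 u and τ^2 ∂_x ∂_t^2 u, which need not exist pointwise but are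
controlled in L^2 over space-time by parabolic smoothing. The equation reads u_t = λΔu - (∂_x +
∂_y)(u^2)/2, so a finite combination g of space-time translates of u solves the same linear
equation, driven by the same combination q of translates of u^2. The energy inequality bounds the
mean square of ∇g by sup|g| and sup|q| alone (`energy_estimate`, `Flow.energy`). It is applied to
fourth order differences in space and to second difference quotients in time, whose sizes follow
from C^{4,2} (`Flow.space_residual`, `Flow.time_residual`). The averages built into the comparison
function turn sums over mesh points into integrals.

`discrete_gronwall` concludes when τ is below a fixed threshold. Above it, the exact and the
discrete solution are bounded in L^2, and O(1) is O(τ^2) (`Flow.coarse_error`). Linear interpolation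
in time and cubic interpolation in space are stable in the discrete L^2 norm and accurate to O(τ^2)
and O(h^4) (`SmoothData.fine_error`). The fixed ratios convert coarse steps into fine ones. -/

theorem intervalIntegral_swap {a b c d : ℝ} (hab : a ≤ b) (hcd : c ≤ d) (f : ℝ → ℝ → ℝ)
    (hf : Continuous fun p : ℝ × ℝ => f p.1 p.2) :
    ∫ x in a..b, ∫ y in c..d, f x y = ∫ y in c..d, ∫ x in a..b, f x y := by
  simp only [intervalIntegral.integral_of_le hab, intervalIntegral.integral_of_le hcd]
  apply MeasureTheory.integral_integral_swap
  rw [Measure.prod_restrict]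
  have : IntegrableOn (fun p : ℝ × ℝ => f p.1 p.2) (Set.Icc a b ×ˢ Set.Icc c d)
      ((volume : Measure ℝ).prod volume) :=
    hf.continuousOn.integrableOn_compact (isCompact_Icc.prod isCompact_Icc)
  exact this.mono_set (Set.prod_mono Set.Ioc_subset_Icc_self Set.Ioc_subset_Icc_self)

theorem continuous_intervalIntegral {X : Type*} [TopologicalSpace X] [FirstCountableTopology X]
    [LocallyCompactSpace X] (a b : ℝ) (f : X → ℝ → ℝ) (hf : Continuous fun p : X × ℝ => f p.1 p.2) :
    Continuous fun x => ∫ t in a..b, f x t :=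
  intervalIntegral.continuous_parametric_intervalIntegral_of_continuous' hf a b

/-- Weighted Jensen (Cauchy–Schwarz) inequality on an interval. -/
theorem sq_integral_mul_le {a b m : ℝ} (hab : a ≤ b) (hm : 0 < m) {w g : ℝ → ℝ}
    (hw : Continuous w) (hg : Continuous g) (hw0 : ∀ s ∈ Set.Icc a b, 0 ≤ w s)
    (hwm : ∫ s in a..b, w s = m) :
    (∫ s in a..b, w s * g s) ^ 2 ≤ m * ∫ s in a..b, w s * g s ^ 2 := by
  set I := ∫ s in a..b, w s * g s with hI
  -- The weighted variance of `g` about its weighted mean `I / m` is nonnegative; expanding it gives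
  -- the claim.
  have h0 : 0 ≤ ∫ s in a..b, w s * (g s - I / m) ^ 2 :=
    intervalIntegral.integral_nonneg hab fun s hs => mul_nonneg (hw0 s hs) (sq_nonneg _)
  have h1 : ∫ s in a..b, w s * (g s - I / m) ^ 2
      = (∫ s in a..b, w s * g s ^ 2) - 2 * (I / m) * I + (I / m) ^ 2 * m := by
    have : ∀ s, w s * (g s - I / m) ^ 2
        = w s * g s ^ 2 - 2 * (I / m) * (w s * g s) + (I / m) ^ 2 * w s := fun s => by ring
    simp only [this]
    rw [intervalIntegral.integral_add, intervalIntegral.integral_sub,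
      intervalIntegral.integral_const_mul, intervalIntegral.integral_const_mul, hwm]
    all_goals exact Continuous.intervalIntegrable (by fun_prop) _ _
  rw [h1] at h0
  have h2 : m * (2 * (I / m) * I - (I / m) ^ 2 * m) = I ^ 2 := by field_simp; ring
  nlinarith

section averages

variable {E : Type*} [NormedAddCommGroup E] [NormedSpace ℝ E]

/-- The weighted average of `f` along the segment from `z` to `z + v`. -/
noncomputable def avg (w : ℝ → ℝ) (v : E) (f : E → ℝ) (z : E) : ℝ :=
  ∫ a in (0 : ℝ)..1, w a * f (z + a • v)

/-- The unweighted average along a segment. -/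
noncomputable def box (v : E) (f : E → ℝ) (z : E) : ℝ := ∫ a in (0 : ℝ)..1, f (z + a • v)

/-- The average against the hat function supported on `[z - v, z + v]`. -/
noncomputable def hat (v : E) (f : E → ℝ) (z : E) : ℝ :=
  ∫ s in (0 : ℝ)..1, (1 - s) * (f (z + s • v) + f (z - s • v))

theorem box_eq_avg (v : E) (f : E → ℝ) : box v f = avg (fun _ => 1) v f := by
  funext z; simp [box, avg]

/-- Splitting the hat into two one-sided averages reduces every commutation rule for hats to
Fubini's theorem, in the form of `avg_comm`. -/
theorem hat_eq_avg (v : E) {f : E → ℝ} (hf : Continuous f) (z : E) :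
    hat v f z = avg (fun s => 1 - s) v f z + avg (fun s => 1 - s) (-v) f z := by
  unfold hat avg
  rw [← intervalIntegral.integral_add]
  · simp only [smul_neg, ← sub_eq_add_neg, mul_add]
  all_goals exact Continuous.intervalIntegrable (by fun_prop) _ _

theorem continuous_avg [LocallyCompactSpace E] {w : ℝ → ℝ} (hw : Continuous w) (v : E) {f : E → ℝ} (hf : Continuous f) :
    Continuous (avg w v f) :=
  continuous_intervalIntegral _ _ (fun z a => w a * f (z + a • v)) (by fun_prop)

theorem continuous_box [LocallyCompactSpace E] (v : E) {f : E → ℝ} (hf : Continuous f) : Continuous (box v f) :=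
  continuous_intervalIntegral _ _ (fun z a => f (z + a • v)) (by fun_prop)

theorem continuous_hat [LocallyCompactSpace E] (v : E) {f : E → ℝ} (hf : Continuous f) : Continuous (hat v f) :=
  continuous_intervalIntegral _ _ (fun z s => (1 - s) * (f (z + s • v) + f (z - s • v)))
    (by fun_prop)

theorem avg_comm {w w' : ℝ → ℝ} (hw : Continuous w) (hw' : Continuous w') (v v' : E) {f : E → ℝ}
    (hf : Continuous f) (z : E) : avg w v (avg w' v' f) z = avg w' v' (avg w v f) z := by
  unfold avg
  simp only [← intervalIntegral.integral_const_mul]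
  rw [intervalIntegral_swap zero_le_one zero_le_one _ (by fun_prop)]
  refine intervalIntegral.integral_congr fun a _ => intervalIntegral.integral_congr fun b _ => ?_
  simp only [add_right_comm z]
  ring

theorem avg_add {w : ℝ → ℝ} (hw : Continuous w) (v : E) {f g : E → ℝ} (hf : Continuous f)
    (hg : Continuous g) (z : E) :
    avg w v (fun z => f z + g z) z = avg w v f z + avg w v g z := by
  unfold avg
  rw [← intervalIntegral.integral_add]
  · simp only [mul_add]
  all_goals exact Continuous.intervalIntegrable (by fun_prop) _ _

theorem avg_hat_comm [LocallyCompactSpace E] {w : ℝ → ℝ} (hw : Continuous w) (v v' : E) {f : E → ℝ} (hf : Continuous f)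
    (z : E) : avg w v (hat v' f) z = hat v' (avg w v f) z := by
  have h1 : Continuous fun s : ℝ => 1 - s := by fun_prop
  have : hat v' f = fun z => avg (fun s => 1 - s) v' f z + avg (fun s => 1 - s) (-v') f z :=
    funext fun z => hat_eq_avg v' hf z
  rw [this, avg_add hw _ (continuous_avg h1 _ hf) (continuous_avg h1 _ hf),
    hat_eq_avg _ (continuous_avg hw _ hf), avg_comm hw h1 _ _ hf, avg_comm hw h1 _ _ hf]

theorem box_hat_comm [LocallyCompactSpace E] (v v' : E) {f : E → ℝ} (hf : Continuous f) (z : E) :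
    box v (hat v' f) z = hat v' (box v f) z := by
  rw [box_eq_avg, box_eq_avg, avg_hat_comm continuous_const _ _ hf]

theorem hat_comm [LocallyCompactSpace E] (v v' : E) {f : E → ℝ} (hf : Continuous f) (z : E) :
    hat v (hat v' f) z = hat v' (hat v f) z := by
  have h1 : Continuous fun s : ℝ => 1 - s := by fun_prop
  rw [hat_eq_avg _ (continuous_hat _ hf), avg_hat_comm h1 _ _ hf, avg_hat_comm h1 _ _ hf]
  have : hat v f = fun z => avg (fun s => 1 - s) v f z + avg (fun s => 1 - s) (-v) f z :=
    funext fun z => hat_eq_avg v hf z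
  rw [this]
  have c1 := continuous_avg h1 v hf
  have c2 := continuous_avg h1 (-v) hf
  rw [hat_eq_avg _ c1, hat_eq_avg _ c2, hat_eq_avg _ (show Continuous fun z => avg (fun s => 1 - s) v f z + avg (fun s => 1 - s) (-v) f z
      from c1.add c2), avg_add h1 _ c1 c2,
    avg_add h1 _ c1 c2]
  ring

theorem box_comm (v v' : E) {f : E → ℝ} (hf : Continuous f) (z : E) :
    box v (box v' f) z = box v' (box v f) z := by
  simp only [box_eq_avg]
  exact avg_comm continuous_const continuous_const _ _ hf z

theorem box_add (v : E) {f g : E → ℝ} (hf : Continuous f) (hg : Continuous g) (z : E) :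
    box v (fun z => f z + g z) z = box v f z + box v g z := by
  simp only [box_eq_avg]; exact avg_add continuous_const _ hf hg z

theorem box_sub (v : E) {f g : E → ℝ} (hf : Continuous f) (hg : Continuous g) (z : E) :
    box v (fun z => f z - g z) z = box v f z - box v g z :=
  intervalIntegral.integral_sub (Continuous.intervalIntegrable (by fun_prop) _ _)
    (Continuous.intervalIntegrable (by fun_prop) _ _)

theorem box_const_mul (v : E) (c : ℝ) (f : E → ℝ) (z : E) :
    box v (fun z => c * f z) z = c * box v f z :=
  intervalIntegral.integral_const_mul _ _

theorem hat_add (v : E) {f g : E → ℝ} (hf : Continuous f) (hg : Continuous g) (z : E) :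
    hat v (fun z => f z + g z) z = hat v f z + hat v g z := by
  unfold hat
  rw [← intervalIntegral.integral_add]
  · exact intervalIntegral.integral_congr fun s _ => by ring
  all_goals exact Continuous.intervalIntegrable (by fun_prop) _ _

theorem hat_const_mul (v : E) (c : ℝ) (f : E → ℝ) (z : E) :
    hat v (fun z => c * f z) z = c * hat v f z := by
  unfold hat
  rw [← intervalIntegral.integral_const_mul]
  exact intervalIntegral.integral_congr fun s _ => by ring

theorem hat_sub (v : E) {f g : E → ℝ} (hf : Continuous f) (hg : Continuous g) (z : E) :
    hat v (fun z => f z - g z) z = hat v f z - hat v g z := by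
  have := hat_add v hf (g := fun z => (-1) * g z) (by fun_prop) z
  rw [hat_const_mul] at this
  rw [sub_eq_add_neg, ← neg_one_mul, ← this]
  congr 1; funext z; ring

theorem avg_shift (w : ℝ → ℝ) (v c : E) (f : E → ℝ) (z : E) :
    avg w v f (z + c) = avg w v (fun z => f (z + c)) z := by
  simp only [avg, add_right_comm z]

theorem box_shift (v c : E) (f : E → ℝ) (z : E) :
    box v f (z + c) = box v (fun z => f (z + c)) z := by
  simp only [box, add_right_comm z]

theorem hat_shift (v c : E) (f : E → ℝ) (z : E) :
    hat v f (z + c) = hat v (fun z => f (z + c)) z := by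
  simp only [hat, add_right_comm z, add_sub_right_comm z]

theorem abs_avg_le {w : ℝ → ℝ} {m K : ℝ} (hw : Continuous w) (hw0 : ∀ s ∈ Set.Icc (0 : ℝ) 1, 0 ≤ w s)
    (hwm : ∫ s in (0 : ℝ)..1, w s = m) (v : E) (f : E → ℝ) (z : E)
    (hf : ∀ a ∈ Set.Icc (0 : ℝ) 1, |f (z + a • v)| ≤ K) : |avg w v f z| ≤ m * K := by
  rw [avg, ← hwm, ← intervalIntegral.integral_mul_const, ← Real.norm_eq_abs]
  refine intervalIntegral.norm_integral_le_of_norm_le zero_le_one ?_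
    (Continuous.intervalIntegrable (by fun_prop) _ _)
  refine Filter.Eventually.of_forall fun s hs => ?_
  have hs' := Set.Ioc_subset_Icc_self hs
  rw [Real.norm_eq_abs, abs_mul, abs_of_nonneg (hw0 s hs')]
  exact mul_le_mul_of_nonneg_left (hf s hs') (hw0 s hs')

theorem abs_box_le {K : ℝ} (v : E) (f : E → ℝ) (z : E)
    (hf : ∀ a ∈ Set.Icc (0 : ℝ) 1, |f (z + a • v)| ≤ K) : |box v f z| ≤ K := by
  have := abs_avg_le (w := fun _ => 1) (m := 1) continuous_const (by simp) (by simp) v f z hf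
  rwa [← box_eq_avg, one_mul] at this

theorem integral_one_sub : ∫ s in (0 : ℝ)..1, (1 - s) = 1 / 2 := by
  rw [intervalIntegral.integral_sub] <;> norm_num

theorem abs_integral_one_sub_le {K : ℝ} {g : ℝ → ℝ} (hg : ∀ s ∈ Set.Icc (0 : ℝ) 1, |g s| ≤ K) :
    |∫ s in (0 : ℝ)..1, (1 - s) * g s| ≤ K / 2 := by
  have := abs_avg_le (E := ℝ) (w := fun s => 1 - s) (m := 1 / 2) (K := K) (by fun_prop)
    (fun s hs => by linarith [hs.2]) integral_one_sub 1 g 0 (by simpa using hg)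
  simp only [avg, smul_eq_mul, mul_one, zero_add] at this
  linarith

theorem abs_hat_le {K : ℝ} (v : E) (f : E → ℝ) (z : E)
    (hf : ∀ a ∈ Set.Icc (-1 : ℝ) 1, |f (z + a • v)| ≤ K) : |hat v f z| ≤ K := by
  have := abs_integral_one_sub_le (K := 2 * K) (g := fun s => f (z + s • v) + f (z - s • v))
    fun s hs => by
      have h1 := hf s ⟨by linarith [hs.1], hs.2⟩
      have h2 := hf (-s) ⟨by linarith [hs.2], by linarith [hs.1]⟩
      rw [neg_smul, ← sub_eq_add_neg] at h2
      exact (abs_add_le _ _).trans (by linarith)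
  rw [hat]; linarith

theorem sq_integral_one_sub_le {g : ℝ → ℝ} (hg : Continuous g) :
    (∫ s in (0 : ℝ)..1, (1 - s) * g s) ^ 2 ≤ 1 / 2 * ∫ s in (0 : ℝ)..1, (1 - s) * g s ^ 2 :=
  sq_integral_mul_le zero_le_one (by norm_num) (by fun_prop) hg (fun s hs => by linarith [hs.2])
    integral_one_sub

theorem box_sq_le (v : E) {f : E → ℝ} (hf : Continuous f) (z : E) :
    box v f z ^ 2 ≤ box v (fun z => f z ^ 2) z := by
  have := sq_integral_mul_le (w := fun _ => 1) (m := 1) (g := fun s => f (z + s • v))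
    zero_le_one one_pos continuous_const (by fun_prop) (by simp) (by simp)
  simpa [box] using this

/-- Jensen for a kernel of total mass one: the weight 1 - s has mass 1/2, and this factor pays for
(a + b)^2 ≤ 2 (a^2 + b^2). -/
theorem hat_sq_le (v : E) {f : E → ℝ} (hf : Continuous f) (z : E) :
    hat v f z ^ 2 ≤ hat v (fun z => f z ^ 2) z := by
  have h1 := sq_integral_one_sub_le (g := fun s => f (z + s • v) + f (z - s • v)) (by fun_prop)
  have h2 : 1 / 2 * ∫ s in (0 : ℝ)..1, (1 - s) * (f (z + s • v) + f (z - s • v)) ^ 2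
      ≤ hat v (fun z => f z ^ 2) z := by
    rw [hat, ← intervalIntegral.integral_const_mul]
    refine intervalIntegral.integral_mono_on zero_le_one
      (Continuous.intervalIntegrable (by fun_prop) _ _)
      (Continuous.intervalIntegrable (by fun_prop) _ _) fun s hs => ?_
    have : 0 ≤ 1 - s := by linarith [hs.2]
    nlinarith [mul_nonneg this (sq_nonneg (f (z + s • v) - f (z - s • v)))]
  exact h1.trans h2

/-! ## Directional derivatives -/

/-- `f'` is the derivative of `f` in the direction `v` at every point. -/
def DD (v : E) (f f' : E → ℝ) : Prop :=
  ∀ (z : E) (s : ℝ), HasDerivAt (fun s : ℝ => f (z + s • v)) (f' (z + s • v)) s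

theorem DD.smul {v : E} {f f' : E → ℝ} (h : DD v f f') (c : ℝ) :
    DD (c • v) f (fun z => c * f' z) := fun z s => by
  have := (h z (s * c)).comp s ((hasDerivAt_id s).mul_const c)
  simp only [Function.comp_def, id, one_mul, mul_smul] at this
  rwa [mul_comm] at this

theorem DD.shift {v : E} {f f' : E → ℝ} (h : DD v f f') (w : E) :
    DD v (fun z => f (z + w)) (fun z => f' (z + w)) := fun z s => by
  have := h (z + w) s
  simpa only [add_right_comm z] using this

theorem DD.add {v : E} {f f' g g' : E → ℝ} (h : DD v f f') (k : DD v g g') :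
    DD v (fun z => f z + g z) (fun z => f' z + g' z) := fun z s => (h z s).add (k z s)

theorem DD.const_mul {v : E} {f f' : E → ℝ} (c : ℝ) (h : DD v f f') :
    DD v (fun z => c * f z) (fun z => c * f' z) := fun z s => (h z s).const_mul c

theorem DD.mul {v : E} {f f' g g' : E → ℝ} (h : DD v f f') (k : DD v g g') :
    DD v (fun z => f z * g z) (fun z => f' z * g z + f z * g' z) := fun z s => (h z s).mul (k z s)

theorem DD.sum {ι : Type*} (J : Finset ι) {v : E} {f f' : ι → E → ℝ}
    (h : ∀ j ∈ J, DD v (f j) (f' j)) :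
    DD v (fun z => ∑ j ∈ J, f j z) (fun z => ∑ j ∈ J, f' j z) := fun z s =>
  HasDerivAt.fun_sum fun j hj => h j hj z s

theorem DD.box_eq {v : E} {f f' : E → ℝ} (h : DD v f f') (hf' : Continuous f') (z : E) :
    box v f' z = f (z + v) - f z := by
  have := intervalIntegral.integral_eq_sub_of_hasDerivAt (a := 0) (b := 1)
    (fun s _ => h z s) (Continuous.intervalIntegrable (by fun_prop) _ _)
  simpa [box] using this

/-- Integration by parts; the weight vanishes at s = 1, so the only boundary term is at the base
point. -/
theorem DD.integral_one_sub_mul {v : E} {f f' : E → ℝ} (h : DD v f f') (hf : Continuous f)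
    (hf' : Continuous f') (z : E) :
    ∫ s in (0 : ℝ)..1, (1 - s) * f' (z + s • v) = box v f z - f z := by
  have h1 : ∀ s ∈ Set.uIcc (0 : ℝ) 1, HasDerivAt (fun s : ℝ => (1 - s) * f (z + s • v))
      (-1 * f (z + s • v) + (1 - s) * f' (z + s • v)) s := fun s _ => by
    exact ((hasDerivAt_id s).const_sub 1).mul (h z s)
  have h2 := intervalIntegral.integral_eq_sub_of_hasDerivAt h1
    (Continuous.intervalIntegrable (by fun_prop) _ _)
  rw [intervalIntegral.integral_add, intervalIntegral.integral_const_mul] at h2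
  · simp only [box]
    simp at h2
    linarith
  all_goals exact Continuous.intervalIntegrable (by fun_prop) _ _

theorem DD.neg {v : E} {f f' : E → ℝ} (h : DD v f f') : DD (-v) f (fun z => - f' z) := by
  have := h.smul (-1)
  simpa using this

theorem box_neg (v : E) (f : E → ℝ) (z : E) : box (-v) f (z + v) = box v f z := by
  have := intervalIntegral.integral_comp_sub_left (a := 0) (b := 1) (fun s => f (z + s • v)) (1 : ℝ)
  simp only [sub_self, sub_zero] at this
  rw [box, box, ← this]
  refine intervalIntegral.integral_congr fun s _ => ?_
  congr 1
  simp only [sub_smul, one_smul, smul_neg]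
  abel

/-- Averaging the first derivative against the hat gives a backward difference of box averages. -/
theorem DD.hat_eq {v : E} {f f' : E → ℝ} (h : DD v f f') (hf : Continuous f)
    (hf' : Continuous f') (z : E) :
    hat v f' z = box v f z - box v f (z - v) := by
  rw [hat_eq_avg v hf']
  have h1 := h.integral_one_sub_mul hf hf' z
  have h2 := h.neg.integral_one_sub_mul hf hf'.neg z
  simp only [mul_neg, intervalIntegral.integral_neg] at h2
  have h3 := box_neg v f (z - v)
  rw [sub_add_cancel] at h3
  unfold avg
  rw [h1]
  linarith

/-- Averaging the second derivative against the hat gives the second difference. -/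
theorem DD.hat_eq_second {v : E} {f f' f'' : E → ℝ} (h : DD v f f') (h' : DD v f' f'')
    (hf' : Continuous f') (hf'' : Continuous f'') (z : E) :
    hat v f'' z = f (z + v) - 2 * f z + f (z - v) := by
  rw [h'.hat_eq hf' hf'', h.box_eq hf', h.box_eq hf', sub_add_cancel]
  ring

/-! ## Cell averages and sampling sums -/

theorem box_mono (v : E) {f g : E → ℝ} (hf : Continuous f) (hg : Continuous g) (z : E)
    (h : ∀ a ∈ Set.Icc (0 : ℝ) 1, f (z + a • v) ≤ g (z + a • v)) : box v f z ≤ box v g z :=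
  intervalIntegral.integral_mono_on zero_le_one (Continuous.intervalIntegrable (by fun_prop) _ _)
    (Continuous.intervalIntegrable (by fun_prop) _ _) h

theorem box_congr (v : E) {f g : E → ℝ} (z : E)
    (h : ∀ a ∈ Set.Icc (0 : ℝ) 1, f (z + a • v) = g (z + a • v)) : box v f z = box v g z :=
  intervalIntegral.integral_congr fun a ha => h a (by rwa [Set.uIcc_of_le zero_le_one] at ha)

theorem mul_box_smul (v : E) (c : ℝ) (f : E → ℝ) (z : E) :
    c * box (c • v) f z = ∫ t in (0 : ℝ)..c, f (z + t • v) := by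
  have := intervalIntegral.mul_integral_comp_mul_right (a := 0) (b := 1) (c := c)
    (f := fun t => f (z + t • v))
  simpa [box, smul_smul] using this

theorem sum_box (v : E) (M : ℕ) {f : E → ℝ} (hf : Continuous f) (z : E) :
    ∑ p ∈ Finset.range M, box v f (z + (p : ℝ) • v) = M * box ((M : ℝ) • v) f z := by
  rw [mul_box_smul]
  have h := intervalIntegral.sum_integral_adjacent_intervals (μ := volume) (n := M)
    (f := fun t => f (z + t • v)) (a := fun k : ℕ => (k : ℝ))
    (fun k _ => Continuous.intervalIntegrable (by fun_prop) _ _)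
  simp only [Nat.cast_zero] at h
  rw [← h]
  refine Finset.sum_congr rfl fun p _ => ?_
  have := intervalIntegral.integral_comp_add_left (a := 0) (b := 1) (fun t => f (z + t • v)) (p : ℝ)
  simp only [add_zero] at this
  push_cast
  rw [← this]
  simp only [box, add_smul, add_assoc]

theorem box_periodic {P : E} {f : E → ℝ} (hP : ∀ z, f (z + P) = f z) (z : E) (c : ℝ) :
    box P f (z + c • P) = box P f z := by
  have hper : Function.Periodic (fun t : ℝ => f (z + t • P)) 1 := fun t => by
    simp only [add_smul, one_smul, ← add_assoc, hP]
  have h1 := hper.intervalIntegral_add_eq c 0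
  have h2 := intervalIntegral.integral_comp_add_left (a := 0) (b := 1) (fun t => f (z + t • P)) c
  simp only [add_zero, zero_add] at h1 h2
  rw [h1] at h2
  rw [box, box, ← h2]
  simp only [add_smul, add_assoc]

theorem sum_range_shift {M : ℕ} {g : ℕ → ℝ} (hg : g M = g 0) :
    ∑ p ∈ Finset.range M, g (p + 1) = ∑ p ∈ Finset.range M, g p := by
  have := Finset.sum_range_succ g M
  rw [Finset.sum_range_succ', hg] at this
  linarith

/-- The translates of the hat form a partition of unity. -/
theorem sum_hat (w : E) (M : ℕ) {f : E → ℝ} (hf : Continuous f)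
    (hper : ∀ z, f (z + (M : ℝ) • w) = f z) (z : E) :
    ∑ p ∈ Finset.range M, hat w f (z + (p : ℝ) • w) = M * box ((M : ℝ) • w) f z := by
  rw [← sum_box w M hf z]
  -- With `L` the first moment over a segment, the hat average is the segment average plus a
  -- difference of translates of `L`. Over a full period these moments cancel, and the segments tile
  -- the period.
  set L : E → ℝ := fun z => ∫ s in (0 : ℝ)..1, s * f (z + s • w) with hL
  have h1 : ∀ z, hat w f z = box w f z - L z + L (z - w) := fun z => by
    have hr := intervalIntegral.integral_comp_sub_left (a := 0) (b := 1)
      (fun s => s * f (z - w + s • w)) (1 : ℝ)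
    simp only [sub_self, sub_zero] at hr
    have hr' : L (z - w) = ∫ s in (0 : ℝ)..1, (1 - s) * f (z - s • w) := by
      rw [hL]
      simp only
      rw [← hr]
      refine intervalIntegral.integral_congr fun s _ => ?_
      simp only [sub_smul, one_smul]
      congr 2
      abel
    rw [hr']
    simp only [hat, box, hL, mul_add, sub_mul, one_mul]
    rw [intervalIntegral.integral_add, intervalIntegral.integral_sub]
    all_goals exact Continuous.intervalIntegrable (by fun_prop) _ _
  simp only [h1, Finset.sum_add_distrib, Finset.sum_sub_distrib]
  have h2 := sum_range_shift (M := M) (g := fun p : ℕ => L (z - w + (p : ℝ) • w)) (by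
    simp only [hL, Nat.cast_zero, zero_smul, add_zero]
    refine intervalIntegral.integral_congr fun s _ => ?_
    rw [add_right_comm, hper])
  have h3 : ∀ p : ℕ, L (z - w + ((p + 1 : ℕ) : ℝ) • w) = L (z + (p : ℝ) • w) := fun p => by
    congr 1; push_cast; rw [add_smul, one_smul]; abel
  have h4 : ∀ p : ℕ, L (z + (p : ℝ) • w - w) = L (z - w + (p : ℝ) • w) := fun p => by
    congr 1; abel
  simp only [h3] at h2
  simp only [h4, h2]
  ring

/-- Discrete differences of hat averages are controlled by the derivative in mean square. -/
theorem sum_sq_hat_diff_le [LocallyCompactSpace E] (v w : E) (M1 M2 : ℕ) {f f' : E → ℝ} (h : DD v f f')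
    (hf' : Continuous f') (hper : ∀ z, f' (z + (M2 : ℝ) • w) = f' z) (z : E) :
    ∑ p ∈ Finset.range M1, ∑ q ∈ Finset.range M2,
        hat w (fun z => f (z + v) - f z) (z + (p : ℝ) • v + (q : ℝ) • w) ^ 2
      ≤ M1 * (M2 * box ((M1 : ℝ) • v) (box ((M2 : ℝ) • w) fun z => f' z ^ 2) z) := by
  have hc : Continuous fun z => f' z ^ 2 := by fun_prop
  -- The forward difference is itself a segment average of the derivative along `v`, while the hat
  -- averages along `w`. Jensen moves the square inside both; the segments along `v` then tile, the
  -- hats along `w` sum to one, and point samples become an integral over the cell.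
  have hΔ : (fun z => f (z + v) - f z) = box v f' := funext fun z => (h.box_eq hf' z).symm
  have hcb := continuous_box v hc
  have h1 : ∀ z, hat w (fun z => f (z + v) - f z) z ^ 2 ≤ hat w (box v fun z => f' z ^ 2) z := by
    intro z
    rw [hΔ]
    refine (hat_sq_le w (continuous_box v hf') z).trans ?_
    refine intervalIntegral.integral_mono_on zero_le_one ?_ ?_ fun s hs => ?_
    · have := continuous_box v hf'
      exact Continuous.intervalIntegrable (by fun_prop) _ _
    · exact Continuous.intervalIntegrable (by fun_prop) _ _
    · exact mul_le_mul_of_nonneg_left (add_le_add (box_sq_le v hf' _) (box_sq_le v hf' _))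
        (by linarith [hs.2])
  calc _ ≤ ∑ p ∈ Finset.range M1, ∑ q ∈ Finset.range M2,
        hat w (box v fun z => f' z ^ 2) (z + (p : ℝ) • v + (q : ℝ) • w) :=
        Finset.sum_le_sum fun p _ => Finset.sum_le_sum fun q _ => h1 _
    _ = ∑ p ∈ Finset.range M1, M2 * box v (box ((M2 : ℝ) • w) fun z => f' z ^ 2)
          (z + (p : ℝ) • v) := by
        refine Finset.sum_congr rfl fun p _ => ?_
        rw [sum_hat w M2 hcb, box_comm _ _ hc]
        intro z
        simp only [box]
        refine intervalIntegral.integral_congr fun s _ => ?_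
        rw [add_right_comm, hper]
    _ = _ := by
        rw [← Finset.mul_sum, sum_box v M1 (continuous_box _ hc)]
        ring

/-! ## The parabolic energy estimate -/

theorem box_deriv_periodic {e : E} {L : ℝ} (hL : L ≠ 0) {F F' : E → ℝ} (h : DD e F F')
    (hF' : Continuous F') (hper : ∀ z, F (z + L • e) = F z) (z : E) : box (L • e) F' z = 0 := by
  have h1 := (h.smul L).box_eq (by fun_prop) z
  rw [box_const_mul, hper, sub_self] at h1
  exact (mul_eq_zero.mp h1).resolve_left hL

/-- Testing the equation with 2g and integrating by parts in space puts the derivative of `q` onto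
`g`, where the diffusion absorbs it. The bound thus involves only the sizes of `g` and `q`: one
derivative of `g` is gained in mean square. -/
theorem energy_estimate [LocallyCompactSpace E] {lam L1 L2 T ε : ℝ} (hlam : 0 < lam) (hL1 : L1 ≠ 0)
    (hL2 : L2 ≠ 0) (hT : 0 ≤ T) (ex ey et : E) {g gx gxx gy gyy q qx qy : E → ℝ}
    (cg : Continuous g) (cgx : Continuous gx) (cgxx : Continuous gxx) (cgy : Continuous gy)
    (cgyy : Continuous gyy) (cq : Continuous q) (cqx : Continuous qx) (cqy : Continuous qy)
    (dgx : DD ex g gx) (dgxx : DD ex gx gxx) (dgy : DD ey g gy) (dgyy : DD ey gy gyy)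
    (dqx : DD ex q qx) (dqy : DD ey q qy)
    (pg : ∀ z, g (z + L1 • ex) = g z) (pgx : ∀ z, gx (z + L1 • ex) = gx z)
    (pq : ∀ z, q (z + L1 • ex) = q z)
    (pg' : ∀ z, g (z + L2 • ey) = g z) (pgy : ∀ z, gy (z + L2 • ey) = gy z)
    (pq' : ∀ z, q (z + L2 • ey) = q z)
    (heq : ∀ a b t : ℝ, 0 < t → t < T →
      HasDerivAt (fun t : ℝ => g (a • (L1 • ex) + b • (L2 • ey) + t • et))
        (lam * (gxx (a • (L1 • ex) + b • (L2 • ey) + t • et)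
            + gyy (a • (L1 • ex) + b • (L2 • ey) + t • et))
          - 1 / 2 * (qx (a • (L1 • ex) + b • (L2 • ey) + t • et)
            + qy (a • (L1 • ex) + b • (L2 • ey) + t • et))) t)
    (hgε : ∀ a b t : ℝ, 0 ≤ t → t ≤ T → |g (a • (L1 • ex) + b • (L2 • ey) + t • et)| ≤ ε)
    (hqε : ∀ a b t : ℝ, 0 ≤ t → t ≤ T → |q (a • (L1 • ex) + b • (L2 • ey) + t • et)| ≤ ε) :
    ∫ t in (0 : ℝ)..T, box (L1 • ex) (box (L2 • ey) fun z => gx z ^ 2 + gy z ^ 2) (t • et)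
      ≤ (1 / lam + T / (2 * lam ^ 2)) * ε ^ 2 := by
  set P := L1 • ex with hP
  set Q := L2 • ey with hQ
  set G : E → ℝ := fun z => lam * (gxx z + gyy z) - 1 / 2 * (qx z + qy z) with hG
  have cG : Continuous G := by fun_prop
  -- `Fx` and `Fy` are the derivatives along `ex` and `ey` of the periodic functions 2λ g g_x - g q
  -- and 2λ g g_y - g q, hence have mean zero over a cell.
  set Fx : E → ℝ := fun z => 2 * lam * (gx z * gx z + g z * gxx z) + (-1) * (gx z * q z + g z * qx z)
  set Fy : E → ℝ := fun z => 2 * lam * (gy z * gy z + g z * gyy z) + (-1) * (gy z * q z + g z * qy z)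
  have dFx : DD ex (fun z => 2 * lam * (g z * gx z) + (-1) * (g z * q z)) Fx :=
    ((dgx.mul dgxx).const_mul _).add ((dgx.mul dqx).const_mul _)
  have dFy : DD ey (fun z => 2 * lam * (g z * gy z) + (-1) * (g z * q z)) Fy :=
    ((dgy.mul dgyy).const_mul _).add ((dgy.mul dqy).const_mul _)
  have cFx : Continuous Fx := by fun_prop
  have cFy : Continuous Fy := by fun_prop
  have hFx : ∀ z, box P (box Q Fx) z = 0 := fun z => by
    rw [box_comm _ _ cFx]
    have : box P Fx = fun _ => 0 := funext fun z =>
      box_deriv_periodic hL1 dFx cFx (fun z => by simp only [← hP, pg, pgx, pq]) z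
    rw [this]; simp [box]
  have hFy : ∀ z, box P (box Q Fy) z = 0 := fun z => by
    have : box Q Fy = fun _ => 0 := funext fun z =>
      box_deriv_periodic hL2 dFy cFy (fun z => by simp only [← hQ, pg', pgy, pq']) z
    rw [this]; simp [box]
  -- the pointwise inequality, averaged over a cell
  have cS : Continuous fun z => gx z ^ 2 + gy z ^ 2 := by fun_prop
  have cgG : Continuous fun z => 2 * (g z * G z) := by fun_prop
  have key : ∀ t ∈ Set.Icc (0 : ℝ) T,
      lam * box P (box Q fun z => gx z ^ 2 + gy z ^ 2) (t • et)
        ≤ ε ^ 2 / (2 * lam) - box P (box Q fun z => 2 * (g z * G z)) (t • et) := by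
    intro t ht
    -- Half of the dissipation 2λ|∇g|^2 absorbs g_x q and g_y q by completing squares. Each
    -- direction costs q^2/(4λ).
    have hpt : ∀ z, lam * (gx z ^ 2 + gy z ^ 2) + 2 * (g z * G z)
        ≤ (Fx z + Fy z) + q z ^ 2 / (2 * lam) := fun z => by
      have e1 : 0 ≤ (2 * lam * gx z - q z) ^ 2 / (4 * lam) := by positivity
      have e2 : 0 ≤ (2 * lam * gy z - q z) ^ 2 / (4 * lam) := by positivity
      have e3 : (2 * lam * gx z - q z) ^ 2 / (4 * lam)
          = lam * gx z ^ 2 - gx z * q z + q z ^ 2 / (4 * lam) := by field_simp; ring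
      have e4 : (2 * lam * gy z - q z) ^ 2 / (4 * lam)
          = lam * gy z ^ 2 - gy z * q z + q z ^ 2 / (4 * lam) := by field_simp; ring
      have e5 : q z ^ 2 / (2 * lam) = q z ^ 2 / (4 * lam) + q z ^ 2 / (4 * lam) := by
        field_simp; ring
      simp only [hG, Fx, Fy]
      linarith
    have c0 : Continuous fun z => ε ^ 2 / (2 * lam) + (Fx z + Fy z) := by fun_prop
    have c1 : Continuous fun z => lam * (gx z ^ 2 + gy z ^ 2) + 2 * (g z * G z) := by fun_prop
    have h1 : box P (box Q fun z => lam * (gx z ^ 2 + gy z ^ 2) + 2 * (g z * G z)) (t • et)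
        ≤ box P (box Q fun z => ε ^ 2 / (2 * lam) + (Fx z + Fy z)) (t • et) := by
      refine box_mono _ (continuous_box _ c1) (continuous_box _ c0) _ fun a _ =>
        box_mono _ c1 c0 _ fun b _ => (hpt _).trans ?_
      have hq := hqε a b t ht.1 ht.2
      rw [show a • P + b • Q + t • et = t • et + a • P + b • Q by abel] at hq
      have : q (t • et + a • P + b • Q) ^ 2 / (2 * lam) ≤ ε ^ 2 / (2 * lam) := by
        apply div_le_div_of_nonneg_right _ (by positivity)
        rw [← sq_abs]; gcongr
      linarith
    have h2 : box P (box Q fun z => lam * (gx z ^ 2 + gy z ^ 2) + 2 * (g z * G z)) (t • et)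
        = lam * box P (box Q fun z => gx z ^ 2 + gy z ^ 2) (t • et)
          + box P (box Q fun z => 2 * (g z * G z)) (t • et) := by
      rw [show (box Q fun z => lam * (gx z ^ 2 + gy z ^ 2) + 2 * (g z * G z))
        = fun z => lam * box Q (fun z => gx z ^ 2 + gy z ^ 2) z + box Q (fun z => 2 * (g z * G z)) z
        from funext fun z => by rw [box_add Q (by fun_prop) (by fun_prop), box_const_mul]]
      have := continuous_box Q cS
      have := continuous_box Q cgG
      rw [box_add P (by fun_prop) (by fun_prop), box_const_mul]
    have h3 : box P (box Q fun z => ε ^ 2 / (2 * lam) + (Fx z + Fy z)) (t • et)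
        = ε ^ 2 / (2 * lam) := by
      rw [show (box Q fun z => ε ^ 2 / (2 * lam) + (Fx z + Fy z))
        = fun z => ε ^ 2 / (2 * lam) + (box Q Fx z + box Q Fy z)
        from funext fun z => by
          rw [box_add Q (by fun_prop) (by fun_prop), box_add Q cFx cFy]
          simp [box]]
      have := continuous_box Q cFx
      have := continuous_box Q cFy
      rw [box_add P (by fun_prop) (by fun_prop), box_add P (by fun_prop) (by fun_prop), hFx, hFy]
      simp [box]
    linarith
  -- integration in time
  have hint : ∫ t in (0 : ℝ)..T, box P (box Q fun z => 2 * (g z * G z)) (t • et)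
      = box P (box Q fun z => g (z + T • et) ^ 2 - g z ^ 2) 0 := by
    have e1 := mul_box_smul et T (box P (box Q fun z => 2 * (g z * G z))) 0
    simp only [zero_add] at e1
    rw [← e1, box_comm _ _ (continuous_box _ cgG),
      show box (T • et) (box Q fun z => 2 * (g z * G z))
        = box Q (box (T • et) fun z => 2 * (g z * G z)) from funext fun z => box_comm _ _ cgG z,
      ← box_const_mul]
    refine box_congr _ _ fun a _ => ?_
    rw [← box_const_mul]
    refine box_congr _ _ fun b _ => ?_
    rw [mul_box_smul, zero_add]
    have hcont : ContinuousOn (fun t : ℝ => g (a • P + b • Q + t • et) ^ 2) (Set.Icc 0 T) :=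
      Continuous.continuousOn (by fun_prop)
    have := intervalIntegral.integral_eq_sub_of_hasDerivAt_of_le hT hcont
      (f' := fun t => 2 * (g (a • P + b • Q + t • et) * G (a • P + b • Q + t • et)))
      (fun t ht => by
        refine ((heq a b t ht.1 ht.2).pow 2).congr_deriv ?_
        simp only [G]; norm_num; ring)
      (Continuous.intervalIntegrable (by fun_prop) _ _)
    simpa using this
  have cS2 := continuous_box P (continuous_box Q cS)
  have cgG2 := continuous_box P (continuous_box Q cgG)
  have hmain : lam * ∫ t in (0 : ℝ)..T, box P (box Q fun z => gx z ^ 2 + gy z ^ 2) (t • et)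
      ≤ T * (ε ^ 2 / (2 * lam)) - box P (box Q fun z => g (z + T • et) ^ 2 - g z ^ 2) 0 := by
    rw [← hint, ← intervalIntegral.integral_const_mul]
    have : T * (ε ^ 2 / (2 * lam)) = ∫ _ in (0 : ℝ)..T, ε ^ 2 / (2 * lam) := by simp [mul_div_assoc]
    rw [this, ← intervalIntegral.integral_sub (by simp)
      (Continuous.intervalIntegrable (by fun_prop) _ _)]
    exact intervalIntegral.integral_mono_on hT (Continuous.intervalIntegrable (by fun_prop) _ _)
      (Continuous.intervalIntegrable (by fun_prop) _ _) key
  -- The energy at the final time is dropped; only the initial energy, at most ε^2, is lost.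
  have hlow : -ε ^ 2 ≤ box P (box Q fun z => g (z + T • et) ^ 2 - g z ^ 2) 0 := by
    have c3 : Continuous fun z => g (z + T • et) ^ 2 - g z ^ 2 := by fun_prop
    have : box P (box Q fun _ => -ε ^ 2) (0 : E) = -ε ^ 2 := by simp [box]
    rw [← this]
    refine box_mono _ (continuous_box _ continuous_const) (continuous_box _ c3) _ fun a _ =>
        box_mono _ continuous_const c3 _ fun b _ => ?_
    have h0 := hgε a b 0 le_rfl hT
    simp only [zero_smul, add_zero] at h0
    have : g (0 + a • P + b • Q) ^ 2 ≤ ε ^ 2 := by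
      rw [zero_add, ← sq_abs]; gcongr
    nlinarith [sq_nonneg (g (0 + a • P + b • Q + T • et))]
  have hfin : lam * ∫ t in (0 : ℝ)..T, box P (box Q fun z => gx z ^ 2 + gy z ^ 2) (t • et)
      ≤ lam * ((1 / lam + T / (2 * lam ^ 2)) * ε ^ 2) := by
    have : lam * ((1 / lam + T / (2 * lam ^ 2)) * ε ^ 2) = T * (ε ^ 2 / (2 * lam)) + ε ^ 2 := by
      field_simp; ring
    rw [this]; linarith
  exact le_of_mul_le_mul_left hfin hlam

end averages

/-! ## Regularity of the exact solution -/

/-- The unit vector of the `x`-axis in the space of the variables `(x, y, t)`. -/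
def eX : ℝ × ℝ × ℝ := (1, 0, 0)

/-- The unit vector of the `y`-axis. -/
def eY : ℝ × ℝ × ℝ := (0, 1, 0)

/-- The unit vector of the `t`-axis. -/
def eT : ℝ × ℝ × ℝ := (0, 0, 1)

/-- A chain of four successive directional derivatives, all continuous and bounded by `K`. -/
structure Chain4 {E : Type*} [NormedAddCommGroup E] [NormedSpace ℝ E] (v : E) (K : ℝ)
    (f : ℕ → E → ℝ) : Prop where
  deriv : ∀ i < 4, DD v (f i) (f (i + 1))
  cont : ∀ i ≤ 4, Continuous (f i)
  bdd : ∀ i ≤ 4, ∀ z, |f i z| ≤ K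

/-- The solution, extended to all times, together with its derivatives: `ux i` and `uy i` are the
derivatives of order `i` in `x` and in `y`, `ut` and `utt` the time derivatives. -/
structure SmoothData (lam L1 L2 T : ℝ) (u : ℝ → ℝ → ℝ → ℝ) (K : ℝ) (ux uy : ℕ → ℝ × ℝ × ℝ → ℝ)
    (ut utt : ℝ × ℝ × ℝ → ℝ) : Prop where
  chain_x : Chain4 eX K ux
  chain_y : Chain4 eY K uy
  zero_eq : uy 0 = ux 0
  per_x : ∀ i ≤ 4, ∀ z, ux i (z + L1 • eX) = ux i z ∧ ux i (z + L2 • eY) = ux i z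
  per_y : ∀ i ≤ 4, ∀ z, uy i (z + L1 • eX) = uy i z ∧ uy i (z + L2 • eY) = uy i z
  cont_t : Continuous ut
  cont_tt : Continuous utt
  bdd_t : ∀ z, |ut z| ≤ K
  bdd_tt : ∀ z, |utt z| ≤ K
  unif_tt : ∀ ω > 0, ∃ δ > 0, ∀ x y t t' : ℝ, |t - t'| ≤ δ → |utt (x, y, t) - utt (x, y, t')| ≤ ω
  deriv_t : ∀ x y, ∀ t ∈ Set.Ioo 0 T, HasDerivAt (fun s => ux 0 (x, y, s)) (ut (x, y, t)) t
  deriv_tt : ∀ x y, ∀ t ∈ Set.Ioo 0 T, HasDerivAt (fun s => ut (x, y, s)) (utt (x, y, t)) t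
  equation : ∀ x y, ∀ t ∈ Set.Ioo 0 T, ut (x, y, t)
    = lam * (ux 2 (x, y, t) + uy 2 (x, y, t)) - ux 0 (x, y, t) * (ux 1 (x, y, t) + uy 1 (x, y, t))
  agree : ∀ x y, ∀ t ∈ Set.Icc 0 T, ux 0 (x, y, t) = u x y t

/-- On the constant tuple v, …, v the iterated Fréchet derivative is the iterated directional
derivative; this turns joint smoothness in space into the chains used below. -/
theorem hasDerivAt_iteratedFDeriv_line {E : Type*} [NormedAddCommGroup E] [NormedSpace ℝ E]
    {n : ℕ} {φ : E → ℝ} (h : ContDiff ℝ n φ) (v z : E) {i : ℕ} (hi : i < n) (s : ℝ) :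
    HasDerivAt (fun s : ℝ => iteratedFDeriv ℝ i φ (z + s • v) fun _ => v)
      (iteratedFDeriv ℝ (i + 1) φ (z + s • v) fun _ => v) s := by
  have hd : DifferentiableAt ℝ (iteratedFDeriv ℝ i φ) (z + s • v) :=
    h.differentiable_iteratedFDeriv (by exact_mod_cast hi) _
  have hl : HasDerivAt (fun s : ℝ => z + s • v) v s := by
    simpa using ((hasDerivAt_id s).smul_const v).const_add z
  have h1 := hd.hasFDerivAt.comp_hasDerivAt s hl
  have h2 := ((ContinuousMultilinearMap.apply ℝ (fun _ : Fin i => E) ℝ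
    (fun _ => v)).hasFDerivAt.comp_hasDerivAt s h1)
  rw [iteratedFDeriv_succ_apply_left]
  exact h2

/-- Periodicity in space and clamping in time reduce all values to those on a compact box. -/
theorem bounded_of_periodic {L1 L2 T : ℝ} (hL1 : 0 < L1) (hL2 : 0 < L2) (hT : 0 ≤ T)
    {f : ℝ × ℝ × ℝ → ℝ} (hf : Continuous f) (hx : ∀ z, f (z + L1 • eX) = f z)
    (hy : ∀ z, f (z + L2 • eY) = f z)
    (ht : ∀ x y t, f (x, y, t) = f (x, y, Set.projIcc 0 T hT t)) : ∃ K, ∀ z, |f z| ≤ K := by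
  obtain ⟨K, hK⟩ := ((isCompact_Icc (a := (0 : ℝ)) (b := L1)).prod
    ((isCompact_Icc (a := (0 : ℝ)) (b := L2)).prod
      (isCompact_Icc (a := (0 : ℝ)) (b := T)))).exists_bound_of_continuousOn hf.continuousOn
  refine ⟨K, fun ⟨x, y, t⟩ => ?_⟩
  rw [ht]
  set t' : ℝ := ((Set.projIcc 0 T hT t : Set.Icc 0 T) : ℝ)
  have ht' : t' ∈ Set.Icc 0 T := (Set.projIcc 0 T hT t).2
  have px : Function.Periodic (fun x => f (x, y, t')) L1 := fun x => by
    simpa [eX] using hx (x, y, t')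
  obtain ⟨x', hx', ex'⟩ := px.exists_mem_Ico₀ hL1 x
  have py : Function.Periodic (fun y => f (x', y, t')) L2 := fun y => by
    simpa [eY] using hy (x', y, t')
  obtain ⟨y', hy', ey'⟩ := py.exists_mem_Ico₀ hL2 y
  rw [ex', ey']
  exact hK (x', y', t') ⟨Set.Ico_subset_Icc_self hx', Set.Ico_subset_Icc_self hy', ht'⟩

theorem uniform_of_periodic {L1 L2 T : ℝ} (hL1 : 0 < L1) (hL2 : 0 < L2) (hT : 0 ≤ T)
    {f : ℝ × ℝ × ℝ → ℝ} (hf : Continuous f) (hx : ∀ z, f (z + L1 • eX) = f z)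
    (hy : ∀ z, f (z + L2 • eY) = f z)
    (ht : ∀ x y t, f (x, y, t) = f (x, y, Set.projIcc 0 T hT t)) :
    ∀ ω > 0, ∃ δ > 0, ∀ x y t t' : ℝ, |t - t'| ≤ δ → |f (x, y, t) - f (x, y, t')| ≤ ω := by
  intro ω hω
  have huc := ((isCompact_Icc (a := (0 : ℝ)) (b := L1)).prod
    ((isCompact_Icc (a := (0 : ℝ)) (b := L2)).prod
      (isCompact_Icc (a := (0 : ℝ)) (b := T)))).uniformContinuousOn_of_continuous hf.continuousOn
  rw [Metric.uniformContinuousOn_iff] at huc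
  obtain ⟨δ, hδ, h⟩ := huc ω hω
  refine ⟨δ / 2, by positivity, fun x y t s hts => ?_⟩
  rw [ht x y t, ht x y s]
  have hp : |(Set.projIcc 0 T hT t : ℝ) - Set.projIcc 0 T hT s| ≤ |t - s| :=
    Set.abs_projIcc_sub_projIcc hT
  set t' : ℝ := ((Set.projIcc 0 T hT t : Set.Icc 0 T) : ℝ)
  set s' : ℝ := ((Set.projIcc 0 T hT s : Set.Icc 0 T) : ℝ)
  have ht' : t' ∈ Set.Icc 0 T := (Set.projIcc 0 T hT t).2
  have hs' : s' ∈ Set.Icc 0 T := (Set.projIcc 0 T hT s).2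
  -- Periodicity is applied to the difference of two time slices, so that both samples are moved to
  -- the same point of the period cell.
  have px : Function.Periodic (fun x => f (x, y, t') - f (x, y, s')) L1 := fun x => by
    have h1 := hx (x, y, t')
    have h2 := hx (x, y, s')
    simp [eX] at h1 h2
    simp only [h1, h2]
  obtain ⟨x', hx', ex'⟩ := px.exists_mem_Ico₀ hL1 x
  have py : Function.Periodic (fun y => f (x', y, t') - f (x', y, s')) L2 := fun y => by
    have h1 := hy (x', y, t')
    have h2 := hy (x', y, s')
    simp [eY] at h1 h2
    simp only [h1, h2]
  obtain ⟨y', hy', ey'⟩ := py.exists_mem_Ico₀ hL2 y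
  rw [ex', ey']
  have := h (x', y', t') ⟨Set.Ico_subset_Icc_self hx', Set.Ico_subset_Icc_self hy', ht'⟩
    (x', y', s') ⟨Set.Ico_subset_Icc_self hx', Set.Ico_subset_Icc_self hy', hs'⟩
    (by
      simp only [Prod.dist_eq, dist_self, Real.dist_eq]
      rw [max_eq_right (a := (0 : ℝ)) (le_max_left _ _), max_eq_right (abs_nonneg _)]
      linarith)
  rw [Real.dist_eq] at this
  exact this.le

section extension

variable {T : ℝ} (hT : 0 ≤ T) (u : ℝ → ℝ → ℝ → ℝ)

/-- The spatial derivative of order `i` in direction `v`, extended to all times. -/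
noncomputable def spaceDeriv (v : ℝ × ℝ) (i : ℕ) (z : ℝ × ℝ × ℝ) : ℝ :=
  iteratedFDeriv ℝ i (fun w : ℝ × ℝ => u w.1 w.2 (Set.projIcc 0 T hT z.2.2)) (z.1, z.2.1)
    fun _ => v

/-- The time derivative of order `j`, extended to all times. -/
noncomputable def timeDeriv (j : ℕ) (z : ℝ × ℝ × ℝ) : ℝ :=
  iteratedDerivWithin j (fun t => u z.1 z.2.1 t) (Set.Icc 0 T) (Set.projIcc 0 T hT z.2.2)

variable {u}

theorem continuous_spaceDeriv (hreg : IsC42 T u) (v : ℝ × ℝ) {i : ℕ} (hi : i ≤ 4) :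
    Continuous (spaceDeriv hT u v i) := by
  have h1 := (hreg.space_continuousOn i hi).comp_continuous
    (f := fun z : ℝ × ℝ × ℝ => ((z.1, z.2.1), (Set.projIcc 0 T hT z.2.2 : ℝ)))
    (by
      have := (continuous_projIcc (h := hT)).comp (continuous_snd.comp (continuous_snd (X := ℝ) (Y := ℝ × ℝ)))
      have := continuous_subtype_val.comp this
      fun_prop)
    (fun z => ⟨trivial, (Set.projIcc 0 T hT z.2.2).2⟩)
  exact (ContinuousMultilinearMap.apply ℝ (fun _ : Fin i => ℝ × ℝ) ℝ
    (fun _ => v)).continuous.comp h1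

theorem continuous_timeDeriv (hreg : IsC42 T u) {j : ℕ} (hj : j ≤ 2) :
    Continuous (timeDeriv hT u j) :=
  (hreg.time_continuousOn j hj).comp_continuous
    (f := fun z : ℝ × ℝ × ℝ => ((z.1, z.2.1), (Set.projIcc 0 T hT z.2.2 : ℝ)))
    (by
      have := (continuous_projIcc (h := hT)).comp (continuous_snd.comp (continuous_snd (X := ℝ) (Y := ℝ × ℝ)))
      have := continuous_subtype_val.comp this
      fun_prop)
    (fun z => ⟨trivial, (Set.projIcc 0 T hT z.2.2).2⟩)

theorem dd_spaceDeriv (hreg : IsC42 T u) (v : ℝ × ℝ) {i : ℕ} (hi : i < 4) :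
    DD (v.1, v.2, (0 : ℝ)) (spaceDeriv hT u v i) (spaceDeriv hT u v (i + 1)) := fun z s => by
  have h := hasDerivAt_iteratedFDeriv_line (n := 4)
    (hreg.space_contDiff _ (Set.projIcc 0 T hT z.2.2).2) v (z.1, z.2.1) hi s
  have e : ∀ s : ℝ, (z.1, z.2.1) + s • v = (z.1 + s * v.1, z.2.1 + s * v.2) := fun s => by
    ext <;> simp
  simp only [e] at h
  simpa [spaceDeriv] using h

theorem spaceDeriv_zero (v : ℝ × ℝ) (z : ℝ × ℝ × ℝ) :
    spaceDeriv hT u v 0 z = u z.1 z.2.1 (Set.projIcc 0 T hT z.2.2) := by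
  simp [spaceDeriv]

theorem timeDeriv_zero (z : ℝ × ℝ × ℝ) :
    timeDeriv hT u 0 z = u z.1 z.2.1 (Set.projIcc 0 T hT z.2.2) := by
  simp [timeDeriv]

theorem hasDerivAt_timeDeriv (hreg : IsC42 T u) {j : ℕ} (hj : j < 2) (x y : ℝ) {t : ℝ}
    (ht : t ∈ Set.Ioo 0 T) : HasDerivAt (fun s => timeDeriv hT u j (x, y, s))
      (timeDeriv hT u (j + 1) (x, y, t)) t := by
  have hT' : 0 < T := ht.1.trans ht.2
  have hmem : Set.Icc 0 T ∈ nhds t := Icc_mem_nhds ht.1 ht.2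
  have hd := (hreg.time_contDiffOn x y).differentiableOn_iteratedDerivWithin (m := j)
    (by exact_mod_cast hj) (uniqueDiffOn_Icc hT') t (Set.Ioo_subset_Icc_self ht)
  have h1 := hd.hasDerivWithinAt.hasDerivAt hmem
  rw [← iteratedDerivWithin_succ] at h1
  have e : ∀ s ∈ Set.Icc 0 T, (Set.projIcc 0 T hT s : ℝ) = s := fun s hs => by
    rw [Set.projIcc_of_mem hT hs]
  have h2 : timeDeriv hT u (j + 1) (x, y, t)
      = iteratedDerivWithin (j + 1) (fun t => u x y t) (Set.Icc 0 T) t := by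
    simp only [timeDeriv, e t (Set.Ioo_subset_Icc_self ht)]
  rw [h2]
  refine h1.congr_of_eventuallyEq ?_
  filter_upwards [hmem] with s hs
  simp only [timeDeriv, e s hs]

end extension

/-- Times are clamped to [0, T], which makes all functions globally continuous and bounded; time
derivatives and the equation are asserted only in the open interval. Periodicity, assumed for
positive times, reaches t = 0 by continuity, and the derivatives inherit it. -/
theorem exists_smoothData {lam L1 L2 T : ℝ} (hL1 : 0 < L1) (hL2 : 0 < L2) (hT : 0 < T)
    {u0 : ℝ → ℝ → ℝ} {u : ℝ → ℝ → ℝ → ℝ} (hu : IsBurgersSolution lam L1 L2 T u0 u)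
    (hreg : IsC42 T u) : ∃ K ux uy ut utt, SmoothData lam L1 L2 T u K ux uy ut utt := by
  have hT0 := hT.le
  have hcl : Set.Icc 0 T ⊆ closure (Set.Ioc 0 T) := (closure_Ioc hT.ne).ge
  have hperx : ∀ x y, Set.EqOn (fun t => u (x + L1) y t) (fun t => u x y t) (Set.Icc 0 T) :=
    fun x y => Set.EqOn.of_subset_closure (fun t ht => hu.periodic_x x y t ht.1 ht.2)
      (hreg.time_contDiffOn _ _).continuousOn (hreg.time_contDiffOn _ _).continuousOn
      Set.Ioc_subset_Icc_self hcl
  have hpery : ∀ x y, Set.EqOn (fun t => u x (y + L2) t) (fun t => u x y t) (Set.Icc 0 T) :=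
    fun x y => Set.EqOn.of_subset_closure (fun t ht => hu.periodic_y x y t ht.1 ht.2)
      (hreg.time_contDiffOn _ _).continuousOn (hreg.time_contDiffOn _ _).continuousOn
      Set.Ioc_subset_Icc_self hcl
  have spx : ∀ v i z, spaceDeriv hT0 u v i (z + L1 • eX) = spaceDeriv hT0 u v i z := fun v i z => by
    have h := iteratedFDeriv_comp_add_right (𝕜 := ℝ)
      (f := fun w : ℝ × ℝ => u w.1 w.2 (Set.projIcc 0 T hT0 z.2.2)) i (L1, 0) (z.1, z.2.1)
    have hf : (fun w : ℝ × ℝ => u (w + (L1, 0)).1 (w + (L1, 0)).2 (Set.projIcc 0 T hT0 z.2.2))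
        = fun w : ℝ × ℝ => u w.1 w.2 (Set.projIcc 0 T hT0 z.2.2) := funext fun w => by
      simpa using hperx w.1 w.2 (Set.projIcc 0 T hT0 z.2.2).2
    rw [hf] at h
    simp only [spaceDeriv, h]
    simp [eX]
  have spy : ∀ v i z, spaceDeriv hT0 u v i (z + L2 • eY) = spaceDeriv hT0 u v i z := fun v i z => by
    have h := iteratedFDeriv_comp_add_right (𝕜 := ℝ)
      (f := fun w : ℝ × ℝ => u w.1 w.2 (Set.projIcc 0 T hT0 z.2.2)) i (0, L2) (z.1, z.2.1)
    have hf : (fun w : ℝ × ℝ => u (w + (0, L2)).1 (w + (0, L2)).2 (Set.projIcc 0 T hT0 z.2.2))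
        = fun w : ℝ × ℝ => u w.1 w.2 (Set.projIcc 0 T hT0 z.2.2) := funext fun w => by
      simpa using hpery w.1 w.2 (Set.projIcc 0 T hT0 z.2.2).2
    rw [hf] at h
    simp only [spaceDeriv, h]
    simp [eY]
  have tpx : ∀ j z, timeDeriv hT0 u j (z + L1 • eX) = timeDeriv hT0 u j z := fun j z => by
    have h := iteratedDerivWithin_congr (n := j) (hperx z.1 z.2.1) (Set.projIcc 0 T hT0 z.2.2).2
    simpa [timeDeriv, eX] using h
  have tpy : ∀ j z, timeDeriv hT0 u j (z + L2 • eY) = timeDeriv hT0 u j z := fun j z => by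
    have h := iteratedDerivWithin_congr (n := j) (hpery z.1 z.2.1) (Set.projIcc 0 T hT0 z.2.2).2
    simpa [timeDeriv, eY] using h
  have sproj : ∀ v i x y t, spaceDeriv hT0 u v i (x, y, t)
      = spaceDeriv hT0 u v i (x, y, Set.projIcc 0 T hT0 t) := fun v i x y t => by
    simp [spaceDeriv]
  have tproj : ∀ j x y t, timeDeriv hT0 u j (x, y, t)
      = timeDeriv hT0 u j (x, y, Set.projIcc 0 T hT0 t) := fun j x y t => by
    simp [timeDeriv]
  have sb : ∀ v, ∃ K, ∀ i ≤ 4, ∀ z, |spaceDeriv hT0 u v i z| ≤ K := fun v => by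
    have : ∀ i : ℕ, ∃ K, i ≤ 4 → ∀ z, |spaceDeriv hT0 u v i z| ≤ K := fun i => by
      by_cases hi : i ≤ 4
      · obtain ⟨K, hK⟩ := bounded_of_periodic hL1 hL2 hT0 (continuous_spaceDeriv hT0 hreg v hi)
          (spx v i) (spy v i) (sproj v i)
        exact ⟨K, fun _ => hK⟩
      · exact ⟨0, fun h => absurd h hi⟩
    choose K hK using this
    refine ⟨∑ i ∈ Finset.range 5, |K i|, fun i hi z => (hK i hi z).trans ((le_abs_self _).trans ?_)⟩
    exact Finset.single_le_sum (f := fun i => |K i|) (fun _ _ => abs_nonneg _)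
      (Finset.mem_range.mpr (by omega))
  obtain ⟨Kx, hKx⟩ := sb (1, 0)
  obtain ⟨Ky, hKy⟩ := sb (0, 1)
  obtain ⟨Kt, hKt⟩ := bounded_of_periodic hL1 hL2 hT0 (continuous_timeDeriv hT0 hreg one_le_two)
    (tpx 1) (tpy 1) (tproj 1)
  obtain ⟨Ktt, hKtt⟩ := bounded_of_periodic hL1 hL2 hT0 (continuous_timeDeriv hT0 hreg le_rfl)
    (tpx 2) (tpy 2) (tproj 2)
  have dx : ∀ i < 4, DD eX (spaceDeriv hT0 u (1, 0) i) (spaceDeriv hT0 u (1, 0) (i + 1)) :=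
    fun i hi => dd_spaceDeriv hT0 hreg (1, 0) hi
  have dy : ∀ i < 4, DD eY (spaceDeriv hT0 u (0, 1) i) (spaceDeriv hT0 u (0, 1) (i + 1)) :=
    fun i hi => dd_spaceDeriv hT0 hreg (0, 1) hi
  have hagree : ∀ v x y, ∀ t ∈ Set.Icc 0 T, spaceDeriv hT0 u v 0 (x, y, t) = u x y t :=
    fun v x y t ht => by
      rw [spaceDeriv_zero]; simp only [Set.projIcc_of_mem hT0 ht]
  have h0 : spaceDeriv hT0 u (1, 0) 0 = timeDeriv hT0 u 0 := funext fun z => by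
    rw [spaceDeriv_zero, timeDeriv_zero]
  refine ⟨|Kx| + |Ky| + |Kt| + |Ktt|, spaceDeriv hT0 u (1, 0), spaceDeriv hT0 u (0, 1),
    timeDeriv hT0 u 1, timeDeriv hT0 u 2, ?_⟩
  have p1 := le_abs_self Kx
  have p2 := le_abs_self Ky
  have p3 := le_abs_self Kt
  have p4 := le_abs_self Ktt
  have q1 := abs_nonneg Kx
  have q2 := abs_nonneg Ky
  have q3 := abs_nonneg Kt
  have q4 := abs_nonneg Ktt
  refine
    { chain_x := ⟨dx, fun i hi => continuous_spaceDeriv hT0 hreg _ hi,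
        fun i hi z => (hKx i hi z).trans (by linarith)⟩
      chain_y := ⟨dy, fun i hi => continuous_spaceDeriv hT0 hreg _ hi,
        fun i hi z => (hKy i hi z).trans (by linarith)⟩
      zero_eq := funext fun z => by rw [spaceDeriv_zero, spaceDeriv_zero]
      per_x := fun i _ z => ⟨spx _ i z, spy _ i z⟩
      per_y := fun i _ z => ⟨spx _ i z, spy _ i z⟩
      cont_t := continuous_timeDeriv hT0 hreg one_le_two
      cont_tt := continuous_timeDeriv hT0 hreg le_rfl
      bdd_t := fun z => (hKt z).trans (by linarith)
      bdd_tt := fun z => (hKtt z).trans (by linarith)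
      unif_tt := uniform_of_periodic hL1 hL2 hT0 (continuous_timeDeriv hT0 hreg le_rfl)
        (tpx 2) (tpy 2) (tproj 2)
      deriv_t := fun x y t ht => by
        rw [h0]; exact hasDerivAt_timeDeriv hT0 hreg (by norm_num) x y ht
      deriv_tt := fun x y t ht => hasDerivAt_timeDeriv hT0 hreg (by norm_num) x y ht
      equation := fun x y t ht => ?_
      agree := hagree _ }
  have ht' := Set.Ioo_subset_Icc_self ht
  have heq := hu.equation x y t ht.1 ht.2.le
  have ht1 : derivWithin (fun s => u x y s) (Set.Icc 0 T) t = timeDeriv hT0 u 1 (x, y, t) := by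
    simp only [timeDeriv, Set.projIcc_of_mem hT0 ht', iteratedDerivWithin_one]
  have lineX : ∀ i < 4, ∀ x, HasDerivAt (fun ξ => spaceDeriv hT0 u (1, 0) i (ξ, y, t))
      (spaceDeriv hT0 u (1, 0) (i + 1) (x, y, t)) x := fun i hi x => by
    simpa [eX] using dx i hi (0, y, t) x
  have lineY : ∀ i < 4, ∀ y, HasDerivAt (fun η => spaceDeriv hT0 u (0, 1) i (x, η, t))
      (spaceDeriv hT0 u (0, 1) (i + 1) (x, y, t)) y := fun i hi y => by
    simpa [eY] using dy i hi (x, 0, t) y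
  have hux : (fun ξ => u ξ y t) = fun ξ => spaceDeriv hT0 u (1, 0) 0 (ξ, y, t) :=
    funext fun ξ => (hagree _ ξ y t ht').symm
  have huy : (fun η => u x η t) = fun η => spaceDeriv hT0 u (0, 1) 0 (x, η, t) :=
    funext fun η => (hagree _ x η t ht').symm
  have hx1 : deriv (fun ξ => u ξ y t) = fun x => spaceDeriv hT0 u (1, 0) 1 (x, y, t) := by
    rw [hux]; exact funext fun ξ => (lineX 0 (by norm_num) ξ).deriv
  have hy1 : deriv (fun η => u x η t) = fun y => spaceDeriv hT0 u (0, 1) 1 (x, y, t) := by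
    rw [huy]; exact funext fun η => (lineY 0 (by norm_num) η).deriv
  have hx2 : iteratedDeriv 2 (fun ξ => u ξ y t) x = spaceDeriv hT0 u (1, 0) 2 (x, y, t) := by
    rw [iteratedDeriv_succ, iteratedDeriv_one, hx1]; exact (lineX 1 (by norm_num) x).deriv
  have hy2 : iteratedDeriv 2 (fun η => u x η t) y = spaceDeriv hT0 u (0, 1) 2 (x, y, t) := by
    rw [iteratedDeriv_succ, iteratedDeriv_one, hy1]; exact (lineY 1 (by norm_num) y).deriv
  rw [ht1, hx1, hy1, hx2, hy2] at heq
  rw [hagree _ x y t ht']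
  linarith

/-! ## Taylor estimates -/

/-- The monomial c s^(n+1)/(n+1) minus ±R is monotone. Derivatives are needed only in the interior,
which suits functions differentiable in time on (0, T) alone; iterating the lemma produces all
Taylor remainders below. -/
theorem abs_le_of_abs_deriv_le {S c : ℝ} (hS : 0 ≤ S) (n : ℕ) {R r : ℝ → ℝ} (h0 : R 0 = 0)
    (hc : ContinuousOn R (Set.Icc 0 S)) (hd : ∀ s ∈ Set.Ioo 0 S, HasDerivAt R (r s) s)
    (hr : ∀ s ∈ Set.Ioo 0 S, |r s| ≤ c * s ^ n) : |R S| ≤ c * S ^ (n + 1) / (n + 1) := by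
  have hP : ∀ s : ℝ, HasDerivAt (fun s : ℝ => c * s ^ (n + 1) / (n + 1)) (c * s ^ n) s := fun s => by
    have := ((hasDerivAt_pow (n + 1) s).const_mul c).div_const ((n : ℝ) + 1)
    refine this.congr_deriv ?_
    push_cast
    have : (n : ℝ) + 1 ≠ 0 := by positivity
    field_simp
  have hPc : ContinuousOn (fun s : ℝ => c * s ^ (n + 1) / (n + 1)) (Set.Icc 0 S) :=
    Continuous.continuousOn (by fun_prop)
  have key : ∀ σ : ℝ, |σ| = 1 → σ * R S ≤ c * S ^ (n + 1) / (n + 1) := fun σ hσ => by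
    have hm : MonotoneOn (fun s => c * s ^ (n + 1) / (n + 1) - σ * R s) (Set.Icc 0 S) := by
      refine monotoneOn_of_hasDerivWithinAt_nonneg (convex_Icc 0 S) (hPc.sub (hc.const_mul σ))
        (f' := fun s => c * s ^ n - σ * r s) ?_ ?_
      · intro s hs
        rw [interior_Icc] at hs
        exact ((hP s).sub ((hd s hs).const_mul σ)).hasDerivWithinAt
      · intro s hs
        rw [interior_Icc] at hs
        have : σ * r s ≤ |r s| := (le_abs_self _).trans (by rw [abs_mul, hσ, one_mul])
        linarith [hr s hs]
    have := hm (Set.left_mem_Icc.mpr hS) (Set.right_mem_Icc.mpr hS) hS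
    simp only [h0] at this
    simp at this
    linarith
  rw [abs_le]
  have h1 := key 1 (by simp)
  have h2 := key (-1) (by simp)
  constructor <;> linarith

/-- First order Taylor estimate on an interval, centred at any of its points. -/
theorem taylor_two {a b K : ℝ} {φ φ' φ'' : ℝ → ℝ} (hc : ContinuousOn φ (Set.Icc a b))
    (hc' : ContinuousOn φ' (Set.Icc a b)) (hd : ∀ s ∈ Set.Ioo a b, HasDerivAt φ (φ' s) s)
    (hd' : ∀ s ∈ Set.Ioo a b, HasDerivAt φ' (φ'' s) s) (hK : ∀ s ∈ Set.Ioo a b, |φ'' s| ≤ K)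
    {s t : ℝ} (hs : s ∈ Set.Icc a b) (ht : t ∈ Set.Icc a b) :
    |φ t - φ s - φ' s * (t - s)| ≤ K * (t - s) ^ 2 / 2 := by
  -- The sign σ reflects the line, so that one argument covers points on both sides of the centre.
  have aux : ∀ σ : ℝ, |σ| = 1 → ∀ S : ℝ, 0 ≤ S → s + σ * S ∈ Set.Icc a b →
      |φ (s + σ * S) - φ s - φ' s * (σ * S)| ≤ K * S ^ 2 / 2 := by
    intro σ hσ S hS hend
    have hσ2 : σ * σ = 1 := by rw [← abs_mul_abs_self, hσ, one_mul]
    have hσ' : σ = 1 ∨ σ = -1 := by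
      rcases abs_eq (zero_le_one (α := ℝ)) |>.mp hσ with h | h <;> simp [h]
    have hin : ∀ r ∈ Set.Icc 0 S, s + σ * r ∈ Set.Icc a b := fun r hr => by
      rcases hσ' with h | h <;> subst h <;>
        exact ⟨by linarith [hr.1, hr.2, hs.1, hs.2, hend.1, hend.2],
          by linarith [hr.1, hr.2, hs.1, hs.2, hend.1, hend.2]⟩
    have hin' : ∀ r ∈ Set.Ioo 0 S, s + σ * r ∈ Set.Ioo a b := fun r hr => by
      rcases hσ' with h | h <;> subst h <;>
        exact ⟨by linarith [hr.1, hr.2, hs.1, hs.2, hend.1, hend.2],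
          by linarith [hr.1, hr.2, hs.1, hs.2, hend.1, hend.2]⟩
    have hline : ∀ r : ℝ, HasDerivAt (fun r => s + σ * r) σ r := fun r => by
      simpa using ((hasDerivAt_id r).const_mul σ).const_add s
    have hcl : ∀ T : ℝ, Continuous fun r : ℝ => s + σ * r := fun _ => by fun_prop
    have h1 : ∀ S' ∈ Set.Ioo 0 S, |σ * (φ' (s + σ * S') - φ' s)| ≤ K * S' ^ 1 := by
      intro S' hS'
      have hsub : ∀ r ∈ Set.Ioo 0 S', r ∈ Set.Ioo 0 S := fun r hr => ⟨hr.1, hr.2.trans hS'.2⟩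
      have := abs_le_of_abs_deriv_le (c := K) hS'.1.le 0
        (R := fun r => σ * (φ' (s + σ * r) - φ' s)) (r := fun r => σ * (φ'' (s + σ * r) * σ))
        (by simp)
        (by
          refine ContinuousOn.const_mul (ContinuousOn.sub (hc'.comp (hcl 0).continuousOn
            fun r hr => hin r ⟨hr.1, hr.2.trans hS'.2.le⟩) continuousOn_const) _)
        (fun r hr => (((hd' _ (hin' r (hsub r hr))).comp r (hline r)).sub_const _).const_mul σ)
        (fun r hr => by
          rw [show σ * (φ'' (s + σ * r) * σ) = (σ * σ) * φ'' (s + σ * r) by ring, hσ2, one_mul]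
          simpa using hK _ (hin' r (hsub r hr)))
      simpa using this
    have := abs_le_of_abs_deriv_le (c := K) hS 1
      (R := fun r => φ (s + σ * r) - φ s - φ' s * (σ * r))
      (r := fun r => σ * (φ' (s + σ * r) - φ' s)) (by simp)
      (((hc.comp (hcl 0).continuousOn hin).sub continuousOn_const).sub
        (Continuous.continuousOn (by fun_prop)))
      (fun r hr => by
        refine ((((hd _ (hin' r hr)).comp r (hline r)).sub_const _).sub
          (((hasDerivAt_id r).const_mul σ).const_mul (φ' s))).congr_deriv ?_
        ring)
      h1
    refine this.trans (le_of_eq ?_)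
    push_cast; ring
  rcases le_total s t with h | h
  · have := aux 1 (by simp) (t - s) (by linarith) (by simpa using ht)
    simpa using this
  · have := aux (-1) (by simp) (s - t) (by linarith) (by simpa using ht)
    simp only [neg_mul, one_mul, neg_sub, add_sub_cancel] at this
    rwa [show (s - t) ^ 2 = (t - s) ^ 2 by ring] at this

/-- Subtracting the parabola c (s - a)^2/2 leaves second derivative φ'' - c; two Taylor estimates
from the midpoint to the ends are then added. -/
theorem taylor_second_difference {a k K : ℝ} (hk : 0 ≤ k) {φ φ' φ'' : ℝ → ℝ}
    (hc : ContinuousOn φ (Set.Icc a (a + 2 * k))) (hc' : ContinuousOn φ' (Set.Icc a (a + 2 * k)))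
    (hd : ∀ s ∈ Set.Ioo a (a + 2 * k), HasDerivAt φ (φ' s) s)
    (hd' : ∀ s ∈ Set.Ioo a (a + 2 * k), HasDerivAt φ' (φ'' s) s) (c : ℝ)
    (hK : ∀ s ∈ Set.Ioo a (a + 2 * k), |φ'' s - c| ≤ K) :
    |φ (a + 2 * k) - 2 * φ (a + k) + φ a - k ^ 2 * c| ≤ K * k ^ 2 := by
  have hlin : ∀ s : ℝ, HasDerivAt (fun s : ℝ => c * (s - a) ^ 2 / 2) (c * (s - a)) s := fun s => by
    have := ((((hasDerivAt_id s).sub_const a).pow 2).const_mul c).div_const 2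
    refine this.congr_deriv ?_
    simp; ring
  have hlin' : ∀ s : ℝ, HasDerivAt (fun s : ℝ => c * (s - a)) c s := fun s => by
    simpa using ((hasDerivAt_id s).sub_const a).const_mul c
  have T := fun t ht => taylor_two (K := K) (φ := fun s => φ s - c * (s - a) ^ 2 / 2)
    (φ' := fun s => φ' s - c * (s - a)) (φ'' := fun s => φ'' s - c)
    (hc.sub (Continuous.continuousOn (by fun_prop)))
    (hc'.sub (Continuous.continuousOn (by fun_prop)))
    (fun s hs => (hd s hs).sub (hlin s)) (fun s hs => (hd' s hs).sub (hlin' s)) hK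
    (s := a + k) ⟨by linarith, by linarith⟩ (t := t) ht
  have h1 := T (a + 2 * k) ⟨by linarith, by linarith⟩
  have h2 := T a ⟨by linarith, by linarith⟩
  rw [abs_le] at h1 h2 ⊢
  constructor <;> nlinarith [h1.1, h1.2, h2.1, h2.2]

/-- The error of the trapezoidal rule as a weighted mean of the second derivative. -/
theorem trapezoid_sub_integral {φ φ' φ'' : ℝ → ℝ} (hc : Continuous φ)
    (hc' : Continuous φ') (hc'' : Continuous φ'')
    (hd : ∀ s ∈ Set.Ioo (0 : ℝ) 1, HasDerivAt φ (φ' s) s)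
    (hd' : ∀ s ∈ Set.Ioo (0 : ℝ) 1, HasDerivAt φ' (φ'' s) s) :
    (φ 0 + φ 1) / 2 - ∫ s in (0 : ℝ)..1, φ s = ∫ s in (0 : ℝ)..1, (s * (1 - s) / 2) * φ'' s := by
  -- Two integrations by parts at once: the kernel s(1 - s)/2 vanishes at both ends, its derivative
  -- is (1 - 2s)/2, and the boundary values of the primitive give the trapezoidal mean.
  have h := intervalIntegral.integral_eq_sub_of_hasDerivAt_of_le (zero_le_one (α := ℝ))
    (f := fun s => s * (1 - s) / 2 * φ' s - (1 - 2 * s) / 2 * φ s)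
    (f' := fun s => (s * (1 - s) / 2) * φ'' s + φ s) (Continuous.continuousOn (by fun_prop))
    (fun s hs => by
      have e1 : HasDerivAt (fun s : ℝ => s * (1 - s) / 2) ((1 - 2 * s) / 2) s := by
        refine (((hasDerivAt_id s).mul ((hasDerivAt_id s).const_sub 1)).div_const 2).congr_deriv ?_
        simp; ring
      have e2 : HasDerivAt (fun s : ℝ => (1 - 2 * s) / 2) (-1) s := by
        refine ((((hasDerivAt_id s).const_mul 2).const_sub 1).div_const 2).congr_deriv ?_
        norm_num
      refine ((e1.mul (hd' s hs)).sub (e2.mul (hd s hs))).congr_deriv ?_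
      ring)
    (Continuous.intervalIntegrable (by fun_prop) _ _)
  rw [intervalIntegral.integral_add (Continuous.intervalIntegrable (by fun_prop) _ _)
    (Continuous.intervalIntegrable (by fun_prop) _ _)] at h
  norm_num at h
  linarith

/-! ### Symmetric Taylor estimates along a chain of directional derivatives. -/

section chain

variable {E : Type*} [NormedAddCommGroup E] [NormedSpace ℝ E] {e : E} {K : ℝ} {f : ℕ → E → ℝ}

theorem Chain4.nonneg (H : Chain4 e K f) : 0 ≤ K := (abs_nonneg _).trans (H.bdd 0 (by norm_num) 0)

theorem Chain4.hasDerivAt (H : Chain4 e K f) {i : ℕ} (hi : i < 4) (z : E) (s : ℝ) :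
    HasDerivAt (fun s : ℝ => f i (z + s • e)) (f (i + 1) (z + s • e)) s := H.deriv i hi z s

theorem Chain4.hasDerivAt_neg (H : Chain4 e K f) {i : ℕ} (hi : i < 4) (z : E) (s : ℝ) :
    HasDerivAt (fun s : ℝ => f i (z - s • e)) (-f (i + 1) (z - s • e)) s := by
  have := (H.deriv i hi).neg z s
  simpa only [smul_neg, ← sub_eq_add_neg] using this

theorem Chain4.continuous_line (H : Chain4 e K f) {i : ℕ} (hi : i ≤ 4) (z : E) :
    Continuous fun s : ℝ => f i (z + s • e) := by have := H.cont i hi; fun_prop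

theorem Chain4.continuous_line_neg (H : Chain4 e K f) {i : ℕ} (hi : i ≤ 4) (z : E) :
    Continuous fun s : ℝ => f i (z - s • e) := by have := H.cont i hi; fun_prop

/-- Start of a ladder: differentiating an odd combination in `s` gives an even combination of the
next derivative and conversely, so each estimate integrates the preceding one. -/
theorem Chain4.odd_one (H : Chain4 e K f) {i : ℕ} (hi : i < 4) (z : E) {s : ℝ} (hs : 0 ≤ s) :
    |f i (z + s • e) - f i (z - s • e)| ≤ 2 * K * s := by
  have := abs_le_of_abs_deriv_le (c := 2 * K) hs 0
    (R := fun s => f i (z + s • e) - f i (z - s • e))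
    (r := fun s => f (i + 1) (z + s • e) - -f (i + 1) (z - s • e)) (by simp)
    ((H.continuous_line hi.le z).sub (H.continuous_line_neg hi.le z)).continuousOn
    (fun s _ => (H.hasDerivAt hi z s).sub (H.hasDerivAt_neg hi z s))
    (fun s _ => by
      rw [sub_neg_eq_add, pow_zero, mul_one]
      refine (abs_add_le _ _).trans ?_
      linarith [H.bdd (i + 1) hi (z + s • e), H.bdd (i + 1) hi (z - s • e)])
  simpa using this

theorem Chain4.even_two (H : Chain4 e K f) {i : ℕ} (hi : i < 3) (z : E) {s : ℝ} (hs : 0 ≤ s) :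
    |f i (z + s • e) + f i (z - s • e) - 2 * f i z| ≤ K * s ^ 2 := by
  have := abs_le_of_abs_deriv_le (c := 2 * K) hs 1
    (R := fun s => f i (z + s • e) + f i (z - s • e) - 2 * f i z)
    (r := fun s => f (i + 1) (z + s • e) + -f (i + 1) (z - s • e)) (by simp; ring)
    (((H.continuous_line (by omega) z).add (H.continuous_line_neg (by omega) z)).sub
      continuous_const).continuousOn
    (fun s _ => ((H.hasDerivAt (by omega) z s).add (H.hasDerivAt_neg (by omega) z s)).sub_const _)
    (fun s hs => by
      rw [← sub_eq_add_neg, pow_one]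
      exact H.odd_one (by omega) z hs.1.le)
  refine this.trans (le_of_eq ?_)
  push_cast; ring

theorem Chain4.odd_three (H : Chain4 e K f) {i : ℕ} (hi : i < 2) (z : E) {s : ℝ} (hs : 0 ≤ s) :
    |f i (z + s • e) - f i (z - s • e) - 2 * s * f (i + 1) z| ≤ K * s ^ 3 / 3 := by
  have := abs_le_of_abs_deriv_le (c := K) hs 2
    (R := fun s => f i (z + s • e) - f i (z - s • e) - 2 * s * f (i + 1) z)
    (r := fun s => f (i + 1) (z + s • e) - -f (i + 1) (z - s • e) - 2 * f (i + 1) z) (by simp)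
    (((H.continuous_line (by omega) z).sub (H.continuous_line_neg (by omega) z)).sub
      (by fun_prop)).continuousOn
    (fun s _ => by
      refine ((H.hasDerivAt (by omega) z s).sub (H.hasDerivAt_neg (by omega) z s)).sub ?_
      simpa using ((hasDerivAt_id s).const_mul 2).mul_const (f (i + 1) z))
    (fun s hs => by
      rw [sub_neg_eq_add]
      exact H.even_two (by omega) z hs.1.le)
  refine this.trans (le_of_eq ?_)
  push_cast; ring

theorem Chain4.even_four (H : Chain4 e K f) (z : E) {s : ℝ} (hs : 0 ≤ s) :
    |f 0 (z + s • e) + f 0 (z - s • e) - 2 * f 0 z - s ^ 2 * f 2 z| ≤ K * s ^ 4 / 12 := by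
  have := abs_le_of_abs_deriv_le (c := K / 3) hs 3
    (R := fun s => f 0 (z + s • e) + f 0 (z - s • e) - 2 * f 0 z - s ^ 2 * f 2 z)
    (r := fun s => f 1 (z + s • e) + -f 1 (z - s • e) - 2 * s * f 2 z) (by simp; ring)
    ((((H.continuous_line (by omega) z).add (H.continuous_line_neg (by omega) z)).sub
      continuous_const).sub (by fun_prop)).continuousOn
    (fun s _ => by
      refine (((H.hasDerivAt (by omega) z s).add (H.hasDerivAt_neg (by omega) z s)).sub_const
        _).sub ?_
      simpa using (hasDerivAt_pow 2 s).mul_const (f 2 z))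
    (fun s hs => by
      rw [← sub_eq_add_neg]
      refine (H.odd_three (i := 1) (by omega) z hs.1.le).trans (le_of_eq ?_)
      ring)
  refine this.trans (le_of_eq ?_)
  push_cast; ring

/-- The square of the base function of a chain, with its derivatives. -/
def sqChain (f : ℕ → E → ℝ) : ℕ → E → ℝ
  | 0 => fun z => f 0 z * f 0 z
  | 1 => fun z => 2 * (f 0 z * f 1 z)
  | 2 => fun z => 2 * (f 1 z * f 1 z + f 0 z * f 2 z)
  | 3 => fun z => 2 * (3 * (f 1 z * f 2 z) + f 0 z * f 3 z)
  | 4 => fun z => 2 * (3 * (f 2 z * f 2 z) + 4 * (f 1 z * f 3 z) + f 0 z * f 4 z)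
  | _ => fun _ => 0

/-- Leibniz' rule. The constant 16 = 2 (3 + 4 + 1) is the sum of the coefficients in the fourth
derivative of the square. -/
theorem Chain4.sq (H : Chain4 e K f) : Chain4 e (16 * K ^ 2) (sqChain f) := by
  refine ⟨fun i hi => ?_, fun i hi => ?_, fun i hi z => ?_⟩
  · have d0 := H.deriv 0 (by norm_num)
    have d1 := H.deriv 1 (by norm_num)
    have d2 := H.deriv 2 (by norm_num)
    have d3 := H.deriv 3 (by norm_num)
    simp only [zero_add, Nat.reduceAdd] at d0 d1 d2 d3
    interval_cases i
    · intro z s; refine (d0.mul d0 z s).congr_deriv ?_; simp only [sqChain]; ring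
    · intro z s; refine ((d0.mul d1).const_mul 2 z s).congr_deriv ?_; simp only [sqChain]
    · intro z s
      refine (((d1.mul d1).add (d0.mul d2)).const_mul 2 z s).congr_deriv ?_
      simp only [sqChain]; ring
    · intro z s
      refine ((((d1.mul d2).const_mul 3).add (d0.mul d3)).const_mul 2 z s).congr_deriv ?_
      simp only [sqChain]; ring
  · have c0 := H.cont 0 (by norm_num)
    have c1 := H.cont 1 (by norm_num)
    have c2 := H.cont 2 (by norm_num)
    have c3 := H.cont 3 (by norm_num)
    have c4 := H.cont 4 (by norm_num)
    interval_cases i <;> simp only [sqChain] <;> fun_prop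
  · have hb : ∀ j ≤ 4, ∀ k ≤ 4, |f j z * f k z| ≤ K ^ 2 := fun j hj k hk => by
      rw [abs_mul, pow_two]
      exact mul_le_mul (H.bdd j hj z) (H.bdd k hk z) (abs_nonneg _) H.nonneg
    have b00 := abs_le.mp (hb 0 (by norm_num) 0 (by norm_num))
    have b01 := abs_le.mp (hb 0 (by norm_num) 1 (by norm_num))
    have b02 := abs_le.mp (hb 0 (by norm_num) 2 (by norm_num))
    have b03 := abs_le.mp (hb 0 (by norm_num) 3 (by norm_num))
    have b04 := abs_le.mp (hb 0 (by norm_num) 4 (by norm_num))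
    have b11 := abs_le.mp (hb 1 (by norm_num) 1 (by norm_num))
    have b12 := abs_le.mp (hb 1 (by norm_num) 2 (by norm_num))
    have b13 := abs_le.mp (hb 1 (by norm_num) 3 (by norm_num))
    have b22 := abs_le.mp (hb 2 (by norm_num) 2 (by norm_num))
    rw [abs_le]
    interval_cases i <;> simp only [sqChain] <;> constructor <;> linarith

end chain

/-! ## Compact difference operators -/

section ops

variable {A : Type*} [AddCommGroup A]

/-- The undivided second difference. -/
def sd (v : A) (f : A → ℝ) (z : A) : ℝ := f (z + v) - 2 * f z + f (z - v)

/-- The compact averaging operator `1 + sd / 12`. -/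
noncomputable def cA (v : A) (f : A → ℝ) (z : A) : ℝ := f z + sd v f z / 12

/-- The operator `1 - sd / 12`, an approximate inverse of `cA`. -/
noncomputable def cB (v : A) (f : A → ℝ) (z : A) : ℝ := f z - sd v f z / 12

theorem abs_sd_le {v : A} {f : A → ℝ} {c : ℝ} (h : ∀ z, |f z| ≤ c) (z : A) :
    |sd v f z| ≤ 4 * c := by
  have h1 := abs_le.mp (h (z + v))
  have h2 := abs_le.mp (h z)
  have h3 := abs_le.mp (h (z - v))
  rw [sd, abs_le]; constructor <;> linarith

theorem abs_cB_le {v : A} {f : A → ℝ} {c : ℝ} (h : ∀ z, |f z| ≤ c) (z : A) :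
    |cB v f z| ≤ 4 / 3 * c := by
  have h1 := abs_le.mp (abs_sd_le (v := v) h z)
  have h2 := abs_le.mp (h z)
  rw [cB, abs_le]; constructor <;> linarith

theorem abs_sd_le_at {v : A} {f : A → ℝ} {c : ℝ} (z : A) (h0 : |f z| ≤ c) (h1 : |f (z + v)| ≤ c)
    (h2 : |f (z - v)| ≤ c) : |sd v f z| ≤ 4 * c := by
  rw [abs_le] at *; rw [sd]; constructor <;> linarith

theorem abs_cB_le_at {v : A} {f : A → ℝ} {c : ℝ} (z : A) (h0 : |f z| ≤ c) (h1 : |f (z + v)| ≤ c)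
    (h2 : |f (z - v)| ≤ c) : |cB v f z| ≤ 4 / 3 * c := by
  have := abs_sd_le_at z h0 h1 h2
  rw [abs_le] at *; rw [cB]; constructor <;> linarith

/-- This is (1 - x)(1 + x) = 1 - x^2 with x = sd/12: the error is a fourth order difference. -/
theorem cA_cB (v : A) (f : A → ℝ) (z : A) : cB v (cA v f) z = f z - sd v (sd v f) z / 144 := by
  simp only [cB, cA, sd]; ring

theorem sd_sub (v : A) (f g : A → ℝ) (z : A) :
    sd v (fun z => f z - g z) z = sd v f z - sd v g z := by simp only [sd]; ring

theorem cB_sub (v : A) (f g : A → ℝ) (z : A) :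
    cB v (fun z => f z - g z) z = cB v f z - cB v g z := by simp only [cB, sd]; ring

theorem cB_add (v : A) (f g : A → ℝ) (z : A) :
    cB v (fun z => f z + g z) z = cB v f z + cB v g z := by simp only [cB, sd]; ring

theorem cB_const_mul (v : A) (c : ℝ) (f : A → ℝ) (z : A) :
    cB v (fun z => c * f z) z = c * cB v f z := by simp only [cB, sd]; ring

theorem cB_shift (v w : A) (f : A → ℝ) (z : A) :
    cB v f (z + w) = cB v (fun z => f (z + w)) z := by
  simp only [cB, sd, add_right_comm z, add_sub_right_comm z]

theorem sd_cB_comm (v w : A) (f : A → ℝ) (z : A) : sd v (cB w f) z = cB w (sd v f) z := by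
  simp only [sd, cB, add_sub_right_comm, add_right_comm z, sub_right_comm z]; ring

theorem cA_cB_comm (v w : A) (f : A → ℝ) (z : A) : cA v (cB w f) z = cB w (cA v f) z := by
  simp only [sd, cB, cA, add_sub_right_comm, add_right_comm z, sub_right_comm z]; ring

end ops

/-! ### Averages combined with difference operators; consistency of the compact average and of the
flux. -/

section analytic

variable {E : Type*} [NormedAddCommGroup E] [NormedSpace ℝ E]

theorem continuous_sd {E : Type*} [NormedAddCommGroup E] (v : E) {f : E → ℝ} (hf : Continuous f) :
    Continuous (sd v f) := by
  unfold sd; fun_prop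

theorem continuous_cA {E : Type*} [NormedAddCommGroup E] (v : E) {f : E → ℝ} (hf : Continuous f) :
    Continuous (cA v f) := by
  have := continuous_sd v hf
  unfold cA; fun_prop

theorem continuous_cB {E : Type*} [NormedAddCommGroup E] (v : E) {f : E → ℝ} (hf : Continuous f) :
    Continuous (cB v f) := by
  have := continuous_sd v hf
  unfold cB; fun_prop

theorem hat_sd (v w : E) {f : E → ℝ} (hf : Continuous f) (z : E) :
    hat v (sd w f) z = sd w (hat v f) z := by
  unfold sd
  rw [hat_add v (by fun_prop) (by fun_prop), hat_sub v (by fun_prop) (by fun_prop),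
    hat_const_mul, hat_shift, sub_eq_add_neg z w, hat_shift]
  simp only [sub_eq_add_neg]

theorem hat_cA (v w : E) {f : E → ℝ} (hf : Continuous f) (z : E) :
    hat v (cA w f) z = cA w (hat v f) z := by
  have hs := continuous_sd w hf
  unfold cA
  simp only [div_eq_inv_mul]
  rw [hat_add v hf (by fun_prop), hat_const_mul, hat_sd v w hf]

theorem hat_cB (v w : E) {f : E → ℝ} (hf : Continuous f) (z : E) :
    hat v (cB w f) z = cB w (hat v f) z := by
  have hs := continuous_sd w hf
  unfold cB
  simp only [div_eq_inv_mul]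
  rw [hat_sub v hf (by fun_prop), hat_const_mul, hat_sd v w hf]

theorem box_sd (v w : E) {f : E → ℝ} (hf : Continuous f) (z : E) :
    box v (sd w f) z = sd w (box v f) z := by
  unfold sd
  rw [box_add v (by fun_prop) (by fun_prop), box_sub v (by fun_prop) (by fun_prop),
    box_const_mul, box_shift, sub_eq_add_neg z w, box_shift]
  simp only [sub_eq_add_neg]

theorem box_cB (v w : E) {f : E → ℝ} (hf : Continuous f) (z : E) :
    box v (cB w f) z = cB w (box v f) z := by
  have hs := continuous_sd w hf
  unfold cB
  simp only [div_eq_inv_mul]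
  rw [box_sub v hf (by fun_prop), box_const_mul, box_sd v w hf]

theorem integral_one_sub_mul_sq : ∫ s in (0 : ℝ)..1, (1 - s) * s ^ 2 = 1 / 12 := by
  have : ∀ s : ℝ, (1 - s) * s ^ 2 = s ^ 2 - s ^ 3 := fun s => by ring
  simp only [this]
  rw [intervalIntegral.integral_sub (Continuous.intervalIntegrable (by fun_prop) _ _)
    (Continuous.intervalIntegrable (by fun_prop) _ _), integral_pow, integral_pow]
  norm_num

/-- The compact average differs from the hat average by a superposition of fourth order
difference operators. -/
theorem cA_sub_hat (v : E) {f : E → ℝ} (hf : Continuous f) (z : E) :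
    cA v f z - hat v f z = ∫ s in (0 : ℝ)..1, (1 - s) * (s ^ 2 * sd v f z - sd (s • v) f z) := by
  -- The coefficient 1/12 of the compact average is exactly the integral of (1 - s) s^2, which is
  -- why the second order terms cancel for every s.
  have h : ∀ s : ℝ, (1 - s) * (s ^ 2 * sd v f z - sd (s • v) f z)
      = (1 - s) * s ^ 2 * sd v f z + 2 * f z * (1 - s)
        - (1 - s) * (f (z + s • v) + f (z - s • v)) := fun s => by
    simp only [sd]; ring
  simp only [h]
  rw [intervalIntegral.integral_sub, intervalIntegral.integral_add,
    intervalIntegral.integral_mul_const, intervalIntegral.integral_const_mul,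
    integral_one_sub_mul_sq, integral_one_sub, cA, hat]
  · ring
  all_goals exact Continuous.intervalIntegrable (by fun_prop) _ _

variable {e : E} {K h : ℝ} {f : ℕ → E → ℝ}

theorem Chain4.abs_sd_sub_le (H : Chain4 e K f) (hh : 0 ≤ h) (z : E) :
    |sd (h • e) (f 0) z - h ^ 2 * f 2 z| ≤ K * h ^ 4 / 12 := by
  have := H.even_four z hh
  rwa [show sd (h • e) (f 0) z - h ^ 2 * f 2 z
    = f 0 (z + h • e) + f 0 (z - h • e) - 2 * f 0 z - h ^ 2 * f 2 z by rw [sd]; ring]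

/-- Both second differences have the leading term (sh)^2 f''; only their fourth order remainders
survive. -/
theorem Chain4.abs_sd_family_le (H : Chain4 e K f) (hh : 0 ≤ h) (z : E) {s : ℝ}
    (hs : s ∈ Set.Icc (0 : ℝ) 1) :
    |s ^ 2 * sd (h • e) (f 0) z - sd (s • h • e) (f 0) z| ≤ K * h ^ 4 / 6 := by
  have h1 := H.abs_sd_sub_le hh z
  have h2 := H.abs_sd_sub_le (mul_nonneg hs.1 hh) z
  rw [mul_smul] at h2
  have hs2 : s ^ 2 ≤ 1 := pow_le_one₀ hs.1 hs.2
  have hs4 : s ^ 4 ≤ 1 := pow_le_one₀ hs.1 hs.2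
  have hK := H.nonneg
  have h3 : |s ^ 2 * (sd (h • e) (f 0) z - h ^ 2 * f 2 z)| ≤ K * h ^ 4 / 12 := by
    rw [abs_mul, abs_of_nonneg (sq_nonneg s)]
    exact (mul_le_of_le_one_left (abs_nonneg _) hs2).trans h1
  have h4 : K * (s * h) ^ 4 / 12 ≤ K * h ^ 4 / 12 := by
    have : K * h ^ 4 * s ^ 4 ≤ K * h ^ 4 * 1 :=
      mul_le_mul_of_nonneg_left hs4 (by positivity)
    nlinarith
  have h5 := h2.trans h4
  rw [abs_le] at *
  constructor <;> nlinarith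

theorem Chain4.abs_cA_sub_hat_le (H : Chain4 e K f) (hh : 0 ≤ h) (z : E) :
    |cA (h • e) (f 0) z - hat (h • e) (f 0) z| ≤ K * h ^ 4 / 12 := by
  rw [cA_sub_hat _ (H.cont 0 (by norm_num))]
  have := abs_integral_one_sub_le (K := K * h ^ 4 / 6) fun s hs => H.abs_sd_family_le hh z hs
  linarith

theorem Chain4.abs_sd_sd_le (H : Chain4 e K f) (hh : 0 ≤ h) (z : E) :
    |sd (h • e) (sd (h • e) (f 0)) z| ≤ 2 * K * h ^ 4 := by
  have h1 := H.even_four z hh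
  have h2 := H.even_four z (mul_nonneg zero_le_two hh)
  have e1 : z + h • e + h • e = z + (2 * h) • e := by rw [two_mul, add_smul, add_assoc]
  have e2 : z - h • e - h • e = z - (2 * h) • e := by rw [two_mul, add_smul, sub_sub]
  have hK := mul_nonneg H.nonneg (pow_nonneg hh 4)
  simp only [sd, add_sub_cancel_right, sub_add_cancel, e1, e2]
  rw [abs_le] at *
  constructor <;> nlinarith

/-- Write cB ∘ hat - 1 as (cB ∘ cA - 1) - cB ∘ (cA - hat). The contributions K h^4/72 and K h^4/9
are both of fourth order. -/
theorem Chain4.abs_cB_hat_sub_le (H : Chain4 e K f) (hh : 0 ≤ h) (z : E) :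
    |cB (h • e) (hat (h • e) (f 0)) z - f 0 z| ≤ K * h ^ 4 := by
  have h1 := abs_cB_le (v := h • e) (f := fun z => cA (h • e) (f 0) z - hat (h • e) (f 0) z)
    (fun z => H.abs_cA_sub_hat_le hh z) z
  rw [cB_sub, cA_cB] at h1
  have h2 := H.abs_sd_sd_le hh z
  have hK := mul_nonneg H.nonneg (pow_nonneg hh 4)
  rw [abs_le] at *
  constructor <;> nlinarith

/-- A segment average, written symmetrically about the centre of the segment. -/
theorem box_symm (v : E) {g : E → ℝ} (hg : Continuous g) (c : E) :
    box v g (c - (1 / 2 : ℝ) • v) = ∫ s in (0 : ℝ)..1,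
      (g (c + (s / 2) • v) + g (c - (s / 2) • v)) / 2 := by
  have h1 := sum_box ((1 / 2 : ℝ) • v) 2 hg (c - (1 / 2 : ℝ) • v)
  simp only [Finset.sum_range_succ, Finset.sum_range_zero, Nat.cast_zero, Nat.cast_one, zero_add,
    Nat.cast_ofNat, smul_smul] at h1
  norm_num at h1
  have h2 := box_neg ((1 / 2 : ℝ) • v) g (c - (1 / 2 : ℝ) • v)
  rw [sub_add_cancel] at h2
  norm_num at h2
  rw [← h2] at h1
  rw [intervalIntegral.integral_div, intervalIntegral.integral_add
    (Continuous.intervalIntegrable (by fun_prop) _ _)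
    (Continuous.intervalIntegrable (by fun_prop) _ _)]
  simp only [box, smul_smul, smul_neg, ← sub_eq_add_neg] at h1 ⊢
  simp only [mul_one_div] at h1
  norm_num at h1 ⊢
  linarith

theorem abs_integral_unit_le {g : ℝ → ℝ} {c : ℝ} (hg : ∀ s ∈ Set.Icc (0 : ℝ) 1, |g s| ≤ c) :
    |∫ s in (0 : ℝ)..1, g s| ≤ c := by
  have := abs_box_le (E := ℝ) (K := c) 1 g 0 (by simpa using hg)
  simpa [box] using this

theorem abs_mul_le_mul {a b α β : ℝ} (ha : |a| ≤ α) (hb : |b| ≤ β) : |a * b| ≤ α * β := by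
  rw [abs_mul]; exact mul_le_mul ha hb (abs_nonneg _) ((abs_nonneg _).trans ha)

/-- Algebraic core of the flux consistency. Here p, m are the end values on a segment, n₁, n₀ the
second derivatives and S₁, S₀ the second differences there, f0, f1, f2 the derivatives at the
centre, and B, D the averaged square and its second difference. The identity `hid` cancels all terms
of order 1 and h^2 and leaves products of Taylor remainders with bounded quantities. -/
theorem abs_flux_le {p m n₁ n₀ S₀ S₁ B D f0 f1 f2 h K : ℝ} (hh : 0 ≤ h)
    (a4 : |p + m - 2 * f0 - (h / 2) ^ 2 * f2| ≤ K * (h / 2) ^ 4 / 12)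
    (a2 : |p + m - 2 * f0| ≤ K * (h / 2) ^ 2) (b2 : |n₁ + n₀ - 2 * f2| ≤ K * (h / 2) ^ 2)
    (o1 : |p - m| ≤ 2 * K * (h / 2)) (o1' : |n₁ - n₀| ≤ 2 * K * (h / 2))
    (o3 : |p - m - 2 * (h / 2) * f1| ≤ K * (h / 2) ^ 3 / 3)
    (s1 : |S₀ - h ^ 2 * n₀| ≤ K * h ^ 4 / 12) (s2 : |S₁ - h ^ 2 * n₁| ≤ K * h ^ 4 / 12)
    (k0 : |f0| ≤ K) (k1 : |f1| ≤ K) (kp : |p| ≤ K) (km : |m| ≤ K) (np : |n₁| ≤ K) (nm : |n₀| ≤ K)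
    (hB : |B - (f0 * f0 + h ^ 2 / 24 * (2 * (f1 * f1 + f0 * f2)))| ≤ 16 * K ^ 2 * h ^ 4 / 384)
    (hD : |D - h ^ 2 * (2 * (f1 * f1 + f0 * f2))| ≤ 4 * K ^ 2 * h ^ 4) :
    |1 / 6 * (m * p + m ^ 2 + p ^ 2) - 1 / 6 * ((p - m) ^ 2 / 2 + (S₀ * m + S₁ * p) / 2)
      - 1 / 2 * (B - D / 12)| ≤ 10 * K ^ 2 * h ^ 4 := by
  have r1 := abs_mul_le_mul a2 a2
  have r2 := abs_mul_le_mul k0 a4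
  have r3 : |(p - m - 2 * (h / 2) * f1) * (p - m + 2 * (h / 2) * f1)|
      ≤ K * (h / 2) ^ 3 / 3 * (4 * K * (h / 2)) := by
    refine abs_mul_le_mul o3 ?_
    have : |2 * (h / 2) * f1| ≤ 2 * (h / 2) * K := by
      rw [abs_mul, abs_of_nonneg (by positivity)]
      exact mul_le_mul_of_nonneg_left k1 (by positivity)
    refine (abs_add_le _ _).trans ?_
    linarith
  have r4 := abs_mul_le_mul s1 km
  have r5 := abs_mul_le_mul s2 kp
  have hn : |n₁ + n₀| ≤ 2 * K := (abs_add_le _ _).trans (by linarith)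
  have hsq : |h ^ 2| ≤ h ^ 2 := (abs_of_nonneg (sq_nonneg h)).le
  have r6 := abs_mul_le_mul hsq (abs_mul_le_mul a2 hn)
  have r7 := abs_mul_le_mul hsq (abs_mul_le_mul k0 b2)
  have r8 := abs_mul_le_mul hsq (abs_mul_le_mul o1 o1')
  have hKh : 0 ≤ K ^ 2 * h ^ 4 := by positivity
  have hid : 1 / 6 * (m * p + m ^ 2 + p ^ 2) - 1 / 6 * ((p - m) ^ 2 / 2 + (S₀ * m + S₁ * p) / 2)
      - 1 / 2 * (B - D / 12)
      = 1 / 8 * ((p + m - 2 * f0) * (p + m - 2 * f0))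
        + 1 / 2 * (f0 * (p + m - 2 * f0 - (h / 2) ^ 2 * f2))
        - 1 / 24 * ((p - m - 2 * (h / 2) * f1) * (p - m + 2 * (h / 2) * f1))
        - 1 / 12 * ((S₀ - h ^ 2 * n₀) * m) - 1 / 12 * ((S₁ - h ^ 2 * n₁) * p)
        - 1 / 24 * (h ^ 2 * ((p + m - 2 * f0) * (n₁ + n₀)))
        - 1 / 12 * (h ^ 2 * (f0 * (n₁ + n₀ - 2 * f2)))
        - 1 / 24 * (h ^ 2 * ((p - m) * (n₁ - n₀)))
        - 1 / 2 * (B - (f0 * f0 + h ^ 2 / 24 * (2 * (f1 * f1 + f0 * f2))))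
        + 1 / 24 * (D - h ^ 2 * (2 * (f1 * f1 + f0 * f2))) := by ring
  rw [hid]
  rw [abs_le] at r1 r2 r3 r4 r5 r6 r7 r8 hB hD ⊢
  obtain ⟨r1a, r1b⟩ := r1
  obtain ⟨r2a, r2b⟩ := r2
  obtain ⟨r3a, r3b⟩ := r3
  obtain ⟨r4a, r4b⟩ := r4
  obtain ⟨r5a, r5b⟩ := r5
  obtain ⟨r6a, r6b⟩ := r6
  obtain ⟨r7a, r7b⟩ := r7
  obtain ⟨r8a, r8b⟩ := r8
  obtain ⟨r9a, r9b⟩ := hB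
  obtain ⟨r10a, r10b⟩ := hD
  constructor <;> linarith

/-- Consistency of the numerical flux of the compact scheme. -/
theorem Chain4.flux_consistency (H : Chain4 e K f) (hh : 0 ≤ h) (z : E) :
    |1 / 6 * (f 0 z * f 0 (z + h • e) + f 0 z ^ 2 + f 0 (z + h • e) ^ 2)
      - 1 / 6 * ((f 0 (z + h • e) - f 0 z) ^ 2 / 2
        + (sd (h • e) (f 0) z * f 0 z + sd (h • e) (f 0) (z + h • e) * f 0 (z + h • e)) / 2)
      - 1 / 2 * cB (h • e) (box (h • e) (sqChain f 0)) z| ≤ 10 * K ^ 2 * h ^ 4 := by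
  -- The flux lives between two mesh points; expanding about the centre makes the expressions
  -- symmetric and leaves no odd powers of h.
  obtain ⟨c, rfl⟩ : ∃ c, z = c - (h / 2) • e := ⟨z + (h / 2) • e, by abel⟩
  have hz : c - (h / 2) • e + h • e = c + (h / 2) • e := by
    rw [sub_add_eq_add_sub, add_sub_assoc, ← sub_smul]; congr 2; ring
  have hh2 : 0 ≤ h / 2 := by positivity
  -- Taylor expansions about the centre
  have a4 := H.even_four c hh2
  have a2 := H.even_two (i := 0) (by norm_num) c hh2
  have b2 := H.even_two (i := 2) (by norm_num) c hh2
  have o1 := H.odd_one (i := 0) (by norm_num) c hh2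
  have o1' := H.odd_one (i := 2) (by norm_num) c hh2
  have o3 := H.odd_three (i := 0) (by norm_num) c hh2
  have s1 := H.abs_sd_sub_le hh (c - (h / 2) • e)
  have s2 := H.abs_sd_sub_le hh (c + (h / 2) • e)
  have k0 := H.bdd 0 (by norm_num) c
  have k1 := H.bdd 1 (by norm_num) c
  have k2 := H.bdd 2 (by norm_num) c
  have kp := H.bdd 0 (by norm_num) (c + (h / 2) • e)
  have km := H.bdd 0 (by norm_num) (c - (h / 2) • e)
  have np := H.bdd 2 (by norm_num) (c + (h / 2) • e)
  have nm := H.bdd 2 (by norm_num) (c - (h / 2) • e)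
  -- the averaged square
  have hq := H.sq
  have cq0 := hq.cont 0 (by norm_num)
  have cq2 := hq.cont 2 (by norm_num)
  set q := sqChain f with hqdef
  have hhalf : c - (h / 2) • e = c - (1 / 2 : ℝ) • (h • e) := by
    rw [smul_smul]; congr 2; ring
  -- The mean of a function over a segment of length h is its central value plus h^2/24 times its
  -- second derivative, up to fourth order.
  have hbox : |box (h • e) (q 0) (c - (h / 2) • e) - (q 0 c + h ^ 2 / 24 * q 2 c)|
      ≤ 16 * K ^ 2 * h ^ 4 / 384 := by
    have hint : q 0 c + h ^ 2 / 24 * q 2 c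
        = ∫ s in (0 : ℝ)..1, (q 0 c + s ^ 2 * (h ^ 2 / 8 * q 2 c)) := by
      rw [intervalIntegral.integral_add (Continuous.intervalIntegrable (by fun_prop) _ _)
        (Continuous.intervalIntegrable (by fun_prop) _ _), intervalIntegral.integral_mul_const,
        integral_pow]
      norm_num; ring
    rw [hhalf, box_symm _ cq0, hint, ← intervalIntegral.integral_sub
      (Continuous.intervalIntegrable (by fun_prop) _ _)
      (Continuous.intervalIntegrable (by fun_prop) _ _)]
    refine abs_integral_unit_le fun s hs => ?_
    have := hq.even_four c (mul_nonneg (div_nonneg hs.1 zero_le_two) hh)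
    rw [mul_smul] at this
    have hs4 : s ^ 4 ≤ 1 := pow_le_one₀ hs.1 hs.2
    have : |((q 0 (c + (s / 2) • h • e) + q 0 (c - (s / 2) • h • e)) / 2
        - (q 0 c + s ^ 2 * (h ^ 2 / 8 * q 2 c)))| ≤ 16 * K ^ 2 * (s / 2 * h) ^ 4 / 12 / 2 := by
      rw [abs_le] at this ⊢; constructor <;> linarith [this.1, this.2]
    refine this.trans ?_
    have : K ^ 2 * h ^ 4 * s ^ 4 ≤ K ^ 2 * h ^ 4 * 1 :=
      mul_le_mul_of_nonneg_left hs4 (by positivity)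
    nlinarith
  have hbox2 : |sd (h • e) (box (h • e) (q 0)) (c - (h / 2) • e) - h ^ 2 * q 2 c|
      ≤ 4 * K ^ 2 * h ^ 4 := by
    rw [← box_sd _ _ cq0]
    have hc2 : |box (h • e) (q 2) (c - (h / 2) • e) - q 2 c| ≤ 16 * K ^ 2 * h ^ 2 / 8 := by
      have hint : q 2 c = ∫ s in (0 : ℝ)..1, q 2 c := by simp
      rw [hhalf, box_symm _ cq2]
      conv_lhs => rw [hint]
      rw [← intervalIntegral.integral_sub
        (Continuous.intervalIntegrable (by fun_prop) _ _)
        (Continuous.intervalIntegrable (by fun_prop) _ _)]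
      refine abs_integral_unit_le fun s hs => ?_
      have h1 := hq.even_two (i := 2) (by norm_num) c (mul_nonneg (div_nonneg hs.1 zero_le_two) hh)
      rw [mul_smul] at h1
      have hs2 : s ^ 2 ≤ 1 := pow_le_one₀ hs.1 hs.2
      have h2 : 16 * K ^ 2 * (s / 2 * h) ^ 2 ≤ 16 * K ^ 2 * h ^ 2 / 4 := by
        have : K ^ 2 * h ^ 2 * s ^ 2 ≤ K ^ 2 * h ^ 2 * 1 :=
          mul_le_mul_of_nonneg_left hs2 (by positivity)
        nlinarith
      have h3 := h1.trans h2
      rw [abs_le] at h3 ⊢; constructor <;> linarith [h3.1, h3.2]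
    have hc1 : |box (h • e) (sd (h • e) (q 0)) (c - (h / 2) • e)
        - h ^ 2 * box (h • e) (q 2) (c - (h / 2) • e)| ≤ 16 * K ^ 2 * h ^ 4 / 12 := by
      rw [← box_const_mul, ← box_sub _ (continuous_sd _ cq0) (by fun_prop)]
      exact abs_box_le _ _ _ fun s _ => hq.abs_sd_sub_le hh _
    have hc3 : |h ^ 2 * (box (h • e) (q 2) (c - (h / 2) • e) - q 2 c)|
        ≤ h ^ 2 * (16 * K ^ 2 * h ^ 2 / 8) := by
      rw [abs_mul, abs_of_nonneg (sq_nonneg h)]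
      exact mul_le_mul_of_nonneg_left hc2 (sq_nonneg h)
    have hKh : 0 ≤ K ^ 2 * h ^ 4 := by positivity
    rw [abs_le] at hc1 hc3 ⊢
    constructor <;> linarith [hc1.1, hc1.2, hc3.1, hc3.2]
  rw [hz, cB]
  have hq0 : q 0 c = f 0 c * f 0 c := rfl
  have hq2 : q 2 c = 2 * (f 1 c * f 1 c + f 0 c * f 2 c) := rfl
  rw [hq0, hq2] at hbox
  rw [hq2] at hbox2
  exact abs_flux_le hh a4 a2 b2 o1 o1' o3 s1 s2 k0 k1 kp km np nm hbox hbox2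

end analytic

/-! ## Energy inequalities for periodic mesh functions

Periodic mesh functions are functions on a finite abelian group `G`; a direction is an element
`s` of `G`. -/

section mesh

variable {G : Type*} [AddCommGroup G]

/-- The centred difference in direction `s`. -/
noncomputable def dhat (h : ℝ) (s : G) (f : G → ℝ) (a : G) : ℝ := (f (a + s) - f (a - s)) / (2 * h)

/-- The skew-symmetric discretization of the transport term in direction `s`. -/
noncomputable def psi (h : ℝ) (s : G) (u v : G → ℝ) (a : G) : ℝ :=
  1 / 3 * (u a * dhat h s v a + dhat h s (fun b => u b * v b) a)

variable [Fintype G]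

theorem sum_shift_sub (s : G) (φ : G → ℝ) : ∑ a, (φ (a + s) - φ a) = 0 := by
  rw [Finset.sum_sub_distrib, sub_eq_zero]
  exact Equiv.sum_comp (Equiv.addRight s) φ

theorem sum_shift (s : G) (φ : G → ℝ) : ∑ a, φ (a + s) = ∑ a, φ a :=
  Equiv.sum_comp (Equiv.addRight s) φ

theorem sum_shift_neg (s : G) (φ : G → ℝ) : ∑ a, φ (a - s) = ∑ a, φ a :=
  Equiv.sum_comp (Equiv.subRight s) φ

/-- Summing a pointwise inequality that holds up to a telescoping term. -/
theorem sum_le_of_telescoping (s : G) (φ f g : G → ℝ)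
    (h : ∀ a, f a ≤ g a + (φ (a + s) - φ a)) : ∑ a, f a ≤ ∑ a, g a := by
  calc ∑ a, f a ≤ ∑ a, (g a + (φ (a + s) - φ a)) := Finset.sum_le_sum fun a _ => h a
    _ = ∑ a, g a := by rw [Finset.sum_add_distrib, sum_shift_sub, add_zero]

theorem sum_mul_sd (s : G) (f g : G → ℝ) :
    ∑ a, f a * sd s g a = -∑ a, (f (a + s) - f a) * (g (a + s) - g a) := by
  have h := sum_shift_sub s fun a => f a * g a - f a * g (a - s)
  rw [← sub_eq_zero, sub_neg_eq_add, ← Finset.sum_add_distrib, ← h]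
  refine Finset.sum_congr rfl fun a _ => ?_
  simp only [sd, add_sub_cancel_right]
  ring

/-- The summand telescopes whatever the transporting field `u` is. Both the stability of the scheme
and the absence of any bound on the numerical solution rest on this. -/
theorem sum_psi_mul_self {h : ℝ} (s : G) (u e : G → ℝ) : ∑ a, psi h s u e a * e a = 0 := by
  have hs := sum_shift_sub s
    fun a => (u a * e a * e (a - s) + e a * (u (a - s) * e (a - s))) / (6 * h)
  rw [← hs]
  refine Finset.sum_congr rfl fun a _ => ?_
  simp only [psi, dhat, add_sub_cancel_right]
  ring

theorem sum_sq_diff_le (s : G) (f : G → ℝ) :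
    ∑ a, (f (a + s) - f a) ^ 2 ≤ 4 * ∑ a, f a ^ 2 := by
  rw [Finset.mul_sum]
  refine sum_le_of_telescoping s (fun a => 2 * f a ^ 2) _ _ fun a => ?_
  nlinarith [sq_nonneg (f (a + s) + f a)]

/-- Coercivity of the compact second difference. -/
theorem sum_compact_mul_le {h : ℝ} (hh : 0 < h) (s : G) {η e σ : G → ℝ}
    (H : ∀ a, h ^ 2 * cA s η a = sd s (fun b => e b + σ b) a) :
    ∑ a, η a * e a ≤ -(1 / 4) * ((∑ a, (e (a + s) - e a) ^ 2) / h ^ 2)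
      - h ^ 2 / 36 * ∑ a, η a ^ 2 + 5 / 4 * ((∑ a, (σ (a + s) - σ a) ^ 2) / h ^ 2) := by
  set θ : G → ℝ := fun b => e b + σ b with hθ
  have h2 : 0 < h ^ 2 := by positivity
  have hη : ∀ a, η a = sd s θ a / h ^ 2 - sd s η a / 12 := fun a => by
    rw [eq_sub_iff_add_eq, eq_div_iff h2.ne', ← H a, cA]; ring
  have key : ∀ g : G → ℝ, ∑ a, η a * g a
      = -(∑ a, (g (a + s) - g a) * (θ (a + s) - θ a)) / h ^ 2
        + (∑ a, (g (a + s) - g a) * (η (a + s) - η a)) / 12 := fun g => by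
    have e1 := sum_mul_sd s g θ
    have e2 := sum_mul_sd s g η
    have : ∑ a, η a * g a = (∑ a, g a * sd s θ a) / h ^ 2 - (∑ a, g a * sd s η a) / 12 := by
      rw [Finset.sum_div, Finset.sum_div, ← Finset.sum_sub_distrib]
      refine Finset.sum_congr rfl fun a _ => ?_
      rw [hη a]
      ring
    rw [this, e1, e2]; ring
  have k1 := key θ
  have k2 := key σ
  -- Testing the compact relation with η itself produces the term -h^2/12 ‖η‖^2.
  have hcross : ∑ a, (θ (a + s) - θ a) * (η (a + s) - η a)
      = -h ^ 2 * ∑ a, η a ^ 2 + h ^ 2 / 12 * ∑ a, (η (a + s) - η a) ^ 2 := by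
    have e1 := sum_mul_sd s η θ
    have e2 := sum_mul_sd s η η
    have e3 : ∑ a, η a * sd s θ a = h ^ 2 * ∑ a, η a ^ 2 + h ^ 2 / 12 * ∑ a, η a * sd s η a := by
      rw [Finset.mul_sum, Finset.mul_sum, ← Finset.sum_add_distrib]
      refine Finset.sum_congr rfl fun a _ => ?_
      rw [← H a, cA]; ring
    have e4 : ∑ a, (θ (a + s) - θ a) * (η (a + s) - η a)
        = ∑ a, (η (a + s) - η a) * (θ (a + s) - θ a) :=
      Finset.sum_congr rfl fun a _ => mul_comm _ _
    simp only [← pow_two] at e2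
    rw [e4]
    rw [e1, e2] at e3
    linarith
  -- Two terms h^2/144 ‖Δη‖^2 occur, and the inverse estimate turns each into h^2/36 ‖η‖^2. Of the
  -- gain h^2/12 ‖η‖^2, the amount h^2/36 ‖η‖^2 is left, to absorb the auxiliary transport term.
  have hη4 := sum_sq_diff_le s η
  have hsplit : ∑ a, η a * e a = ∑ a, η a * θ a - ∑ a, η a * σ a := by
    rw [← Finset.sum_sub_distrib]
    exact Finset.sum_congr rfl fun a _ => by simp only [hθ]; ring
  have y1 : (∑ a, (σ (a + s) - σ a) * (θ (a + s) - θ a)) / h ^ 2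
      ≤ 1 / 2 * ((∑ a, (θ (a + s) - θ a) ^ 2) / h ^ 2)
        + 1 / 2 * ((∑ a, (σ (a + s) - σ a) ^ 2) / h ^ 2) := by
    rw [← mul_div_assoc, ← mul_div_assoc, ← add_div, Finset.mul_sum, Finset.mul_sum,
      ← Finset.sum_add_distrib]
    refine div_le_div_of_nonneg_right (Finset.sum_le_sum fun a _ => ?_) h2.le
    nlinarith [sq_nonneg ((σ (a + s) - σ a) - (θ (a + s) - θ a))]
  have y2 : -(∑ a, (σ (a + s) - σ a) * (η (a + s) - η a)) / 12
      ≤ h ^ 2 / 144 * (∑ a, (η (a + s) - η a) ^ 2)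
        + 1 / 4 * ((∑ a, (σ (a + s) - σ a) ^ 2) / h ^ 2) := by
    rw [Finset.mul_sum, Finset.sum_div, Finset.mul_sum, ← Finset.sum_neg_distrib, Finset.sum_div,
      ← Finset.sum_add_distrib]
    refine Finset.sum_le_sum fun a _ => ?_
    set x := σ (a + s) - σ a
    set y := η (a + s) - η a
    have : 0 ≤ (h ^ 2 * y + 6 * x) ^ 2 / (144 * h ^ 2) := by positivity
    have e : (h ^ 2 * y + 6 * x) ^ 2 / (144 * h ^ 2)
        = h ^ 2 / 144 * y ^ 2 + 1 / 4 * (x ^ 2 / h ^ 2) + x * y / 12 := by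
      field_simp; ring
    linarith
  have y3 : (∑ a, (e (a + s) - e a) ^ 2) / h ^ 2
      ≤ 2 * ((∑ a, (θ (a + s) - θ a) ^ 2) / h ^ 2)
        + 2 * ((∑ a, (σ (a + s) - σ a) ^ 2) / h ^ 2) := by
    rw [← mul_div_assoc, ← mul_div_assoc, ← add_div, Finset.mul_sum, Finset.mul_sum,
      ← Finset.sum_add_distrib]
    refine div_le_div_of_nonneg_right (Finset.sum_le_sum fun a _ => ?_) h2.le
    simp only [hθ]
    nlinarith [sq_nonneg ((e (a + s) - e a) + 2 * (σ (a + s) - σ a))]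
  have hη4' := mul_le_mul_of_nonneg_left hη4 (show 0 ≤ h ^ 2 / 144 by positivity)
  simp only [← pow_two] at k1
  rw [hcross] at k1
  rw [hsplit, k1, k2]
  simp only [neg_div] at y2 ⊢
  linarith

/-- The transport of the error by itself against a Lipschitz profile. -/
theorem neg_sum_psi_mul_le {h K : ℝ} (hh : 0 < h) (s : G) {e U : G → ℝ}
    (hU : ∀ a, |U (a + s) - U a| ≤ K * h) :
    -∑ a, psi h s e U a * e a ≤ K / 2 * ∑ a, e a ^ 2 := by
  rw [← Finset.sum_neg_distrib, Finset.mul_sum]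
  refine sum_le_of_telescoping s
    (fun a => -(e a * e (a - s) * U a) / (6 * h) - K / 12 * e (a - s) ^ 2) _ _ fun a => ?_
  have h1 := hU a
  have h2 := hU (a - s)
  simp only [sub_add_cancel, add_sub_cancel_right] at h2 ⊢
  have hK : 0 ≤ K := nonneg_of_mul_nonneg_left ((abs_nonneg _).trans h1) hh
  set p := (U (a + s) - U a) / h with hp
  set m := (U a - U (a - s)) / h with hm
  have p1 : |p| ≤ K := by rw [hp, abs_div, abs_of_pos hh, div_le_iff₀ hh]; exact h1
  have m1 : |m| ≤ K := by rw [hm, abs_div, abs_of_pos hh, div_le_iff₀ hh]; exact h2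
  -- Up to a telescoping term the difference falls on the profile `U`, whose slopes p and m are
  -- bounded.
  have id1 : -(psi h s e U a * e a) = 1 / 6 * (-(p + m) * e a ^ 2)
      + 1 / 6 * (-(m * (e a * e (a - s))))
      + (-(e (a + s) * e a * U (a + s)) / (6 * h) - -(e a * e (a - s) * U a) / (6 * h)) := by
    simp only [psi, dhat, hp, hm]; field_simp; ring
  have q1 : -(p + m) * e a ^ 2 ≤ 2 * K * e a ^ 2 := by
    rw [abs_le] at p1 m1; nlinarith [sq_nonneg (e a)]
  have q2 : -(m * (e a * e (a - s))) ≤ K * ((e a ^ 2 + e (a - s) ^ 2) / 2) := by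
    refine (neg_le_abs _).trans (abs_mul_le_mul m1 ?_)
    rw [abs_le]
    constructor <;> nlinarith [sq_nonneg (e a + e (a - s)), sq_nonneg (e a - e (a - s))]
  linarith

/-- The contribution of the error in the auxiliary second difference variable. -/
theorem sum_psi_aux_mul_le {h K lam : ℝ} (hh : 0 < h) (hlam : 0 < lam) (s : G) {η e U : G → ℝ}
    (hUK : ∀ a, |U a| ≤ K) (hU : ∀ a, |U (a + s) - U a| ≤ K * h) :
    h ^ 2 / 2 * ∑ a, psi h s η U a * e a
      ≤ lam * h ^ 2 / 36 * ∑ a, η a ^ 2 + K ^ 2 / (2 * lam) * (1 + h ^ 2) * ∑ a, e a ^ 2 := by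
  rw [Finset.mul_sum, Finset.mul_sum, Finset.mul_sum, ← Finset.sum_add_distrib]
  refine sum_le_of_telescoping s
    (fun a => h / 12 * (e a * (η (a - s) * U (a - s)) + η a * U a * e (a - s))
      + K ^ 2 / (8 * lam) * (2 * e a ^ 2 - 2 * e (a - s) ^ 2)) _ _ fun a => ?_
  have h1 := hU a
  have h2 := hU (a - s)
  have h3 := hUK a
  simp only [sub_add_cancel, add_sub_cancel_right] at h2 ⊢
  have hK : 0 ≤ K := (abs_nonneg _).trans h3
  set w := (U (a + s) - U (a - s)) / h with hw
  have w1 : w ^ 2 ≤ (2 * K) ^ 2 := by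
    rw [← sq_abs]
    refine pow_le_pow_left₀ (abs_nonneg _) ?_ 2
    rw [hw, abs_div, abs_of_pos hh, div_le_iff₀ hh]
    rw [abs_le] at *; constructor <;> linarith
  have U2 : U a ^ 2 ≤ K ^ 2 := by
    rw [← sq_abs]; exact pow_le_pow_left₀ (abs_nonneg _) h3 2
  set g := e (a + s) - e (a - s) with hg
  -- The factor h^2 against a single difference quotient leaves h η times the undivided difference g
  -- of the error. So g can be bounded by the error itself, and no part of the gradient is used up.
  have id1 : h ^ 2 / 2 * (psi h s η U a * e a) = h ^ 2 / 12 * w * η a * e a - h / 12 * η a * U a * g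
      + h / 12 * ((e (a + s) * (η a * U a) + η (a + s) * U (a + s) * e a)
        - (e a * (η (a - s) * U (a - s)) + η a * U a * e (a - s))) := by
    simp only [psi, dhat, hw, hg]; field_simp; ring
  have q1 : h ^ 2 / 12 * w * η a * e a
      ≤ lam * h ^ 2 / 72 * η a ^ 2 + h ^ 2 * w ^ 2 / (8 * lam) * e a ^ 2 := by
    have : 0 ≤ (lam * h * η a - 3 * h * w * e a) ^ 2 / (72 * lam) := by positivity
    have e1 : (lam * h * η a - 3 * h * w * e a) ^ 2 / (72 * lam) = lam * h ^ 2 / 72 * η a ^ 2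
        + h ^ 2 * w ^ 2 / (8 * lam) * e a ^ 2 - h ^ 2 / 12 * w * η a * e a := by
      field_simp; ring
    linarith
  have q2 : -(h / 12 * η a * U a * g)
      ≤ lam * h ^ 2 / 72 * η a ^ 2 + U a ^ 2 / (8 * lam) * g ^ 2 := by
    have : 0 ≤ (lam * h * η a + 3 * U a * g) ^ 2 / (72 * lam) := by positivity
    have e1 : (lam * h * η a + 3 * U a * g) ^ 2 / (72 * lam) = lam * h ^ 2 / 72 * η a ^ 2
        + U a ^ 2 / (8 * lam) * g ^ 2 + h / 12 * η a * U a * g := by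
      field_simp; ring
    linarith
  have q3 : h ^ 2 * w ^ 2 / (8 * lam) * e a ^ 2 ≤ h ^ 2 * (2 * K) ^ 2 / (8 * lam) * e a ^ 2 := by
    gcongr
  have q4 : U a ^ 2 / (8 * lam) * g ^ 2
      ≤ K ^ 2 / (8 * lam) * (2 * e (a + s) ^ 2 + 2 * e (a - s) ^ 2) := by
    have : g ^ 2 ≤ 2 * e (a + s) ^ 2 + 2 * e (a - s) ^ 2 := by
      rw [hg]; nlinarith [sq_nonneg (e (a + s) + e (a - s))]
    gcongr
  have e3 : h ^ 2 * (2 * K) ^ 2 / (8 * lam) * e a ^ 2 = K ^ 2 / (2 * lam) * h ^ 2 * e a ^ 2 := by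
    field_simp; ring
  have e4 : K ^ 2 / (2 * lam) = 4 * (K ^ 2 / (8 * lam)) := by field_simp; ring
  rw [e3] at q3
  rw [id1]
  rw [e4] at q3 ⊢
  linarith

/-- Summation by parts removes the division by h from `F`. Young's inequality is weighted so that
the gradient term is exactly λ times the one gained in `sum_compact_mul_le`. -/
theorem sum_flux_mul_le {h lam : ℝ} (hh : 0 < h) (hlam : 0 < lam) (s : G) (F e : G → ℝ) :
    ∑ a, (F a - F (a - s)) / h * e a
      ≤ lam / 4 * ((∑ a, (e (a + s) - e a) ^ 2) / h ^ 2) + 1 / lam * ∑ a, F a ^ 2 := by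
  rw [Finset.sum_div, Finset.mul_sum, Finset.mul_sum, ← Finset.sum_add_distrib]
  refine sum_le_of_telescoping s (fun a => F (a - s) * e a / h) _ _ fun a => ?_
  simp only [add_sub_cancel_right]
  set g := e (a + s) - e a with hg
  have : 0 ≤ (lam * g / h + 2 * F a) ^ 2 / (4 * lam) := by positivity
  have e1 : (lam * g / h + 2 * F a) ^ 2 / (4 * lam)
      = lam / 4 * (g ^ 2 / h ^ 2) + 1 / lam * F a ^ 2 + F a * g / h := by
    field_simp; ring
  have e2 : (F a - F (a - s)) / h * e a
      = -(F a * g / h) + (F a * e (a + s) / h - F (a - s) * e a / h) := by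
    rw [hg]; field_simp; ring
  linarith

/-- All contributions of one direction to the energy balance of the error. -/
theorem sum_direction_le {h K lam H : ℝ} (hh : 0 < h) (hH : h ≤ H) (hlam : 0 < lam) (s : G)
    {η e σ U u v F ρ : G → ℝ}
    (hη : ∀ a, h ^ 2 * cA s η a = sd s (fun b => e b + σ b) a)
    (hUK : ∀ a, |U a| ≤ K) (hU : ∀ a, |U (a + s) - U a| ≤ K * h) :
    ∑ a, (lam * η a - (psi h s e U a + psi h s u e a)
        + h ^ 2 / 2 * (psi h s η U a + psi h s v e a) + (F a - F (a - s)) / h + ρ a) * e a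
      ≤ (K / 2 + K ^ 2 / (2 * lam) * (1 + H ^ 2) + 1 / 2) * ∑ a, e a ^ 2
        + (5 * lam / 4 * ((∑ a, (σ (a + s) - σ a) ^ 2) / h ^ 2) + 1 / lam * ∑ a, F a ^ 2
          + 1 / 2 * ∑ a, ρ a ^ 2) := by
  -- The gains λ/4 ‖Δe‖^2/h^2 and λh^2/36 ‖η‖^2 are consumed completely by the flux term `h4` and
  -- the auxiliary transport term `h3`.
  have h1 := mul_le_mul_of_nonneg_left (sum_compact_mul_le hh s hη) hlam.le
  have h2 := neg_sum_psi_mul_le hh s (e := e) hU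
  have h3 := sum_psi_aux_mul_le hh hlam s (η := η) (e := e) hUK hU
  have h4 := sum_flux_mul_le hh hlam s F e
  have h5 : ∑ a, ρ a * e a ≤ 1 / 2 * ∑ a, ρ a ^ 2 + 1 / 2 * ∑ a, e a ^ 2 := by
    rw [Finset.mul_sum, Finset.mul_sum, ← Finset.sum_add_distrib]
    exact Finset.sum_le_sum fun a _ => by nlinarith [sq_nonneg (ρ a - e a)]
  have h6 := sum_psi_mul_self (h := h) s u e
  have h7 := sum_psi_mul_self (h := h) s v e
  have hsplit : ∑ a, (lam * η a - (psi h s e U a + psi h s u e a)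
        + h ^ 2 / 2 * (psi h s η U a + psi h s v e a) + (F a - F (a - s)) / h + ρ a) * e a
      = lam * ∑ a, η a * e a - ∑ a, psi h s e U a * e a - ∑ a, psi h s u e a * e a
        + h ^ 2 / 2 * ∑ a, psi h s η U a * e a + h ^ 2 / 2 * ∑ a, psi h s v e a * e a
        + ∑ a, (F a - F (a - s)) / h * e a + ∑ a, ρ a * e a := by
    simp only [Finset.mul_sum, ← Finset.sum_add_distrib, ← Finset.sum_sub_distrib]
    exact Finset.sum_congr rfl fun a _ => by ring
  have hS : 0 ≤ ∑ a, e a ^ 2 := Finset.sum_nonneg fun a _ => sq_nonneg _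
  have h8 : K ^ 2 / (2 * lam) * (1 + h ^ 2) * ∑ a, e a ^ 2
      ≤ K ^ 2 / (2 * lam) * (1 + H ^ 2) * ∑ a, e a ^ 2 := by gcongr
  rw [hsplit, h6, h7]
  linarith

/-- One time step of the energy estimate for the error of the compact scheme. -/
theorem scheme_error_step {ι : Type*} [Fintype ι] {h K lam H τ : ℝ} (hh : 0 < h) (hH : h ≤ H)
    (hlam : 0 < lam) (hτ : 0 < τ) (s : ι → G) {X X' x x' : G → ℝ} {V v σ F ρ : ι → G → ℝ}
    (hX : ∀ a, (X' a - X a) / τ = ∑ j, (lam * V j a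
      - (psi h (s j) (fun b => (X' b + X b) / 2) (fun b => (X' b + X b) / 2) a
        - h ^ 2 / 2 * psi h (s j) (V j) (fun b => (X' b + X b) / 2) a)
      + (F j a - F j (a - s j)) / h + ρ j a))
    (hx : ∀ a, (x' a - x a) / τ = ∑ j, (lam * v j a
      - (psi h (s j) (fun b => (x' b + x b) / 2) (fun b => (x' b + x b) / 2) a
        - h ^ 2 / 2 * psi h (s j) (v j) (fun b => (x' b + x b) / 2) a)))
    (hV : ∀ j a, h ^ 2 * cA (s j) (V j) a = sd (s j) (fun b => (X' b + X b) / 2 + σ j b) a)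
    (hv : ∀ j a, h ^ 2 * cA (s j) (v j) a = sd (s j) (fun b => (x' b + x b) / 2) a)
    (hUK : ∀ a, |(X' a + X a) / 2| ≤ K)
    (hU : ∀ j a, |(X' (a + s j) + X (a + s j)) / 2 - (X' a + X a) / 2| ≤ K * h) :
    ∑ a, (X' a - x' a) ^ 2 - ∑ a, (X a - x a) ^ 2
      ≤ τ * (Fintype.card ι * (K / 2 + K ^ 2 / (2 * lam) * (1 + H ^ 2) + 1 / 2)
          * (∑ a, (X' a - x' a) ^ 2 + ∑ a, (X a - x a) ^ 2)
        + ∑ j, (5 * lam / 2 * ((∑ a, (σ j (a + s j) - σ j a) ^ 2) / h ^ 2)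
          + 2 / lam * ∑ a, F j a ^ 2 + ∑ a, ρ j a ^ 2)) := by
  set U : G → ℝ := fun b => (X' b + X b) / 2
  set y : G → ℝ := fun b => (x' b + x b) / 2
  set e : G → ℝ := fun b => U b - y b with he
  have hdir : ∀ j, _ := fun j => sum_direction_le (η := fun b => V j b - v j b) (e := e)
    (σ := σ j) (U := U) (u := y) (v := v j) (F := F j) (ρ := ρ j) hh hH hlam (s j)
    (fun a => by
      have e1 : h ^ 2 * cA (s j) (fun b => V j b - v j b) a
          = h ^ 2 * cA (s j) (V j) a - h ^ 2 * cA (s j) (v j) a := by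
        simp only [cA, sd]; ring
      rw [e1, hV, hv]
      simp only [he, sd]; ring) hUK (hU j)
  -- The bilinear differences are split so that the numerical solution occurs only as a transporting
  -- field in front of the error, where it drops out, while the comparison function is the only
  -- profile.
  have hpsi1 : ∀ j a, psi h (s j) U U a - psi h (s j) y y a = psi h (s j) e U a + psi h (s j) y e a :=
    fun j a => by simp only [psi, dhat, he]; ring
  have hpsi2 : ∀ j a, psi h (s j) (V j) U a - psi h (s j) (v j) y a
      = psi h (s j) (fun b => V j b - v j b) U a + psi h (s j) (v j) e a :=
    fun j a => by simp only [psi, dhat, he]; ring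
  have hpt : ∀ a, ((X' a - x' a) ^ 2 - (X a - x a) ^ 2) / (2 * τ)
      = ∑ j, (lam * (V j a - v j a) - (psi h (s j) e U a + psi h (s j) y e a)
        + h ^ 2 / 2 * (psi h (s j) (fun b => V j b - v j b) U a + psi h (s j) (v j) e a)
        + (F j a - F j (a - s j)) / h + ρ j a) * e a := fun a => by
    have e1 : ((X' a - x' a) ^ 2 - (X a - x a) ^ 2) / (2 * τ)
        = ((X' a - X a) / τ - (x' a - x a) / τ) * e a := by
      simp only [he, U, y]; field_simp; ring
    rw [e1, hX, hx, ← Finset.sum_sub_distrib, Finset.sum_mul]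
    refine Finset.sum_congr rfl fun j _ => ?_
    rw [← hpsi1, ← hpsi2]
    ring
  have hsum : (∑ a, (X' a - x' a) ^ 2 - ∑ a, (X a - x a) ^ 2) / (2 * τ)
      ≤ ∑ j, ((K / 2 + K ^ 2 / (2 * lam) * (1 + H ^ 2) + 1 / 2) * ∑ a, e a ^ 2
        + (5 * lam / 4 * ((∑ a, (σ j (a + s j) - σ j a) ^ 2) / h ^ 2) + 1 / lam * ∑ a, F j a ^ 2
          + 1 / 2 * ∑ a, ρ j a ^ 2)) := by
    rw [← Finset.sum_sub_distrib, Finset.sum_div]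
    simp only [hpt]
    rw [Finset.sum_comm]
    exact Finset.sum_le_sum fun j _ => hdir j
  rw [Finset.sum_add_distrib, Finset.sum_const, Finset.card_univ, nsmul_eq_mul,
    div_le_iff₀ (by positivity)] at hsum
  have he2 : ∑ a, e a ^ 2 ≤ 1 / 2 * (∑ a, (X' a - x' a) ^ 2 + ∑ a, (X a - x a) ^ 2) := by
    rw [← Finset.sum_add_distrib, Finset.mul_sum]
    refine Finset.sum_le_sum fun a _ => ?_
    simp only [he, U, y]
    nlinarith [sq_nonneg ((X' a - x' a) - (X a - x a))]
  have hfin : ∑ j, (5 * lam / 2 * ((∑ a, (σ j (a + s j) - σ j a) ^ 2) / h ^ 2)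
          + 2 / lam * ∑ a, F j a ^ 2 + ∑ a, ρ j a ^ 2)
      = 2 * ∑ j, (5 * lam / 4 * ((∑ a, (σ j (a + s j) - σ j a) ^ 2) / h ^ 2)
          + 1 / lam * ∑ a, F j a ^ 2 + 1 / 2 * ∑ a, ρ j a ^ 2) := by
    rw [Finset.mul_sum]
    exact Finset.sum_congr rfl fun j _ => by ring
  rw [hfin]
  refine hsum.trans ?_
  have hC : 0 ≤ (Fintype.card ι : ℝ) * (K / 2 + K ^ 2 / (2 * lam) * (1 + H ^ 2) + 1 / 2) := by
    have : 0 ≤ K := (abs_nonneg _).trans (hUK 0)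
    positivity
  have := mul_le_mul_of_nonneg_left he2 (mul_nonneg hC hτ.le)
  linarith

/-- The compact scheme does not increase the discrete energy. -/
theorem scheme_energy_step {ι : Type*} [Fintype ι] {h lam τ : ℝ} (hh : 0 < h)
    (hlam : 0 < lam) (hτ : 0 < τ) (s : ι → G) {x x' : G → ℝ} {v : ι → G → ℝ}
    (hx : ∀ a, (x' a - x a) / τ = ∑ j, (lam * v j a
      - (psi h (s j) (fun b => (x' b + x b) / 2) (fun b => (x' b + x b) / 2) a
        - h ^ 2 / 2 * psi h (s j) (v j) (fun b => (x' b + x b) / 2) a)))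
    (hv : ∀ j a, h ^ 2 * cA (s j) (v j) a = sd (s j) (fun b => (x' b + x b) / 2) a) :
    ∑ a, x' a ^ 2 ≤ ∑ a, x a ^ 2 := by
  set y : G → ℝ := fun b => (x' b + x b) / 2 with hy
  have hdir : ∀ j, ∑ a, (lam * v j a - (psi h (s j) y y a - h ^ 2 / 2 * psi h (s j) (v j) y a))
      * y a ≤ 0 := fun j => by
    have h1 := sum_compact_mul_le hh (s j) (η := v j) (e := y) (σ := fun _ => 0)
      (fun a => by simpa using hv j a)
    have h6 := sum_psi_mul_self (h := h) (s j) y y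
    have h7 := sum_psi_mul_self (h := h) (s j) (v j) y
    have hsplit : ∑ a, (lam * v j a - (psi h (s j) y y a - h ^ 2 / 2 * psi h (s j) (v j) y a)) * y a
        = lam * ∑ a, v j a * y a - ∑ a, psi h (s j) y y a * y a
          + h ^ 2 / 2 * ∑ a, psi h (s j) (v j) y a * y a := by
      simp only [Finset.mul_sum, ← Finset.sum_add_distrib, ← Finset.sum_sub_distrib]
      exact Finset.sum_congr rfl fun a _ => by ring
    rw [hsplit, h6, h7]
    have p1 : 0 ≤ (∑ a, (y (a + s j) - y a) ^ 2) / h ^ 2 :=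
      div_nonneg (Finset.sum_nonneg fun a _ => sq_nonneg _) (sq_nonneg h)
    have p2 : 0 ≤ h ^ 2 / 36 * ∑ a, v j a ^ 2 :=
      mul_nonneg (by positivity) (Finset.sum_nonneg fun a _ => sq_nonneg _)
    simp only [sub_self, ne_eq, OfNat.ofNat_ne_zero, not_false_eq_true, zero_pow,
      Finset.sum_const_zero, zero_div, mul_zero, add_zero] at h1
    have : ∑ a, v j a * y a ≤ 0 := by linarith
    nlinarith
  have hpt : ∀ a, (x' a ^ 2 - x a ^ 2) / (2 * τ)
      = ∑ j, (lam * v j a - (psi h (s j) y y a - h ^ 2 / 2 * psi h (s j) (v j) y a)) * y a :=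
    fun a => by
      rw [← Finset.sum_mul, ← hx]
      simp only [hy]; field_simp; ring
  have hsum : (∑ a, x' a ^ 2 - ∑ a, x a ^ 2) / (2 * τ) ≤ 0 := by
    rw [← Finset.sum_sub_distrib, Finset.sum_div]
    simp only [hpt]
    rw [Finset.sum_comm]
    exact Finset.sum_nonpos fun j _ => hdir j
  rw [div_le_iff₀ (by positivity)] at hsum
  linarith

end mesh

/-- Discrete Gronwall inequality for Crank–Nicolson type recursions. -/
theorem discrete_gronwall {C τ T : ℝ} (hC : 0 ≤ C) (hτ : 0 < τ) (hCτ : C * τ ≤ 1 / 2) {N : ℕ}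
    (hNT : N * τ ≤ T) {x b : ℕ → ℝ} (hx : ∀ r, 0 ≤ x r) (hb : ∀ r, 0 ≤ b r)
    (h : ∀ r < N, x (r + 1) - x r ≤ τ * (C * (x (r + 1) + x r) + b r)) :
    ∀ r ≤ N, x r ≤ Real.exp (4 * C * T) * (x 0 + 2 * ∑ j ∈ Finset.range N, τ * b j) := by
  have hstep : ∀ r < N, x (r + 1) ≤ Real.exp (4 * C * τ) * (x r + 2 * (τ * b r)) := fun r hr => by
    have h1 := h r hr
    have hexp : 1 + 4 * C * τ ≤ Real.exp (4 * C * τ) := by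
      linarith [Real.add_one_le_exp (4 * C * τ)]
    have hp : 0 ≤ x r + 2 * (τ * b r) := add_nonneg (hx r) (by have := hb r; positivity)
    refine le_trans ?_ (mul_le_mul_of_nonneg_right hexp hp)
    have hc0 : 0 ≤ C * τ := by positivity
    have h2 : (1 - C * τ) * x (r + 1) ≤ (1 - C * τ) * ((1 + 4 * C * τ) * (x r + 2 * (τ * b r))) := by
      have h3 : (1 - C * τ) * x (r + 1) ≤ (1 + C * τ) * x r + τ * b r := by linarith
      -- Equivalent to (Cτ)^2 ≤ Cτ/2: this fixes the factor 4 in the exponent. The factor 2 in front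
      -- of the data absorbs 1/(1 - Cτ).
      have h4 : 1 + C * τ ≤ (1 - C * τ) * (1 + 4 * C * τ) := by nlinarith
      have h5 : (1 + C * τ) * (x r + 2 * (τ * b r))
          ≤ (1 - C * τ) * (1 + 4 * C * τ) * (x r + 2 * (τ * b r)) :=
        mul_le_mul_of_nonneg_right h4 hp
      have h6 : 0 ≤ τ * b r := mul_nonneg hτ.le (hb r)
      nlinarith
    exact le_of_mul_le_mul_left h2 (by linarith)
  have hind : ∀ r ≤ N, x r ≤ Real.exp (4 * C * τ * r)
      * (x 0 + 2 * ∑ j ∈ Finset.range r, τ * b j) := by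
    intro r
    induction r with
    | zero => intro _; simp
    | succ r ih =>
      intro hr
      have h1 := hstep r (by omega)
      have h2 := ih (by omega)
      have hE : 1 ≤ Real.exp (4 * C * τ * r) := Real.one_le_exp (by positivity)
      have hbr : 0 ≤ τ * b r := mul_nonneg hτ.le (hb r)
      have e1 : Real.exp (4 * C * τ * ((r + 1 : ℕ) : ℝ))
          = Real.exp (4 * C * τ) * Real.exp (4 * C * τ * r) := by
        rw [← Real.exp_add]; congr 1; push_cast; ring
      rw [e1, Finset.sum_range_succ, mul_assoc]
      refine h1.trans (mul_le_mul_of_nonneg_left ?_ (Real.exp_pos _).le)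
      nlinarith
  intro r hr
  refine (hind r hr).trans ?_
  have hr' : (r : ℝ) ≤ N := by exact_mod_cast hr
  have hS : ∑ j ∈ Finset.range r, τ * b j ≤ ∑ j ∈ Finset.range N, τ * b j :=
    Finset.sum_le_sum_of_subset_of_nonneg (Finset.range_mono hr)
      fun j _ _ => mul_nonneg hτ.le (hb j)
  have hS0 : 0 ≤ ∑ j ∈ Finset.range r, τ * b j :=
    Finset.sum_nonneg fun j _ => mul_nonneg hτ.le (hb j)
  have hle : 4 * C * τ * r ≤ 4 * C * T := by
    have : τ * r ≤ T := le_trans (by nlinarith) hNT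
    nlinarith
  have := hx 0
  gcongr

/-! ## The solution as a flow on space-time -/

/-- The analytic data of the exact solution in coordinate-free form: `ex`, `ey` are the two
spatial directions, `ux i`, `uy i` the derivatives of order `i` along them. -/
structure Flow (lam L1 L2 T K : ℝ) (ex ey : ℝ × ℝ × ℝ) (ux uy : ℕ → ℝ × ℝ × ℝ → ℝ)
    (ut utt : ℝ × ℝ × ℝ → ℝ) : Prop where
  ex_time : ex.2.2 = 0
  ey_time : ey.2.2 = 0
  chain_x : Chain4 ex K ux
  chain_y : Chain4 ey K uy
  zero_eq : uy 0 = ux 0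
  per_x : ∀ i ≤ 4, ∀ z, ux i (z + L1 • ex) = ux i z ∧ ux i (z + L2 • ey) = ux i z
  per_y : ∀ i ≤ 4, ∀ z, uy i (z + L1 • ex) = uy i z ∧ uy i (z + L2 • ey) = uy i z
  cont_t : Continuous ut
  cont_tt : Continuous utt
  bdd_t : ∀ z, |ut z| ≤ K
  bdd_tt : ∀ z, |utt z| ≤ K
  unif_tt : ∀ ω > 0, ∃ δ > 0, ∀ (z : ℝ × ℝ × ℝ) (s : ℝ), |s| ≤ δ → |utt (z + s • eT) - utt z| ≤ ω
  deriv_t : ∀ (z : ℝ × ℝ × ℝ) (s : ℝ), z.2.2 + s ∈ Set.Ioo 0 T →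
    HasDerivAt (fun s : ℝ => ux 0 (z + s • eT)) (ut (z + s • eT)) s
  deriv_tt : ∀ (z : ℝ × ℝ × ℝ) (s : ℝ), z.2.2 + s ∈ Set.Ioo 0 T →
    HasDerivAt (fun s : ℝ => ut (z + s • eT)) (utt (z + s • eT)) s
  equation : ∀ z : ℝ × ℝ × ℝ, z.2.2 ∈ Set.Ioo 0 T →
    ut z = lam * (ux 2 z + uy 2 z) - ux 0 z * (ux 1 z + uy 1 z)

theorem SmoothData.flow {lam L1 L2 T K : ℝ} {u : ℝ → ℝ → ℝ → ℝ} {ux uy : ℕ → ℝ × ℝ × ℝ → ℝ}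
    {ut utt : ℝ × ℝ × ℝ → ℝ} (D : SmoothData lam L1 L2 T u K ux uy ut utt) :
    Flow lam L1 L2 T K eX eY ux uy ut utt where
  ex_time := rfl
  ey_time := rfl
  chain_x := D.chain_x
  chain_y := D.chain_y
  zero_eq := D.zero_eq
  per_x := D.per_x
  per_y := D.per_y
  cont_t := D.cont_t
  cont_tt := D.cont_tt
  bdd_t := D.bdd_t
  bdd_tt := D.bdd_tt
  unif_tt := fun ω hω => by
    obtain ⟨δ, hδ, h⟩ := D.unif_tt ω hω
    refine ⟨δ, hδ, fun z s hs => ?_⟩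
    have := h z.1 z.2.1 (z.2.2 + s) z.2.2 (by simpa using hs)
    have e : z + s • eT = (z.1, z.2.1, z.2.2 + s) := by ext <;> simp [eT]
    rw [e]; exact this
  deriv_t := fun z s hs => by
    have e : ∀ s : ℝ, z + s • eT = (z.1, z.2.1, z.2.2 + s) := fun s => by ext <;> simp [eT]
    simp only [e]
    exact HasDerivAt.comp_const_add (f := fun t => ux 0 (z.1, z.2.1, t)) z.2.2 s
      (D.deriv_t z.1 z.2.1 _ hs)
  deriv_tt := fun z s hs => by
    have e : ∀ s : ℝ, z + s • eT = (z.1, z.2.1, z.2.2 + s) := fun s => by ext <;> simp [eT]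
    simp only [e]
    exact HasDerivAt.comp_const_add (f := fun t => ut (z.1, z.2.1, t)) z.2.2 s
      (D.deriv_tt z.1 z.2.1 _ hs)
  equation := fun z hz => D.equation z.1 z.2.1 z.2.2 hz

namespace Flow

variable {lam L1 L2 T K : ℝ} {ex ey : ℝ × ℝ × ℝ} {ux uy : ℕ → ℝ × ℝ × ℝ → ℝ}
  {ut utt : ℝ × ℝ × ℝ → ℝ}

theorem swap (D : Flow lam L1 L2 T K ex ey ux uy ut utt) :
    Flow lam L2 L1 T K ey ex uy ux ut utt where
  ex_time := D.ey_time
  ey_time := D.ex_time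
  chain_x := D.chain_y
  chain_y := D.chain_x
  zero_eq := D.zero_eq.symm
  per_x := fun i hi z => (D.per_y i hi z).symm
  per_y := fun i hi z => (D.per_x i hi z).symm
  cont_t := D.cont_t
  cont_tt := D.cont_tt
  bdd_t := D.bdd_t
  bdd_tt := D.bdd_tt
  unif_tt := D.unif_tt
  deriv_t := fun z s hs => by rw [D.zero_eq]; exact D.deriv_t z s hs
  deriv_tt := D.deriv_tt
  equation := fun z hz => by rw [D.equation z hz, D.zero_eq]; ring

theorem cont_zero (D : Flow lam L1 L2 T K ex ey ux uy ut utt) : Continuous (ux 0) :=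
  D.chain_x.cont 0 (by norm_num)

theorem K_nonneg (D : Flow lam L1 L2 T K ex ey ux uy ut utt) : 0 ≤ K := D.chain_x.nonneg

/-- The energy estimate for a finite combination of space-time translates of the solution. -/
theorem energy (D : Flow lam L1 L2 T K ex ey ux uy ut utt) (hlam : 0 < lam) (hL1 : L1 ≠ 0)
    (hL2 : L2 ≠ 0) {ι : Type*} [Fintype ι] (c : ι → ℝ) (w : ι → ℝ × ℝ × ℝ) {T' ε : ℝ}
    (hT' : 0 ≤ T') (hw : ∀ j, 0 ≤ (w j).2.2 ∧ T' + (w j).2.2 ≤ T) (hTT : T' ≤ T)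
    (hg : ∀ z : ℝ × ℝ × ℝ, z.2.2 ∈ Set.Icc 0 T' → |∑ j, c j * ux 0 (z + w j)| ≤ ε)
    (hq : ∀ z : ℝ × ℝ × ℝ, z.2.2 ∈ Set.Icc 0 T' → |∑ j, c j * sqChain ux 0 (z + w j)| ≤ ε) :
    ∫ t in (0 : ℝ)..T', box (L1 • ex) (box (L2 • ey) fun z => (∑ j, c j * ux 1 (z + w j)) ^ 2)
      (t • eT) ≤ (1 / lam + T / (2 * lam ^ 2)) * ε ^ 2 := by
  have cx : ∀ i ≤ 4, Continuous fun z => ∑ j, c j * ux i (z + w j) := fun i hi => by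
    have := D.chain_x.cont i hi
    fun_prop
  have cy : ∀ i ≤ 4, Continuous fun z => ∑ j, c j * uy i (z + w j) := fun i hi => by
    have := D.chain_y.cont i hi
    fun_prop
  have cqx : ∀ i ≤ 4, Continuous fun z => ∑ j, c j * sqChain ux i (z + w j) := fun i hi => by
    have := D.chain_x.sq.cont i hi
    fun_prop
  have cqy : ∀ i ≤ 4, Continuous fun z => ∑ j, c j * sqChain uy i (z + w j) := fun i hi => by
    have := D.chain_y.sq.cont i hi
    fun_prop
  have dd : ∀ {e : ℝ × ℝ × ℝ} {f f' : ℝ × ℝ × ℝ → ℝ}, DD e f f' →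
      DD e (fun z => ∑ j, c j * f (z + w j)) (fun z => ∑ j, c j * f' (z + w j)) :=
    fun h => DD.sum _ fun j _ => (h.shift (w j)).const_mul (c j)
  have hq0 : sqChain uy 0 = sqChain ux 0 := by simp only [sqChain, D.zero_eq]
  have per : ∀ (P : ℝ × ℝ × ℝ) (f : ℝ × ℝ × ℝ → ℝ), (∀ z, f (z + P) = f z) →
      ∀ z, ∑ j, c j * f (z + P + w j) = ∑ j, c j * f (z + w j) := fun P f h z =>
    Finset.sum_congr rfl fun j _ => by rw [add_right_comm, h]
  have tm : ∀ (a b t : ℝ), (a • (L1 • ex) + b • (L2 • ey) + t • eT).2.2 = t := fun a b t => by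
    simp [D.ex_time, D.ey_time, eT]
  -- The equation is linear in the pair (u, u^2), so the combination of the translates of `u` and
  -- the same combination of the translates of u^2 play the parts of g and q. The constraint on `w`
  -- keeps all translated times inside (0, T).
  have key := energy_estimate hlam hL1 hL2 hT' ex ey eT (ε := ε)
    (g := fun z => ∑ j, c j * ux 0 (z + w j)) (gx := fun z => ∑ j, c j * ux 1 (z + w j))
    (gxx := fun z => ∑ j, c j * ux 2 (z + w j)) (gy := fun z => ∑ j, c j * uy 1 (z + w j))
    (gyy := fun z => ∑ j, c j * uy 2 (z + w j)) (q := fun z => ∑ j, c j * sqChain ux 0 (z + w j))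
    (qx := fun z => ∑ j, c j * sqChain ux 1 (z + w j))
    (qy := fun z => ∑ j, c j * sqChain uy 1 (z + w j))
    (cx 0 (by norm_num)) (cx 1 (by norm_num)) (cx 2 (by norm_num)) (cy 1 (by norm_num))
    (cy 2 (by norm_num)) (cqx 0 (by norm_num)) (cqx 1 (by norm_num)) (cqy 1 (by norm_num))
    (dd (D.chain_x.deriv 0 (by norm_num))) (dd (D.chain_x.deriv 1 (by norm_num)))
    (dd (by have := D.chain_y.deriv 0 (by norm_num); rwa [D.zero_eq] at this))
    (dd (D.chain_y.deriv 1 (by norm_num))) (dd (D.chain_x.sq.deriv 0 (by norm_num)))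
    (dd (by have := D.chain_y.sq.deriv 0 (by norm_num); rwa [hq0] at this))
    (per _ _ fun z => (D.per_x 0 (by norm_num) z).1)
    (per _ _ fun z => (D.per_x 1 (by norm_num) z).1)
    (per _ _ fun z => by simp only [sqChain, (D.per_x 0 (by norm_num) z).1])
    (per _ _ fun z => (D.per_x 0 (by norm_num) z).2)
    (per _ _ fun z => (D.per_y 1 (by norm_num) z).2)
    (per _ _ fun z => by simp only [sqChain, (D.per_x 0 (by norm_num) z).2])
    (fun a b t ht0 ht => by
      have : HasDerivAt (fun t : ℝ => ∑ j, c j * ux 0 (a • (L1 • ex) + b • (L2 • ey) + t • eT + w j))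
          (∑ j, c j * ut (a • (L1 • ex) + b • (L2 • ey) + t • eT + w j)) t :=
        HasDerivAt.fun_sum fun j _ => by
          have h := D.deriv_t (a • (L1 • ex) + b • (L2 • ey) + w j) t (by
            have := tm a b 0
            simp only [zero_smul, add_zero] at this
            rw [Prod.snd_add, Prod.snd_add, this]
            exact ⟨by linarith [(hw j).1], by linarith [(hw j).2]⟩)
          simp only [add_right_comm _ (w j)] at h
          exact h.const_mul (c j)
      refine this.congr_deriv ?_
      simp only [Finset.mul_sum, ← Finset.sum_add_distrib, ← Finset.sum_sub_distrib]
      refine Finset.sum_congr rfl fun j _ => ?_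
      rw [D.equation _ (by
        rw [Prod.snd_add, Prod.snd_add, tm]
        exact ⟨by linarith [(hw j).1], by linarith [(hw j).2]⟩)]
      simp only [sqChain, D.zero_eq]
      ring)
    (fun a b t ht0 ht => hg _ (by rw [tm]; exact ⟨ht0, ht⟩))
    (fun a b t ht0 ht => hq _ (by rw [tm]; exact ⟨ht0, ht⟩))
  have c1 : Continuous fun z => (∑ j, c j * ux 1 (z + w j)) ^ 2 := (cx 1 (by norm_num)).pow 2
  have c2 : Continuous fun z => (∑ j, c j * ux 1 (z + w j)) ^ 2 + (∑ j, c j * uy 1 (z + w j)) ^ 2 :=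
    c1.add ((cy 1 (by norm_num)).pow 2)
  have b1 := continuous_box (L1 • ex) (continuous_box (L2 • ey) c1)
  have b2 := continuous_box (L1 • ex) (continuous_box (L2 • ey) c2)
  refine le_trans (intervalIntegral.integral_mono_on hT'
    (Continuous.intervalIntegrable (by fun_prop) _ _)
    (Continuous.intervalIntegrable (by fun_prop) _ _) fun t _ => ?_) (key.trans ?_)
  · exact box_mono _ (continuous_box _ c1) (continuous_box _ c2) _ fun a _ =>
      box_mono _ c1 c2 _ fun b _ => le_add_of_nonneg_right (sq_nonneg _)
  · gcongr

/-! ### Time differences -/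

theorem sq_deriv_t (D : Flow lam L1 L2 T K ex ey ux uy ut utt) (z : ℝ × ℝ × ℝ) (s : ℝ)
    (hs : z.2.2 + s ∈ Set.Ioo 0 T) : HasDerivAt (fun s : ℝ => sqChain ux 0 (z + s • eT))
      (2 * (ux 0 (z + s • eT) * ut (z + s • eT))) s := by
  have h := D.deriv_t z s hs
  refine (h.mul h).congr_deriv ?_
  ring

theorem sq_deriv_tt (D : Flow lam L1 L2 T K ex ey ux uy ut utt) (z : ℝ × ℝ × ℝ) (s : ℝ)
    (hs : z.2.2 + s ∈ Set.Ioo 0 T) :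
    HasDerivAt (fun s : ℝ => 2 * (ux 0 (z + s • eT) * ut (z + s • eT)))
      (2 * (ut (z + s • eT) * ut (z + s • eT) + ux 0 (z + s • eT) * utt (z + s • eT))) s :=
  ((D.deriv_t z s hs).mul (D.deriv_tt z s hs)).const_mul 2

theorem abs_sq_tt_le (D : Flow lam L1 L2 T K ex ey ux uy ut utt) (z : ℝ × ℝ × ℝ) :
    |2 * (ut z * ut z + ux 0 z * utt z)| ≤ 4 * K ^ 2 := by
  have h1 := abs_mul_le_mul (D.bdd_t z) (D.bdd_t z)
  have h2 := abs_mul_le_mul (D.chain_x.bdd 0 (by norm_num) z) (D.bdd_tt z)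
  rw [abs_le] at *; constructor <;> linarith

/-- Second order accuracy in time of the linear Taylor polynomial. -/
theorem taylor_t (D : Flow lam L1 L2 T K ex ey ux uy ut utt) (z : ℝ × ℝ × ℝ) {s t : ℝ}
    (hs : z.2.2 + s ∈ Set.Icc 0 T) (ht : z.2.2 + t ∈ Set.Icc 0 T) :
    |ux 0 (z + t • eT) - ux 0 (z + s • eT) - ut (z + s • eT) * (t - s)|
      ≤ K * (t - s) ^ 2 / 2 := by
  have c0 := D.cont_zero
  have c1 := D.cont_t
  refine taylor_two (a := -z.2.2) (b := T - z.2.2) (φ := fun t => ux 0 (z + t • eT))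
    (φ' := fun t => ut (z + t • eT)) (φ'' := fun t => utt (z + t • eT))
    (Continuous.continuousOn (by fun_prop)) (Continuous.continuousOn (by fun_prop))
    (fun r hr => D.deriv_t z r ⟨by linarith [hr.1], by linarith [hr.2]⟩)
    (fun r hr => D.deriv_tt z r ⟨by linarith [hr.1], by linarith [hr.2]⟩)
    (fun r _ => D.bdd_tt _) ⟨by linarith [hs.1], by linarith [hs.2]⟩
    ⟨by linarith [ht.1], by linarith [ht.2]⟩

theorem taylor_sq_t (D : Flow lam L1 L2 T K ex ey ux uy ut utt) (z : ℝ × ℝ × ℝ) {s t : ℝ}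
    (hs : z.2.2 + s ∈ Set.Icc 0 T) (ht : z.2.2 + t ∈ Set.Icc 0 T) :
    |sqChain ux 0 (z + t • eT) - sqChain ux 0 (z + s • eT)
      - 2 * (ux 0 (z + s • eT) * ut (z + s • eT)) * (t - s)| ≤ 4 * K ^ 2 * (t - s) ^ 2 / 2 := by
  have c0 := D.cont_zero
  have c1 := D.cont_t
  refine taylor_two (a := -z.2.2) (b := T - z.2.2) (φ := fun t => sqChain ux 0 (z + t • eT))
    (φ' := fun t => 2 * (ux 0 (z + t • eT) * ut (z + t • eT)))
    (φ'' := fun t => 2 * (ut (z + t • eT) * ut (z + t • eT) + ux 0 (z + t • eT) * utt (z + t • eT)))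
    (Continuous.continuousOn (by simp only [sqChain]; fun_prop))
    (Continuous.continuousOn (by fun_prop))
    (fun r hr => D.sq_deriv_t z r ⟨by linarith [hr.1], by linarith [hr.2]⟩)
    (fun r hr => D.sq_deriv_tt z r ⟨by linarith [hr.1], by linarith [hr.2]⟩)
    (fun r _ => D.abs_sq_tt_le _) ⟨by linarith [hs.1], by linarith [hs.2]⟩
    ⟨by linarith [ht.1], by linarith [ht.2]⟩

/-- Used with c = 0 to bound the second difference quotient, and with c = u_tt(z) to compare it with
u_tt. -/
theorem second_difference_t (D : Flow lam L1 L2 T K ex ey ux uy ut utt) (z : ℝ × ℝ × ℝ) {k : ℝ}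
    (hk : 0 ≤ k) (hz : 0 ≤ z.2.2) (hz' : z.2.2 + 2 * k ≤ T) (c : ℝ) {K' : ℝ}
    (hK : ∀ s ∈ Set.Ioo 0 (2 * k), |utt (z + s • eT) - c| ≤ K') :
    |ux 0 (z + (2 * k) • eT) - 2 * ux 0 (z + k • eT) + ux 0 z - k ^ 2 * c| ≤ K' * k ^ 2 := by
  have c0 := D.cont_zero
  have c1 := D.cont_t
  have := taylor_second_difference (a := 0) hk (φ := fun t => ux 0 (z + t • eT))
    (φ' := fun t => ut (z + t • eT)) (φ'' := fun t => utt (z + t • eT))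
    (Continuous.continuousOn (by fun_prop)) (Continuous.continuousOn (by fun_prop))
    (fun r hr => D.deriv_t z r ⟨by linarith [hr.1], by linarith [hr.2]⟩)
    (fun r hr => D.deriv_tt z r ⟨by linarith [hr.1], by linarith [hr.2]⟩) c
    (by simpa using hK)
  simpa using this

theorem second_difference_sq_t (D : Flow lam L1 L2 T K ex ey ux uy ut utt) (z : ℝ × ℝ × ℝ)
    {k : ℝ} (hk : 0 ≤ k) (hz : 0 ≤ z.2.2) (hz' : z.2.2 + 2 * k ≤ T) :
    |sqChain ux 0 (z + (2 * k) • eT) - 2 * sqChain ux 0 (z + k • eT) + sqChain ux 0 z|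
      ≤ 4 * K ^ 2 * k ^ 2 := by
  have c0 := D.cont_zero
  have c1 := D.cont_t
  have := taylor_second_difference (a := 0) hk (φ := fun t => sqChain ux 0 (z + t • eT))
    (φ' := fun t => 2 * (ux 0 (z + t • eT) * ut (z + t • eT)))
    (φ'' := fun t => 2 * (ut (z + t • eT) * ut (z + t • eT) + ux 0 (z + t • eT) * utt (z + t • eT)))
    (Continuous.continuousOn (by simp only [sqChain]; fun_prop))
    (Continuous.continuousOn (by fun_prop))
    (fun r hr => D.sq_deriv_t z r ⟨by linarith [hr.1], by linarith [hr.2]⟩)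
    (fun r hr => D.sq_deriv_tt z r ⟨by linarith [hr.1], by linarith [hr.2]⟩) 0
    (fun s _ => by rw [sub_zero]; exact D.abs_sq_tt_le _)
  simpa using this

/-- The error of the trapezoidal rule over one time step. -/
theorem trapezoid_sub_box (D : Flow lam L1 L2 T K ex ey ux uy ut utt) (z : ℝ × ℝ × ℝ) {τ : ℝ}
    (hτ : 0 ≤ τ) (hz : 0 ≤ z.2.2) (hz' : z.2.2 + τ ≤ T) :
    (ux 0 z + ux 0 (z + τ • eT)) / 2 - box (τ • eT) (ux 0) z
      = τ ^ 2 * avg (fun s => s * (1 - s) / 2) (τ • eT) utt z := by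
  have c0 := D.cont_zero
  have c1 := D.cont_t
  have c2 := D.cont_tt
  rcases hτ.eq_or_lt with rfl | hτ
  · simp [box]
  have hin : ∀ s ∈ Set.Ioo (0 : ℝ) 1, z.2.2 + s * τ ∈ Set.Ioo 0 T := fun s hs =>
    ⟨by nlinarith [hs.1], by nlinarith [hs.2]⟩
  have hl : ∀ s : ℝ, HasDerivAt (fun s : ℝ => s * τ) τ s := fun s => by
    simpa using (hasDerivAt_id s).mul_const τ
  have h := trapezoid_sub_integral (φ := fun s => ux 0 (z + (s * τ) • eT))
    (φ' := fun s => ut (z + (s * τ) • eT) * τ) (φ'' := fun s => utt (z + (s * τ) • eT) * τ * τ)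
    (by fun_prop) (by fun_prop) (by fun_prop)
    (fun s hs => HasDerivAt.comp (h₂ := fun t : ℝ => ux 0 (z + t • eT)) s
      (D.deriv_t z (s * τ) (hin s hs)) (hl s))
    (fun s hs => (HasDerivAt.comp (h₂ := fun t : ℝ => ut (z + t • eT)) s
      (D.deriv_tt z (s * τ) (hin s hs)) (hl s)).mul_const τ)
  simp only [zero_mul, zero_smul, add_zero, one_mul] at h
  simp only [box, avg, smul_smul]
  rw [h, ← intervalIntegral.integral_const_mul]
  exact intervalIntegral.integral_congr fun s _ => by ring

end Flow

/-! ## Residuals of the comparison function in the discrete `H¹` seminorm -/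

section

variable {E : Type*} [NormedAddCommGroup E] [NormedSpace ℝ E]

/-- The undivided forward difference. -/
def fd {A : Type*} [Add A] (v : A) (f : A → ℝ) (z : A) : ℝ := f (z + v) - f z

/-- The sum of `f` over the mesh points of one cell based at `z`. -/
noncomputable def meshSum (v w : E) (M1 M2 : ℕ) (f : E → ℝ) (z : E) : ℝ :=
  ∑ p ∈ Finset.range M1, ∑ q ∈ Finset.range M2, f (z + (p : ℝ) • v + (q : ℝ) • w)

theorem continuous_fd {E : Type*} [NormedAddCommGroup E] (v : E) {f : E → ℝ} (hf : Continuous f) : Continuous (fd v f) := by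
  unfold fd; fun_prop

theorem continuous_meshSum (v w : E) (M1 M2 : ℕ) {f : E → ℝ} (hf : Continuous f) :
    Continuous (meshSum v w M1 M2 f) := by
  unfold meshSum; fun_prop

theorem meshSum_le {v w : E} {M1 M2 : ℕ} {f g : E → ℝ} {z : E}
    (h : ∀ p q : ℕ, f (z + (p : ℝ) • v + (q : ℝ) • w) ≤ g (z + (p : ℝ) • v + (q : ℝ) • w)) :
    meshSum v w M1 M2 f z ≤ meshSum v w M1 M2 g z :=
  Finset.sum_le_sum fun p _ => Finset.sum_le_sum fun q _ => h p q

theorem meshSum_const (v w : E) (M1 M2 : ℕ) (c : ℝ) (z : E) :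
    meshSum v w M1 M2 (fun _ => c) z = M1 * M2 * c := by
  simp [meshSum, mul_assoc]

theorem meshSum_add (v w : E) (M1 M2 : ℕ) (f g : E → ℝ) (z : E) :
    meshSum v w M1 M2 (fun z => f z + g z) z = meshSum v w M1 M2 f z + meshSum v w M1 M2 g z := by
  simp only [meshSum, Finset.sum_add_distrib]

theorem meshSum_const_mul (v w : E) (M1 M2 : ℕ) (c : ℝ) (f : E → ℝ) (z : E) :
    meshSum v w M1 M2 (fun z => c * f z) z = c * meshSum v w M1 M2 f z := by
  simp only [meshSum, Finset.mul_sum]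

theorem meshSum_nonneg {v w : E} {M1 M2 : ℕ} {f : E → ℝ} {z : E} (h : ∀ z, 0 ≤ f z) :
    0 ≤ meshSum v w M1 M2 f z :=
  Finset.sum_nonneg fun _ _ => Finset.sum_nonneg fun _ _ => h _

theorem meshSum_box (v w e : E) (M1 M2 : ℕ) {f : E → ℝ} (hf : Continuous f) (z : E) :
    meshSum v w M1 M2 (box e f) z = box e (meshSum v w M1 M2 f) z := by
  simp only [meshSum, box]
  rw [intervalIntegral.integral_finsetSum fun p _ =>
    Continuous.intervalIntegrable (by fun_prop) _ _]
  refine Finset.sum_congr rfl fun p _ => ?_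
  rw [intervalIntegral.integral_finsetSum fun q _ =>
    Continuous.intervalIntegrable (by fun_prop) _ _]
  refine Finset.sum_congr rfl fun q _ => intervalIntegral.integral_congr fun s _ => ?_
  congr 1; abel

/-- Averages over the time steps add up to the integral over the whole time interval. -/
theorem sum_time_meshSum_box (v w e : E) (M1 M2 N : ℕ) (τ : ℝ) {f : E → ℝ} (hf : Continuous f) :
    ∑ r ∈ Finset.range N, τ * meshSum v w M1 M2 (box (τ • e) f) ((r : ℝ) • τ • e)
      = ∫ t in (0 : ℝ)..(N * τ), meshSum v w M1 M2 f (t • e) := by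
  have hc := continuous_meshSum v w M1 M2 hf
  have h1 := sum_box (τ • e) N hc 0
  have h2 := mul_box_smul e (N * τ) (meshSum v w M1 M2 f) 0
  simp only [zero_add] at h1 h2
  simp only [meshSum_box v w (τ • e) M1 M2 hf]
  rw [← h2, ← Finset.mul_sum, h1]
  simp only [smul_smul]
  ring

theorem avg_fd {w' : ℝ → ℝ} (hw : Continuous w') (e v : E) {f : E → ℝ} (hf : Continuous f) (z : E) :
    avg w' e (fd v f) z = fd v (avg w' e f) z := by
  unfold fd
  rw [avg_shift]
  unfold avg
  rw [← intervalIntegral.integral_sub]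
  · exact intervalIntegral.integral_congr fun s _ => by ring
  all_goals exact Continuous.intervalIntegrable (by fun_prop) _ _

/-- Exchanges a finite weighted sum with the superposition over s, so that residuals need only be
bounded for each fixed s. The factor 1/2 comes from Jensen, another 1/2 is the mass of the weight.
-/
theorem sum_integral_one_sub_le {ι : Type*} (J : Finset ι) {c X : ι → ℝ} {G : ι → ℝ → ℝ} {B : ℝ}
    (hc : ∀ j ∈ J, 0 ≤ c j) (hG : ∀ j ∈ J, Continuous (G j))
    (hX : ∀ j ∈ J, X j ≤ 1 / 2 * ∫ s in (0 : ℝ)..1, (1 - s) * G j s)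
    (hB : ∀ s ∈ Set.Icc (0 : ℝ) 1, ∑ j ∈ J, c j * G j s ≤ B) : ∑ j ∈ J, c j * X j ≤ B / 4 := by
  have hcont : Continuous fun s => ∑ j ∈ J, c j * G j s :=
    continuous_finsetSum _ fun j hj => (hG j hj).const_mul (c j)
  calc ∑ j ∈ J, c j * X j ≤ ∑ j ∈ J, c j * (1 / 2 * ∫ s in (0 : ℝ)..1, (1 - s) * G j s) :=
        Finset.sum_le_sum fun j hj => mul_le_mul_of_nonneg_left (hX j hj) (hc j hj)
    _ = 1 / 2 * ∫ s in (0 : ℝ)..1, (1 - s) * ∑ j ∈ J, c j * G j s := by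
        simp only [Finset.mul_sum]
        rw [intervalIntegral.integral_finsetSum, Finset.mul_sum]
        · refine Finset.sum_congr rfl fun j _ => ?_
          rw [mul_left_comm, ← intervalIntegral.integral_const_mul]
          congr 1
          exact intervalIntegral.integral_congr fun s _ => by ring
        · intro j hj
          have := hG j hj
          exact Continuous.intervalIntegrable (by fun_prop) _ _
    _ ≤ 1 / 2 * ∫ s in (0 : ℝ)..1, (1 - s) * B := by
        refine mul_le_mul_of_nonneg_left (intervalIntegral.integral_mono_on zero_le_one
          (Continuous.intervalIntegrable (by fun_prop) _ _)
          (Continuous.intervalIntegrable (by fun_prop) _ _) fun s hs =>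
          mul_le_mul_of_nonneg_left (hB s hs) (by linarith [hs.2])) (by norm_num)
    _ = B / 4 := by rw [intervalIntegral.integral_mul_const, integral_one_sub]; ring

/-- Hat averaging does not increase mean squares over the mesh. -/
theorem meshSum_hat_sq_le [LocallyCompactSpace E] (v w : E) (M1 M2 : ℕ) {f : E → ℝ}
    (hf : Continuous f) {z : E} {B : ℝ}
    (hB : ∀ s : ℝ, meshSum v w M1 M2 (fun z => f z ^ 2) (z + s • v) ≤ B) :
    meshSum v w M1 M2 (fun z => hat v f z ^ 2) z ≤ B := by
  have hX : ∀ z, hat v f z ^ 2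
      ≤ 1 / 2 * ∫ s in (0 : ℝ)..1, (1 - s) * (2 * (f (z + s • v) ^ 2 + f (z - s • v) ^ 2)) := by
    intro z
    refine (hat_sq_le v hf z).trans (le_of_eq ?_)
    rw [hat, ← intervalIntegral.integral_const_mul]
    exact intervalIntegral.integral_congr fun s _ => by ring
  have := sum_integral_one_sub_le (Finset.range M1 ×ˢ Finset.range M2) (c := fun _ => 1)
    (X := fun x => hat v f (z + (x.1 : ℝ) • v + (x.2 : ℝ) • w) ^ 2)
    (G := fun x s => 2 * (f (z + (x.1 : ℝ) • v + (x.2 : ℝ) • w + s • v) ^ 2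
      + f (z + (x.1 : ℝ) • v + (x.2 : ℝ) • w - s • v) ^ 2)) (B := 4 * B)
    (fun _ _ => zero_le_one) (fun _ _ => by fun_prop) (fun _ _ => hX _) (fun s _ => by
      simp only [one_mul, Finset.sum_product, ← Finset.mul_sum, Finset.sum_add_distrib]
      have h1 := hB s
      have h2 := hB (-s)
      have e1 : ∀ p q : ℕ, z + (p : ℝ) • v + (q : ℝ) • w + s • v
          = z + s • v + (p : ℝ) • v + (q : ℝ) • w := fun p q => by abel
      have e2 : ∀ p q : ℕ, z + (p : ℝ) • v + (q : ℝ) • w - s • v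
          = z + (-s) • v + (p : ℝ) • v + (q : ℝ) • w := fun p q => by rw [neg_smul]; abel
      simp only [meshSum] at h1 h2
      simp only [e1, e2]
      linarith)
  simp only [one_mul, Finset.sum_product] at this
  simp only [meshSum]
  linarith

/-- Sampled differences of a function are controlled by its derivative over the cell. -/
theorem meshSum_hat_fd_sq_le [LocallyCompactSpace E] {ex ey : E} {h L1 L2 : ℝ} {M1 M2 : ℕ}
    (hL1 : L1 = h * M1) (hL2 : L2 = h * M2) {f f' : E → ℝ} (hd : DD ex f f')
    (hf' : Continuous f') (hper : ∀ z, f' (z + L2 • ey) = f' z) (z : E) :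
    meshSum (h • ex) (h • ey) M1 M2 (fun z => hat (h • ey) (fd (h • ex) f) z ^ 2) z
      ≤ M1 * M2 * h ^ 2 * box (L1 • ex) (box (L2 • ey) fun z => f' z ^ 2) z := by
  have e1 : (M1 : ℝ) • h • ex = L1 • ex := by rw [smul_smul, hL1, mul_comm]
  have e2 : (M2 : ℝ) • h • ey = L2 • ey := by rw [smul_smul, hL2, mul_comm]
  have := sum_sq_hat_diff_le (h • ex) (h • ey) M1 M2 (hd.smul h) (by fun_prop)
    (fun z => by rw [e2, hper]) z
  rw [e1, e2] at this
  refine this.trans (le_of_eq ?_)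
  have e3 : (box (L2 • ey) fun z => (h * f' z) ^ 2)
      = fun z => h ^ 2 * box (L2 • ey) (fun z => f' z ^ 2) z := funext fun z => by
    rw [← box_const_mul]
    simp only [mul_pow]
  rw [e3, box_const_mul]
  ring

end

theorem hat_congr_time {v : ℝ × ℝ × ℝ} (hv : v.2.2 = 0) {f g : ℝ × ℝ × ℝ → ℝ} {z : ℝ × ℝ × ℝ}
    (h : ∀ y : ℝ × ℝ × ℝ, y.2.2 = z.2.2 → f y = g y) : hat v f z = hat v g z := by
  refine intervalIntegral.integral_congr fun s _ => ?_
  rw [h _ (by simp [hv]), h _ (by simp [hv])]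

namespace Flow

variable {lam L1 L2 T K : ℝ} {ex ey : ℝ × ℝ × ℝ} {ux uy : ℕ → ℝ × ℝ × ℝ → ℝ}
  {ut utt : ℝ × ℝ × ℝ → ℝ}

/-- The spatial part of the residual. -/
theorem space_residual (D : Flow lam L1 L2 T K ex ey ux uy ut utt) (hlam : 0 < lam)
    {h τ : ℝ} (hh : 0 < h) (hτ : 0 < τ) {M1 M2 N : ℕ} (hM1 : 1 ≤ M1) (hM2 : 1 ≤ M2)
    (hL1 : L1 = h * M1) (hL2 : L2 = h * M2) (hT : N * τ = T) :
    ∑ r ∈ Finset.range N, τ * meshSum (h • ex) (h • ey) M1 M2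
        (fun z => (cA (h • ex) (box (τ • eT) (hat (h • ey) (fd (h • ex) (ux 0)))) z
          - hat (h • ex) (box (τ • eT) (hat (h • ey) (fd (h • ex) (ux 0)))) z) ^ 2)
        ((r : ℝ) • τ • eT)
      ≤ M1 * M2 * h ^ 2 * ((1 / lam + T / (2 * lam ^ 2)) * ((K + 16 * K ^ 2) * h ^ 4) ^ 2) := by
  have hM1' : (0 : ℝ) < M1 := by exact_mod_cast hM1
  have hM2' : (0 : ℝ) < M2 := by exact_mod_cast hM2
  have hL1' : L1 ≠ 0 := by rw [hL1]; positivity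
  have hL2' : L2 ≠ 0 := by rw [hL2]; positivity
  have hT0 : 0 ≤ T := by rw [← hT]; positivity
  have hK := D.K_nonneg
  set v := h • ex with hv
  set w := h • ey with hw
  have c0 := D.cont_zero
  set f0 := hat w (fd v (ux 0)) with hf0
  have cf0 : Continuous f0 := continuous_hat _ (continuous_fd _ c0)
  set f := box (τ • eT) f0 with hf
  have cf : Continuous f := continuous_box _ cf0
  -- By `cA_sub_hat` the residual is a superposition of the fourth order operators s^2 sd_v -
  -- sd_{sv}; `Q` is one of them before averaging over the time step.
  set Q : ℝ → ℝ × ℝ × ℝ → ℝ := fun s z => s ^ 2 * sd v f0 z - sd (s • v) f0 z with hQ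
  have cQ : Continuous fun p : ℝ × (ℝ × ℝ × ℝ) => Q p.1 p.2 := by
    simp only [hQ, sd]; fun_prop
  have cQs : ∀ s, Continuous (Q s) := fun s => by simp only [hQ, sd]; fun_prop
  set B := (M1 : ℝ) * M2 * h ^ 2 * ((1 / lam + T / (2 * lam ^ 2)) * ((K + 16 * K ^ 2) * h ^ 4) ^ 2)
    with hB
  have hB0 : 0 ≤ B := by positivity
  have hbox : ∀ s z, s ^ 2 * sd v f z - sd (s • v) f z = box (τ • eT) (Q s) z := fun s z => by
    have h1 := continuous_sd v cf0
    have h2 := continuous_sd (s • v) cf0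
    rw [hf, ← box_sd _ _ cf0, ← box_sd _ _ cf0, ← box_const_mul, ← box_sub _ (by fun_prop) h2]
  have hX : ∀ z, (cA v f z - hat v f z) ^ 2
      ≤ 1 / 2 * ∫ s in (0 : ℝ)..1, (1 - s) * box (τ • eT) (fun z => Q s z ^ 2) z := fun z => by
    have cG : Continuous fun s => box (τ • eT) (fun z => Q s z ^ 2) z :=
      continuous_intervalIntegral _ _ (fun s a => Q s (z + a • τ • eT) ^ 2)
        ((cQ.comp (f := fun p : ℝ × ℝ => (p.1, z + p.2 • τ • eT)) (by fun_prop)).pow 2)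
    have cg : Continuous fun s : ℝ => s ^ 2 * sd v f z - sd (s • v) f z := by
      simp only [sd]; fun_prop
    rw [cA_sub_hat v cf]
    refine (sq_integral_one_sub_le cg).trans (mul_le_mul_of_nonneg_left ?_ (by norm_num))
    refine intervalIntegral.integral_mono_on zero_le_one
      (Continuous.intervalIntegrable (by fun_prop) _ _)
      (Continuous.intervalIntegrable (by fun_prop) _ _) fun s hs => ?_
    rw [hbox]
    exact mul_le_mul_of_nonneg_left (box_sq_le _ (cQs s) _) (by linarith [hs.2])
  have hΦ : ∀ s ∈ Set.Icc (0 : ℝ) 1, ∑ r ∈ Finset.range N, τ * meshSum v w M1 M2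
      (box (τ • eT) (fun z => Q s z ^ 2)) ((r : ℝ) • τ • eT) ≤ B := fun s hs => by
    rw [sum_time_meshSum_box v w eT M1 M2 N τ (show Continuous fun z => Q s z ^ 2 from (cQs s).pow 2), hT]
    -- The fourth order operator as a combination of six spatial translates, the form required by
    -- the energy estimate. Its values on `u` and on u^2 are O(h^4), with constants K and 16 K^2
    -- covered by the common bound.
    set c : Fin 6 → ℝ := ![s ^ 2, -2 * s ^ 2, s ^ 2, -1, 2, -1] with hc
    set W : Fin 6 → ℝ × ℝ × ℝ := ![v, 0, -v, s • v, 0, -(s • v)] with hW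
    have hcomb : ∀ (g : ℝ × ℝ × ℝ → ℝ) z, ∑ j, c j * g (z + W j)
        = s ^ 2 * sd v g z - sd (s • v) g z := fun g z => by
      simp only [hc, hW, Fin.sum_univ_succ, Fin.sum_univ_zero, Matrix.cons_val_zero,
        Matrix.cons_val_succ, add_zero, ← sub_eq_add_neg, sd]
      ring
    have hvt : v.2.2 = 0 := by simp [hv, D.ex_time]
    have hen := D.energy hlam hL1' hL2' c W hT0 (ε := (K + 16 * K ^ 2) * h ^ 4) (T' := T)
      (fun j => by fin_cases j <;> simp [hW, hvt]) le_rfl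
      (fun z _ => by
        rw [hcomb]
        refine (D.chain_x.abs_sd_family_le hh.le z hs).trans ?_
        have : 0 ≤ h ^ 4 := by positivity
        nlinarith [sq_nonneg K, mul_nonneg hK this, mul_nonneg (sq_nonneg K) this])
      (fun z _ => by
        rw [hcomb]
        refine (D.chain_x.sq.abs_sd_family_le hh.le z hs).trans ?_
        have : 0 ≤ h ^ 4 := by positivity
        nlinarith [sq_nonneg K, mul_nonneg hK this, mul_nonneg (sq_nonneg K) this])
    have cg' : Continuous fun z => ∑ j, c j * ux 1 (z + W j) := by
      have := D.chain_x.cont 1 (by norm_num)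
      fun_prop
    -- The operator commutes with the forward difference and the hat, so `Q` is the hat average of a
    -- forward difference of the combination. Its samples are therefore controlled by the mean
    -- square of the differentiated combination.
    have hpt : ∀ t : ℝ, meshSum v w M1 M2 (fun z => Q s z ^ 2) (t • eT)
        ≤ M1 * M2 * h ^ 2 * box (L1 • ex) (box (L2 • ey)
          fun z => (∑ j, c j * ux 1 (z + W j)) ^ 2) (t • eT) := fun t => by
      refine le_trans (le_of_eq ?_) (meshSum_hat_fd_sq_le (ey := ey) hL1 hL2
        (f := fun z => ∑ j, c j * ux 0 (z + W j))
        (DD.sum _ fun j _ => ((D.chain_x.deriv 0 (by norm_num)).shift (W j)).const_mul (c j))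
        cg' (fun z => Finset.sum_congr rfl fun j _ => by
          rw [add_right_comm, (D.per_x 1 (by norm_num) _).2]) (t • eT))
      congr 1
      funext z
      congr 1
      have e1 : fd v (fun z => ∑ j, c j * ux 0 (z + W j))
          = fun z => s ^ 2 * sd v (fd v (ux 0)) z - sd (s • v) (fd v (ux 0)) z := by
        funext z
        simp only [fd, hcomb]
        simp only [sd, fd, add_right_comm z (s • v) v, add_sub_right_comm]
        ring
      have k1 := continuous_sd v (continuous_fd v c0)
      have k2 := continuous_sd (s • v) (continuous_fd v c0)
      rw [e1, hat_sub w (by fun_prop) k2, hat_const_mul, hat_sd w _ (continuous_fd v c0),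
        hat_sd w _ (continuous_fd v c0)]
    have i1 := continuous_meshSum v w M1 M2 (show Continuous fun z => Q s z ^ 2 from (cQs s).pow 2)
    have i2 := continuous_box (L1 • ex) (continuous_box (L2 • ey) (show Continuous
      fun z => (∑ j, c j * ux 1 (z + W j)) ^ 2 from cg'.pow 2))
    refine (intervalIntegral.integral_mono_on hT0
      (Continuous.intervalIntegrable (by fun_prop) _ _)
      (Continuous.intervalIntegrable (u := fun t => M1 * M2 * h ^ 2 * box (L1 • ex) (box (L2 • ey)
          fun z => (∑ j, c j * ux 1 (z + W j)) ^ 2) (t • eT)) (by fun_prop) _ _)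
      fun t _ => hpt t).trans ?_
    rw [intervalIntegral.integral_const_mul]
    exact mul_le_mul_of_nonneg_left hen (by positivity)
  have := sum_integral_one_sub_le (Finset.range N ×ˢ (Finset.range M1 ×ˢ Finset.range M2))
    (c := fun _ => τ)
    (X := fun x => (cA v f ((x.1 : ℝ) • τ • eT + (x.2.1 : ℝ) • v + (x.2.2 : ℝ) • w)
      - hat v f ((x.1 : ℝ) • τ • eT + (x.2.1 : ℝ) • v + (x.2.2 : ℝ) • w)) ^ 2)
    (G := fun x s => box (τ • eT) (fun z => Q s z ^ 2)
      ((x.1 : ℝ) • τ • eT + (x.2.1 : ℝ) • v + (x.2.2 : ℝ) • w)) (B := B)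
    (fun _ _ => hτ.le) (fun x _ => continuous_intervalIntegral _ _
      (fun s a => Q s ((x.1 : ℝ) • τ • eT + (x.2.1 : ℝ) • v + (x.2.2 : ℝ) • w + a • τ • eT) ^ 2)
        ((cQ.comp (f := fun p : ℝ × ℝ => (p.1, (x.1 : ℝ) • τ • eT + (x.2.1 : ℝ) • v
          + (x.2.2 : ℝ) • w + p.2 • τ • eT)) (by fun_prop)).pow 2)) (fun _ _ => hX _)
    (fun s hs => by
      have := hΦ s hs
      simpa only [Finset.sum_product, meshSum, Finset.mul_sum] using this)
  simp only [Finset.sum_product] at this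
  simp only [meshSum, Finset.mul_sum]
  linarith

end Flow

theorem fd_const_mul {A : Type*} [Add A] (v : A) (c : ℝ) (f : A → ℝ) (z : A) :
    fd v (fun z => c * f z) z = c * fd v f z := by
  simp only [fd]; ring

/-- Smoothing by the kernel of the trapezoidal rule. -/
theorem avg_kernel_sq_le {E : Type*} [NormedAddCommGroup E] [NormedSpace ℝ E] (v : E) {f : E → ℝ}
    (hf : Continuous f) (z : E) :
    avg (fun s => s * (1 - s) / 2) v f z ^ 2 ≤ 1 / 96 * box v (fun z => f z ^ 2) z := by
  have hm : ∫ s in (0 : ℝ)..1, s * (1 - s) / 2 = 1 / 12 := by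
    have : ∀ s : ℝ, s * (1 - s) / 2 = s / 2 - s ^ 2 / 2 := fun s => by ring
    simp only [this]
    rw [intervalIntegral.integral_sub (Continuous.intervalIntegrable (by fun_prop) _ _)
      (Continuous.intervalIntegrable (by fun_prop) _ _)]
    simp only [intervalIntegral.integral_div, integral_pow, integral_id]
    norm_num
  have h1 := sq_integral_mul_le (w := fun s => s * (1 - s) / 2) (m := 1 / 12)
    (g := fun s => f (z + s • v)) zero_le_one (by norm_num) (by fun_prop) (by fun_prop)
    (fun s hs => by have := mul_nonneg hs.1 (sub_nonneg.2 hs.2); linarith) hm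
  -- The constant 1/96 is the mass 1/12 of the kernel times its maximum 1/8.
  have h2 : ∫ s in (0 : ℝ)..1, s * (1 - s) / 2 * f (z + s • v) ^ 2
      ≤ ∫ s in (0 : ℝ)..1, 1 / 8 * f (z + s • v) ^ 2 :=
    intervalIntegral.integral_mono_on zero_le_one
      (Continuous.intervalIntegrable (by fun_prop) _ _)
      (Continuous.intervalIntegrable (by fun_prop) _ _) fun s _ =>
      mul_le_mul_of_nonneg_right (by nlinarith [sq_nonneg (s - 1 / 2)]) (sq_nonneg _)
  rw [intervalIntegral.integral_const_mul] at h2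
  simp only [avg, box]
  linarith

namespace Flow

variable {lam L1 L2 T K : ℝ} {ex ey : ℝ × ℝ × ℝ} {ux uy : ℕ → ℝ × ℝ × ℝ → ℝ}
  {ut utt : ℝ × ℝ × ℝ → ℝ}

/-- A space derivative of u_tt need not exist. Second difference quotients in time with a step k
stand in for u_tt: their energy bound does not depend on k, and k is chosen, depending on h, so
small that the replacement is invisible at the scale of the claim. -/
theorem integral_meshSum_sq_tt_le (D : Flow lam L1 L2 T K ex ey ux uy ut utt) (hlam : 0 < lam)
    (hT : 0 < T) {h : ℝ} (hh : 0 < h) {M1 M2 : ℕ} (hM1 : 1 ≤ M1) (hM2 : 1 ≤ M2)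
    (hL1 : L1 = h * M1) (hL2 : L2 = h * M2) :
    ∫ t in (0 : ℝ)..T, meshSum (h • ex) (h • ey) M1 M2
        (fun z => hat (h • ey) (fd (h • ex) (hat (h • ex) utt)) z ^ 2) (t • eT)
      ≤ M1 * M2 * h ^ 2
        * (2 * ((1 / lam + T / (2 * lam ^ 2)) * (K + 4 * K ^ 2) ^ 2) + 8 * T + 1) := by
  have hM1' : (0 : ℝ) < M1 := by exact_mod_cast hM1
  have hM2' : (0 : ℝ) < M2 := by exact_mod_cast hM2
  have hL1' : L1 ≠ 0 := by rw [hL1]; positivity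
  have hL2' : L2 ≠ 0 := by rw [hL2]; positivity
  have hK := D.K_nonneg
  have c0 := D.cont_zero
  have ctt := D.cont_tt
  set v := h • ex with hv
  set w := h • ey with hw
  have hvt : v.2.2 = 0 := by simp [hv, D.ex_time]
  have hwt : w.2.2 = 0 := by simp [hw, D.ey_time]
  set f2 := hat w (fd v (hat v utt)) with hf2
  have cf2 : Continuous f2 := continuous_hat _ (continuous_fd _ (continuous_hat _ ctt))
  -- The tolerance is h because the squares of the sampled differences are to be bounded by a
  -- multiple of h^2.
  obtain ⟨δ, hδ, hunif⟩ := D.unif_tt h hh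
  -- 2k ≤ δ makes the quotient uniformly h-close to u_tt, 2k ≤ T keeps its stencil inside the time
  -- interval, and the last condition makes the final layer of length 2k, where no quotient is
  -- available, contribute at most order h^2.
  obtain ⟨k, hk, hkδ, hkT, hkh⟩ : ∃ k : ℝ, 0 < k ∧ 2 * k ≤ δ ∧ 2 * k ≤ T
      ∧ 2 * k * (4 * K ^ 2) ≤ h ^ 2 := by
    refine ⟨min (min (δ / 2) (T / 2)) (h ^ 2 / (2 * (4 * K ^ 2 + 1))), by positivity, ?_, ?_, ?_⟩
    · have := (min_le_left (min (δ / 2) (T / 2)) (h ^ 2 / (2 * (4 * K ^ 2 + 1)))).trans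
        (min_le_left _ _)
      linarith
    · have := (min_le_left (min (δ / 2) (T / 2)) (h ^ 2 / (2 * (4 * K ^ 2 + 1)))).trans
        (min_le_right _ _)
      linarith
    · have h1 := min_le_right (min (δ / 2) (T / 2)) (h ^ 2 / (2 * (4 * K ^ 2 + 1)))
      have h2 : 0 < min (min (δ / 2) (T / 2)) (h ^ 2 / (2 * (4 * K ^ 2 + 1))) := by positivity
      rw [le_div_iff₀ (by positivity)] at h1
      nlinarith
  set c : Fin 3 → ℝ := ![1 / k ^ 2, -2 / k ^ 2, 1 / k ^ 2] with hc
  set W : Fin 3 → ℝ × ℝ × ℝ := ![(2 * k) • eT, k • eT, 0] with hW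
  have hcomb : ∀ (g : ℝ × ℝ × ℝ → ℝ) z, ∑ j, c j * g (z + W j)
      = (g (z + (2 * k) • eT) - 2 * g (z + k • eT) + g z) / k ^ 2 := fun g z => by
    simp only [hc, hW, Fin.sum_univ_succ, Fin.sum_univ_zero, Matrix.cons_val_zero,
      Matrix.cons_val_succ, add_zero]
    ring
  have hk2 : 0 < k ^ 2 := by positivity
  have hen := D.energy hlam hL1' hL2' c W (ε := K + 4 * K ^ 2) (T' := T - 2 * k)
    (by linarith) (fun j => by
      fin_cases j <;> simp [hW, eT, hk.le]
      linarith) (by linarith)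
    (fun z hz => by
      rw [hcomb, abs_div, abs_of_pos hk2, div_le_iff₀ hk2]
      have := D.second_difference_t z hk.le hz.1 (by linarith [hz.2]) 0 (K' := K)
        (fun s _ => by rw [sub_zero]; exact D.bdd_tt _)
      rw [mul_zero, sub_zero] at this
      nlinarith [mul_nonneg (sq_nonneg K) hk2.le])
    (fun z hz => by
      rw [hcomb, abs_div, abs_of_pos hk2, div_le_iff₀ hk2]
      have := D.second_difference_sq_t z hk.le hz.1 (by linarith [hz.2])
      nlinarith [mul_nonneg hK hk2.le])
  set g := fun z => ∑ j, c j * ux 0 (z + W j) with hg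
  set g' := fun z => ∑ j, c j * ux 1 (z + W j) with hg'
  have cg : Continuous g := by rw [hg]; fun_prop
  have cg' : Continuous g' := by
    have := D.chain_x.cont 1 (by norm_num)
    rw [hg']; fun_prop
  have cg'2 : Continuous fun z => g' z ^ 2 := cg'.pow 2
  have hdd : DD ex g g' :=
    DD.sum _ fun j _ => ((D.chain_x.deriv 0 (by norm_num)).shift (W j)).const_mul (c j)
  have hpx : ∀ z, g' (z + L1 • ex) = g' z := fun z => Finset.sum_congr rfl fun j _ => by
    rw [add_right_comm, (D.per_x 1 (by norm_num) _).1]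
  have hpy : ∀ z, g' (z + L2 • ey) = g' z := fun z => Finset.sum_congr rfl fun j _ => by
    rw [add_right_comm, (D.per_x 1 (by norm_num) _).2]
  set Φ := box (L1 • ex) (box (L2 • ey) fun z => g' z ^ 2) with hΦ
  have cΦ : Continuous Φ := continuous_box _ (continuous_box _ cg'2)
  set fk := hat w (fd v (hat v g)) with hfk
  have cfk : Continuous fk := continuous_hat _ (continuous_fd _ (continuous_hat _ cg))
  have hfkeq : fk = hat v (hat w (fd v g)) := by
    funext z
    rw [hat_comm v w (continuous_fd v cg)]
    refine congrArg (fun f => hat w f z) (funext fun y => ?_)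
    change hat v g (y + v) - hat v g y = hat v (fun z => g (z + v) - g z) y
    rw [hat_shift, ← hat_sub v (by fun_prop) cg]
  have hmesh : ∀ t : ℝ, meshSum v w M1 M2 (fun z => fk z ^ 2) (t • eT)
      ≤ M1 * M2 * h ^ 2 * Φ (t • eT) := fun t => by
    rw [hfkeq]
    refine meshSum_hat_sq_le v w M1 M2 (continuous_hat _ (continuous_fd _ cg)) fun s => ?_
    refine (meshSum_hat_fd_sq_le hL1 hL2 hdd cg' hpy _).trans (le_of_eq ?_)
    -- The bound is an average over full periods and hence does not see the translation by s • v;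
    -- this is what allows the additional hat along `v` to be removed.
    have e : s • v = (s / M1) • (L1 • ex) := by
      rw [hv, smul_smul, smul_smul, hL1]; congr 1; field_simp
    rw [e, box_periodic fun z => by rw [box_shift]; simp only [hpx]]
  have happrox : ∀ z : ℝ × ℝ × ℝ, z.2.2 ∈ Set.Icc 0 (T - 2 * k) → |g z - utt z| ≤ h :=
    fun z hz => by
      have := D.second_difference_t z hk.le hz.1 (by linarith [hz.2]) (utt z) (K' := h)
        (fun s hs => hunif z s (by rw [abs_of_pos hs.1]; linarith [hs.2]))
      have e : g z - utt z
          = (ux 0 (z + (2 * k) • eT) - 2 * ux 0 (z + k • eT) + ux 0 z - k ^ 2 * utt z) / k ^ 2 := by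
        rw [hg]; simp only [hcomb]; field_simp
      rw [e, abs_div, abs_of_pos hk2, div_le_iff₀ hk2]
      exact this
  have hdiff : ∀ z : ℝ × ℝ × ℝ, z.2.2 ∈ Set.Icc 0 (T - 2 * k) → |fk z - f2 z| ≤ 2 * h :=
    fun z hz => by
      have cG := continuous_hat v (cg.sub ctt)
      have e1 : fk z - f2 z = hat w (fd v (hat v fun z => g z - utt z)) z := by
        rw [hfk, hf2, ← hat_sub w (continuous_fd _ (continuous_hat _ cg))
          (continuous_fd _ (continuous_hat _ ctt))]
        refine congrArg (fun f => hat w f z) (funext fun y => ?_)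
        simp only [fd, hat_sub v cg ctt]
        ring
      rw [e1]
      refine abs_hat_le w _ z fun a _ => ?_
      have h1 : ∀ y : ℝ × ℝ × ℝ, y.2.2 = z.2.2 → |hat v (fun z => g z - utt z) y| ≤ h :=
        fun y hy => abs_hat_le v _ y fun b _ => happrox _ (by simpa [hvt, hy] using hz)
      have h2 := h1 (z + a • w + v) (by simp [hvt, hwt])
      have h3 := h1 (z + a • w) (by simp [hwt])
      simp only [fd]
      rw [abs_le] at *
      constructor <;> linarith
  have hf2b : ∀ z, |f2 z| ≤ 2 * K := fun z => abs_hat_le w _ z fun a _ => by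
    have h1 : ∀ y : ℝ × ℝ × ℝ, |hat v utt y| ≤ K := fun y => abs_hat_le v _ y fun b _ => D.bdd_tt _
    have h2 := h1 (z + a • w + v)
    have h3 := h1 (z + a • w)
    simp only [fd]
    rw [abs_le] at *
    constructor <;> linarith
  have cm := continuous_meshSum v w M1 M2 (show Continuous fun z => f2 z ^ 2 from cf2.pow 2)
  have cmt : Continuous fun t : ℝ => meshSum v w M1 M2 (fun z => f2 z ^ 2) (t • eT) := by fun_prop
  -- On [0, T - 2k] the energy estimate applies; on the final layer the crude bound 2K on the
  -- sampled difference suffices.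
  rw [← intervalIntegral.integral_add_adjacent_intervals (b := T - 2 * k)
    (cmt.intervalIntegrable _ _) (cmt.intervalIntegrable _ _)]
  have hmain : ∫ t in (0 : ℝ)..(T - 2 * k), meshSum v w M1 M2 (fun z => f2 z ^ 2) (t • eT)
      ≤ ∫ t in (0 : ℝ)..(T - 2 * k), (2 * (M1 * M2 * h ^ 2 * Φ (t • eT)) + M1 * M2 * (8 * h ^ 2)) := by
    refine intervalIntegral.integral_mono_on (by linarith) (cmt.intervalIntegrable _ _)
      (Continuous.intervalIntegrable (by fun_prop) _ _) fun t ht => ?_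
    calc meshSum v w M1 M2 (fun z => f2 z ^ 2) (t • eT)
        ≤ meshSum v w M1 M2 (fun z => 2 * fk z ^ 2 + 8 * h ^ 2) (t • eT) :=
          meshSum_le fun p q => by
            have := hdiff (t • eT + (p : ℝ) • v + (q : ℝ) • w) (by
              simpa [hvt, hwt, eT] using ht)
            have h2 := sq_le_sq' (by linarith [(abs_le.1 this).1]) (abs_le.1 this).2
            nlinarith [sq_nonneg (2 * fk (t • eT + (p : ℝ) • v + (q : ℝ) • w)
              - f2 (t • eT + (p : ℝ) • v + (q : ℝ) • w))]
      _ = 2 * meshSum v w M1 M2 (fun z => fk z ^ 2) (t • eT) + M1 * M2 * (8 * h ^ 2) := by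
          rw [meshSum_add, meshSum_const_mul, meshSum_const]
      _ ≤ _ := by linarith [hmesh t]
  have htail : ∫ t in (T - 2 * k)..T, meshSum v w M1 M2 (fun z => f2 z ^ 2) (t • eT)
      ≤ ∫ _t in (T - 2 * k)..T, M1 * M2 * (4 * K ^ 2) := by
    refine intervalIntegral.integral_mono_on (by linarith) (cmt.intervalIntegrable _ _)
      (Continuous.intervalIntegrable (by fun_prop) _ _) fun t _ => ?_
    rw [← meshSum_const v w M1 M2 (4 * K ^ 2) (t • eT)]
    refine meshSum_le fun p q => ?_
    have := hf2b (t • eT + (p : ℝ) • v + (q : ℝ) • w)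
    have h2 := sq_le_sq' (by linarith [(abs_le.1 this).1]) (abs_le.1 this).2
    nlinarith
  rw [intervalIntegral.integral_add (Continuous.intervalIntegrable (by fun_prop) _ _)
    (Continuous.intervalIntegrable (by fun_prop) _ _), intervalIntegral.integral_const_mul,
    intervalIntegral.integral_const_mul, intervalIntegral.integral_const, smul_eq_mul] at hmain
  rw [intervalIntegral.integral_const, smul_eq_mul] at htail
  have hMM : (0 : ℝ) < M1 * M2 := by positivity
  have hen' := mul_le_mul_of_nonneg_left hen (show (0 : ℝ) ≤ M1 * M2 * h ^ 2 by positivity)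
  have ht1 := mul_le_mul_of_nonneg_left hkh hMM.le
  have ht2 : (T - 2 * k - 0) * (M1 * M2 * (8 * h ^ 2)) ≤ M1 * M2 * h ^ 2 * (8 * T) := by
    have : 0 ≤ M1 * M2 * h ^ 2 * k := by positivity
    nlinarith
  have hh2 : 0 < h ^ 2 := by positivity
  nlinarith

/-- The temporal part of the residual. -/
theorem time_residual (D : Flow lam L1 L2 T K ex ey ux uy ut utt) (hlam : 0 < lam)
    (hT0 : 0 < T) {h τ : ℝ} (hh : 0 < h) (hτ : 0 < τ) {M1 M2 N : ℕ} (hM1 : 1 ≤ M1) (hM2 : 1 ≤ M2)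
    (hL1 : L1 = h * M1) (hL2 : L2 = h * M2) (hT : N * τ = T) :
    ∑ r ∈ Finset.range N, τ * meshSum (h • ex) (h • ey) M1 M2
        (fun z => hat (h • ey) (fd (h • ex) (hat (h • ex)
          fun z => (ux 0 z + ux 0 (z + τ • eT)) / 2 - box (τ • eT) (ux 0) z)) z ^ 2)
        ((r : ℝ) • τ • eT)
      ≤ M1 * M2 * h ^ 2 * ((2 * ((1 / lam + T / (2 * lam ^ 2)) * (K + 4 * K ^ 2) ^ 2) + 8 * T + 1)
        * τ ^ 4) := by
  have ctt := D.cont_tt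
  have key := D.integral_meshSum_sq_tt_le hlam hT0 hh hM1 hM2 hL1 hL2
  set v := h • ex with hv
  set w := h • ey with hw
  have hvt : v.2.2 = 0 := by simp [hv, D.ex_time]
  have hwt : w.2.2 = 0 := by simp [hw, D.ey_time]
  set f2 := hat w (fd v (hat v utt)) with hf2
  have cf2 : Continuous f2 := continuous_hat _ (continuous_fd _ (continuous_hat _ ctt))
  set ω : ℝ → ℝ := fun s => s * (1 - s) / 2 with hω
  have cω : Continuous ω := by rw [hω]; fun_prop
  -- The trapezoidal error is τ^2 times a time average of u_tt. Spatial averages and differences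
  -- commute with that average and stay on one time slice, so the formula is used only where it is
  -- valid.
  have hrep : ∀ z : ℝ × ℝ × ℝ, 0 ≤ z.2.2 → z.2.2 + τ ≤ T → hat w (fd v (hat v
      fun z => (ux 0 z + ux 0 (z + τ • eT)) / 2 - box (τ • eT) (ux 0) z)) z
      = τ ^ 2 * avg ω (τ • eT) f2 z := fun z hz hz' => by
    have h1 : ∀ y : ℝ × ℝ × ℝ, y.2.2 = z.2.2 → hat v
        (fun z => (ux 0 z + ux 0 (z + τ • eT)) / 2 - box (τ • eT) (ux 0) z) y
        = hat v (fun z => τ ^ 2 * avg ω (τ • eT) utt z) y := fun y hy =>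
      hat_congr_time hvt fun x hx => D.trapezoid_sub_box x hτ.le (by rw [hx, hy]; exact hz)
        (by rw [hx, hy]; exact hz')
    rw [hat_congr_time hwt (g := fd v (hat v fun z => τ ^ 2 * avg ω (τ • eT) utt z)) fun y hy => by
      simp only [fd]
      rw [h1 y hy, h1 (y + v) (by simp [hy, hvt])]]
    have e1 : hat v (fun z => τ ^ 2 * avg ω (τ • eT) utt z)
        = fun z => τ ^ 2 * avg ω (τ • eT) (hat v utt) z := funext fun y => by
      rw [hat_const_mul, avg_hat_comm cω _ _ ctt]
    have e2 : fd v (fun z => τ ^ 2 * avg ω (τ • eT) (hat v utt) z)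
        = fun z => τ ^ 2 * avg ω (τ • eT) (fd v (hat v utt)) z := funext fun y => by
      rw [fd_const_mul, avg_fd cω _ _ (continuous_hat _ ctt)]
    rw [e1, e2, hat_const_mul, avg_hat_comm cω _ _ (continuous_fd _ (continuous_hat _ ctt))]
  have hstep : ∀ r ∈ Finset.range N, τ * meshSum v w M1 M2 (fun z => hat w (fd v (hat v
      fun z => (ux 0 z + ux 0 (z + τ • eT)) / 2 - box (τ • eT) (ux 0) z)) z ^ 2)
        ((r : ℝ) • τ • eT) ≤ τ ^ 4 / 96 * (τ * meshSum v w M1 M2 (box (τ • eT) fun z => f2 z ^ 2)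
          ((r : ℝ) • τ • eT)) := fun r hr => by
    have hr' : (r : ℝ) + 1 ≤ N := by exact_mod_cast Finset.mem_range.1 hr
    rw [mul_left_comm, ← meshSum_const_mul v w M1 M2 (τ ^ 4 / 96)]
    refine mul_le_mul_of_nonneg_left ?_ hτ.le
    refine meshSum_le fun p q => ?_
    rw [hrep _ (by
      simp only [Prod.snd_add, Prod.smul_snd, hvt, hwt, eT, smul_eq_mul]
      have : 0 ≤ (r : ℝ) * τ := by positivity
      linarith) (by
      simp only [Prod.snd_add, Prod.smul_snd, hvt, hwt, eT, smul_eq_mul]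
      nlinarith)]
    have := mul_le_mul_of_nonneg_left (avg_kernel_sq_le (τ • eT) cf2
      ((r : ℝ) • τ • eT + (p : ℝ) • v + (q : ℝ) • w)) (show 0 ≤ τ ^ 4 by positivity)
    rw [mul_pow]
    nlinarith
  refine (Finset.sum_le_sum hstep).trans ?_
  rw [← Finset.mul_sum, sum_time_meshSum_box v w eT M1 M2 N τ
    (show Continuous fun z => f2 z ^ 2 from cf2.pow 2), hT]
  have h4 : 0 ≤ τ ^ 4 := by positivity
  have hi : 0 ≤ ∫ t in (0 : ℝ)..T, meshSum v w M1 M2 (fun z => f2 z ^ 2) (t • eT) :=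
    intervalIntegral.integral_nonneg hT0.le fun t _ => meshSum_nonneg fun z => sq_nonneg _
  have := mul_le_mul_of_nonneg_left key h4
  nlinarith [mul_nonneg h4 hi]

end Flow

/-! ## The comparison function -/

section smoothing

variable {E : Type*} [NormedAddCommGroup E] [NormedSpace ℝ E]

/-- Hat averaging followed by the approximate inverse of the compact average. -/
noncomputable def smooth (v : E) (f : E → ℝ) (z : E) : ℝ := cB v (hat v f) z

theorem smooth_sub (v : E) {f g : E → ℝ} (hf : Continuous f) (hg : Continuous g) (z : E) :
    smooth v (fun z => f z - g z) z = smooth v f z - smooth v g z := by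
  unfold smooth
  rw [← cB_sub]
  exact congrArg (fun f => cB v f z) (funext fun y => hat_sub v hf hg y)

theorem smooth_add (v : E) {f g : E → ℝ} (hf : Continuous f) (hg : Continuous g) (z : E) :
    smooth v (fun z => f z + g z) z = smooth v f z + smooth v g z := by
  unfold smooth
  rw [← cB_add]
  exact congrArg (fun f => cB v f z) (funext fun y => hat_add v hf hg y)

theorem smooth_const_mul (v : E) (c : ℝ) (f : E → ℝ) (z : E) :
    smooth v (fun z => c * f z) z = c * smooth v f z := by
  unfold smooth
  rw [← cB_const_mul]
  exact congrArg (fun f => cB v f z) (funext fun y => hat_const_mul v c f y)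

theorem smooth_shift (v c : E) (f : E → ℝ) (z : E) :
    smooth v f (z + c) = smooth v (fun z => f (z + c)) z := by
  unfold smooth
  rw [cB_shift]
  exact congrArg (fun f => cB v f z) (funext fun y => hat_shift v c f y)

theorem sd_smooth (v w : E) {f : E → ℝ} (hf : Continuous f) :
    sd v (smooth w f) = smooth w (sd v f) := funext fun z => by
  unfold smooth
  change sd v (cB w (hat w f)) z = _
  rw [sd_cB_comm]
  exact congrArg (fun f => cB w f z) (funext fun y => (hat_sd w v hf y).symm)

variable [LocallyCompactSpace E]

theorem continuous_smooth (v : E) {f : E → ℝ} (hf : Continuous f) : Continuous (smooth v f) :=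
  continuous_cB v (continuous_hat v hf)

theorem hat_smooth (v w : E) {f : E → ℝ} (hf : Continuous f) :
    hat v (smooth w f) = smooth w (hat v f) := funext fun z => by
  unfold smooth
  change hat v (cB w (hat w f)) z = _
  rw [hat_cB v w (continuous_hat _ hf)]
  exact congrArg (fun f => cB w f z) (funext fun y => hat_comm v w hf y)

theorem box_smooth (v w : E) {f : E → ℝ} (hf : Continuous f) :
    box v (smooth w f) = smooth w (box v f) := funext fun z => by
  unfold smooth
  change box v (cB w (hat w f)) z = _
  rw [box_cB v w (continuous_hat _ hf)]
  exact congrArg (fun f => cB w f z) (funext fun y => box_hat_comm v w hf y)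

theorem cB_comm {A : Type*} [AddCommGroup A] (v w : A) (f : A → ℝ) (z : A) :
    cB v (cB w f) z = cB w (cB v f) z := by
  simp only [sd, cB, add_sub_right_comm, add_right_comm z, sub_right_comm z]; ring

/-- The comparison function must be the same whichever direction is treated first, so that the two
directional analyses can be added. -/
theorem smooth_comm (v w : E) {f : E → ℝ} (hf : Continuous f) :
    smooth v (smooth w f) = smooth w (smooth v f) := funext fun z => by
  have h1 : hat v (smooth w f) = cB w (hat v (hat w f)) := funext fun y =>
    hat_cB v w (continuous_hat _ hf) y
  have h2 : hat w (smooth v f) = cB v (hat v (hat w f)) := funext fun y => by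
    have : hat v (hat w f) = hat w (hat v f) := funext fun y => hat_comm v w hf y
    rw [this]
    exact hat_cB w v (continuous_hat _ hf) y
  change cB v (hat v (smooth w f)) z = cB w (hat w (smooth v f)) z
  rw [h1, h2, cB_comm]

end smoothing

section periodic

variable {E : Type*} [NormedAddCommGroup E] [NormedSpace ℝ E]

theorem _root_.Function.Periodic.shift_eq {A : Type*} [Add A] {f : A → ℝ} {P : A} (hf : Function.Periodic f P) :
    (fun z => f (z + P)) = f := funext hf

theorem periodic_sd {A : Type*} [AddCommGroup A] {f : A → ℝ} {P : A} (hf : Function.Periodic f P)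
    (v : A) : Function.Periodic (sd v f) P := fun z => by
  simp only [sd, add_right_comm z P, add_sub_right_comm z P, hf _]

theorem periodic_cB {A : Type*} [AddCommGroup A] {f : A → ℝ} {P : A} (hf : Function.Periodic f P)
    (v : A) : Function.Periodic (cB v f) P := fun z => by
  simp only [cB, periodic_sd hf v z, hf _]

theorem periodic_cA {A : Type*} [AddCommGroup A] {f : A → ℝ} {P : A} (hf : Function.Periodic f P)
    (v : A) : Function.Periodic (cA v f) P := fun z => by
  simp only [cA, periodic_sd hf v z, hf _]

theorem periodic_shift {A : Type*} [AddCommGroup A] {f : A → ℝ} {P : A}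
    (hf : Function.Periodic f P) (c : A) : Function.Periodic (fun z => f (z + c)) P := fun z => by
  simp only [add_right_comm z P, hf _]

theorem periodic_box {f : E → ℝ} {P : E} (hf : Function.Periodic f P) (v : E) :
    Function.Periodic (box v f) P := fun z => by rw [box_shift, hf.shift_eq]

theorem periodic_hat {f : E → ℝ} {P : E} (hf : Function.Periodic f P) (v : E) :
    Function.Periodic (hat v f) P := fun z => by rw [hat_shift, hf.shift_eq]

theorem periodic_smooth {f : E → ℝ} {P : E} (hf : Function.Periodic f P) (v : E) :
    Function.Periodic (smooth v f) P := fun z => by rw [smooth_shift, hf.shift_eq]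

end periodic

/-! ### Bounds on a single time slice. -/

section slices

/-- `|f| ≤ c` on the time slice `t`. -/
def SliceLE (t c : ℝ) (f : ℝ × ℝ × ℝ → ℝ) : Prop := ∀ y : ℝ × ℝ × ℝ, y.2.2 = t → |f y| ≤ c

variable {t c : ℝ} {f : ℝ × ℝ × ℝ → ℝ} {v : ℝ × ℝ × ℝ}

/-- Consistency holds only for times whose step lies in [0, T]. Spatial operators preserve the
slice, so bounds on one slice propagate through them without any reference to other times. -/
theorem SliceLE.sd (H : SliceLE t c f) (hv : v.2.2 = 0) : SliceLE t (4 * c) (sd v f) :=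
  fun y hy => abs_sd_le_at y (H y hy) (H _ (by simp [hv, hy])) (H _ (by simp [hv, hy]))

theorem SliceLE.cB (H : SliceLE t c f) (hv : v.2.2 = 0) : SliceLE t (4 / 3 * c) (cB v f) :=
  fun y hy => abs_cB_le_at y (H y hy) (H _ (by simp [hv, hy])) (H _ (by simp [hv, hy]))

theorem SliceLE.hat (H : SliceLE t c f) (hv : v.2.2 = 0) : SliceLE t c (hat v f) :=
  fun y hy => abs_hat_le v f y fun _ _ => H _ (by simp [hv, hy])

theorem SliceLE.box (H : SliceLE t c f) (hv : v.2.2 = 0) : SliceLE t c (box v f) :=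
  fun y hy => abs_box_le v f y fun _ _ => H _ (by simp [hv, hy])

theorem SliceLE.smooth (H : SliceLE t c f) (hv : v.2.2 = 0) : SliceLE t (4 / 3 * c) (smooth v f) :=
  (H.hat hv).cB hv

end slices

theorem abs_smooth_le {E : Type*} [NormedAddCommGroup E] [NormedSpace ℝ E] {f : E → ℝ} {c : ℝ}
    (hf : ∀ z, |f z| ≤ c) (v z : E) : |smooth v f z| ≤ 4 / 3 * c :=
  abs_cB_le (fun z => abs_hat_le v f z fun _ _ => hf _) z

theorem smooth_congr_time {v : ℝ × ℝ × ℝ} (hv : v.2.2 = 0) {f g : ℝ × ℝ × ℝ → ℝ}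
    {z : ℝ × ℝ × ℝ} (h : ∀ y : ℝ × ℝ × ℝ, y.2.2 = z.2.2 → f y = g y) :
    smooth v f z = smooth v g z := by
  have : ∀ y : ℝ × ℝ × ℝ, y.2.2 = z.2.2 → hat v f y = hat v g y := fun y hy =>
    hat_congr_time hv fun x hx => h x (hx.trans hy)
  simp only [smooth, cB, sd]
  rw [this z rfl, this (z + v) (by simp [hv]), this (z - v) (by simp [hv])]

/-- A linear term has mean zero about the midpoint; subtracting it makes the midpoint rule second
order accurate with two derivatives only. -/
theorem box_sub_mid_le {E : Type*} [NormedAddCommGroup E] [NormedSpace ℝ E] {f : E → ℝ}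
    (hf : Continuous f) {v z : E} {c M : ℝ}
    (h : ∀ s ∈ Set.Icc (0 : ℝ) 1, |f (z + s • v) - f (z + (1 / 2 : ℝ) • v) - c * (s - 1 / 2)| ≤ M) :
    |box v f z - f (z + (1 / 2 : ℝ) • v)| ≤ M := by
  have h1 := abs_integral_unit_le h
  rw [intervalIntegral.integral_sub (Continuous.intervalIntegrable (by fun_prop) _ _)
    (Continuous.intervalIntegrable (by fun_prop) _ _), intervalIntegral.integral_sub
    (Continuous.intervalIntegrable (by fun_prop) _ _)
    (Continuous.intervalIntegrable (by fun_prop) _ _), intervalIntegral.integral_const_mul,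
    intervalIntegral.integral_sub (Continuous.intervalIntegrable (by fun_prop) _ _)
    (Continuous.intervalIntegrable (by fun_prop) _ _)] at h1
  simp only [integral_id, intervalIntegral.integral_const] at h1
  norm_num at h1
  convert h1 using 2
  norm_num [box]

theorem Chain4.shift {E : Type*} [NormedAddCommGroup E] [NormedSpace ℝ E] {e : E} {K : ℝ}
    {f : ℕ → E → ℝ} (H : Chain4 e K f) (c : E) : Chain4 e K (fun i z => f i (z + c)) where
  deriv i hi := (H.deriv i hi).shift c
  cont i hi := by have := H.cont i hi; fun_prop
  bdd i hi z := H.bdd i hi _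

theorem Chain4.abs_fd_le {E : Type*} [NormedAddCommGroup E] [NormedSpace ℝ E] {e : E} {K : ℝ}
    {f : ℕ → E → ℝ} (H : Chain4 e K f) {h : ℝ} (hh : 0 ≤ h) (z : E) :
    |f 0 (z + h • e) - f 0 z| ≤ K * h := by
  have h1 := H.odd_one (i := 0) (by norm_num) (z + (h / 2) • e) (show 0 ≤ h / 2 by positivity)
  rw [add_sub_cancel_right, add_assoc, ← add_smul, add_halves] at h1
  linarith

theorem Chain4.abs_sd_le {E : Type*} [NormedAddCommGroup E] [NormedSpace ℝ E] {e : E} {K : ℝ}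
    {f : ℕ → E → ℝ} (H : Chain4 e K f) {h : ℝ} (hh : 0 ≤ h) (z : E) :
    |sd (h • e) (f 0) z| ≤ K * h ^ 2 := by
  have h1 := H.even_two (i := 0) (by norm_num) z hh
  rwa [show sd (h • e) (f 0) z = f 0 (z + h • e) + f 0 (z - h • e) - 2 * f 0 z by rw [sd]; ring]

/-- The flux remainder of the discrete transport term. -/
noncomputable def fluxRem {A : Type*} [AddCommGroup A] (v : A) (U W m Fl : A → ℝ) (z : A) : ℝ :=
  1 / 6 * (U z * U (z + v) + U z ^ 2 + U (z + v) ^ 2)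
    - 1 / 6 * ((m (z + v) - m z) ^ 2 / 2 + (W z * U z + W (z + v) * U (z + v)) / 2) - Fl z

/-- The remainder of the discrete transport term that is not in flux form. -/
noncomputable def sourceRem {A : Type*} [AddCommGroup A] (h : ℝ) (v : A) (U W m : A → ℝ) (z : A) :
    ℝ := -(1 / 6) * (W z * dhat h v U z - sd v m z * dhat h v m z)

/-- Flux form of the difference between the discrete and the exact transport term. -/
theorem psi_flux_identity {A : Type*} [AddCommGroup A] {h : ℝ} (hh : h ≠ 0) (v : A)
    (U W m Fl : A → ℝ) (z : A) :
    -(Fl z - Fl (z - v)) / h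
      = -(psi h v U U z - h ^ 2 / 2 * psi h v (fun z => W z / h ^ 2) U z)
        + (fluxRem v U W m Fl z - fluxRem v U W m Fl (z - v)) / h + sourceRem h v U W m z := by
  -- ψ(U, U) is an exact flux difference, and so is δ̂(WU), but W δ̂U is not. It is replaced by sd m
  -- · δ̂m, the difference of (m₊ - m)^2/2 divided by h; the discrepancy is the source remainder.
  simp only [psi, dhat, sd, fluxRem, sourceRem, sub_add_cancel]
  field_simp
  ring

theorem periodic_fluxRem {A : Type*} [AddCommGroup A] {U W m Fl : A → ℝ} {P : A}
    (hU : Function.Periodic U P) (hW : Function.Periodic W P) (hm : Function.Periodic m P)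
    (hF : Function.Periodic Fl P) (v : A) : Function.Periodic (fluxRem v U W m Fl) P := fun z => by
  simp only [fluxRem, add_right_comm z P, hU _, hW _, hm _, hF _]

/-- The mean of the two time levels of a step. -/
noncomputable def trap (τ : ℝ) (U : ℝ × ℝ × ℝ → ℝ) (z : ℝ × ℝ × ℝ) : ℝ :=
  (U z + U (z + τ • eT)) / 2

/-- The mesh second difference multiplied by `h ^ 2` that belongs to the comparison function. -/
noncomputable def auxV (v w : ℝ × ℝ × ℝ) (τ : ℝ) (U : ℝ × ℝ × ℝ → ℝ) : ℝ × ℝ × ℝ → ℝ :=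
  cB v (smooth w (box (τ • eT) (sd v U)))

/-- The flux of the exact transport term, averaged over the cell faces. -/
noncomputable def exactFlux (v w : ℝ × ℝ × ℝ) (τ : ℝ) (U : ℝ × ℝ × ℝ → ℝ) (z : ℝ × ℝ × ℝ) : ℝ :=
  1 / 2 * cB v (box v (smooth w (box (τ • eT) fun z => U z * U z))) z

/-- The defect in the relation between the comparison function and its second difference. -/
noncomputable def defect (v w : ℝ × ℝ × ℝ) (τ : ℝ) (U : ℝ × ℝ × ℝ → ℝ) : ℝ × ℝ × ℝ → ℝ :=
  cB v (cB w fun z => hat w (fun z => cA v (box (τ • eT) U) z - hat v (box (τ • eT) U) z) z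
    - hat w (hat v fun z => trap τ U z - box (τ • eT) U z) z)

theorem continuous_trap (τ : ℝ) {U : ℝ × ℝ × ℝ → ℝ} (hU : Continuous U) :
    Continuous (trap τ U) := by
  unfold trap; fun_prop

/-- The defect is designed to make this exact. It trades the hat along `v` for the compact average
and the two-level mean for the time average, after which both sides are cB cB sd cA applied to the
same averages of `U`. -/
theorem cA_auxV (v w : ℝ × ℝ × ℝ) (τ : ℝ) {U : ℝ × ℝ × ℝ → ℝ} (hU : Continuous U)
    (z : ℝ × ℝ × ℝ) : cA v (auxV v w τ U) z
      = sd v (fun z => smooth v (smooth w (trap τ U)) z + defect v w τ U z) z := by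
  have ct := continuous_trap τ hU
  have cb := continuous_box (τ • eT) hU
  have csd := continuous_sd v cb
  have cca := continuous_cA v cb
  have c1 := continuous_hat v cb
  have c2 := continuous_hat v ct
  have e1 : hat v (fun z => trap τ U z - box (τ • eT) U z)
      = fun z => hat v (trap τ U) z - hat v (box (τ • eT) U) z := funext fun z => hat_sub v ct cb z
  have e2 : (fun z => hat w (fun z => cA v (box (τ • eT) U) z - hat v (box (τ • eT) U) z) z
      - hat w (hat v fun z => trap τ U z - box (τ • eT) U z) z)
      = fun z => hat w (cA v (box (τ • eT) U)) z - hat w (hat v (trap τ U)) z := funext fun z => by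
    rw [e1, hat_sub w cca c1, hat_sub w c2 c1]; ring
  have e3 : smooth v (smooth w (trap τ U)) = cB v (cB w (hat w (hat v (trap τ U)))) := by
    change cB v (hat v (smooth w (trap τ U))) = _
    rw [hat_smooth v w ct]; rfl
  -- In the sum, the two-level means cancel, as do the terms in hat_w hat_v of the time average;
  -- only the compact average remains.
  have e4 : (fun z => smooth v (smooth w (trap τ U)) z + defect v w τ U z)
      = cB v (cB w (hat w (cA v (box (τ • eT) U)))) := funext fun z => by
    unfold defect
    rw [e2, e3, ← cB_add]
    refine congrArg (fun f => cB v f z) (funext fun y => ?_)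
    rw [cB_sub]; ring
  have e5 : box (τ • eT) (sd v U) = sd v (box (τ • eT) U) := funext fun z => box_sd _ _ hU z
  have e6 : hat w (cA v (box (τ • eT) U)) = cA v (hat w (box (τ • eT) U)) :=
    funext fun z => hat_cA w v cb z
  have e7 : hat w (sd v (box (τ • eT) U)) = sd v (hat w (box (τ • eT) U)) :=
    funext fun z => hat_sd w v cb z
  have swapA : ∀ f : ℝ × ℝ × ℝ → ℝ, cA v (cB v (cB w f)) = cB v (cB w (cA v f)) := fun f =>
    funext fun z => (cA_cB_comm v v _ z).trans
      (congrArg (fun f => cB v f z) (funext fun y => cA_cB_comm v w f y))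
  have swapS : ∀ f : ℝ × ℝ × ℝ → ℝ, sd v (cB v (cB w f)) = cB v (cB w (sd v f)) := fun f =>
    funext fun z => (sd_cB_comm v v _ z).trans
      (congrArg (fun f => cB v f z) (funext fun y => sd_cB_comm v w f y))
  rw [e4, e6]
  unfold auxV
  rw [e5]
  change cA v (cB v (cB w (hat w (sd v (box (τ • eT) U))))) z = _
  rw [e7, swapA, swapS]
  refine congrArg (fun f => cB v (cB w f) z) (funext fun y => ?_)
  simp only [cA, sd]; ring

section periodic

variable {U : ℝ × ℝ × ℝ → ℝ} {P : ℝ × ℝ × ℝ}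

theorem periodic_trap (hU : Function.Periodic U P) (τ : ℝ) : Function.Periodic (trap τ U) P :=
  fun z => by simp only [trap, add_right_comm z P, hU _]

theorem periodic_auxV (hU : Function.Periodic U P) (v w : ℝ × ℝ × ℝ) (τ : ℝ) :
    Function.Periodic (auxV v w τ U) P :=
  periodic_cB (periodic_smooth (periodic_box (periodic_sd hU v) _) w) v

theorem periodic_exactFlux (hU : Function.Periodic U P) (v w : ℝ × ℝ × ℝ) (τ : ℝ) :
    Function.Periodic (exactFlux v w τ U) P := fun z => by
  have hq : Function.Periodic (fun z => U z * U z) P := hU.mul hU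
  unfold exactFlux
  rw [periodic_cB (periodic_box (periodic_smooth (periodic_box hq (τ • eT)) w) v) v z]

theorem periodic_defect (hU : Function.Periodic U P) (v w : ℝ × ℝ × ℝ) (τ : ℝ) :
    Function.Periodic (defect v w τ U) P := by
  have hb := periodic_box hU (τ • eT)
  refine periodic_cB (periodic_cB (Function.Periodic.sub (periodic_hat (Function.Periodic.sub
    (periodic_cA hb v) (periodic_hat hb v)) w) (periodic_hat (periodic_hat
    (Function.Periodic.sub (periodic_trap hU τ) hb) v) w)) w) v

end periodic

/-! ### Pointwise consistency of the comparison function. -/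

namespace Flow

variable {lam L1 L2 T K : ℝ} {ex ey : ℝ × ℝ × ℝ} {ux uy : ℕ → ℝ × ℝ × ℝ → ℝ}
  {ut utt : ℝ × ℝ × ℝ → ℝ}

/-- One smoothing costs K h^4; applying the other smoothing, of norm at most 4/3, to that error and
adding its own gives 7/3. -/
theorem abs_smooth_smooth_sub_le (D : Flow lam L1 L2 T K ex ey ux uy ut utt) {h : ℝ} (hh : 0 ≤ h)
    (z : ℝ × ℝ × ℝ) :
    |smooth (h • ex) (smooth (h • ey) (ux 0)) z - ux 0 z| ≤ 7 / 3 * K * h ^ 4 := by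
  have c0 := D.cont_zero
  have h1 := abs_smooth_le (f := fun z => smooth (h • ey) (ux 0) z - ux 0 z) (fun z => by
    have := D.chain_y.abs_cB_hat_sub_le hh z
    rw [D.zero_eq] at this
    exact this) (h • ex) z
  rw [smooth_sub _ (continuous_smooth _ c0) c0] at h1
  have h2 : |smooth (h • ex) (ux 0) z - ux 0 z| ≤ K * h ^ 4 := D.chain_x.abs_cB_hat_sub_le hh z
  rw [abs_le] at *
  constructor <;> linarith

theorem abs_trap_sub_mid_le (D : Flow lam L1 L2 T K ex ey ux uy ut utt) {τ : ℝ} (hτ : 0 ≤ τ)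
    (z : ℝ × ℝ × ℝ) (hz : 0 ≤ z.2.2) (hz' : z.2.2 + τ ≤ T) :
    |trap τ (ux 0) z - ux 0 (z + (τ / 2) • eT)| ≤ K * τ ^ 2 / 8 := by
  have h1 := D.taylor_t z (s := τ / 2) (t := 0) ⟨by linarith, by linarith⟩ ⟨by linarith, by linarith⟩
  have h2 := D.taylor_t z (s := τ / 2) (t := τ) ⟨by linarith, by linarith⟩ ⟨by linarith, by linarith⟩
  rw [zero_smul, add_zero] at h1
  rw [trap]
  rw [abs_le] at *
  constructor <;> nlinarith

theorem abs_box_sub_mid_le (D : Flow lam L1 L2 T K ex ey ux uy ut utt) {τ : ℝ} (hτ : 0 ≤ τ)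
    (z : ℝ × ℝ × ℝ) (hz : 0 ≤ z.2.2) (hz' : z.2.2 + τ ≤ T) :
    |box (τ • eT) (ux 0) z - ux 0 (z + (τ / 2) • eT)| ≤ K * τ ^ 2 / 8 := by
  have hK := D.K_nonneg
  have e : (1 / 2 : ℝ) • τ • eT = (τ / 2) • eT := by rw [smul_smul]; congr 1; ring
  have := box_sub_mid_le (z := z) (M := K * τ ^ 2 / 8) (c := ut (z + (τ / 2) • eT) * τ)
    D.cont_zero (v := τ • eT)
    fun s hs => by
      have h1 := D.taylor_t z (s := τ / 2) (t := s * τ) ⟨by linarith, by linarith⟩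
        ⟨by nlinarith [hs.1], by nlinarith [hs.2]⟩
      rw [e, smul_smul]
      have e2 : ut (z + (τ / 2) • eT) * τ * (s - 1 / 2)
          = ut (z + (τ / 2) • eT) * (s * τ - τ / 2) := by ring
      rw [e2]
      refine h1.trans ?_
      have : (s * τ - τ / 2) ^ 2 ≤ τ ^ 2 / 4 := by
        have := mul_nonneg hs.1 (sub_nonneg.2 hs.2)
        nlinarith [mul_nonneg this (sq_nonneg τ)]
      nlinarith
  rwa [e] at this

theorem abs_box_sq_sub_mid_le (D : Flow lam L1 L2 T K ex ey ux uy ut utt) {τ : ℝ} (hτ : 0 ≤ τ)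
    (z : ℝ × ℝ × ℝ) (hz : 0 ≤ z.2.2) (hz' : z.2.2 + τ ≤ T) :
    |box (τ • eT) (sqChain ux 0) z - sqChain ux 0 (z + (τ / 2) • eT)| ≤ K ^ 2 * τ ^ 2 / 2 := by
  have e : (1 / 2 : ℝ) • τ • eT = (τ / 2) • eT := by rw [smul_smul]; congr 1; ring
  have := box_sub_mid_le (z := z) (M := K ^ 2 * τ ^ 2 / 2)
    (c := 2 * (ux 0 (z + (τ / 2) • eT) * ut (z + (τ / 2) • eT)) * τ)
    (D.chain_x.sq.cont 0 (by norm_num)) (v := τ • eT)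
    fun s hs => by
      have h1 := D.taylor_sq_t z (s := τ / 2) (t := s * τ) ⟨by linarith, by linarith⟩
        ⟨by nlinarith [hs.1], by nlinarith [hs.2]⟩
      rw [e, smul_smul]
      have e2 : 2 * (ux 0 (z + (τ / 2) • eT) * ut (z + (τ / 2) • eT)) * τ * (s - 1 / 2)
          = 2 * (ux 0 (z + (τ / 2) • eT) * ut (z + (τ / 2) • eT)) * (s * τ - τ / 2) := by ring
      rw [e2]
      refine h1.trans ?_
      have : (s * τ - τ / 2) ^ 2 ≤ τ ^ 2 / 4 := by
        have := mul_nonneg hs.1 (sub_nonneg.2 hs.2)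
        nlinarith [mul_nonneg this (sq_nonneg τ)]
      nlinarith [mul_le_mul_of_nonneg_left this (sq_nonneg K)]
  rwa [e] at this

theorem abs_smooth_trap_sub_mid_le (D : Flow lam L1 L2 T K ex ey ux uy ut utt) {h τ : ℝ}
    (hh : 0 ≤ h) (hτ : 0 ≤ τ) (z : ℝ × ℝ × ℝ) (hz : 0 ≤ z.2.2) (hz' : z.2.2 + τ ≤ T) :
    |trap τ (smooth (h • ex) (smooth (h • ey) (ux 0))) z - ux 0 (z + (τ / 2) • eT)|
      ≤ 3 * K * (τ ^ 2 + h ^ 4) := by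
  have h1 := D.abs_trap_sub_mid_le hτ z hz hz'
  have h2 := D.abs_smooth_smooth_sub_le hh z
  have h3 := D.abs_smooth_smooth_sub_le hh (z + τ • eT)
  have k1 := mul_nonneg D.K_nonneg (sq_nonneg τ)
  have k2 := mul_nonneg D.K_nonneg (pow_nonneg hh 4)
  rw [trap] at *
  rw [abs_le] at *
  constructor <;> linarith

/-- Undivided second differences lose only a factor 4, so replacing the smoothed time average by the
midpoint value is harmless. The correction in the outer `cB` is a fourth order difference and hence
O(h^4). -/
theorem abs_auxV_sub_le (D : Flow lam L1 L2 T K ex ey ux uy ut utt) {h τ : ℝ}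
    (hh : 0 ≤ h) (hτ : 0 ≤ τ) (z : ℝ × ℝ × ℝ) (hz : 0 ≤ z.2.2) (hz' : z.2.2 + τ ≤ T) :
    |auxV (h • ex) (h • ey) τ (ux 0) z - sd (h • ex) (fun z => ux 0 (z + (τ / 2) • eT)) z|
      ≤ 9 * K * (τ ^ 2 + h ^ 4) := by
  have c0 := D.cont_zero
  have hvt : (h • ex).2.2 = 0 := by simp [D.ex_time]
  have hwt : (h • ey).2.2 = 0 := by simp [D.ey_time]
  set v := h • ex with hv
  set w := h • ey with hw
  set m : ℝ × ℝ × ℝ → ℝ := fun z => ux 0 (z + (τ / 2) • eT) with hm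
  have cm : Continuous m := by rw [hm]; fun_prop
  have cb := continuous_box (τ • eT) c0
  have k1 := mul_nonneg D.K_nonneg (sq_nonneg τ)
  have k2 := mul_nonneg D.K_nonneg (pow_nonneg hh 4)
  set L := smooth w (box (τ • eT) (ux 0)) with hL
  have h1 : SliceLE z.2.2 (2 * K * (τ ^ 2 + h ^ 4)) fun z => L z - m z := fun y hy => by
    have a1 : SliceLE z.2.2 (K * τ ^ 2 / 8) fun y => box (τ • eT) (ux 0) y - m y := fun y hy =>
      D.abs_box_sub_mid_le hτ y (by rwa [hy]) (by rwa [hy])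
    have a2 := a1.smooth hwt y hy
    rw [smooth_sub w cb cm] at a2
    have a3 : |smooth w m y - m y| ≤ K * h ^ 4 := by
      have := (D.chain_y.shift ((τ / 2) • eT)).abs_cB_hat_sub_le hh y
      rw [D.zero_eq] at this
      exact this
    rw [abs_le] at *
    constructor <;> linarith
  have h2 := h1.sd hvt z rfl
  rw [sd_sub] at h2
  have e1 : smooth w (box (τ • eT) (sd v (ux 0))) = sd v L := by
    have : box (τ • eT) (sd v (ux 0)) = sd v (box (τ • eT) (ux 0)) :=
      funext fun z => box_sd _ _ c0 z
    rw [this, hL, sd_smooth v w cb]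
  have h3 : |sd v (sd v L) z| ≤ 4 / 3 * (2 * K * h ^ 4) := by
    have : sd v (sd v L) = smooth w (box (τ • eT) (sd v (sd v (ux 0)))) := by
      rw [← e1, sd_smooth v w (continuous_box _ (continuous_sd v c0))]
      refine congrArg (smooth w) (funext fun z => (box_sd _ _ (continuous_sd v c0) z).symm)
    rw [this]
    exact abs_smooth_le (fun y => abs_box_le _ _ y fun _ _ => D.chain_x.abs_sd_sd_le hh _) _ _
  unfold auxV
  rw [e1, cB]
  rw [abs_le] at *
  constructor <;> linarith

theorem abs_exactFlux_sub_le (D : Flow lam L1 L2 T K ex ey ux uy ut utt) {h τ : ℝ}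
    (hh : 0 ≤ h) (hτ : 0 ≤ τ) (z : ℝ × ℝ × ℝ) (hz : 0 ≤ z.2.2) (hz' : z.2.2 + τ ≤ T) :
    |exactFlux (h • ex) (h • ey) τ (ux 0) z
      - 1 / 2 * cB (h • ex) (box (h • ex) fun z => sqChain ux 0 (z + (τ / 2) • eT)) z|
      ≤ 11 * K ^ 2 * (τ ^ 2 + h ^ 4) := by
  have cq := D.chain_x.sq.cont 0 (by norm_num)
  have hvt : (h • ex).2.2 = 0 := by simp [D.ex_time]
  have hwt : (h • ey).2.2 = 0 := by simp [D.ey_time]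
  set v := h • ex with hv
  set w := h • ey with hw
  set m : ℝ × ℝ × ℝ → ℝ := fun z => sqChain ux 0 (z + (τ / 2) • eT) with hm
  have cm : Continuous m := by rw [hm]; fun_prop
  have cb := continuous_box (τ • eT) cq
  have k1 := mul_nonneg (sq_nonneg K) (sq_nonneg τ)
  have k2 := mul_nonneg (sq_nonneg K) (pow_nonneg hh 4)
  have h1 : SliceLE z.2.2 (16 * K ^ 2 * (τ ^ 2 + h ^ 4))
      fun z => smooth w (box (τ • eT) (sqChain ux 0)) z - m z := fun y hy => by
    have a1 : SliceLE z.2.2 (K ^ 2 * τ ^ 2 / 2) fun y => box (τ • eT) (sqChain ux 0) y - m y :=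
      fun y hy => D.abs_box_sq_sub_mid_le hτ y (by rwa [hy]) (by rwa [hy])
    have a2 := a1.smooth hwt y hy
    rw [smooth_sub w cb cm] at a2
    have a3 : |smooth w m y - m y| ≤ 16 * K ^ 2 * h ^ 4 := by
      have := (D.chain_y.sq.shift ((τ / 2) • eT)).abs_cB_hat_sub_le hh y
      have e : sqChain uy 0 = sqChain ux 0 := by simp only [sqChain, D.zero_eq]
      rw [e] at this
      exact this
    rw [abs_le] at *
    constructor <;> linarith
  have h2 := ((h1.box hvt).cB hvt) z rfl
  have e : box v (fun z => smooth w (box (τ • eT) (sqChain ux 0)) z - m z)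
      = fun z => box v (smooth w (box (τ • eT) (sqChain ux 0))) z - box v m z :=
    funext fun y => box_sub v (continuous_smooth w cb) cm y
  rw [e, cB_sub] at h2
  change |1 / 2 * cB v (box v (smooth w (box (τ • eT) (sqChain ux 0)))) z - 1 / 2 * cB v (box v m) z|
    ≤ _
  rw [abs_le] at *
  constructor <;> linarith

end Flow

namespace Flow

variable {lam L1 L2 T K : ℝ} {ex ey : ℝ × ℝ × ℝ} {ux uy : ℕ → ℝ × ℝ × ℝ → ℝ}
  {ut utt : ℝ × ℝ × ℝ → ℝ}

/-- The flux is quadratic, so each product changes by a small factor times a bounded one; this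
carries consistency from the exact midpoint values to the comparison function. -/
theorem abs_flux_perturb_le {X Y a a' b b' p p' q q' ε K : ℝ} (hε : 0 ≤ ε)
    (hf : |1 / 6 * (b * b' + b ^ 2 + b' ^ 2) - 1 / 6 * ((b' - b) ^ 2 / 2
      + (q * b + q' * b') / 2) - 1 / 2 * Y| ≤ 10 * (K ^ 2 * ε))
    (hx : |X - 1 / 2 * Y| ≤ 11 * K ^ 2 * ε) (v0 : |p - q| ≤ 9 * K * ε) (v1 : |p' - q'| ≤ 9 * K * ε)
    (u0 : |a - b| ≤ 3 * K * ε) (u1 : |a' - b'| ≤ 3 * K * ε) (a0 : |a| ≤ 2 * K) (a1 : |a'| ≤ 2 * K)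
    (b0 : |b| ≤ K) (b1 : |b'| ≤ K) (q0 : |q| ≤ 4 * K) (q1 : |q'| ≤ 4 * K) :
    |1 / 6 * (a * a' + a ^ 2 + a' ^ 2) - 1 / 6 * ((b' - b) ^ 2 / 2 + (p * a + p' * a') / 2) - X|
      ≤ 31 * K ^ 2 * ε := by
  have hKε : 0 ≤ K ^ 2 * ε := by positivity
  have t1 := abs_mul_le_mul u0 a1
  have t2 := abs_mul_le_mul b0 u1
  have t3 := abs_mul_le_mul u0 a0
  have t4 := abs_mul_le_mul b0 u0
  have t5 := abs_mul_le_mul u1 a1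
  have t6 := abs_mul_le_mul b1 u1
  have t7 := abs_mul_le_mul v0 a0
  have t8 := abs_mul_le_mul q0 u0
  have t9 := abs_mul_le_mul v1 a1
  have t10 := abs_mul_le_mul q1 u1
  clear v0 v1 u0 u1 a0 a1 b0 b1 q0 q1
  rw [abs_le] at *
  constructor <;> linarith

/-- The smoothed right-hand side in one direction, in mesh form. -/
theorem smooth_direction (D : Flow lam L1 L2 T K ex ey ux uy ut utt) {h : ℝ} (hh : h ≠ 0) (τ : ℝ)
    (z : ℝ × ℝ × ℝ) :
    smooth (h • ex) (smooth (h • ey) (box (τ • eT)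
        fun z => lam * ux 2 z - 1 / 2 * sqChain ux 1 z)) z
      = lam * (auxV (h • ex) (h • ey) τ (ux 0) z / h ^ 2)
        + -(exactFlux (h • ex) (h • ey) τ (ux 0) z
          - exactFlux (h • ex) (h • ey) τ (ux 0) (z - h • ex)) / h := by
  have c0 := D.cont_zero
  have c1 := D.chain_x.cont 1 (by norm_num)
  have c2 := D.chain_x.cont 2 (by norm_num)
  have cq := D.chain_x.sq.cont 0 (by norm_num)
  have cq1 := D.chain_x.sq.cont 1 (by norm_num)
  have d0 := (D.chain_x.deriv 0 (by norm_num)).smul h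
  have d1 := ((D.chain_x.deriv 1 (by norm_num)).smul h).const_mul h
  have dq := (D.chain_x.sq.deriv 0 (by norm_num)).smul h
  set v := h • ex with hv
  set w := h • ey with hw
  set f : ℝ × ℝ × ℝ → ℝ := fun z => lam * ux 2 z - 1 / 2 * sqChain ux 1 z with hf
  have cf : Continuous f := by rw [hf]; fun_prop
  have csd := continuous_sd v c0
  have cbq := continuous_box v cq
  set g := smooth w (box (τ • eT) (box v (sqChain ux 0))) with hg
  -- The hat along `v` removes both derivatives exactly, leaving a second difference and a backward
  -- difference of segment averages. No Taylor remainder arises here.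
  have e1 : hat v f = fun z => lam / h ^ 2 * sd v (ux 0) z
      - 1 / (2 * h) * (box v (sqChain ux 0) z - box v (sqChain ux 0) (z + -v)) := funext fun z => by
    have a1 := DD.hat_eq_second d0 d1 (by fun_prop) (by fun_prop) z
    have a2 := dq.hat_eq cq (by fun_prop) z
    simp only [zero_add, Nat.reduceAdd, hat_const_mul] at a1 a2
    rw [hf, hat_sub v (by fun_prop) (by fun_prop), hat_const_mul, hat_const_mul, sd,
      ← sub_eq_add_neg, ← a1, ← a2]
    field_simp
  have e2 : ∀ y, smooth w (box (τ • eT) (hat v f)) y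
      = lam / h ^ 2 * smooth w (box (τ • eT) (sd v (ux 0))) y - 1 / (2 * h) * (g y - g (y + -v)) :=
    fun y => by
      have cs : Continuous fun z => box v (sqChain ux 0) (z + -v) := by fun_prop
      have b1 : box (τ • eT) (hat v f) = fun z => lam / h ^ 2 * box (τ • eT) (sd v (ux 0)) z
          - 1 / (2 * h) * (box (τ • eT) (box v (sqChain ux 0)) z
            - box (τ • eT) (box v (sqChain ux 0)) (z + -v)) := funext fun z => by
        rw [e1, box_sub _ (by fun_prop) (by fun_prop), box_const_mul, box_const_mul,
          box_sub _ cbq cs, box_shift (τ • eT) (-v)]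
      have k1 := continuous_box (τ • eT) csd
      have k2 := continuous_box (τ • eT) cbq
      have k3 : Continuous fun z => box (τ • eT) (box v (sqChain ux 0)) (z + -v) := by fun_prop
      rw [b1, smooth_sub w (by fun_prop) (by fun_prop), smooth_const_mul, smooth_const_mul,
        smooth_sub w k2 k3, hg, smooth_shift w (-v)]
  have e3 : g = box v (smooth w (box (τ • eT) (sqChain ux 0))) := by
    rw [hg, box_smooth v w (continuous_box _ cq)]
    exact congrArg (smooth w) (funext fun y => box_comm _ _ cq y)
  have e4 : smooth v (smooth w (box (τ • eT) f)) z = cB v (smooth w (box (τ • eT) (hat v f))) z := by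
    change cB v (hat v (smooth w (box (τ • eT) f))) z = _
    rw [hat_smooth v w (continuous_box _ cf)]
    refine congrArg (fun f => cB v (smooth w f) z) (funext fun y => ?_)
    exact (box_hat_comm _ _ cf y).symm
  have e5 : ∀ y, exactFlux v w τ (ux 0) y = 1 / 2 * cB v g y := fun y => by rw [e3]; rfl
  rw [e4, e5, e5, show smooth w (box (τ • eT) (hat v f)) = _ from funext e2, cB_sub, cB_const_mul,
    cB_const_mul, cB_sub, sub_eq_add_neg z v, cB_shift v (-v) g]
  unfold auxV
  field_simp
  ring

theorem abs_comparison_le (D : Flow lam L1 L2 T K ex ey ux uy ut utt) {h : ℝ}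
    (z : ℝ × ℝ × ℝ) :
    |smooth (h • ex) (smooth (h • ey) (ux 0)) z| ≤ 2 * K := by
  have h1 := abs_smooth_le (abs_smooth_le (D.chain_x.bdd 0 (by norm_num)) (h • ey)) (h • ex) z
  have := D.K_nonneg
  linarith

theorem abs_comparison_fd_le (D : Flow lam L1 L2 T K ex ey ux uy ut utt) {h : ℝ}
    (hh : 0 ≤ h) (z : ℝ × ℝ × ℝ) :
    |smooth (h • ex) (smooth (h • ey) (ux 0)) (z + h • ex)
      - smooth (h • ex) (smooth (h • ey) (ux 0)) z| ≤ 2 * K * h := by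
  have c0 := D.cont_zero
  have cs : Continuous fun z => ux 0 (z + h • ex) := by fun_prop
  have h1 := abs_smooth_le (abs_smooth_le (fun z => D.chain_x.abs_fd_le hh z) (h • ey)) (h • ex) z
  have e : smooth (h • ey) (fun z => ux 0 (z + h • ex) - ux 0 z)
      = fun z => smooth (h • ey) (ux 0) (z + h • ex) - smooth (h • ey) (ux 0) z := funext fun y => by
    rw [smooth_sub _ cs c0, smooth_shift (h • ey) (h • ex)]
  have k1 := continuous_smooth (h • ey) c0
  have k2 : Continuous fun z => smooth (h • ey) (ux 0) (z + h • ex) := by fun_prop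
  rw [e, smooth_sub _ k2 k1, ← smooth_shift] at h1
  have := mul_nonneg D.K_nonneg hh
  linarith

/-- Consistency of the flux is known for the exact midpoint values; the two-level mean, the
auxiliary variable and the averaged flux each differ from their midpoint counterparts by O(τ^2 +
h^4). -/
theorem abs_fluxRem_le (D : Flow lam L1 L2 T K ex ey ux uy ut utt) {h τ : ℝ} {z : ℝ × ℝ × ℝ}
    (hh : 0 ≤ h) (hτ : 0 ≤ τ) (hz : 0 ≤ z.2.2) (hz' : z.2.2 + τ ≤ T) :
    |fluxRem (h • ex) (trap τ (smooth (h • ex) (smooth (h • ey) (ux 0))))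
      (auxV (h • ex) (h • ey) τ (ux 0)) (fun z => ux 0 (z + (τ / 2) • eT))
      (exactFlux (h • ex) (h • ey) τ (ux 0)) z| ≤ 31 * K ^ 2 * (τ ^ 2 + h ^ 4) := by
  have hK := D.K_nonneg
  have ht : (z + h • ex).2.2 = z.2.2 := by simp [D.ex_time]
  have hf := (D.chain_x.shift ((τ / 2) • eT)).flux_consistency hh z
  have hx := D.abs_exactFlux_sub_le hh hτ z hz hz'
  have v0 := D.abs_auxV_sub_le hh hτ z hz hz'
  have v1 := D.abs_auxV_sub_le hh hτ (z + h • ex) (by rwa [ht]) (by rwa [ht])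
  have u0 := D.abs_smooth_trap_sub_mid_le hh hτ z hz hz'
  have u1 := D.abs_smooth_trap_sub_mid_le hh hτ (z + h • ex) (by rwa [ht]) (by rwa [ht])
  have b0 : |trap τ (smooth (h • ex) (smooth (h • ey) (ux 0))) z| ≤ 2 * K := by
    have k1 := D.abs_comparison_le (h := h) z
    have k2 := D.abs_comparison_le (h := h) (z + τ • eT)
    rw [trap]; rw [abs_le] at *; constructor <;> linarith
  have b1 : |trap τ (smooth (h • ex) (smooth (h • ey) (ux 0))) (z + h • ex)| ≤ 2 * K := by
    have k1 := D.abs_comparison_le (h := h) (z + h • ex)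
    have k2 := D.abs_comparison_le (h := h) (z + h • ex + τ • eT)
    rw [trap]; rw [abs_le] at *; constructor <;> linarith
  have m0 := D.chain_x.bdd 0 (by norm_num) (z + (τ / 2) • eT)
  have m1 := D.chain_x.bdd 0 (by norm_num) (z + h • ex + (τ / 2) • eT)
  have s0 := abs_sd_le (v := h • ex) (fun z => D.chain_x.bdd 0 (by norm_num) (z + (τ / 2) • eT)) z
  have s1 := abs_sd_le (v := h • ex) (fun z => D.chain_x.bdd 0 (by norm_num) (z + (τ / 2) • eT))
    (z + h • ex)
  have hsq : (fun z => sqChain ux 0 (z + (τ / 2) • eT))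
    = sqChain (fun i z => ux i (z + (τ / 2) • eT)) 0 := rfl
  rw [hsq] at hx
  simp only [fluxRem]
  have hε0 : 0 ≤ τ ^ 2 + h ^ 4 := by positivity
  exact abs_flux_perturb_le hε0 (hf.trans (by
    rw [mul_assoc]; gcongr; linarith [sq_nonneg τ])) hx v0 v1 u0 u1 b0 b1 m0 m1 s0 s1

/-- Of the two factors, W - sd m is small against a bounded difference quotient. In the other term
the quotient costs a division by h, more than repaid by sd m = O(h^2); this is the origin of the
summand h in the constant. -/
theorem abs_sourceRem_le (D : Flow lam L1 L2 T K ex ey ux uy ut utt) {h τ : ℝ} {z : ℝ × ℝ × ℝ}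
    (hh : 0 < h) (hτ : 0 ≤ τ) (hz : 0 ≤ z.2.2) (hz' : z.2.2 + τ ≤ T) :
    |sourceRem h (h • ex) (trap τ (smooth (h • ex) (smooth (h • ey) (ux 0))))
      (auxV (h • ex) (h • ey) τ (ux 0)) (fun z => ux 0 (z + (τ / 2) • eT)) z|
      ≤ (3 + h) * K ^ 2 * (τ ^ 2 + h ^ 4) := by
  have hK := D.K_nonneg
  have v0 := D.abs_auxV_sub_le hh.le hτ z hz hz'
  have up : (z + h • ex).2.2 = z.2.2 := by simp [D.ex_time]
  have um : (z - h • ex).2.2 = z.2.2 := by simp [D.ex_time]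
  have u1 := D.abs_smooth_trap_sub_mid_le hh.le hτ (z + h • ex) (by rwa [up]) (by rwa [up])
  have u2 := D.abs_smooth_trap_sub_mid_le hh.le hτ (z - h • ex) (by rwa [um]) (by rwa [um])
  have s0 := (D.chain_x.shift ((τ / 2) • eT)).abs_sd_le hh.le z
  set Ut := smooth (h • ex) (smooth (h • ey) (ux 0)) with hUt
  have b0 : |dhat h (h • ex) (trap τ Ut) z| ≤ 2 * K := by
    have k1 := D.abs_comparison_fd_le hh.le z
    have k2 := D.abs_comparison_fd_le hh.le (z - h • ex)
    have k3 := D.abs_comparison_fd_le hh.le (z + τ • eT)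
    have k4 := D.abs_comparison_fd_le hh.le (z - h • ex + τ • eT)
    rw [sub_add_cancel] at k2
    rw [add_right_comm] at k3
    rw [add_right_comm, sub_add_cancel] at k4
    simp only [dhat, trap]
    rw [abs_div, abs_of_pos (by positivity : 0 < 2 * h), div_le_iff₀ (by positivity)]
    rw [abs_le] at *
    constructor <;> linarith
  set ε := τ ^ 2 + h ^ 4 with hε
  have hε0 : 0 ≤ ε := by positivity
  have b1 : |dhat h (h • ex) (trap τ Ut) z
      - dhat h (h • ex) (fun z => ux 0 (z + (τ / 2) • eT)) z| ≤ 3 * K * ε / h := by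
    have e : dhat h (h • ex) (trap τ Ut) z - dhat h (h • ex) (fun z => ux 0 (z + (τ / 2) • eT)) z
        = ((trap τ Ut (z + h • ex) - ux 0 (z + h • ex + (τ / 2) • eT))
          - (trap τ Ut (z - h • ex) - ux 0 (z - h • ex + (τ / 2) • eT))) / (2 * h) := by
      simp only [dhat]; ring
    rw [e, abs_div, abs_of_pos (by positivity : 0 < 2 * h), div_le_div_iff₀ (by positivity) hh]
    rw [abs_le] at u1 u2
    have : |(trap τ Ut (z + h • ex) - ux 0 (z + h • ex + (τ / 2) • eT))
          - (trap τ Ut (z - h • ex) - ux 0 (z - h • ex + (τ / 2) • eT))| ≤ 2 * (3 * K * ε) := by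
      rw [abs_le]; constructor <;> linarith
    nlinarith
  have t1 := abs_mul_le_mul v0 b0
  have t2 := abs_mul_le_mul s0 b1
  have e2 : K * h ^ 2 * (3 * K * ε / h) = 3 * (h * (K ^ 2 * ε)) := by field_simp
  rw [e2] at t2
  have hKε : 0 ≤ K ^ 2 * ε := by positivity
  have hKε' : 0 ≤ h * (K ^ 2 * ε) := by positivity
  simp only [sourceRem]
  have key : ∀ p q a b : ℝ, p * a - q * b = (p - q) * a + q * (a - b) := fun p q a b => by ring
  rw [key]
  rw [abs_le] at t1 t2 ⊢
  constructor <;> nlinarith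

end Flow

/-! ## Sampling on the periodic mesh -/

section sampling

variable {v w : ℝ × ℝ × ℝ} {M1 M2 : ℕ} {f : ℝ × ℝ × ℝ → ℝ}

/-- The mesh points of the time slice `t`. -/
noncomputable def pt (v w : ℝ × ℝ × ℝ) (M1 M2 : ℕ) (t : ℝ) (a : ZMod M1 × ZMod M2) : ℝ × ℝ × ℝ :=
  t • eT + (a.1.val : ℝ) • v + (a.2.val : ℝ) • w

theorem pt_time (hv : v.2.2 = 0) (hw : w.2.2 = 0) (t : ℝ) (a : ZMod M1 × ZMod M2) :
    (pt v w M1 M2 t a).2.2 = t := by simp [pt, hv, hw, eT]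

theorem pt_add_time (t τ : ℝ) (a : ZMod M1 × ZMod M2) :
    pt v w M1 M2 (t + τ) a = pt v w M1 M2 t a + τ • eT := by
  simp only [pt, add_smul]; abel

theorem pt_swap (t : ℝ) (a : ZMod M1 × ZMod M2) : pt w v M2 M1 t a.swap = pt v w M1 M2 t a := by
  simp only [pt, Prod.fst_swap, Prod.snd_swap]; abel

/-- When the representative wraps around in `ZMod M`, the sample point moves by a multiple of the
period. -/
theorem apply_add_val_succ {A : Type*} [AddCommGroup A] [Module ℝ A] {v : A} {M : ℕ} [NeZero M]
    {f : A → ℝ} (hf : Function.Periodic f ((M : ℝ) • v)) (a : ZMod M) (z : A) :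
    f (z + ((a + 1).val : ℝ) • v) = f (z + (a.val : ℝ) • v + v) := by
  have h1 : (a + 1).val = (a.val + 1) % M := by
    rw [ZMod.val_add, ZMod.val_one_eq_one_mod, Nat.add_mod_mod]
  have h2 := Nat.mod_add_div (a.val + 1) M
  rw [← h1] at h2
  have h3 : ((a + 1).val : ℝ) + M * ((a.val + 1) / M : ℕ) = a.val + 1 := by exact_mod_cast h2
  have h4 := hf.nsmul ((a.val + 1) / M) (z + ((a + 1).val : ℝ) • v)
  rw [← h4, add_assoc z, add_assoc z]
  congr 2
  rw [← Nat.cast_smul_eq_nsmul ℝ, smul_smul, ← add_smul, mul_comm, h3, add_smul, one_smul]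

theorem sample_add_fst [NeZero M1] (h1 : Function.Periodic f ((M1 : ℝ) • v)) (t : ℝ) (a : ZMod M1 × ZMod M2) :
    f (pt v w M1 M2 t (a + (1, 0))) = f (pt v w M1 M2 t a + v) := by
  simp only [pt, Prod.fst_add, Prod.snd_add, add_zero]
  rw [add_right_comm, apply_add_val_succ h1]
  congr 1; abel

theorem sample_add_snd [NeZero M2] (h2 : Function.Periodic f ((M2 : ℝ) • w)) (t : ℝ) (a : ZMod M1 × ZMod M2) :
    f (pt v w M1 M2 t (a + (0, 1))) = f (pt v w M1 M2 t a + w) := by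
  simp only [pt, Prod.fst_add, Prod.snd_add, add_zero]
  rw [apply_add_val_succ h2]

theorem sample_sub_fst [NeZero M1] (h1 : Function.Periodic f ((M1 : ℝ) • v)) (t : ℝ) (a : ZMod M1 × ZMod M2) :
    f (pt v w M1 M2 t (a - (1, 0))) = f (pt v w M1 M2 t a - v) := by
  have := sample_add_fst (periodic_shift h1 (-v)) (w := w) (M2 := M2) t (a - (1, 0))
  simpa only [sub_add_cancel, ← sub_eq_add_neg, add_sub_cancel_right] using this.symm

theorem sample_sub_snd [NeZero M2] (h2 : Function.Periodic f ((M2 : ℝ) • w)) (t : ℝ) (a : ZMod M1 × ZMod M2) :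
    f (pt v w M1 M2 t (a - (0, 1))) = f (pt v w M1 M2 t a - w) := by
  have := sample_add_snd (periodic_shift h2 (-w)) (v := v) (M1 := M1) t (a - (0, 1))
  simpa only [sub_add_cancel, ← sub_eq_add_neg, add_sub_cancel_right] using this.symm

theorem sum_zmod_val (M : ℕ) [NeZero M] (g : ℕ → ℝ) :
    ∑ a : ZMod M, g a.val = ∑ p ∈ Finset.range M, g p := by
  obtain ⟨n, rfl⟩ := Nat.exists_eq_succ_of_ne_zero (NeZero.ne M)
  exact Fin.sum_univ_eq_sum_range g (n + 1)

theorem sum_pt_eq_meshSum [NeZero M1] [NeZero M2] (f : ℝ × ℝ × ℝ → ℝ) (t : ℝ) :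
    ∑ a, f (pt v w M1 M2 t a) = meshSum v w M1 M2 f (t • eT) := by
  rw [Fintype.sum_prod_type, meshSum,
    ← sum_zmod_val M1 fun p => ∑ q ∈ Finset.range M2, f (t • eT + (p : ℝ) • v + (q : ℝ) • w)]
  refine Finset.sum_congr rfl fun a _ => ?_
  rw [← sum_zmod_val M2 fun q => f (t • eT + (a.val : ℝ) • v + (q : ℝ) • w)]
  rfl

theorem sum_pt_swap [NeZero M1] [NeZero M2] (f : ℝ × ℝ × ℝ → ℝ) (t : ℝ) :
    ∑ a, f (pt w v M2 M1 t a) = ∑ a, f (pt v w M1 M2 t a) := by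
  rw [← Equiv.sum_comp (Equiv.prodComm (ZMod M1) (ZMod M2))]
  exact Finset.sum_congr rfl fun a _ => by rw [Equiv.prodComm_apply, pt_swap]

/-- A map from a mesh to an ambient group along which `f` is sampled compatibly with translations
by `s` on the mesh and by `v` in the ambient group. -/
structure Sampled {G A : Type*} [AddCommGroup G] [AddCommGroup A] (π : G → A) (s : G) (v : A)
    (f : A → ℝ) : Prop where
  add : ∀ a, f (π (a + s)) = f (π a + v)
  sub : ∀ a, f (π (a - s)) = f (π a - v)

theorem sampled_fst [NeZero M1] (h1 : Function.Periodic f ((M1 : ℝ) • v)) (t : ℝ) :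
    Sampled (pt v w M1 M2 t) (1, 0) v f := ⟨sample_add_fst h1 t, sample_sub_fst h1 t⟩

theorem sampled_snd [NeZero M2] (h2 : Function.Periodic f ((M2 : ℝ) • w)) (t : ℝ) :
    Sampled (pt v w M1 M2 t) (0, 1) w f := ⟨sample_add_snd h2 t, sample_sub_snd h2 t⟩

namespace Sampled

variable {G A : Type*} [AddCommGroup G] [AddCommGroup A] {π : G → A} {s : G} {v : A} {f g : A → ℝ}

theorem sd_eq (hf : Sampled π s v f) (a : G) : sd s (fun b => f (π b)) a = sd v f (π a) := by
  simp only [sd, hf.add, hf.sub]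

theorem cA_eq (hf : Sampled π s v f) (a : G) : cA s (fun b => f (π b)) a = cA v f (π a) := by
  simp only [cA, hf.sd_eq]

theorem cB_eq (hf : Sampled π s v f) (a : G) : cB s (fun b => f (π b)) a = cB v f (π a) := by
  simp only [cB, hf.sd_eq]

theorem psi_eq (hf : Sampled π s v f) (hg : Sampled π s v g) (h : ℝ) (a : G) :
    psi h s (fun b => f (π b)) (fun b => g (π b)) a = psi h v f g (π a) := by
  simp only [psi, dhat, hf.add, hf.sub, hg.add, hg.sub]

end Sampled

/-- `cB` has weights 7/6, -1/12, -1/12 with absolute sum 4/3, so Cauchy–Schwarz bounds its ℓ² norm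
by 4/3. -/
theorem sum_cB_sq_le {G : Type*} [AddCommGroup G] [Fintype G] (s : G) (f : G → ℝ) :
    ∑ a, cB s f a ^ 2 ≤ 16 / 9 * ∑ a, f a ^ 2 := by
  have h1 := sum_shift s fun a => f a ^ 2
  have h2 := sum_shift_neg s fun a => f a ^ 2
  calc ∑ a, cB s f a ^ 2
      ≤ ∑ a, 4 / 3 * (7 / 6 * f a ^ 2 + 1 / 12 * f (a + s) ^ 2 + 1 / 12 * f (a - s) ^ 2) :=
        Finset.sum_le_sum fun a _ => by
          simp only [cB, sd]
          nlinarith [sq_nonneg (f a + f (a + s)), sq_nonneg (f a + f (a - s)),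
            sq_nonneg (f (a + s) - f (a - s))]
    _ = 16 / 9 * ∑ a, f a ^ 2 := by
        rw [← Finset.mul_sum, Finset.sum_add_distrib, Finset.sum_add_distrib, ← Finset.mul_sum,
          ← Finset.mul_sum, ← Finset.mul_sum, h1, h2]
        ring

end sampling

theorem fd_cB {A : Type*} [AddCommGroup A] (u v : A) (f : A → ℝ) : fd u (cB v f) = cB v (fd u f) :=
  funext fun z => by
    change cB v f (z + u) - cB v f z = cB v (fun z => f (z + u) - f z) z
    rw [cB_sub, cB_shift]

theorem fd_sd {A : Type*} [AddCommGroup A] (u v : A) (f : A → ℝ) : fd u (sd v f) = sd v (fd u f) :=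
  funext fun z => by
    simp only [fd, sd, add_right_comm z, add_sub_right_comm z]; ring

theorem fd_cA {A : Type*} [AddCommGroup A] (u v : A) (f : A → ℝ) : fd u (cA v f) = cA v (fd u f) :=
  funext fun z => by
    have := congrFun (fd_sd u v f) z
    simp only [fd, cA] at this ⊢
    rw [← this]; ring

section
variable {E : Type*} [NormedAddCommGroup E] [NormedSpace ℝ E] {f : E → ℝ}

theorem fd_hat (u v : E) (hf : Continuous f) : fd u (hat v f) = hat v (fd u f) :=
  funext fun z => by
    change hat v f (z + u) - hat v f z = hat v (fun z => f (z + u) - f z) z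
    rw [hat_sub v (by fun_prop) hf, hat_shift]

theorem fd_box (u v : E) (hf : Continuous f) : fd u (box v f) = box v (fd u f) :=
  funext fun z => by
    change box v f (z + u) - box v f z = box v (fun z => f (z + u) - f z) z
    rw [box_sub v (by fun_prop) hf, box_shift]

end

/-- Everything commutes, so the difference and the transverse hat can be moved onto `U`. Inside the
two bounded operators there remain precisely the functions of the space and time residual estimates.
-/
theorem fd_defect (v w : ℝ × ℝ × ℝ) (τ : ℝ) {U : ℝ × ℝ × ℝ → ℝ} (hU : Continuous U) :
    fd v (defect v w τ U) = cB v (cB w fun z =>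
      (cA v (box (τ • eT) (hat w (fd v U))) z - hat v (box (τ • eT) (hat w (fd v U))) z)
      - hat w (fd v (hat v fun z => trap τ U z - box (τ • eT) U z)) z) := by
  have cb := continuous_box (τ • eT) hU
  have ct := continuous_trap τ hU
  have cf := continuous_fd v hU
  have cca := continuous_cA v cb
  have ch := continuous_hat v cb
  have cd : Continuous fun z => trap τ U z - box (τ • eT) U z := by fun_prop
  have cfb := continuous_box (τ • eT) cf
  unfold defect
  rw [fd_cB, fd_cB]
  refine congrArg (fun f => cB v (cB w f)) ?_
  have e1 := fd_hat v w (show Continuous fun z =>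
    cA v (box (τ • eT) U) z - hat v (box (τ • eT) U) z by fun_prop)
  have e2 := fd_hat v w (continuous_hat v cd)
  have e3 : fd v (fun z => cA v (box (τ • eT) U) z - hat v (box (τ • eT) U) z)
      = fun z => cA v (box (τ • eT) (fd v U)) z - hat v (box (τ • eT) (fd v U)) z :=
    funext fun z => by
      have a1 := congrFun (fd_cA v v (box (τ • eT) U)) z
      have a2 := congrFun (fd_hat v v cb) z
      rw [fd_box v _ hU] at a1 a2
      rw [← a1, ← a2]
      simp only [fd]; ring
  have e4 : box (τ • eT) (hat w (fd v U)) = hat w (box (τ • eT) (fd v U)) :=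
    funext fun z => box_hat_comm _ _ cf z
  have k1 := continuous_cA v cfb
  have k2 := continuous_hat v cfb
  funext z
  have b1 := congrFun e1 z
  have b2 := congrFun e2 z
  rw [e3, hat_sub w k1 k2, hat_cA w v cfb, hat_comm w v cfb] at b1
  rw [e4, ← b1, ← b2]
  simp only [fd]; ring

/-! ### The defect in the discrete seminorm and the exact discrete equation. -/

namespace Flow

variable {lam L1 L2 T K : ℝ} {ex ey : ℝ × ℝ × ℝ} {ux uy : ℕ → ℝ × ℝ × ℝ → ℝ}
  {ut utt : ℝ × ℝ × ℝ → ℝ}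

theorem periodic_zero (D : Flow lam L1 L2 T K ex ey ux uy ut utt) {h : ℝ} {M1 M2 : ℕ}
    (hL1 : L1 = h * M1) (hL2 : L2 = h * M2) :
    Function.Periodic (ux 0) ((M1 : ℝ) • h • ex) ∧ Function.Periodic (ux 0) ((M2 : ℝ) • h • ey) := by
  rw [smul_smul, smul_smul, mul_comm, ← hL1, mul_comm, ← hL2]
  exact ⟨fun z => (D.per_x 0 (by norm_num) z).1, fun z => (D.per_x 0 (by norm_num) z).2⟩

/-- The defect of the comparison function is small in the discrete `H¹` seminorm. -/
theorem sum_defect_le (D : Flow lam L1 L2 T K ex ey ux uy ut utt) (hlam : 0 < lam) (hT0 : 0 < T)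
    {h τ : ℝ} (hh : 0 < h) (hτ : 0 < τ) {M1 M2 N : ℕ} [NeZero M1] [NeZero M2]
    (hL1 : L1 = h * M1) (hL2 : L2 = h * M2) (hT : N * τ = T) :
    ∑ r ∈ Finset.range N, τ * ∑ a,
        fd (h • ex) (defect (h • ex) (h • ey) τ (ux 0)) (pt (h • ex) (h • ey) M1 M2 (r * τ) a) ^ 2
      ≤ M1 * M2 * h ^ 2 * (8 * ((1 / lam + T / (2 * lam ^ 2)) * (K + 16 * K ^ 2) ^ 2
        + (2 * ((1 / lam + T / (2 * lam ^ 2)) * (K + 4 * K ^ 2) ^ 2) + 8 * T + 1))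
        * (τ ^ 2 + h ^ 4) ^ 2) := by
  have hM1 : 1 ≤ M1 := NeZero.one_le
  have hM2 : 1 ≤ M2 := NeZero.one_le
  have key1 := D.space_residual hlam hh hτ hM1 hM2 hL1 hL2 hT
  have key2 := D.time_residual hlam hT0 hh hτ hM1 hM2 hL1 hL2 hT
  obtain ⟨p1, p2⟩ := D.periodic_zero hL1 hL2
  rw [fd_defect _ _ _ D.cont_zero]
  set v := h • ex
  set w := h • ey
  set A : ℝ × ℝ × ℝ → ℝ := fun z => cA v (box (τ • eT) (hat w (fd v (ux 0)))) z
    - hat v (box (τ • eT) (hat w (fd v (ux 0)))) z with hA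
  set B := hat w (fd v (hat v fun z => trap τ (ux 0) z - box (τ • eT) (ux 0) z)) with hB
  have perA : ∀ P, Function.Periodic (ux 0) P → Function.Periodic A P := fun P hP => by
    have hf : Function.Periodic (fd v (ux 0)) P := fun z => by
      simp only [fd, add_right_comm z P, hP _]
    have := periodic_box (periodic_hat hf w) (τ • eT)
    exact Function.Periodic.sub (periodic_cA this v) (periodic_hat this v)
  have perB : ∀ P, Function.Periodic (ux 0) P → Function.Periodic B P := fun P hP => by
    have h1 := periodic_hat (Function.Periodic.sub (periodic_trap hP τ)
      (periodic_box hP (τ • eT))) v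
    have hf : Function.Periodic (fd v (hat v (trap τ (ux 0) - box (τ • eT) (ux 0)))) P :=
      fun z => by simp only [fd, add_right_comm z P, h1 _]
    exact periodic_hat hf w
  have per : ∀ P, Function.Periodic (ux 0) P → Function.Periodic (fun z => A z - B z) P :=
    fun P hP => (perA P hP).sub (perB P hP)
  -- Two factors 16/9 from `cB` and one factor 2 from separating A and B give less than 8.
  have hstep : ∀ t, ∑ a, cB v (cB w fun z => A z - B z) (pt v w M1 M2 t a) ^ 2
      ≤ 8 * (meshSum v w M1 M2 (fun z => A z ^ 2) (t • eT)
        + meshSum v w M1 M2 (fun z => B z ^ 2) (t • eT)) := fun t => by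
    have s1 : Sampled (pt v w M1 M2 t) (1, 0) v (cB w fun z => A z - B z) :=
      sampled_fst (periodic_cB (per _ p1) w) t
    have s2 : Sampled (pt v w M1 M2 t) (0, 1) w (fun z => A z - B z) := sampled_snd (per _ p2) t
    simp only [← s1.cB_eq]
    refine (sum_cB_sq_le _ _).trans ?_
    simp only [← s2.cB_eq]
    have h1 := sum_cB_sq_le ((0, 1) : ZMod M1 × ZMod M2)
      fun b => A (pt v w M1 M2 t b) - B (pt v w M1 M2 t b)
    have h2 : ∑ a, (A (pt v w M1 M2 t a) - B (pt v w M1 M2 t a)) ^ 2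
        ≤ 2 * (∑ a, A (pt v w M1 M2 t a) ^ 2 + ∑ a, B (pt v w M1 M2 t a) ^ 2) := by
      rw [← Finset.sum_add_distrib, Finset.mul_sum]
      exact Finset.sum_le_sum fun a _ => by
        nlinarith [sq_nonneg (A (pt v w M1 M2 t a) + B (pt v w M1 M2 t a))]
    have h3 := sum_pt_eq_meshSum (v := v) (w := w) (M1 := M1) (M2 := M2) (fun z => A z ^ 2) t
    have h4 := sum_pt_eq_meshSum (v := v) (w := w) (M1 := M1) (M2 := M2) (fun z => B z ^ 2) t
    rw [← h3, ← h4]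
    have h5 : 0 ≤ ∑ a, A (pt v w M1 M2 t a) ^ 2 := Finset.sum_nonneg fun _ _ => sq_nonneg _
    have h6 : 0 ≤ ∑ a, B (pt v w M1 M2 t a) ^ 2 := Finset.sum_nonneg fun _ _ => sq_nonneg _
    linarith
  have hsum : ∑ r ∈ Finset.range N, τ * ∑ a,
      cB v (cB w fun z => A z - B z) (pt v w M1 M2 (r * τ) a) ^ 2
      ≤ 8 * (∑ r ∈ Finset.range N, τ * meshSum v w M1 M2 (fun z => A z ^ 2) ((r : ℝ) • τ • eT)
        + ∑ r ∈ Finset.range N, τ * meshSum v w M1 M2 (fun z => B z ^ 2) ((r : ℝ) • τ • eT)) := by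
    rw [← Finset.sum_add_distrib, Finset.mul_sum]
    refine Finset.sum_le_sum fun r _ => ?_
    have := mul_le_mul_of_nonneg_left (hstep (r * τ)) hτ.le
    rw [mul_smul] at this
    linarith
  refine hsum.trans ?_
  refine (mul_le_mul_of_nonneg_left (add_le_add key1 key2) (by norm_num)).trans ?_
  have hε1 : (h ^ 4) ^ 2 ≤ (τ ^ 2 + h ^ 4) ^ 2 :=
    pow_le_pow_left₀ (by positivity) (by linarith [sq_nonneg τ]) 2
  have hε2 : τ ^ 4 ≤ (τ ^ 2 + h ^ 4) ^ 2 := by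
    have : (τ ^ 2) ^ 2 ≤ (τ ^ 2 + h ^ 4) ^ 2 :=
      pow_le_pow_left₀ (by positivity) (by linarith [pow_nonneg hh.le 4]) 2
    linarith
  have hc : 0 ≤ (1 / lam + T / (2 * lam ^ 2)) * (K + 16 * K ^ 2) ^ 2 := by positivity
  have hc' : 0 ≤ 2 * ((1 / lam + T / (2 * lam ^ 2)) * (K + 4 * K ^ 2) ^ 2) + 8 * T + 1 := by
    positivity
  have := mul_le_mul_of_nonneg_left (add_le_add (mul_le_mul_of_nonneg_left hε1 hc)
    (mul_le_mul_of_nonneg_left hε2 hc')) (show (0 : ℝ) ≤ 8 * (M1 * M2 * h ^ 2) by positivity)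
  linarith

/-- The comparison function solves a perturbed semi-discrete equation. -/
theorem comparison_time_difference (D : Flow lam L1 L2 T K ex ey ux uy ut utt) {h τ : ℝ}
    (hh : h ≠ 0) (hτ : 0 < τ) (z : ℝ × ℝ × ℝ) (hz : 0 ≤ z.2.2) (hz' : z.2.2 + τ ≤ T) :
    (smooth (h • ex) (smooth (h • ey) (ux 0)) (z + τ • eT)
      - smooth (h • ex) (smooth (h • ey) (ux 0)) z) / τ
      = (lam * (auxV (h • ex) (h • ey) τ (ux 0) z / h ^ 2)
        + -(exactFlux (h • ex) (h • ey) τ (ux 0) z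
          - exactFlux (h • ex) (h • ey) τ (ux 0) (z - h • ex)) / h)
      + (lam * (auxV (h • ey) (h • ex) τ (ux 0) z / h ^ 2)
        + -(exactFlux (h • ey) (h • ex) τ (ux 0) z
          - exactFlux (h • ey) (h • ex) τ (ux 0) (z - h • ey)) / h) := by
  have c0 := D.cont_zero
  have k1 := D.smooth_direction hh τ z
  have k2 := D.swap.smooth_direction hh τ z
  rw [D.zero_eq] at k2
  have hvt : (h • ex).2.2 = 0 := by simp [D.ex_time]
  have hwt : (h • ey).2.2 = 0 := by simp [D.ey_time]
  have cx2 := D.chain_x.cont 2 (by norm_num)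
  have cy2 := D.chain_y.cont 2 (by norm_num)
  have cx := D.chain_x.sq.cont 1 (by norm_num)
  have cy := D.chain_y.sq.cont 1 (by norm_num)
  set f : ℝ × ℝ × ℝ → ℝ := fun z => lam * ux 2 z - 1 / 2 * sqChain ux 1 z with hf
  set g : ℝ × ℝ × ℝ → ℝ := fun z => lam * uy 2 z - 1 / 2 * sqChain uy 1 z with hg
  have cf : Continuous f := by rw [hf]; fun_prop
  have cg : Continuous g := by rw [hg]; fun_prop
  -- The differential equation integrated over one time step, an identity without remainder.
  -- Smoothing it in space then yields the discrete equation.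
  have hstep : ∀ y : ℝ × ℝ × ℝ, y.2.2 = z.2.2 → ux 0 (y + τ • eT) - ux 0 y
      = τ * (box (τ • eT) f y + box (τ • eT) g y) := fun y hy => by
    have hd : ∀ s ∈ Set.Ioo (0 : ℝ) 1, HasDerivAt (fun s : ℝ => ux 0 (y + s • τ • eT))
        (τ * (f (y + s • τ • eT) + g (y + s • τ • eT))) s := fun s hs => by
      have hin : y.2.2 + s * τ ∈ Set.Ioo 0 T := by
        rw [hy]; exact ⟨by nlinarith [hs.1], by nlinarith [hs.2]⟩
      have h1 := (D.deriv_t y (s * τ) hin).comp s ((hasDerivAt_id s).mul_const τ)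
      simp only [Function.comp_def, id, one_mul] at h1
      simp only [smul_smul]
      refine h1.congr_deriv ?_
      rw [D.equation _ (by simpa [eT] using hin), hf, hg]
      simp only [sqChain, D.zero_eq]
      ring
    have := intervalIntegral.integral_eq_sub_of_hasDerivAt_of_le zero_le_one
      (Continuous.continuousOn (by fun_prop)) hd (Continuous.intervalIntegrable (by fun_prop) _ _)
    rw [intervalIntegral.integral_const_mul, intervalIntegral.integral_add
      (Continuous.intervalIntegrable (by fun_prop) _ _)
      (Continuous.intervalIntegrable (by fun_prop) _ _)] at this
    simp only [one_smul, zero_smul, add_zero] at this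
    exact this.symm
  have bf := continuous_box (τ • eT) cf
  have bg := continuous_box (τ • eT) cg
  have cs : Continuous fun z => ux 0 (z + τ • eT) := by fun_prop
  have sf := continuous_smooth (h • ey) bf
  have sg := continuous_smooth (h • ey) bg
  have e1 : smooth (h • ex) (smooth (h • ey) (ux 0)) (z + τ • eT)
      - smooth (h • ex) (smooth (h • ey) (ux 0)) z
      = smooth (h • ex) (smooth (h • ey) fun z => ux 0 (z + τ • eT) - ux 0 z) z := by
    have a1 : smooth (h • ey) (fun z => ux 0 (z + τ • eT) - ux 0 z)
        = fun z => smooth (h • ey) (ux 0) (z + τ • eT) - smooth (h • ey) (ux 0) z :=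
      funext fun y => by rw [smooth_sub _ cs c0, smooth_shift _ (τ • eT)]
    have b1 := continuous_smooth (h • ey) c0
    have b2 : Continuous fun z => smooth (h • ey) (ux 0) (z + τ • eT) := by fun_prop
    rw [a1, smooth_sub _ b2 b1, smooth_shift _ (τ • eT)]
  have e2 : smooth (h • ex) (smooth (h • ey) fun z => ux 0 (z + τ • eT) - ux 0 z) z
      = smooth (h • ex) (smooth (h • ey) fun z => τ * (box (τ • eT) f z + box (τ • eT) g z)) z :=
    smooth_congr_time hvt fun y hy => smooth_congr_time hwt fun x hx => hstep x (hx.trans hy)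
  have e3 : smooth (h • ey) (fun z => τ * (box (τ • eT) f z + box (τ • eT) g z))
      = fun z => τ * (smooth (h • ey) (box (τ • eT) f) z + smooth (h • ey) (box (τ • eT) g) z) :=
    funext fun y => by rw [smooth_const_mul, smooth_add _ bf bg]
  rw [e1, e2, e3, smooth_const_mul, smooth_add _ sf sg, k1,
    congrFun (smooth_comm (h • ex) (h • ey) bg) z, k2]
  field_simp

end Flow

theorem trap_smooth (v : ℝ × ℝ × ℝ) (τ : ℝ) {U : ℝ × ℝ × ℝ → ℝ} (hU : Continuous U) :
    smooth v (trap τ U) = trap τ (smooth v U) := funext fun z => by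
  have e : trap τ U = fun z => 1 / 2 * (U z + U (z + τ • eT)) := funext fun z => by
    rw [trap]; ring
  have cs : Continuous fun z => U (z + τ • eT) := by fun_prop
  rw [e, smooth_const_mul, smooth_add v hU cs, trap, smooth_shift v (τ • eT)]
  ring

/-! ### The error recursion for the coarse scheme. -/

namespace Flow

variable {lam L1 L2 T K : ℝ} {ex ey : ℝ × ℝ × ℝ} {ux uy : ℕ → ℝ × ℝ × ℝ → ℝ}
  {ut utt : ℝ × ℝ × ℝ → ℝ}

/-- The comparison function. -/
noncomputable def comparison (v w : ℝ × ℝ × ℝ) (U : ℝ × ℝ × ℝ → ℝ) : ℝ × ℝ × ℝ → ℝ :=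
  smooth v (smooth w U)

/-- The flux remainder of the comparison function. -/
noncomputable def compFlux (v w : ℝ × ℝ × ℝ) (τ : ℝ) (U : ℝ × ℝ × ℝ → ℝ) : ℝ × ℝ × ℝ → ℝ :=
  fluxRem v (trap τ (comparison v w U)) (auxV v w τ U) (fun z => U (z + (τ / 2) • eT))
    (exactFlux v w τ U)

/-- The source remainder of the comparison function. -/
noncomputable def compSource (h : ℝ) (v w : ℝ × ℝ × ℝ) (τ : ℝ) (U : ℝ × ℝ × ℝ → ℝ) :
    ℝ × ℝ × ℝ → ℝ :=
  sourceRem h v (trap τ (comparison v w U)) (auxV v w τ U) (fun z => U (z + (τ / 2) • eT))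

theorem comparison_swap (v w : ℝ × ℝ × ℝ) {U : ℝ × ℝ × ℝ → ℝ} (hU : Continuous U) :
    comparison w v U = comparison v w U := smooth_comm w v hU

theorem sum_sq_le_of_abs_le {G : Type*} [Fintype G] {f : G → ℝ} {c : ℝ} (h : ∀ a, |f a| ≤ c) :
    ∑ a, f a ^ 2 ≤ Fintype.card G * c ^ 2 := by
  calc ∑ a, f a ^ 2 ≤ ∑ _a : G, c ^ 2 := Finset.sum_le_sum fun a _ => by
        rw [← sq_abs]; exact pow_le_pow_left₀ (abs_nonneg _) (h a) 2
    _ = _ := by simp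

theorem card_mesh (M1 M2 : ℕ) [NeZero M1] [NeZero M2] :
    (Fintype.card (ZMod M1 × ZMod M2) : ℝ) = M1 * M2 := by
  rw [Fintype.card_prod, ZMod.card, ZMod.card, Nat.cast_mul]

/-- The constant in the residual bound of one direction. -/
noncomputable def residualConst (lam T K H : ℝ) : ℝ :=
  5 * lam / 2 * (8 * ((1 / lam + T / (2 * lam ^ 2)) * (K + 16 * K ^ 2) ^ 2
        + (2 * ((1 / lam + T / (2 * lam ^ 2)) * (K + 4 * K ^ 2) ^ 2) + 8 * T + 1)))
    + T * (2 / lam * (31 * K ^ 2) ^ 2 + ((3 + H) * K ^ 2) ^ 2)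

/-- All residuals of one direction. -/
theorem sum_residual_le (D : Flow lam L1 L2 T K ex ey ux uy ut utt) (hlam : 0 < lam) (hT0 : 0 < T)
    {h τ H : ℝ} (hh : 0 < h) (hH : h ≤ H) (hτ : 0 < τ) {M1 M2 N : ℕ} [NeZero M1] [NeZero M2]
    (hL1 : L1 = h * M1) (hL2 : L2 = h * M2) (hT : N * τ = T) :
    ∑ r ∈ Finset.range N, τ * (5 * lam / 2 * ((∑ a, fd (h • ex)
          (defect (h • ex) (h • ey) τ (ux 0)) (pt (h • ex) (h • ey) M1 M2 (r * τ) a) ^ 2) / h ^ 2)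
        + 2 / lam * ∑ a, compFlux (h • ex) (h • ey) τ (ux 0)
          (pt (h • ex) (h • ey) M1 M2 (r * τ) a) ^ 2
        + ∑ a, compSource h (h • ex) (h • ey) τ (ux 0)
          (pt (h • ex) (h • ey) M1 M2 (r * τ) a) ^ 2)
      ≤ M1 * M2 * (residualConst lam T K H * (τ ^ 2 + h ^ 4) ^ 2) := by
  have hvt : (h • ex).2.2 = 0 := by simp [D.ex_time]
  have hwt : (h • ey).2.2 = 0 := by simp [D.ey_time]
  have key := D.sum_defect_le hlam hT0 hh hτ hL1 hL2 hT
  set S : ℕ → ℝ := fun r => ∑ a, fd (h • ex)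
          (defect (h • ex) (h • ey) τ (ux 0)) (pt (h • ex) (h • ey) M1 M2 (r * τ) a) ^ 2 with hS
  set ε := τ ^ 2 + h ^ 4 with hε
  have hε0 : 0 ≤ ε := by positivity
  have hF : ∀ r ∈ Finset.range N, 2 / lam * ∑ a, compFlux (h • ex) (h • ey) τ (ux 0)
          (pt (h • ex) (h • ey) M1 M2 (r * τ) a) ^ 2
        + ∑ a, compSource h (h • ex) (h • ey) τ (ux 0)
          (pt (h • ex) (h • ey) M1 M2 (r * τ) a) ^ 2
      ≤ M1 * M2 * ((2 / lam * (31 * K ^ 2) ^ 2 + ((3 + H) * K ^ 2) ^ 2) * ε ^ 2) := fun r hr => by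
    have hr' : (r : ℝ) + 1 ≤ N := by exact_mod_cast Finset.mem_range.1 hr
    have hz : ∀ a, 0 ≤ (pt (h • ex) (h • ey) M1 M2 (r * τ) a).2.2 := fun a => by
      rw [pt_time hvt hwt]; positivity
    have hz' : ∀ a, (pt (h • ex) (h • ey) M1 M2 (r * τ) a).2.2 + τ ≤ T := fun a => by
      rw [pt_time hvt hwt]; nlinarith
    have h1 := sum_sq_le_of_abs_le fun a => D.abs_fluxRem_le hh.le hτ.le (hz a) (hz' a)
    have h2 := sum_sq_le_of_abs_le fun a => (D.abs_sourceRem_le hh hτ.le (hz a) (hz' a)).trans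
      (show (3 + h) * K ^ 2 * ε ≤ (3 + H) * K ^ 2 * ε by gcongr)
    rw [card_mesh] at h1 h2
    have h3 := mul_le_mul_of_nonneg_left h1 (show 0 ≤ 2 / lam by positivity)
    refine (add_le_add h3 h2).trans (le_of_eq ?_)
    ring
  calc _ ≤ ∑ r ∈ Finset.range N, (5 * lam / 2 / h ^ 2 * (τ * S r) + τ * (M1 * M2
        * ((2 / lam * (31 * K ^ 2) ^ 2 + ((3 + H) * K ^ 2) ^ 2) * ε ^ 2))) := by
        refine Finset.sum_le_sum fun r hr => ?_
        rw [add_assoc, mul_add]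
        refine add_le_add (le_of_eq (by ring)) (mul_le_mul_of_nonneg_left (hF r hr) hτ.le)
    _ = 5 * lam / 2 / h ^ 2 * ∑ r ∈ Finset.range N, τ * S r + N * τ * (M1 * M2
        * ((2 / lam * (31 * K ^ 2) ^ 2 + ((3 + H) * K ^ 2) ^ 2) * ε ^ 2)) := by
        rw [Finset.sum_add_distrib, ← Finset.mul_sum, Finset.sum_const, Finset.card_range,
          nsmul_eq_mul]
        ring
    -- The h^2 in the bound on the defect cancels the division by h^2 in the seminorm.
    _ ≤ _ := by
        refine (add_le_add (mul_le_mul_of_nonneg_left key (by positivity)) le_rfl).trans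
          (le_of_eq ?_)
        rw [hT, residualConst]
        field_simp

/-- The equation of the comparison function at the mesh points, with all remainders. -/
theorem comparison_step (D : Flow lam L1 L2 T K ex ey ux uy ut utt) {h τ : ℝ} (hh : h ≠ 0)
    (hτ : 0 < τ) (z : ℝ × ℝ × ℝ) (hz : 0 ≤ z.2.2) (hz' : z.2.2 + τ ≤ T) :
    (comparison (h • ex) (h • ey) (ux 0) (z + τ • eT) - comparison (h • ex) (h • ey) (ux 0) z) / τ
      = (lam * (auxV (h • ex) (h • ey) τ (ux 0) z / h ^ 2)
        - (psi h (h • ex) (trap τ (comparison (h • ex) (h • ey) (ux 0)))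
            (trap τ (comparison (h • ex) (h • ey) (ux 0))) z
          - h ^ 2 / 2 * psi h (h • ex) (fun z => auxV (h • ex) (h • ey) τ (ux 0) z / h ^ 2)
            (trap τ (comparison (h • ex) (h • ey) (ux 0))) z)
        + (compFlux (h • ex) (h • ey) τ (ux 0) z
          - compFlux (h • ex) (h • ey) τ (ux 0) (z - h • ex)) / h
        + compSource h (h • ex) (h • ey) τ (ux 0) z)
      + (lam * (auxV (h • ey) (h • ex) τ (ux 0) z / h ^ 2)
        - (psi h (h • ey) (trap τ (comparison (h • ex) (h • ey) (ux 0)))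
            (trap τ (comparison (h • ex) (h • ey) (ux 0))) z
          - h ^ 2 / 2 * psi h (h • ey) (fun z => auxV (h • ey) (h • ex) τ (ux 0) z / h ^ 2)
            (trap τ (comparison (h • ex) (h • ey) (ux 0))) z)
        + (compFlux (h • ey) (h • ex) τ (ux 0) z
          - compFlux (h • ey) (h • ex) τ (ux 0) (z - h • ey)) / h
        + compSource h (h • ey) (h • ex) τ (ux 0) z) := by
  rw [comparison, D.comparison_time_difference hh hτ z hz hz',
    psi_flux_identity hh (h • ex) (trap τ (comparison (h • ex) (h • ey) (ux 0)))
      (auxV (h • ex) (h • ey) τ (ux 0)) (fun z => ux 0 (z + (τ / 2) • eT)),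
    psi_flux_identity hh (h • ey) (trap τ (comparison (h • ey) (h • ex) (ux 0)))
      (auxV (h • ey) (h • ex) τ (ux 0)) (fun z => ux 0 (z + (τ / 2) • eT)),
    comparison_swap (h • ex) (h • ey) D.cont_zero]
  simp only [compFlux, compSource, comparison_swap (h • ex) (h • ey) D.cont_zero]
  simp only [comparison]
  ring

theorem cA_auxV_div (h : ℝ) (v w : ℝ × ℝ × ℝ) (τ : ℝ) {U : ℝ × ℝ × ℝ → ℝ} (hh : h ≠ 0)
    (hU : Continuous U) (z : ℝ × ℝ × ℝ) :
    h ^ 2 * cA v (fun z => auxV v w τ U z / h ^ 2) z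
      = sd v (fun z => trap τ (comparison v w U) z + defect v w τ U z) z := by
  have h1 := cA_auxV v w τ hU z
  rw [trap_smooth w τ hU] at h1
  rw [show comparison v w U = smooth v (smooth w U) from rfl,
    ← trap_smooth v τ (continuous_smooth w hU), ← h1]
  simp only [cA, sd]
  field_simp

/-- One step of the error recursion for the coarse scheme. -/
theorem coarse_step (D : Flow lam L1 L2 T K ex ey ux uy ut utt) (hlam : 0 < lam)
    {h τ H t : ℝ} (hh : 0 < h) (hH : h ≤ H) (hτ : 0 < τ) {M1 M2 : ℕ} [NeZero M1] [NeZero M2]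
    (hL1 : L1 = h * M1) (hL2 : L2 = h * M2) (ht : 0 ≤ t) (ht' : t + τ ≤ T)
    {x x' : ZMod M1 × ZMod M2 → ℝ} {v : Fin 2 → ZMod M1 × ZMod M2 → ℝ}
    (hx : ∀ a, (x' a - x a) / τ = ∑ j, (lam * v j a
      - (psi h ((![(1, 0), (0, 1)] : Fin 2 → ZMod M1 × ZMod M2) j)
          (fun b => (x' b + x b) / 2) (fun b => (x' b + x b) / 2) a
        - h ^ 2 / 2 * psi h ((![(1, 0), (0, 1)] : Fin 2 → ZMod M1 × ZMod M2) j) (v j)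
          (fun b => (x' b + x b) / 2) a)))
    (hv : ∀ j a, h ^ 2 * cA ((![(1, 0), (0, 1)] : Fin 2 → ZMod M1 × ZMod M2) j) (v j) a
      = sd ((![(1, 0), (0, 1)] : Fin 2 → ZMod M1 × ZMod M2) j) (fun b => (x' b + x b) / 2) a) :
    ∑ a, (comparison (h • ex) (h • ey) (ux 0) (pt (h • ex) (h • ey) M1 M2 (t + τ) a) - x' a) ^ 2
        - ∑ a, (comparison (h • ex) (h • ey) (ux 0) (pt (h • ex) (h • ey) M1 M2 t a) - x a) ^ 2
      ≤ τ * (2 * (2 * K / 2 + (2 * K) ^ 2 / (2 * lam) * (1 + H ^ 2) + 1 / 2)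
        * (∑ a, (comparison (h • ex) (h • ey) (ux 0) (pt (h • ex) (h • ey) M1 M2 (t + τ) a)
            - x' a) ^ 2
          + ∑ a, (comparison (h • ex) (h • ey) (ux 0) (pt (h • ex) (h • ey) M1 M2 t a)
            - x a) ^ 2)
        + ((5 * lam / 2 * ((∑ a, fd (h • ex) (defect (h • ex) (h • ey) τ (ux 0))
              (pt (h • ex) (h • ey) M1 M2 t a) ^ 2) / h ^ 2)
            + 2 / lam * ∑ a, compFlux (h • ex) (h • ey) τ (ux 0)
              (pt (h • ex) (h • ey) M1 M2 t a) ^ 2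
            + ∑ a, compSource h (h • ex) (h • ey) τ (ux 0)
              (pt (h • ex) (h • ey) M1 M2 t a) ^ 2)
          + (5 * lam / 2 * ((∑ a, fd (h • ey) (defect (h • ey) (h • ex) τ (ux 0))
              (pt (h • ey) (h • ex) M2 M1 t a) ^ 2) / h ^ 2)
            + 2 / lam * ∑ a, compFlux (h • ey) (h • ex) τ (ux 0)
              (pt (h • ey) (h • ex) M2 M1 t a) ^ 2
            + ∑ a, compSource h (h • ey) (h • ex) τ (ux 0)
              (pt (h • ey) (h • ex) M2 M1 t a) ^ 2))) := by
  have c0 := D.cont_zero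
  have hvt : (h • ex).2.2 = 0 := by simp [D.ex_time]
  have hwt : (h • ey).2.2 = 0 := by simp [D.ey_time]
  obtain ⟨p1, p2⟩ := D.periodic_zero hL1 hL2
  have hcs := D.comparison_step hh.ne' hτ
  have hbd := fun z => D.abs_comparison_le (h := h) z
  have hlx := fun z => D.abs_comparison_fd_le hh.le z
  have hly := fun z => D.swap.abs_comparison_fd_le hh.le z
  rw [D.zero_eq, smooth_comm (h • ey) (h • ex) c0] at hly
  change ∀ z, |comparison (h • ex) (h • ey) (ux 0) z| ≤ 2 * K at hbd
  change ∀ z, |comparison (h • ex) (h • ey) (ux 0) (z + h • ex)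
    - comparison (h • ex) (h • ey) (ux 0) z| ≤ 2 * K * h at hlx
  change ∀ z, |comparison (h • ex) (h • ey) (ux 0) (z + h • ey)
    - comparison (h • ex) (h • ey) (ux 0) z| ≤ 2 * K * h at hly
  have hax := cA_auxV_div h (h • ex) (h • ey) τ hh.ne' c0
  have hay := cA_auxV_div h (h • ey) (h • ex) τ hh.ne' c0
  rw [comparison_swap (h • ex) (h • ey) c0] at hay
  -- The residuals of the second direction are stated on the mesh with exchanged factors, as the
  -- symmetric problem provides them; here they are brought back to a single mesh.
  simp only [sum_pt_swap (v := h • ex) (w := h • ey) (M1 := M1) (M2 := M2)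
    (fun z => fd (h • ey) (defect (h • ey) (h • ex) τ (ux 0)) z ^ 2),
    sum_pt_swap (v := h • ex) (w := h • ey) (M1 := M1) (M2 := M2)
    (fun z => compFlux (h • ey) (h • ex) τ (ux 0) z ^ 2),
    sum_pt_swap (v := h • ex) (w := h • ey) (M1 := M1) (M2 := M2)
    (fun z => compSource h (h • ey) (h • ex) τ (ux 0) z ^ 2)]
  have perU : ∀ P, Function.Periodic (ux 0) P →
      Function.Periodic (comparison (h • ex) (h • ey) (ux 0)) P := fun P hP =>
    periodic_smooth (periodic_smooth hP _) _
  have perV : ∀ v w P, Function.Periodic (ux 0) P →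
      Function.Periodic (fun z => auxV v w τ (ux 0) z / h ^ 2) P := fun v w P hP z => by
    simp only [periodic_auxV hP v w τ z]
  have perD : ∀ v w P, Function.Periodic (ux 0) P →
      Function.Periodic (defect v w τ (ux 0)) P := fun v w P hP => periodic_defect hP v w τ
  have perF : ∀ v w P, Function.Periodic (ux 0) P →
      Function.Periodic (compFlux v w τ (ux 0)) P := fun v w P hP =>
    periodic_fluxRem (periodic_trap (periodic_smooth (periodic_smooth hP _) _) τ)
      (periodic_auxV hP v w τ) (periodic_shift hP _) (periodic_exactFlux hP v w τ) v
  set v1 := h • ex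
  set w1 := h • ey
  set Ut := comparison v1 w1 (ux 0)
  set π := pt v1 w1 M1 M2 t with hπ
  have hπ' : ∀ a, pt v1 w1 M1 M2 (t + τ) a = π a + τ • eT := fun a => pt_add_time t τ a
  have hz : ∀ a, 0 ≤ (π a).2.2 := fun a => by rw [hπ, pt_time hvt hwt]; exact ht
  have hz' : ∀ a, (π a).2.2 + τ ≤ T := fun a => by rw [hπ, pt_time hvt hwt]; exact ht'
  simp only [hπ']
  have hm' : ∀ b, (Ut (π b + τ • eT) + Ut (π b)) / 2 = trap τ Ut (π b) := fun b => by
    rw [trap, add_comm]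
  have hm : (fun b => (Ut (π b + τ • eT) + Ut (π b)) / 2) = fun b => trap τ Ut (π b) :=
    funext hm'
  have sU1 : Sampled π (1, 0) v1 (trap τ Ut) := sampled_fst (periodic_trap (perU _ p1) τ) t
  have sU2 : Sampled π (0, 1) w1 (trap τ Ut) := sampled_snd (periodic_trap (perU _ p2) τ) t
  have sV1 : Sampled π (1, 0) v1 (fun z => auxV v1 w1 τ (ux 0) z / h ^ 2) :=
    sampled_fst (perV v1 w1 _ p1) t
  have sV2 : Sampled π (0, 1) w1 (fun z => auxV w1 v1 τ (ux 0) z / h ^ 2) :=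
    sampled_snd (perV w1 v1 _ p2) t
  have sD1 : Sampled π (1, 0) v1 (defect v1 w1 τ (ux 0)) := sampled_fst (perD _ _ _ p1) t
  have sD2 : Sampled π (0, 1) w1 (defect w1 v1 τ (ux 0)) := sampled_snd (perD _ _ _ p2) t
  have sF1 : Sampled π (1, 0) v1 (compFlux v1 w1 τ (ux 0)) := sampled_fst (perF _ _ _ p1) t
  have sF2 : Sampled π (0, 1) w1 (compFlux w1 v1 τ (ux 0)) := sampled_snd (perF _ _ _ p2) t
  have sS1 : Sampled π (1, 0) v1 (fun z => trap τ Ut z + defect v1 w1 τ (ux 0) z) :=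
    sampled_fst ((periodic_trap (perU _ p1) τ).add (perD _ _ _ p1)) t
  have sS2 : Sampled π (0, 1) w1 (fun z => trap τ Ut z + defect w1 v1 τ (ux 0) z) :=
    sampled_snd ((periodic_trap (perU _ p2) τ).add (perD _ _ _ p2)) t
  -- The comparison function and its difference quotients are bounded by 2K, since (4/3)^2 ≤ 2; so
  -- 2K replaces K in the constants.
  have key := scheme_error_step (K := 2 * K) hh hH hlam hτ
    (![(1, 0), (0, 1)] : Fin 2 → ZMod M1 × ZMod M2)
    (X := fun a => Ut (π a)) (X' := fun a => Ut (π a + τ • eT)) (x := x) (x' := x')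
    (V := ![fun a => auxV v1 w1 τ (ux 0) (π a) / h ^ 2, fun a => auxV w1 v1 τ (ux 0) (π a) / h ^ 2])
    (v := v) (σ := ![fun a => defect v1 w1 τ (ux 0) (π a), fun a => defect w1 v1 τ (ux 0) (π a)])
    (F := ![fun a => compFlux v1 w1 τ (ux 0) (π a), fun a => compFlux w1 v1 τ (ux 0) (π a)])
    (ρ := ![fun a => compSource h v1 w1 τ (ux 0) (π a), fun a => compSource h w1 v1 τ (ux 0) (π a)])
    (fun a => by
      rw [hcs _ (hz a) (hz' a), Fin.sum_univ_two, hm]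
      simp only [Matrix.cons_val_zero, Matrix.cons_val_one]
      rw [sU1.psi_eq sU1, sV1.psi_eq sU1, sU2.psi_eq sU2, sV2.psi_eq sU2, sF1.sub, sF2.sub])
    hx
    (Fin.forall_fin_two.2 ⟨fun a => by
      simp only [hm', Matrix.cons_val_zero]
      rw [sV1.cA_eq, sS1.sd_eq, hax], fun a => by
      simp only [hm', Matrix.cons_val_one, Matrix.cons_val_zero]
      rw [sV2.cA_eq, sS2.sd_eq, hay]⟩)
    hv
    (fun a => by
      have h1 := hbd (π a)
      have h2 := hbd (π a + τ • eT)
      rw [abs_le] at *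
      constructor <;> linarith)
    (Fin.forall_fin_two.2 ⟨fun a => by
      have h1 := hlx (π a)
      have h2 := hlx (π a + τ • eT)
      have e := sU1.add a
      rw [add_right_comm] at h2
      simp only [Matrix.cons_val_zero]
      rw [trap, trap] at e
      rw [add_comm (Ut (π (a + (1, 0)) + τ • eT)), e]
      rw [abs_le] at *
      constructor <;> linarith, fun a => by
      have h1 := hly (π a)
      have h2 := hly (π a + τ • eT)
      have e := sU2.add a
      rw [add_right_comm] at h2
      simp only [Matrix.cons_val_one, Matrix.cons_val_zero]
      rw [trap, trap] at e
      rw [add_comm (Ut (π (a + (0, 1)) + τ • eT)), e]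
      rw [abs_le] at *
      constructor <;> linarith⟩)
  simp only [Fin.sum_univ_two, Matrix.cons_val_zero, Matrix.cons_val_one, Fintype.card_fin,
    sD1.add, sD2.add] at key
  exact key

end Flow

/-- One step of the compact scheme on a finite group with coordinate directions `s`. -/
structure SchemeStep {G : Type*} [AddCommGroup G] {ι : Type*} [Fintype ι] (lam h τ : ℝ) (s : ι → G)
    (x x' : G → ℝ) (v : ι → G → ℝ) : Prop where
  equation : ∀ a, (x' a - x a) / τ = ∑ j, (lam * v j a
      - (psi h (s j) (fun b => (x' b + x b) / 2) (fun b => (x' b + x b) / 2) a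
        - h ^ 2 / 2 * psi h (s j) (v j) (fun b => (x' b + x b) / 2) a))
  compact : ∀ j a, h ^ 2 * cA (s j) (v j) a = sd (s j) (fun b => (x' b + x b) / 2) a

/-! ### The error bound on the coarse grid. -/

namespace Flow

variable {lam L1 L2 T K : ℝ} {ex ey : ℝ × ℝ × ℝ} {ux uy : ℕ → ℝ × ℝ × ℝ → ℝ}
  {ut utt : ℝ × ℝ × ℝ → ℝ}

/-- The error estimate on the coarse grid for small time steps. -/
theorem coarse_error_of_small_step (D : Flow lam L1 L2 T K ex ey ux uy ut utt) (hlam : 0 < lam)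
    (hT0 : 0 < T) {h τ H : ℝ} (hh : 0 < h) (hH : h ≤ H) (hτ : 0 < τ) {M1 M2 N : ℕ} [NeZero M1]
    [NeZero M2] (hL1 : L1 = h * M1) (hL2 : L2 = h * M2) (hT : N * τ = T)
    {C0 : ℝ} (hC0 : C0 = 2 * (2 * K / 2 + (2 * K) ^ 2 / (2 * lam) * (1 + H ^ 2) + 1 / 2))
    (hsmall : C0 * τ ≤ 1 / 2) {x : ℕ → ZMod M1 × ZMod M2 → ℝ}
    {v : ℕ → Fin 2 → ZMod M1 × ZMod M2 → ℝ}
    (hx : ∀ r < N, SchemeStep lam h τ (![(1, 0), (0, 1)] : Fin 2 → ZMod M1 × ZMod M2)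
      (x r) (x (r + 1)) (v r))
    (hx0 : ∀ a, x 0 a = ux 0 (pt (h • ex) (h • ey) M1 M2 0 a)) {r : ℕ} (hr : r ≤ N) :
    ∑ a, (ux 0 (pt (h • ex) (h • ey) M1 M2 (r * τ) a) - x r a) ^ 2
      ≤ M1 * M2 * ((2 * Real.exp (4 * C0 * T) * ((7 / 3 * K) ^ 2 + 4 * residualConst lam T K H)
        + 2 * (7 / 3 * K) ^ 2) * (τ ^ 2 + h ^ 4) ^ 2) := by
  have hK := D.K_nonneg
  have hC0' : 0 ≤ C0 := by rw [hC0]; positivity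
  have r1 := D.sum_residual_le hlam hT0 hh hH hτ hL1 hL2 hT
  have r2 := D.swap.sum_residual_le hlam hT0 hh hH hτ hL2 hL1 hT
  rw [D.zero_eq] at r2
  set b1 : ℕ → ℝ := fun r => 5 * lam / 2 * ((∑ a, fd (h • ex) (defect (h • ex) (h • ey) τ (ux 0))
              (pt (h • ex) (h • ey) M1 M2 (r * τ) a) ^ 2) / h ^ 2)
            + 2 / lam * ∑ a, compFlux (h • ex) (h • ey) τ (ux 0)
              (pt (h • ex) (h • ey) M1 M2 (r * τ) a) ^ 2
            + ∑ a, compSource h (h • ex) (h • ey) τ (ux 0)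
              (pt (h • ex) (h • ey) M1 M2 (r * τ) a) ^ 2 with hb1
  set b2 : ℕ → ℝ := fun r => 5 * lam / 2 * ((∑ a, fd (h • ey) (defect (h • ey) (h • ex) τ (ux 0))
              (pt (h • ey) (h • ex) M2 M1 (r * τ) a) ^ 2) / h ^ 2)
            + 2 / lam * ∑ a, compFlux (h • ey) (h • ex) τ (ux 0)
              (pt (h • ey) (h • ex) M2 M1 (r * τ) a) ^ 2
            + ∑ a, compSource h (h • ey) (h • ex) τ (ux 0)
              (pt (h • ey) (h • ex) M2 M1 (r * τ) a) ^ 2 with hb2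
  have hb : ∀ r, 0 ≤ b1 r + b2 r := fun r => by simp only [hb1, hb2]; positivity
  have hstep : ∀ r < N, _ := fun r hr => D.coarse_step (t := r * τ) hlam hh hH hτ hL1 hL2
    (by positivity) (by
      have : (r : ℝ) + 1 ≤ N := by exact_mod_cast hr
      nlinarith) (hx r hr).equation (hx r hr).compact
  rw [← hC0] at hstep
  set π := pt (h • ex) (h • ey) M1 M2 with hπ
  set Ut := comparison (h • ex) (h • ey) (ux 0) with hUt
  -- Needed twice: at t = 0, where the scheme starts from `u` and not from the comparison function,
  -- and at the final level, to return to `u`.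
  have hcmp : ∀ t, ∑ a, (Ut (π t a) - ux 0 (π t a)) ^ 2
      ≤ M1 * M2 * ((7 / 3 * K) ^ 2 * (τ ^ 2 + h ^ 4) ^ 2) := fun t => by
    have := sum_sq_le_of_abs_le fun a => D.abs_smooth_smooth_sub_le hh.le (π t a)
    rw [card_mesh] at this
    refine this.trans (mul_le_mul_of_nonneg_left ?_ (by positivity))
    rw [mul_pow]
    gcongr
    linarith [sq_nonneg τ]
  have gron := discrete_gronwall (x := fun r => ∑ a, (Ut (π (r * τ) a) - x r a) ^ 2)
    (b := fun r => b1 r + b2 r) hC0' hτ hsmall hT.le (fun r => by positivity) hb (fun r hr => by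
      have := hstep r hr
      rw [show ((r + 1 : ℕ) : ℝ) * τ = r * τ + τ by push_cast; ring]
      exact this) r hr
  simp only [mul_add, Finset.sum_add_distrib, Nat.cast_zero, zero_mul, hx0] at gron
  have hsplit : ∑ a, (ux 0 (π (r * τ) a) - x r a) ^ 2
      ≤ 2 * ∑ a, (Ut (π (r * τ) a) - ux 0 (π (r * τ) a)) ^ 2
        + 2 * ∑ a, (Ut (π (r * τ) a) - x r a) ^ 2 := by
    rw [Finset.mul_sum, Finset.mul_sum, ← Finset.sum_add_distrib]
    exact Finset.sum_le_sum fun a _ => by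
      nlinarith [sq_nonneg (2 * Ut (π (r * τ) a) - ux 0 (π (r * τ) a) - x r a)]
  have hexp := Real.exp_pos (4 * C0 * T)
  have h1 := hcmp (r * τ)
  have h2 := mul_le_mul_of_nonneg_left (add_le_add (hcmp 0) (add_le_add
    (mul_le_mul_of_nonneg_left r1 zero_le_two) (mul_le_mul_of_nonneg_left r2 zero_le_two))) hexp.le
  simp only [← mul_add] at gron
  simp only [← mul_add] at h2
  have h3 := gron.trans h2
  refine hsplit.trans ?_
  refine (add_le_add (mul_le_mul_of_nonneg_left h1 zero_le_two)
    (mul_le_mul_of_nonneg_left h3 zero_le_two)).trans (le_of_eq ?_)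
  ring

/-- The discrete energy of the coarse scheme does not increase. -/
theorem scheme_energy_le (hlam : 0 < lam) {G : Type*} [AddCommGroup G] [Fintype G] {ι : Type*}
    [Fintype ι] {h τ : ℝ} (hh : 0 < h) (hτ : 0 < τ) {s : ι → G} {N : ℕ} {x : ℕ → G → ℝ}
    {v : ℕ → ι → G → ℝ} (hx : ∀ r < N, SchemeStep lam h τ s (x r) (x (r + 1)) (v r)) :
    ∀ r ≤ N, ∑ a, x r a ^ 2 ≤ ∑ a, x 0 a ^ 2 := fun r => by
  induction r with
  | zero => exact fun _ => le_rfl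
  | succ r ih => exact fun hr => (scheme_energy_step hh hlam hτ s (hx r hr).equation
      (hx r hr).compact).trans (ih (Nat.le_of_succ_le hr))

theorem sum_sub_sq_le {G : Type*} [Fintype G] (f g : G → ℝ) :
    ∑ a, (f a - g a) ^ 2 ≤ 2 * ∑ a, f a ^ 2 + 2 * ∑ a, g a ^ 2 := by
  rw [Finset.mul_sum, Finset.mul_sum, ← Finset.sum_add_distrib]
  exact Finset.sum_le_sum fun a _ => by nlinarith [sq_nonneg (f a + g a)]

/-- The error estimate on the coarse grid for large time steps. -/
theorem coarse_error_of_large_step (D : Flow lam L1 L2 T K ex ey ux uy ut utt) (hlam : 0 < lam)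
    {h τ : ℝ} (hh : 0 < h) (hτ : 0 < τ) {M1 M2 N : ℕ} [NeZero M1] [NeZero M2] {C0 : ℝ}
    (hlarge : 1 / 2 < C0 * τ) {x : ℕ → ZMod M1 × ZMod M2 → ℝ}
    {v : ℕ → Fin 2 → ZMod M1 × ZMod M2 → ℝ}
    (hx : ∀ r < N, SchemeStep lam h τ (![(1, 0), (0, 1)] : Fin 2 → ZMod M1 × ZMod M2)
      (x r) (x (r + 1)) (v r))
    (hx0 : ∀ a, x 0 a = ux 0 (pt (h • ex) (h • ey) M1 M2 0 a)) {r : ℕ} (hr : r ≤ N) :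
    ∑ a, (ux 0 (pt (h • ex) (h • ey) M1 M2 (r * τ) a) - x r a) ^ 2
      ≤ M1 * M2 * (8 * K * C0 ^ 2 * (τ ^ 2 + h ^ 4)) ^ 2 := by
  have hK := D.K_nonneg
  have hen := scheme_energy_le hlam hh hτ hx r hr
  have h1 := sum_sq_le_of_abs_le fun a =>
    D.chain_x.bdd 0 (by norm_num) (pt (h • ex) (h • ey) M1 M2 0 a)
  have h2 := sum_sq_le_of_abs_le fun a =>
    D.chain_x.bdd 0 (by norm_num) (pt (h • ex) (h • ey) M1 M2 (r * τ) a)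
  rw [card_mesh] at h1 h2
  simp only [hx0] at hen
  have h3 := sum_sub_sq_le (fun a => ux 0 (pt (h • ex) (h • ey) M1 M2 (r * τ) a)) (x r)
  have h4 : (2 * K) ^ 2 ≤ (8 * K * C0 ^ 2 * (τ ^ 2 + h ^ 4)) ^ 2 := by
    refine pow_le_pow_left₀ (by positivity) ?_ 2
    -- Violation of the smallness condition means that τ is bounded below, so constants may be
    -- written as multiples of τ^2.
    have h5 : 1 ≤ 4 * C0 ^ 2 * τ ^ 2 := by nlinarith
    have h7 : τ ^ 2 ≤ τ ^ 2 + h ^ 4 := by linarith [pow_nonneg hh.le 4]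
    calc 2 * K ≤ 2 * K * (4 * C0 ^ 2 * τ ^ 2) := le_mul_of_one_le_right (by positivity) h5
      _ = 8 * K * C0 ^ 2 * τ ^ 2 := by ring
      _ ≤ _ := mul_le_mul_of_nonneg_left h7 (by positivity)
  have h8 := mul_le_mul_of_nonneg_left h4 (show (0 : ℝ) ≤ M1 * M2 by positivity)
  linarith

/-- The error estimate on the coarse grid. -/
theorem coarse_error (D : Flow lam L1 L2 T K ex ey ux uy ut utt) (hlam : 0 < lam) (hT0 : 0 < T) :
    ∃ C : ℝ, 0 ≤ C ∧ ∀ (h τ : ℝ) (M1 M2 N : ℕ) [NeZero M1] [NeZero M2], 0 < h → 0 < τ →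
      L1 = h * M1 → L2 = h * M2 → N * τ = T →
      ∀ (x : ℕ → ZMod M1 × ZMod M2 → ℝ) (v : ℕ → Fin 2 → ZMod M1 × ZMod M2 → ℝ),
        (∀ r < N, SchemeStep lam h τ (![(1, 0), (0, 1)] : Fin 2 → ZMod M1 × ZMod M2)
          (x r) (x (r + 1)) (v r)) →
        (∀ a, x 0 a = ux 0 (pt (h • ex) (h • ey) M1 M2 0 a)) → ∀ r ≤ N,
          ∑ a, (ux 0 (pt (h • ex) (h • ey) M1 M2 (r * τ) a) - x r a) ^ 2
            ≤ M1 * M2 * (C * (τ ^ 2 + h ^ 4)) ^ 2 := by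
  have hK := D.K_nonneg
  set C0 := 2 * (2 * K / 2 + (2 * K) ^ 2 / (2 * lam) * (1 + L1 ^ 2) + 1 / 2) with hC0
  have hC0' : 0 < C0 := by rw [hC0]; positivity
  set C1 := 2 * Real.exp (4 * C0 * T) * ((7 / 3 * K) ^ 2 + 4 * residualConst lam T K L1)
    + 2 * (7 / 3 * K) ^ 2 with hC1
  -- The constant serves both cases: C1 ≤ (|C1| + 1)^2 ≤ C^2 for small steps, and the last summand
  -- for large ones.
  set C := |C1| + 1 + 8 * K * C0 ^ 2 with hC
  have hCp : 0 ≤ C := by rw [hC]; positivity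
  refine ⟨C, hCp, fun h τ M1 M2 N _ _ hh hτ hL1 hL2 hT x v hx hx0 r hr => ?_⟩
  have hM1 : (1 : ℝ) ≤ M1 := by exact_mod_cast NeZero.one_le
  -- Since there is at least one mesh interval per period, the period bounds h and the constants do
  -- not depend on the mesh.
  have hH : h ≤ L1 := by rw [hL1]; nlinarith
  by_cases hsmall : C0 * τ ≤ 1 / 2
  · refine (D.coarse_error_of_small_step hlam hT0 hh hH hτ hL1 hL2 hT hC0 hsmall hx hx0 hr).trans ?_
    refine mul_le_mul_of_nonneg_left ?_ (by positivity)
    rw [mul_pow C]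
    refine mul_le_mul_of_nonneg_right ?_ (sq_nonneg (τ ^ 2 + h ^ 4))
    have h1 : C1 ≤ |C1| := le_abs_self _
    have h2 : |C1| + 1 ≤ C := by rw [hC]; linarith [show (0 : ℝ) ≤ 8 * K * C0 ^ 2 by positivity]
    have h3 : 0 ≤ |C1| := abs_nonneg _
    nlinarith
  · refine (D.coarse_error_of_large_step hlam hh hτ (not_le.1 hsmall) hx hx0 hr).trans ?_
    have h6 : 8 * K * C0 ^ 2 ≤ C := by rw [hC]; linarith [abs_nonneg C1]
    gcongr

end Flow

/-! ## The coarse scheme on the finite group -/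

theorem sq_mul_dxx {h : ℝ} (hh : h ≠ 0) (f : ℤ → ℤ → ℝ) (a b : ℤ) :
    h ^ 2 * dxx h f a b = f (a + 1) b - 2 * f a b + f (a - 1) b := by
  unfold dxx; field_simp; ring

theorem sq_mul_dyy {h : ℝ} (hh : h ≠ 0) (f : ℤ → ℤ → ℝ) (a b : ℤ) :
    h ^ 2 * dyy h f a b = f a (b + 1) - 2 * f a b + f a (b - 1) := by
  unfold dyy; field_simp; ring

section periodicMesh

variable {M1 M2 : ℕ} {f : ℤ → ℤ → ℝ}

theorem IsPeriodicMesh.add_mul (hf : IsPeriodicMesh M1 M2 f) (a b i j : ℤ) :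
    f (a + i * M1) (b + j * M2) = f a b := by
  have h1 : ∀ b, Function.Periodic (fun a => f a b) (M1 : ℤ) := fun b a => hf.1 a b
  have h2 : Function.Periodic (fun b => f a b) (M2 : ℤ) := fun b => hf.2 a b
  have e1 := (h1 (b + j * M2)).int_mul i a
  have e2 := h2.int_mul j b
  exact e1.trans e2

theorem exists_mul_mem_Icc {M : ℕ} (hM : 1 ≤ M) (a : ℤ) : ∃ i : ℤ, 1 ≤ a + i * M ∧ a + i * M ≤ M := by
  refine ⟨-((a - 1) / M), ?_⟩
  have hM' : (0 : ℤ) < M := by exact_mod_cast hM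
  have h1 := Int.emod_nonneg (a - 1) hM'.ne'
  have h2 := Int.emod_lt_of_pos (a - 1) hM'
  have h3 := Int.emod_add_mul_ediv (a - 1) M
  constructor <;> linarith

/-- The mesh function on the finite group of mesh points. -/
noncomputable def toGroup (M1 M2 : ℕ) (f : ℤ → ℤ → ℝ) (a : ZMod M1 × ZMod M2) : ℝ :=
  f (a.1.val : ℤ) (a.2.val : ℤ)

theorem val_add_one_eq {M : ℕ} [NeZero M] (a : ZMod M) :
    ∃ i : ℤ, (a.val : ℤ) + 1 = ((a + 1).val : ℤ) + i * M := by
  have h1 : (a + 1).val = (a.val + 1) % M := by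
    rw [ZMod.val_add, ZMod.val_one_eq_one_mod, Nat.add_mod_mod]
  have h2 := Nat.mod_add_div (a.val + 1) M
  rw [← h1] at h2
  refine ⟨((a.val + 1) / M : ℕ), ?_⟩
  rw [mul_comm]
  exact_mod_cast h2.symm

theorem val_sub_one_eq {M : ℕ} [NeZero M] (a : ZMod M) :
    ∃ i : ℤ, (a.val : ℤ) - 1 = ((a - 1).val : ℤ) + i * M := by
  obtain ⟨i, hi⟩ := val_add_one_eq (a - 1)
  rw [sub_add_cancel] at hi
  exact ⟨-i, by linarith⟩

theorem IsPeriodicMesh.toGroup_shift [NeZero M1] [NeZero M2] (hf : IsPeriodicMesh M1 M2 f)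
    (a : ZMod M1 × ZMod M2) :
    toGroup M1 M2 f (a + (1, 0)) = f (a.1.val + 1) a.2.val
    ∧ toGroup M1 M2 f (a - (1, 0)) = f (a.1.val - 1) a.2.val
    ∧ toGroup M1 M2 f (a + (0, 1)) = f a.1.val (a.2.val + 1)
    ∧ toGroup M1 M2 f (a - (0, 1)) = f a.1.val (a.2.val - 1) := by
  obtain ⟨i1, h1⟩ := val_add_one_eq a.1
  obtain ⟨i2, h2⟩ := val_sub_one_eq a.1
  obtain ⟨i3, h3⟩ := val_add_one_eq a.2
  obtain ⟨i4, h4⟩ := val_sub_one_eq a.2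
  simp only [toGroup, Prod.fst_add, Prod.snd_add, Prod.fst_sub, Prod.snd_sub, add_zero, sub_zero,
    h1, h2, h3, h4]
  have k := hf.add_mul
  refine ⟨?_, ?_, ?_, ?_⟩
  · simpa using (k ((a.1 + 1).val) a.2.val i1 0).symm
  · simpa using (k ((a.1 - 1).val) a.2.val i2 0).symm
  · simpa using (k a.1.val ((a.2 + 1).val) 0 i3).symm
  · simpa using (k a.1.val ((a.2 - 1).val) 0 i4).symm

end periodicMesh

theorem IsPeriodicMesh.shifts {M1 M2 : ℕ} {f : ℤ → ℤ → ℝ} (hf : IsPeriodicMesh M1 M2 f)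
    (a b i j : ℤ) : f (a + i * M1) (b + j * M2) = f a b
      ∧ f (a + i * M1 + 1) (b + j * M2) = f (a + 1) b
      ∧ f (a + i * M1 - 1) (b + j * M2) = f (a - 1) b
      ∧ f (a + i * M1) (b + j * M2 + 1) = f a (b + 1)
      ∧ f (a + i * M1) (b + j * M2 - 1) = f a (b - 1) := by
  refine ⟨hf.add_mul a b i j, ?_, ?_, ?_, ?_⟩
  · rw [add_right_comm, hf.add_mul]
  · rw [add_sub_right_comm, hf.add_mul]
  · rw [add_right_comm b, hf.add_mul]
  · rw [add_sub_right_comm b, hf.add_mul]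

/-- The scheme is stated for indices 1, …, M, while representatives in `ZMod M` run through 0, …, M
- 1; periodicity translates between them. Multiplying the auxiliary equations by h^2 and averaging
over two levels gives the half-level relation. -/
theorem IsCompactSchemeSolution.schemeStep {lam h τ : ℝ} {M1 M2 N : ℕ} [NeZero M1] [NeZero M2]
    {u0 : ℝ → ℝ → ℝ} {u v w : ℕ → ℤ → ℤ → ℝ}
    (S : IsCompactSchemeSolution lam h τ M1 M2 N u0 u v w) (hh : 0 < h) {r : ℕ} (hr : r < N) :
    SchemeStep lam h τ (![(1, 0), (0, 1)] : Fin 2 → ZMod M1 × ZMod M2)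
      (toGroup M1 M2 (u r)) (toGroup M1 M2 (u (r + 1)))
      ![toGroup M1 M2 (halfLevel v r), toGroup M1 M2 (halfLevel w r)] := by
  obtain ⟨pu, pv, pw⟩ := S.periodic r hr.le
  obtain ⟨pu', pv', pw'⟩ := S.periodic (r + 1) hr
  have rep : ∀ a b : ℤ, ∃ i j : ℤ, (1 ≤ a + i * M1 ∧ a + i * M1 ≤ M1)
      ∧ (1 ≤ b + j * M2 ∧ b + j * M2 ≤ M2) := fun a b => by
    obtain ⟨i, hi⟩ := exists_mul_mem_Icc (M := M1) NeZero.one_le a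
    obtain ⟨j, hj⟩ := exists_mul_mem_Icc (M := M2) NeZero.one_le b
    exact ⟨i, j, hi, hj⟩
  have phv : IsPeriodicMesh M1 M2 (halfLevel v r) :=
    ⟨fun a b => by simp only [halfLevel, pv.1, pv'.1], fun a b => by simp only [halfLevel, pv.2, pv'.2]⟩
  have phw : IsPeriodicMesh M1 M2 (halfLevel w r) :=
    ⟨fun a b => by simp only [halfLevel, pw.1, pw'.1], fun a b => by simp only [halfLevel, pw.2, pw'.2]⟩
  have hdx := sq_mul_dxx hh.ne'
  have hdy := sq_mul_dyy hh.ne'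
  have hv : ∀ a b : ℤ, h ^ 2 * (halfLevel v r a b + (halfLevel v r (a + 1) b
      - 2 * halfLevel v r a b + halfLevel v r (a - 1) b) / 12)
      = halfLevel u r (a + 1) b - 2 * halfLevel u r a b + halfLevel u r (a - 1) b := fun a b => by
    obtain ⟨i, j, hi, hj⟩ := rep a b
    have e1 := S.v_eq r hr.le _ _ hi.1 hi.2 hj.1 hj.2
    have e2 := S.v_eq (r + 1) hr _ _ hi.1 hi.2 hj.1 hj.2
    obtain ⟨a1, a2, a3, -⟩ := pu.shifts a b i j
    obtain ⟨b1, b2, b3, -⟩ := pu'.shifts a b i j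
    obtain ⟨c1, c2, c3, -⟩ := pv.shifts a b i j
    obtain ⟨d1, d2, d3, -⟩ := pv'.shifts a b i j
    have f1 := hdx (u r) (a + i * M1) (b + j * M2)
    have f2 := hdx (u (r + 1)) (a + i * M1) (b + j * M2)
    have f3 := hdx (v r) (a + i * M1) (b + j * M2)
    have f4 := hdx (v (r + 1)) (a + i * M1) (b + j * M2)
    rw [a1, a2, a3] at f1
    rw [b1, b2, b3] at f2
    rw [c1, c2, c3] at f3
    rw [d1, d2, d3] at f4
    rw [c1] at e1
    rw [d1] at e2
    simp only [halfLevel]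
    linear_combination h ^ 2 / 2 * e1 + h ^ 2 / 2 * e2 + f1 / 2 + f2 / 2 - h ^ 2 / 24 * f3
      - h ^ 2 / 24 * f4
  have hw : ∀ a b : ℤ, h ^ 2 * (halfLevel w r a b + (halfLevel w r a (b + 1)
      - 2 * halfLevel w r a b + halfLevel w r a (b - 1)) / 12)
      = halfLevel u r a (b + 1) - 2 * halfLevel u r a b + halfLevel u r a (b - 1) := fun a b => by
    obtain ⟨i, j, hi, hj⟩ := rep a b
    have e1 := S.w_eq r hr.le _ _ hi.1 hi.2 hj.1 hj.2
    have e2 := S.w_eq (r + 1) hr _ _ hi.1 hi.2 hj.1 hj.2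
    obtain ⟨a1, -, -, a2, a3⟩ := pu.shifts a b i j
    obtain ⟨b1, -, -, b2, b3⟩ := pu'.shifts a b i j
    obtain ⟨c1, -, -, c2, c3⟩ := pw.shifts a b i j
    obtain ⟨d1, -, -, d2, d3⟩ := pw'.shifts a b i j
    have f1 := hdy (u r) (a + i * M1) (b + j * M2)
    have f2 := hdy (u (r + 1)) (a + i * M1) (b + j * M2)
    have f3 := hdy (w r) (a + i * M1) (b + j * M2)
    have f4 := hdy (w (r + 1)) (a + i * M1) (b + j * M2)
    rw [a1, a2, a3] at f1
    rw [b1, b2, b3] at f2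
    rw [c1, c2, c3] at f3
    rw [d1, d2, d3] at f4
    rw [c1] at e1
    rw [d1] at e2
    simp only [halfLevel]
    linear_combination h ^ 2 / 2 * e1 + h ^ 2 / 2 * e2 + f1 / 2 + f2 / 2 - h ^ 2 / 24 * f3
      - h ^ 2 / 24 * f4
  refine ⟨fun a => ?_, Fin.forall_fin_two.2 ⟨fun a => ?_, fun a => ?_⟩⟩
  · obtain ⟨i, j, hi, hj⟩ := rep a.1.val a.2.val
    have e := S.equation r hr _ _ hi.1 hi.2 hj.1 hj.2
    obtain ⟨a0, a1, a2, a3, a4⟩ := pu.shifts a.1.val a.2.val i j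
    obtain ⟨b0, b1, b2, b3, b4⟩ := pu'.shifts a.1.val a.2.val i j
    obtain ⟨c0, c1, c2, -⟩ := phv.shifts a.1.val a.2.val i j
    obtain ⟨d0, -, -, d1, d2⟩ := phw.shifts a.1.val a.2.val i j
    obtain ⟨s1, s2, s3, s4⟩ := pu.toGroup_shift a
    obtain ⟨t1, t2, t3, t4⟩ := pu'.toGroup_shift a
    obtain ⟨y1, y2, -⟩ := phv.toGroup_shift a
    obtain ⟨-, -, z1, z2⟩ := phw.toGroup_shift a
    have hu0 : ∀ p q : ℤ, halfLevel u r p q = (u (r + 1) p q + u r p q) / 2 := fun p q => rfl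
    simp only [dtHalf, psiH, psiX, psiY, dhatX, dhatY, hu0, a0, a1, a2, a3, a4, b0, b1, b2, b3, b4,
      c0, c1, c2, d0, d1, d2] at e
    simp only [Fin.sum_univ_two, Matrix.cons_val_zero, Matrix.cons_val_one, psi, dhat, s1, s2, s3,
      s4, t1, t2, t3, t4, y1, y2, z1, z2]
    simp only [toGroup]
    linear_combination e
  · obtain ⟨s1, s2, -⟩ := pu.toGroup_shift a
    obtain ⟨t1, t2, -⟩ := pu'.toGroup_shift a
    obtain ⟨y1, y2, -⟩ := phv.toGroup_shift a
    simp only [Matrix.cons_val_zero, cA, sd, s1, s2, t1, t2, y1, y2]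
    exact hv _ _
  · obtain ⟨-, -, s1, s2⟩ := pu.toGroup_shift a
    obtain ⟨-, -, t1, t2⟩ := pu'.toGroup_shift a
    obtain ⟨-, -, y1, y2⟩ := phw.toGroup_shift a
    simp only [Matrix.cons_val_one, Matrix.cons_val_zero, cA, sd, s1, s2, t1, t2, y1, y2]
    exact hw _ _

theorem pt_eX_eY (h t : ℝ) (M1 M2 : ℕ) (a : ZMod M1 × ZMod M2) :
    pt (h • eX) (h • eY) M1 M2 t a = ((a.1.val : ℝ) * h, (a.2.val : ℝ) * h, t) := by
  ext <;> simp [pt, eX, eY, eT]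

namespace SmoothData

variable {lam L1 L2 T K : ℝ} {u : ℝ → ℝ → ℝ → ℝ} {ux uy : ℕ → ℝ × ℝ × ℝ → ℝ}
  {ut utt : ℝ × ℝ × ℝ → ℝ}

theorem periodic_mesh (D : SmoothData lam L1 L2 T u K ux uy ut utt) {h : ℝ} {M1 M2 : ℕ}
    (hL1 : L1 = h * M1) (hL2 : L2 = h * M2) (t : ℝ) :
    IsPeriodicMesh M1 M2 fun p q => ux 0 (p * h, q * h, t) := by
  refine ⟨fun a b => ?_, fun a b => ?_⟩
  · have := (D.per_x 0 (by norm_num) (a * h, b * h, t)).1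
    refine Eq.trans (congrArg (ux 0) ?_) this
    ext <;> simp [eX, hL1]; ring
  · have := (D.per_x 0 (by norm_num) (a * h, b * h, t)).2
    refine Eq.trans (congrArg (ux 0) ?_) this
    ext <;> simp [eY, hL2]; ring

theorem coarse_error (D : SmoothData lam L1 L2 T u K ux uy ut utt) (hlam : 0 < lam) (hT0 : 0 < T)
    (hL1 : 0 < L1) {u0 : ℝ → ℝ → ℝ} (hu0 : ∀ x y, u x y 0 = u0 x y) :
    ∃ C : ℝ, 0 ≤ C ∧ ∀ (h τ : ℝ) (M1 M2 N : ℕ), 1 ≤ M1 → 1 ≤ M2 → 1 ≤ N →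
      L1 = h * M1 → L2 = h * M2 → τ = T / N → ∀ uc vc wc : ℕ → ℤ → ℤ → ℝ,
        IsCompactSchemeSolution lam h τ M1 M2 N u0 uc vc wc → ∀ r ≤ N,
          ∑ p ∈ Finset.range M1, ∑ q ∈ Finset.range M2,
            (ux 0 (((p : ℤ) : ℝ) * h, ((q : ℤ) : ℝ) * h, r * τ) - uc r p q) ^ 2
            ≤ M1 * M2 * (C * (τ ^ 2 + h ^ 4)) ^ 2 := by
  obtain ⟨C, hC, H⟩ := D.flow.coarse_error hlam hT0
  refine ⟨C, hC, fun h τ M1 M2 N hM1 hM2 hN h1 h2 hτ uc vc wc S r hr => ?_⟩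
  have : NeZero M1 := ⟨by omega⟩
  have : NeZero M2 := ⟨by omega⟩
  have hM1' : (0 : ℝ) < M1 := by exact_mod_cast hM1
  have hN' : (0 : ℝ) < N := by exact_mod_cast hN
  have hh : 0 < h := by
    rw [h1] at hL1
    exact pos_of_mul_pos_left hL1 hM1'.le
  have hτ0 : 0 < τ := by rw [hτ]; positivity
  have hNT : N * τ = T := by rw [hτ]; field_simp
  have key := H h τ M1 M2 N hh hτ0 h1 h2 hNT (fun r => toGroup M1 M2 (uc r))
    (fun r => ![toGroup M1 M2 (halfLevel vc r), toGroup M1 M2 (halfLevel wc r)])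
    (fun r hr => S.schemeStep hh hr) (fun a => by
      obtain ⟨i, hi⟩ := exists_mul_mem_Icc hM1 (a.1.val : ℤ)
      obtain ⟨j, hj⟩ := exists_mul_mem_Icc hM2 (a.2.val : ℤ)
      have e1 := S.initial _ _ hi.1 hi.2 hj.1 hj.2
      rw [(S.periodic 0 (Nat.zero_le _)).1.add_mul, ← hu0,
        ← D.agree _ _ 0 ⟨le_rfl, hT0.le⟩] at e1
      have e2 := (D.periodic_mesh h1 h2 0).add_mul a.1.val a.2.val i j
      rw [pt_eX_eY]
      rw [toGroup, e1, e2]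
      simp only [Int.cast_natCast]) r hr
  rw [Fintype.sum_prod_type] at key
  simp only [pt_eX_eY, toGroup] at key
  rw [← sum_zmod_val M1 fun p => ∑ q ∈ Finset.range M2,
    (ux 0 (((p : ℤ) : ℝ) * h, ((q : ℤ) : ℝ) * h, r * τ) - uc r p q) ^ 2]
  refine le_trans (le_of_eq (Finset.sum_congr rfl fun a _ => ?_)) key
  rw [← sum_zmod_val M2 fun q =>
    (ux 0 (((a.val : ℤ) : ℝ) * h, ((q : ℤ) : ℝ) * h, r * τ) - uc r a.val q) ^ 2]
  simp only [Int.cast_natCast]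

end SmoothData

/-! ## Interpolation to the fine grid -/

/-- The cubic Lagrange basis function of the node `i` among `0, 1, 2, 3`. -/
noncomputable def lag (i : ℕ) (ξ : ℝ) : ℝ := ∏ s ∈ (Finset.range 4).erase i, (ξ - s) / (i - s)

/-- Translating by the first node and dividing by the coarse step reduces all basis functions to the
nodes 0, 1, 2, 3. -/
theorem lagrangeCubic_eq {h : ℝ} (hh : h ≠ 0) {k : ℕ} (hk : k ≠ 0) (p : ℤ) (i l : ℕ) :
    lagrangeCubic h k p i (((p * k + l : ℤ) : ℝ) * h) = lag i (l / k) := by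
  have hk' : (k : ℝ) ≠ 0 := by exact_mod_cast hk
  refine Finset.prod_congr rfl fun s _ => ?_
  rw [← mul_div_mul_left ((l : ℝ) / k - s) (i - s) (mul_ne_zero hk' hh)]
  push_cast
  congr 1
  · field_simp; ring
  · ring

theorem lag_zero (ξ : ℝ) : lag 0 ξ = -((ξ - 1) * (ξ - 2) * (ξ - 3) / 6) := by
  rw [lag, show (Finset.range 4).erase 0 = {1, 2, 3} by decide]
  norm_num [Finset.prod_insert]; ring

theorem lag_one (ξ : ℝ) : lag 1 ξ = ξ * (ξ - 2) * (ξ - 3) / 2 := by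
  rw [lag, show (Finset.range 4).erase 1 = {0, 2, 3} by decide]
  norm_num [Finset.prod_insert]; ring

theorem lag_two (ξ : ℝ) : lag 2 ξ = -(ξ * (ξ - 1) * (ξ - 3) / 2) := by
  rw [lag, show (Finset.range 4).erase 2 = {0, 1, 3} by decide]
  norm_num [Finset.prod_insert]; ring

theorem lag_three (ξ : ℝ) : lag 3 ξ = ξ * (ξ - 1) * (ξ - 2) / 6 := by
  rw [lag, show (Finset.range 4).erase 3 = {0, 1, 2} by decide]
  norm_num [Finset.prod_insert]; ring

/-- Each of the three factors has numerator at most 3 and denominator at least 1 in absolute value.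
-/
theorem abs_lag_le {ξ : ℝ} (hξ : ξ ∈ Set.Icc (0 : ℝ) 1) {i : ℕ} (hi : i ∈ Finset.range 4) :
    |lag i ξ| ≤ 27 := by
  have hf : ∀ s ∈ (Finset.range 4).erase i, |(ξ - s) / (i - s)| ≤ 3 := fun s hs => by
    obtain ⟨hne, hs⟩ := Finset.mem_erase.1 hs
    have h3 : (s : ℝ) ≤ 3 := by
      have := Finset.mem_range.1 hs
      exact_mod_cast (by omega : s ≤ 3)
    have h0 : (0 : ℝ) ≤ s := Nat.cast_nonneg s
    have h1 : (1 : ℝ) ≤ |(i : ℝ) - s| := by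
      have : (1 : ℤ) ≤ |(i : ℤ) - s| := Int.one_le_abs (sub_ne_zero.2 (by exact_mod_cast hne.symm))
      exact_mod_cast this
    rw [abs_div, div_le_iff₀ (by linarith)]
    have h2 : |ξ - s| ≤ 3 := by rw [abs_le]; constructor <;> linarith [hξ.1, hξ.2]
    linarith
  rw [lag, Finset.abs_prod]
  refine (Finset.prod_le_prod (fun _ _ => abs_nonneg _) hf).trans ?_
  rw [Finset.prod_const, Finset.card_erase_of_mem hi, Finset.card_range]
  norm_num

section
variable {E : Type*} [NormedAddCommGroup E] [NormedSpace ℝ E] {e : E} {K : ℝ} {f : ℕ → E → ℝ}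

theorem Chain4.taylor_four (H : Chain4 e K f) (z : E) {s : ℝ} (hs : 0 ≤ s) :
    |f 0 (z + s • e) - (f 0 z + s * f 1 z + s ^ 2 / 2 * f 2 z + s ^ 3 / 6 * f 3 z)|
      ≤ K * s ^ 4 / 24 := by
  have h3 : ∀ s : ℝ, 0 ≤ s → |f 3 (z + s • e) - f 3 z| ≤ K * s := fun s hs => by
    have := abs_le_of_abs_deriv_le (c := K) hs 0 (R := fun s => f 3 (z + s • e) - f 3 z)
      (r := fun s => f 4 (z + s • e)) (by simp)
      ((H.continuous_line (by norm_num) z).sub continuous_const).continuousOn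
      (fun s _ => (H.hasDerivAt (by norm_num) z s).sub_const _)
      (fun s _ => by simpa using H.bdd 4 le_rfl _)
    simpa using this
  have h2 : ∀ s : ℝ, 0 ≤ s → |f 2 (z + s • e) - (f 2 z + s * f 3 z)| ≤ K * s ^ 2 / 2 :=
    fun s hs => by
      have := abs_le_of_abs_deriv_le (c := K) hs 1
        (R := fun s => f 2 (z + s • e) - (f 2 z + s * f 3 z))
        (r := fun s => f 3 (z + s • e) - 1 * f 3 z) (by simp)
        ((H.continuous_line (by norm_num) z).sub (by fun_prop)).continuousOn
        (fun s _ => (H.hasDerivAt (by norm_num) z s).sub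
          (((hasDerivAt_id s).mul_const _).const_add _))
        (fun s hs => by simpa using h3 s hs.1.le)
      norm_num at this ⊢
      exact this
  have h1 : ∀ s : ℝ, 0 ≤ s →
      |f 1 (z + s • e) - (f 1 z + s * f 2 z + s ^ 2 / 2 * f 3 z)| ≤ K / 2 * s ^ 3 / 3 :=
    fun s hs => by
      have := abs_le_of_abs_deriv_le (c := K / 2) hs 2
        (R := fun s => f 1 (z + s • e) - (f 1 z + s * f 2 z + s ^ 2 / 2 * f 3 z))
        (r := fun s => f 2 (z + s • e) - (f 2 z + s * f 3 z)) (by simp)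
        ((H.continuous_line (by norm_num) z).sub (by fun_prop)).continuousOn
        (fun s _ => ((H.hasDerivAt (by norm_num) z s).sub
          ((((hasDerivAt_id s).mul_const _).const_add _).add
            (((hasDerivAt_pow 2 s).div_const 2).mul_const _))).congr_deriv (by
              simp only [Nat.reduceAdd]; push_cast; ring))
        (fun s hs => (h2 s hs.1.le).trans (le_of_eq (by ring)))
      norm_num at this ⊢
      exact this
  have := abs_le_of_abs_deriv_le (c := K / 6) hs 3
    (R := fun s => f 0 (z + s • e) - (f 0 z + s * f 1 z + s ^ 2 / 2 * f 2 z + s ^ 3 / 6 * f 3 z))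
    (r := fun s => f 1 (z + s • e) - (f 1 z + s * f 2 z + s ^ 2 / 2 * f 3 z)) (by simp)
    ((H.continuous_line (by norm_num) z).sub (by fun_prop)).continuousOn
    (fun s _ => ((H.hasDerivAt (by norm_num) z s).sub
      (((((hasDerivAt_id s).mul_const _).const_add _).add
        (((hasDerivAt_pow 2 s).div_const 2).mul_const _)).add
        (((hasDerivAt_pow 3 s).div_const 6).mul_const _))).congr_deriv (by
          simp only [zero_add]; push_cast; ring))
    (fun s hs => (h1 s hs.1.le).trans (le_of_eq (by ring)))
  refine this.trans (le_of_eq ?_)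
  norm_num; ring

/-- The error of cubic Lagrange interpolation. -/
theorem Chain4.abs_sub_lagrange_le (H : Chain4 e K f) {h : ℝ} (hh : 0 ≤ h) (z : E) {ξ : ℝ}
    (hξ : ξ ∈ Set.Icc (0 : ℝ) 1) :
    |f 0 (z + (ξ * h) • e) - ∑ i ∈ Finset.range 4, f 0 (z + (i * h) • e) * lag i ξ|
      ≤ 400 * K * h ^ 4 := by
  set P : ℝ → ℝ := fun s => f 0 z + s * f 1 z + s ^ 2 / 2 * f 2 z + s ^ 3 / 6 * f 3 z with hP
  have hK := mul_nonneg H.nonneg (pow_nonneg hh 4)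
  -- Cubic interpolation reproduces the Taylor polynomial of degree three, so only remainders are
  -- interpolated.
  have hrep : P (ξ * h) = ∑ i ∈ Finset.range 4, P (i * h) * lag i ξ := by
    simp only [Finset.sum_range_succ, Finset.sum_range_zero, lag_zero, lag_one, lag_two, lag_three,
      hP]
    push_cast
    ring
  have h0 : |f 0 (z + (ξ * h) • e) - P (ξ * h)| ≤ K * h ^ 4 / 24 := by
    refine (H.taylor_four z (mul_nonneg hξ.1 hh)).trans ?_
    have : ξ ^ 4 ≤ 1 := pow_le_one₀ hξ.1 hξ.2
    rw [mul_pow]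
    nlinarith
  -- The evaluation point lies in the first of the three intervals, but the nodes reach out to 3h.
  have hi : ∀ i ∈ Finset.range 4, |(f 0 (z + (i * h) • e) - P (i * h)) * lag i ξ|
      ≤ K * (3 * h) ^ 4 / 24 * 27 := fun i hi => by
    refine abs_mul_le_mul ((H.taylor_four z (by positivity)).trans ?_) (abs_lag_le hξ hi)
    have h3 : (i : ℝ) ≤ 3 := by
      have := Finset.mem_range.1 hi
      exact_mod_cast (by omega : i ≤ 3)
    have := H.nonneg
    gcongr
  have hsum := (Finset.abs_sum_le_sum_abs _ _).trans (Finset.sum_le_sum hi)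
  rw [Finset.sum_const, Finset.card_range, nsmul_eq_mul] at hsum
  have e1 : f 0 (z + (ξ * h) • e) - ∑ i ∈ Finset.range 4, f 0 (z + (i * h) • e) * lag i ξ
      = (f 0 (z + (ξ * h) • e) - P (ξ * h))
        - ∑ i ∈ Finset.range 4, (f 0 (z + (i * h) • e) - P (i * h)) * lag i ξ := by
    simp only [sub_mul, Finset.sum_sub_distrib, ← hrep]
    ring
  rw [e1]
  norm_num at hsum
  rw [abs_le] at *
  constructor <;> nlinarith

end

/-- Interpolation first in x, then in y at each of the four x-nodes. The second error is multiplied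
by basis functions of size 27, whence 400 + 4 · 27 · 400 = 43600. -/
theorem Flow.abs_sub_lagrange_le {lam L1 L2 T K : ℝ} {ex ey : ℝ × ℝ × ℝ}
    {ux uy : ℕ → ℝ × ℝ × ℝ → ℝ} {ut utt : ℝ × ℝ × ℝ → ℝ}
    (D : Flow lam L1 L2 T K ex ey ux uy ut utt) {h : ℝ} (hh : 0 ≤ h) (z : ℝ × ℝ × ℝ) {ξ η : ℝ}
    (hξ : ξ ∈ Set.Icc (0 : ℝ) 1) (hη : η ∈ Set.Icc (0 : ℝ) 1) :
    |ux 0 (z + (ξ * h) • ex + (η * h) • ey) - ∑ i ∈ Finset.range 4, ∑ j ∈ Finset.range 4,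
      ux 0 (z + (i * h) • ex + (j * h) • ey) * lag i ξ * lag j η| ≤ 43600 * K * h ^ 4 := by
  have h0 := D.chain_x.abs_sub_lagrange_le hh (z + (η * h) • ey) hξ
  have hi : ∀ i ∈ Finset.range 4, |(ux 0 (z + (i * h) • ex + (η * h) • ey)
      - ∑ j ∈ Finset.range 4, ux 0 (z + (i * h) • ex + (j * h) • ey) * lag j η) * lag i ξ|
      ≤ 400 * K * h ^ 4 * 27 := fun i hi => by
    have := D.chain_y.abs_sub_lagrange_le hh (z + ((i : ℝ) * h) • ex) hη
    rw [D.zero_eq] at this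
    exact abs_mul_le_mul this (abs_lag_le hξ hi)
  have hsum := (Finset.abs_sum_le_sum_abs _ _).trans (Finset.sum_le_sum hi)
  rw [Finset.sum_const, Finset.card_range, nsmul_eq_mul] at hsum
  have e1 : ux 0 (z + (ξ * h) • ex + (η * h) • ey) - ∑ i ∈ Finset.range 4, ∑ j ∈ Finset.range 4,
      ux 0 (z + (i * h) • ex + (j * h) • ey) * lag i ξ * lag j η
      = (ux 0 (z + (η * h) • ey + (ξ * h) • ex)
          - ∑ i ∈ Finset.range 4, ux 0 (z + (η * h) • ey + (i * h) • ex) * lag i ξ)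
        + ∑ i ∈ Finset.range 4, (ux 0 (z + (i * h) • ex + (η * h) • ey)
          - ∑ j ∈ Finset.range 4, ux 0 (z + (i * h) • ex + (j * h) • ey) * lag j η) * lag i ξ := by
    simp only [sub_mul, Finset.sum_sub_distrib, Finset.sum_mul, add_right_comm z ((η * h) • ey)]
    simp only [sub_add_sub_cancel, mul_right_comm _ (lag _ η)]
  rw [e1]
  push_cast at hsum
  rw [abs_le] at *
  constructor <;> linarith

/-! ### Sums over the fine mesh -/

theorem sum_range_add_periodic {M : ℕ} {g : ℤ → ℝ} (hg : Function.Periodic g (M : ℤ)) (i : ℕ) :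
    ∑ p ∈ Finset.range M, g (p + i) = ∑ p ∈ Finset.range M, g p := by
  induction i with
  | zero => simp
  | succ i ih =>
    rw [← ih]
    have := sum_range_shift (M := M) (g := fun p => g (p + i)) (by
      have := hg i
      rw [add_comm] at this
      simpa using this)
    rw [← this]
    exact Finset.sum_congr rfl fun p _ => congrArg g (by push_cast; ring)

theorem sum_range_mul_eq (k M : ℕ) (g : ℕ → ℝ) :
    ∑ a ∈ Finset.range (k * M), g a = ∑ p ∈ Finset.range M, ∑ l ∈ Finset.range k, g (p * k + l) := by
  induction M with
  | zero => simp
  | succ M ih =>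
    rw [mul_add, mul_one, Finset.sum_range_add, ih, Finset.sum_range_succ, mul_comm k M]

theorem sum_Icc_eq_blocks {k M : ℕ} {g : ℤ → ℝ} (hg : Function.Periodic g ((k * M : ℕ) : ℤ)) :
    ∑ a ∈ Finset.Icc 1 (k * M), g a
      = ∑ p ∈ Finset.range M, ∑ l ∈ Finset.range k, g ((p : ℤ) * k + l) := by
  have h1 : ∑ a ∈ Finset.Icc 1 (k * M), g a = ∑ a ∈ Finset.range (k * M), g ((a : ℤ) + (1 : ℕ)) := by
    have := Finset.sum_Ico_add' (fun a : ℕ => g (a : ℤ)) 0 (k * M) 1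
    simp only [Nat.cast_add, zero_add] at this
    rw [Finset.range_eq_Ico]
    exact this.symm
  rw [h1, sum_range_add_periodic hg 1, sum_range_mul_eq k M fun a => g a]
  exact Finset.sum_congr rfl fun p _ => Finset.sum_congr rfl fun l _ => by push_cast; rfl

theorem sum_sum_range_add_periodic {M1 M2 : ℕ} {f : ℤ → ℤ → ℝ} (hf : IsPeriodicMesh M1 M2 f)
    (i j : ℕ) :
    ∑ p ∈ Finset.range M1, ∑ q ∈ Finset.range M2, f ((p : ℤ) + i) ((q : ℤ) + j)
      = ∑ p ∈ Finset.range M1, ∑ q ∈ Finset.range M2, f p q := by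
  have h1 : ∀ a : ℤ, ∑ q ∈ Finset.range M2, f a ((q : ℤ) + j) = ∑ q ∈ Finset.range M2, f a q :=
    fun a => sum_range_add_periodic (g := fun b => f a b) (fun b => hf.2 a b) j
  simp only [h1]
  exact sum_range_add_periodic (g := fun a => ∑ q ∈ Finset.range M2, f a q)
    (fun a => Finset.sum_congr rfl fun q _ => hf.1 a q) i

theorem sum_sum_Icc_eq_blocks {k M1 M2 : ℕ} {g : ℤ → ℤ → ℝ}
    (hg : IsPeriodicMesh (k * M1) (k * M2) g) :
    ∑ a ∈ Finset.Icc 1 (k * M1), ∑ b ∈ Finset.Icc 1 (k * M2), g a b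
      = ∑ l ∈ Finset.range k, ∑ m ∈ Finset.range k, ∑ p ∈ Finset.range M1, ∑ q ∈ Finset.range M2,
          g ((p : ℤ) * k + l) ((q : ℤ) * k + m) := by
  have h1 : ∀ a : ℤ, ∑ b ∈ Finset.Icc 1 (k * M2), g a b
      = ∑ q ∈ Finset.range M2, ∑ m ∈ Finset.range k, g a ((q : ℤ) * k + m) :=
    fun a => sum_Icc_eq_blocks (g := fun b => g a b) (fun b => hg.2 a b)
  simp only [h1]
  rw [sum_Icc_eq_blocks
    (g := fun a => ∑ q ∈ Finset.range M2, ∑ m ∈ Finset.range k, g a ((q : ℤ) * k + m))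
    (fun a => Finset.sum_congr rfl fun q _ => Finset.sum_congr rfl fun m _ => hg.1 a _),
    Finset.sum_comm]
  refine Finset.sum_congr rfl fun l _ => ?_
  rw [Finset.sum_comm (s := Finset.range k)]
  exact Finset.sum_congr rfl fun p _ => Finset.sum_comm

theorem sq_sum_lag_le {d : ℕ → ℕ → ℝ} {ξ η : ℝ} (hξ : ξ ∈ Set.Icc (0 : ℝ) 1)
    (hη : η ∈ Set.Icc (0 : ℝ) 1) :
    (∑ i ∈ Finset.range 4, ∑ j ∈ Finset.range 4, d i j * lag i ξ * lag j η) ^ 2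
      ≤ 16 * 27 ^ 4 * ∑ i ∈ Finset.range 4, ∑ j ∈ Finset.range 4, d i j ^ 2 := by
  rw [← Finset.sum_product', ← Finset.sum_product']
  refine sq_sum_le_card_mul_sum_sq.trans ?_
  rw [Finset.card_product, Finset.card_range, Finset.mul_sum, Finset.mul_sum]
  refine Finset.sum_le_sum fun x hx => ?_
  obtain ⟨hi, hj⟩ := Finset.mem_product.1 hx
  have h1 := abs_mul_le_mul (abs_lag_le hξ hi) (abs_lag_le hη hj)
  have h2 : (lag x.1 ξ * lag x.2 η) ^ 2 ≤ (27 * 27) ^ 2 := sq_le_sq' (by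
    linarith [neg_abs_le (lag x.1 ξ * lag x.2 η)]) ((le_abs_self _).trans h1)
  have h3 := mul_le_mul_of_nonneg_left h2 (sq_nonneg (d x.1 x.2))
  push_cast
  linear_combination 16 * h3

/-- A fine mesh function that is, up to `E`, the tensor-product cubic interpolant of a coarse one is
controlled by the latter in the discrete `L²` norm. -/
theorem sum_sq_le_of_interpolant {k M1 M2 : ℕ} {g d : ℤ → ℤ → ℝ} {E : ℝ}
    (hg : IsPeriodicMesh (k * M1) (k * M2) g) (hd : IsPeriodicMesh M1 M2 d)
    (H : ∀ p < M1, ∀ q < M2, ∀ l < k, ∀ m < k,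
      |g ((p : ℤ) * k + l) ((q : ℤ) * k + m) - ∑ i ∈ Finset.range 4, ∑ j ∈ Finset.range 4,
        d ((p : ℤ) + i) ((q : ℤ) + j) * lag i ((l : ℝ) / k) * lag j ((m : ℝ) / k)| ≤ E) :
    ∑ a ∈ Finset.Icc 1 (k * M1), ∑ b ∈ Finset.Icc 1 (k * M2), g a b * g a b
      ≤ k ^ 2 * (512 * 27 ^ 4 * ∑ p ∈ Finset.range M1, ∑ q ∈ Finset.range M2, d p q ^ 2
          + 2 * (M1 * M2 * E ^ 2)) := by
  have hg2 : IsPeriodicMesh (k * M1) (k * M2) fun a b => g a b * g a b :=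
    ⟨fun a b => by simp only [hg.1], fun a b => by simp only [hg.2]⟩
  have hd2 : IsPeriodicMesh M1 M2 fun a b => d a b ^ 2 :=
    ⟨fun a b => by simp only [hd.1], fun a b => by simp only [hd.2]⟩
  have hI : ∀ l < k, (l : ℝ) / k ∈ Set.Icc (0 : ℝ) 1 := fun l hl => by
    have hk : (0 : ℝ) < k := by exact_mod_cast (by omega : 0 < k)
    exact ⟨by positivity, (div_le_one hk).2 (by exact_mod_cast hl.le)⟩
  have key : ∀ l ∈ Finset.range k, ∀ m ∈ Finset.range k,
      ∑ p ∈ Finset.range M1, ∑ q ∈ Finset.range M2,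
        g ((p : ℤ) * k + l) ((q : ℤ) * k + m) * g ((p : ℤ) * k + l) ((q : ℤ) * k + m)
      ≤ 512 * 27 ^ 4 * ∑ p ∈ Finset.range M1, ∑ q ∈ Finset.range M2, d p q ^ 2
          + 2 * (M1 * M2 * E ^ 2) := fun l hl m hm => by
    have hl := Finset.mem_range.1 hl
    have hm := Finset.mem_range.1 hm
    have h1 : ∀ p ∈ Finset.range M1, ∀ q ∈ Finset.range M2,
        g ((p : ℤ) * k + l) ((q : ℤ) * k + m) * g ((p : ℤ) * k + l) ((q : ℤ) * k + m)
        ≤ 32 * 27 ^ 4 * ∑ i ∈ Finset.range 4, ∑ j ∈ Finset.range 4,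
            d ((p : ℤ) + i) ((q : ℤ) + j) ^ 2 + 2 * E ^ 2 := fun p hp q hq => by
      have h2 := H p (Finset.mem_range.1 hp) q (Finset.mem_range.1 hq) l hl m hm
      have h3 := sq_sum_lag_le (d := fun i j => d ((p : ℤ) + i) ((q : ℤ) + j)) (hI l hl) (hI m hm)
      generalize g ((p : ℤ) * k + l) ((q : ℤ) * k + m) = G at h2 ⊢
      generalize ∑ i ∈ Finset.range 4, ∑ j ∈ Finset.range 4,
        d ((p : ℤ) + i) ((q : ℤ) + j) * lag i ((l : ℝ) / k) * lag j ((m : ℝ) / k) = S at h2 h3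
      have h4 : (G - S) ^ 2 ≤ E ^ 2 := sq_le_sq' (by linarith [neg_abs_le (G - S)])
        ((le_abs_self _).trans h2)
      nlinarith [sq_nonneg (G - 2 * S)]
    refine (Finset.sum_le_sum fun p hp => Finset.sum_le_sum (h1 p hp)).trans (le_of_eq ?_)
    simp only [Finset.sum_add_distrib, ← Finset.mul_sum, Finset.sum_const, Finset.card_range,
      nsmul_eq_mul]
    -- By periodicity each of the 16 shifted stencil sums equals the unshifted one.
    have h5 : ∑ p ∈ Finset.range M1, ∑ q ∈ Finset.range M2, ∑ i ∈ Finset.range 4,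
        ∑ j ∈ Finset.range 4, d ((p : ℤ) + i) ((q : ℤ) + j) ^ 2
        = 16 * ∑ p ∈ Finset.range M1, ∑ q ∈ Finset.range M2, d p q ^ 2 := by
      have h6 := fun i j : ℕ => sum_sum_range_add_periodic hd2 i j
      simp only [Finset.sum_range_succ (n := 3), Finset.sum_range_succ (n := 2),
        Finset.sum_range_succ (n := 1), Finset.sum_range_succ (n := 0), Finset.sum_range_zero,
        zero_add, Finset.sum_add_distrib, h6]
      ring
    rw [h5]; ring
  rw [sum_sum_Icc_eq_blocks hg2]
  refine (Finset.sum_le_sum fun l hl => Finset.sum_le_sum (key l hl)).trans (le_of_eq ?_)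
  simp only [Finset.sum_const, Finset.card_range, nsmul_eq_mul]
  ring

/-- Second order accuracy of linear interpolation in time. -/
theorem Flow.abs_sub_linear_le {lam L1 L2 T K : ℝ} {ex ey : ℝ × ℝ × ℝ}
    {ux uy : ℕ → ℝ × ℝ × ℝ → ℝ} {ut utt : ℝ × ℝ × ℝ → ℝ}
    (D : Flow lam L1 L2 T K ex ey ux uy ut utt) (z : ℝ × ℝ × ℝ) {a b θ : ℝ}
    (ha : z.2.2 + a ∈ Set.Icc 0 T) (hb : z.2.2 + b ∈ Set.Icc 0 T) (hθ : θ ∈ Set.Icc (0 : ℝ) 1) :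
    |ux 0 (z + ((1 - θ) * a + θ * b) • eT)
      - ((1 - θ) * ux 0 (z + a • eT) + θ * ux 0 (z + b • eT))| ≤ K * (b - a) ^ 2 := by
  have hc : z.2.2 + ((1 - θ) * a + θ * b) ∈ Set.Icc 0 T := by
    have := (convex_Icc (0 : ℝ) T) ha hb (sub_nonneg.2 hθ.2) hθ.1 (by ring)
    simp only [smul_eq_mul] at this
    convert this using 1; ring
  have h1 := abs_le.1 (D.taylor_t z ha hc)
  have h2 := abs_le.1 (D.taylor_t z ha hb)
  have e : (1 - θ) * a + θ * b - a = θ * (b - a) := by ring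
  rw [e] at h1
  have hK : 0 ≤ K * (b - a) ^ 2 := mul_nonneg D.K_nonneg (sq_nonneg _)
  have hθ2 : θ ^ 2 ≤ 1 := pow_le_one₀ hθ.1 hθ.2
  have h3 : K * (θ * (b - a)) ^ 2 ≤ K * (b - a) ^ 2 := by nlinarith
  have h4 := mul_le_mul_of_nonneg_left h2.1 hθ.1
  have h5 := mul_le_mul_of_nonneg_left h2.2 hθ.1
  have h6 : θ * (K * (b - a) ^ 2) ≤ K * (b - a) ^ 2 := by nlinarith [hθ.2]
  rw [abs_le]
  constructor <;> nlinarith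

/-- The values of the rough fine solution at the coarse points. -/
theorem IsRoughFineSolution.exists_eq_linear {h : ℝ} {M1 M2 N kh kt : ℕ} {uc uf : ℕ → ℤ → ℤ → ℝ}
    (S : IsRoughFineSolution h M1 M2 N kh kt uc uf) (hM1 : 1 ≤ M1) (hM2 : 1 ≤ M2) (hkt : 1 ≤ kt)
    (huc : ∀ r ≤ N, IsPeriodicMesh M1 M2 (uc r)) {n : ℕ} (hn : n ≤ kt * N) :
    ∃ r ≤ N, ∃ r' ≤ N, ∃ θ ∈ Set.Icc (0 : ℝ) 1, r ≤ r' ∧ r' ≤ r + 1 ∧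
      (n : ℝ) = kt * ((1 - θ) * r + θ * r') ∧
      ∀ p q : ℤ, uf n (p * kh) (q * kh) = (1 - θ) * uc r p q + θ * uc r' p q := by
  have hkt' : (0 : ℝ) < kt := by exact_mod_cast hkt
  -- The definition covers the nodes of one period; the interpolation stencil reaches beyond it, and
  -- periodicity supplies those nodes.
  have lift : ∀ r ≤ N, ∀ r' ≤ N, ∀ θ : ℝ,
      (∀ p q : ℤ, 0 ≤ p → p ≤ M1 → 0 ≤ q → q ≤ M2 →
        uf n (p * kh) (q * kh) = (1 - θ) * uc r p q + θ * uc r' p q) →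
      ∀ p q : ℤ, uf n (p * kh) (q * kh) = (1 - θ) * uc r p q + θ * uc r' p q := by
    intro r hr r' hr' θ H p q
    obtain ⟨i, hi⟩ := exists_mul_mem_Icc hM1 p
    obtain ⟨j, hj⟩ := exists_mul_mem_Icc hM2 q
    have e := H _ _ (by omega) hi.2 (by omega) hj.2
    rw [(huc r hr).add_mul, (huc r' hr').add_mul] at e
    rw [← e, ← (S.periodic n hn).add_mul (p * kh) (q * kh) i j]
    push_cast
    congr 1 <;> ring
  have hdm := Nat.div_add_mod n kt
  have hlt := Nat.mod_lt n hkt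
  set r := n / kt
  set s := n % kt
  have hr : r ≤ N := Nat.div_le_of_le_mul hn
  -- At a coarse time level r' = r and θ = 0 are chosen, so that no level beyond N is needed at the
  -- final time.
  rcases Nat.eq_zero_or_pos s with h0 | h0
  · refine ⟨r, hr, r, hr, 0, ⟨le_rfl, zero_le_one⟩, le_rfl, by omega, ?_, lift r hr r hr 0 ?_⟩
    · rw [← hdm, h0]; push_cast; ring
    · intro p q h1 h2 h3 h4
      have := S.node r hr p q h1 h2 h3 h4
      rw [← hdm, h0, add_zero, mul_comm, this]; ring
  · have hr1 : r < N := by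
      by_contra hcon
      have : r = N := by omega
      rw [this] at hdm; omega
    refine ⟨r, hr, r + 1, hr1, s / kt, ⟨by positivity, (div_le_one hkt').2 ?_⟩, by omega, le_rfl,
      ?_, lift r hr _ hr1 _ ?_⟩
    · exact_mod_cast hlt.le
    · rw [← hdm]; push_cast; field_simp; ring
    · intro p q h1 h2 h3 h4
      rw [← hdm, mul_comm kt]
      exact S.time_interp r hr1 s h0 hlt p q h1 h2 h3 h4

/-! ### The error of the rough fine solution. -/

variable {lam L1 L2 T K : ℝ} {u : ℝ → ℝ → ℝ → ℝ} {ux uy : ℕ → ℝ × ℝ × ℝ → ℝ}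
  {ut utt : ℝ × ℝ × ℝ → ℝ}

/-- The error of the time-interpolated coarse solution at the coarse points. -/
theorem SmoothData.coarse_node_error (D : SmoothData lam L1 L2 T u K ux uy ut utt) {h τ C : ℝ}
    {M1 M2 N kh kt : ℕ} (hτ : 0 ≤ τ) (hNT : N * τ = T) (hM1 : 1 ≤ M1) (hM2 : 1 ≤ M2) (hkt : 1 ≤ kt)
    {uc uf : ℕ → ℤ → ℤ → ℝ} {hf : ℝ} (S : IsRoughFineSolution hf M1 M2 N kh kt uc uf)
    (huc : ∀ r ≤ N, IsPeriodicMesh M1 M2 (uc r))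
    (H : ∀ r ≤ N, ∑ p ∈ Finset.range M1, ∑ q ∈ Finset.range M2,
      (ux 0 (((p : ℤ) : ℝ) * h, ((q : ℤ) : ℝ) * h, r * τ) - uc r p q) ^ 2 ≤ M1 * M2 * C)
    {n : ℕ} (hn : n ≤ kt * N) :
    ∑ p ∈ Finset.range M1, ∑ q ∈ Finset.range M2,
      (ux 0 (((p : ℤ) : ℝ) * h, ((q : ℤ) : ℝ) * h, n * (τ / kt))
        - uf n ((p : ℤ) * kh) ((q : ℤ) * kh)) ^ 2
      ≤ M1 * M2 * (2 * (K * τ ^ 2) ^ 2 + 2 * C) := by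
  obtain ⟨r, hr, r', hr', θ, hθ, hrr, hrr', hnθ, e⟩ := S.exists_eq_linear hM1 hM2 hkt huc hn
  have hkt' : (0 : ℝ) < kt := by exact_mod_cast hkt
  have ht : n * (τ / kt) = (1 - θ) * (r * τ) + θ * (r' * τ) := by
    rw [hnθ]; field_simp
  have hmem : ∀ m ≤ N, (0 : ℝ) + m * τ ∈ Set.Icc 0 T := fun m hm => by
    have : (m : ℝ) ≤ N := by exact_mod_cast hm
    rw [← hNT, zero_add]
    exact ⟨by positivity, by gcongr⟩
  have hpt : ∀ x y t : ℝ, ((x, y, 0) : ℝ × ℝ × ℝ) + t • eT = (x, y, t) := fun x y t => by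
    ext <;> simp [eT]
  have hd : ((r' : ℝ) * τ - r * τ) ^ 2 ≤ τ ^ 2 := by
    have h1 : (r : ℝ) ≤ r' := by exact_mod_cast hrr
    have h2 : (r' : ℝ) ≤ r + 1 := by exact_mod_cast hrr'
    refine pow_le_pow_left₀ ?_ ?_ 2 <;> nlinarith
  have hK : 0 ≤ K := D.flow.K_nonneg
  have hpq : ∀ p ∈ Finset.range M1, ∀ q ∈ Finset.range M2,
      (ux 0 (((p : ℤ) : ℝ) * h, ((q : ℤ) : ℝ) * h, n * (τ / kt))
        - uf n ((p : ℤ) * kh) ((q : ℤ) * kh)) ^ 2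
      ≤ 2 * (K * τ ^ 2) ^ 2
        + 2 * ((1 - θ)
            * (ux 0 (((p : ℤ) : ℝ) * h, ((q : ℤ) : ℝ) * h, r * τ) - uc r p q) ^ 2
          + θ * (ux 0 (((p : ℤ) : ℝ) * h, ((q : ℤ) : ℝ) * h, r' * τ) - uc r' p q) ^ 2) :=
    fun p _ q _ => by
      have h1 := D.flow.abs_sub_linear_le (((p : ℤ) : ℝ) * h, ((q : ℤ) : ℝ) * h, 0)
        (hmem r hr) (hmem r' hr') hθ
      rw [← ht, hpt, hpt, hpt] at h1
      replace h1 := h1.trans (mul_le_mul_of_nonneg_left hd hK)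
      rw [e]
      generalize ux 0 (((p : ℤ) : ℝ) * h, ((q : ℤ) : ℝ) * h, n * (τ / kt)) = U at h1 ⊢
      generalize ux 0 (((p : ℤ) : ℝ) * h, ((q : ℤ) : ℝ) * h, r * τ) = V at h1 ⊢
      generalize ux 0 (((p : ℤ) : ℝ) * h, ((q : ℤ) : ℝ) * h, r' * τ) = W at h1 ⊢
      generalize K * τ ^ 2 = E at h1 ⊢
      have h2 : (U - ((1 - θ) * V + θ * W)) ^ 2 ≤ E ^ 2 :=
        sq_le_sq' (by linarith [neg_abs_le (U - ((1 - θ) * V + θ * W))])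
          ((le_abs_self _).trans h1)
      -- Convexity of the square: interpolating the nodal errors in time does not enlarge them in
      -- mean square.
      have h3 : ((1 - θ) * (V - uc r p q) + θ * (W - uc r' p q)) ^ 2
          ≤ (1 - θ) * (V - uc r p q) ^ 2 + θ * (W - uc r' p q) ^ 2 := by
        have := mul_nonneg (mul_nonneg hθ.1 (sub_nonneg.2 hθ.2))
          (sq_nonneg ((V - uc r p q) - (W - uc r' p q)))
        linear_combination this
      have h4 := sq_nonneg ((U - ((1 - θ) * V + θ * W))
        - ((1 - θ) * (V - uc r p q) + θ * (W - uc r' p q)))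
      linear_combination 2 * h2 + 2 * h3 + h4
  refine (Finset.sum_le_sum fun p hp => Finset.sum_le_sum (hpq p hp)).trans ?_
  simp only [Finset.sum_add_distrib, ← Finset.mul_sum, Finset.sum_const, Finset.card_range,
    nsmul_eq_mul]
  have h1 := mul_le_mul_of_nonneg_left (H r hr) (sub_nonneg.2 hθ.2)
  have h2 := mul_le_mul_of_nonneg_left (H r' hr') hθ.1
  linear_combination 2 * h1 + 2 * h2

/-- The error of the rough fine solution. -/
theorem SmoothData.fine_error (D : SmoothData lam L1 L2 T u K ux uy ut utt) {h τ C : ℝ}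
    {M1 M2 N kh kt : ℕ} (hh : 0 < h) (hτ : 0 ≤ τ) (hNT : N * τ = T) (hM1 : 1 ≤ M1) (hM2 : 1 ≤ M2)
    (hkh : 1 ≤ kh) (hkt : 1 ≤ kt) (h1 : L1 = h * M1) (h2 : L2 = h * M2)
    {uc uf : ℕ → ℤ → ℤ → ℝ} (S : IsRoughFineSolution (h / kh) M1 M2 N kh kt uc uf)
    (huc : ∀ r ≤ N, IsPeriodicMesh M1 M2 (uc r))
    (H : ∀ r ≤ N, ∑ p ∈ Finset.range M1, ∑ q ∈ Finset.range M2,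
      (ux 0 (((p : ℤ) : ℝ) * h, ((q : ℤ) : ℝ) * h, r * τ) - uc r p q) ^ 2 ≤ M1 * M2 * C)
    {n : ℕ} (hn : n ≤ kt * N) :
    meshInner (h / kh) (kh * M1) (kh * M2)
        (fun i j => u (i * (h / kh)) (j * (h / kh)) (n * (τ / kt)) - uf n i j)
        (fun i j => u (i * (h / kh)) (j * (h / kh)) (n * (τ / kt)) - uf n i j)
      ≤ L1 * L2 * (512 * 27 ^ 4 * (2 * (K * τ ^ 2) ^ 2 + 2 * C)
          + 2 * (43600 * K * h ^ 4) ^ 2) := by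
  have hkh' : (0 : ℝ) < kh := by exact_mod_cast hkh
  have hkt' : (0 : ℝ) < kt := by exact_mod_cast hkt
  set t : ℝ := n * (τ / kt) with ht
  have htT : t ∈ Set.Icc 0 T := by
    have : (n : ℝ) ≤ kt * N := by exact_mod_cast hn
    refine ⟨by positivity, ?_⟩
    calc t ≤ kt * N * (τ / kt) := by rw [ht]; gcongr
      _ = T := by rw [← hNT]; field_simp
  have hagree : (fun i j : ℤ => u (i * (h / kh)) (j * (h / kh)) t - uf n i j)
      = fun i j : ℤ => ux 0 (i * (h / kh), j * (h / kh), t) - uf n i j := by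
    funext i j; rw [D.agree _ _ t htT]
  have hper := D.periodic_mesh (h := h / kh) (M1 := kh * M1) (M2 := kh * M2)
    (by rw [h1]; push_cast; field_simp) (by rw [h2]; push_cast; field_simp) t
  have hpf := S.periodic n hn
  have hperc := D.periodic_mesh h1 h2 t
  have hg : IsPeriodicMesh (kh * M1) (kh * M2)
      fun i j : ℤ => ux 0 (i * (h / kh), j * (h / kh), t) - uf n i j :=
    ⟨fun a b => congrArg₂ (· - ·) (hper.1 a b) (hpf.1 a b),
      fun a b => congrArg₂ (· - ·) (hper.2 a b) (hpf.2 a b)⟩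
  have hd : IsPeriodicMesh M1 M2
      fun p q : ℤ => ux 0 (p * h, q * h, t) - uf n (p * kh) (q * kh) := by
    refine ⟨fun a b => congrArg₂ (· - ·) (hperc.1 a b) ?_,
      fun a b => congrArg₂ (· - ·) (hperc.2 a b) ?_⟩
    · rw [← hpf.1 (a * kh)]; push_cast; congr 1; ring
    · rw [← hpf.2 (a * kh) (b * kh)]; push_cast; congr 1; ring
  -- The fine error is the interpolant of the error at the coarse nodes plus the interpolation error
  -- of the exact solution.
  have key := sum_sq_le_of_interpolant (E := 43600 * K * h ^ 4) hg hd
    fun p hp q hq l hl m hm => by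
      have hI : ∀ l < kh, (l : ℝ) / kh ∈ Set.Icc (0 : ℝ) 1 := fun l hl =>
        ⟨by positivity, (div_le_one hkh').2 (by exact_mod_cast hl.le)⟩
      have e := D.flow.abs_sub_lagrange_le hh.le (((p : ℤ) : ℝ) * h, ((q : ℤ) : ℝ) * h, t)
        (hI l hl) (hI m hm)
      rw [S.space_interp n hn p q (by positivity) (by exact_mod_cast hp) (by positivity)
        (by exact_mod_cast hq) l m hl hm]
      simp only [lagrangeCubic_eq (div_pos hh hkh').ne' (by omega : kh ≠ 0), sub_mul,
        Finset.sum_sub_distrib]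
      have ept : ∀ a b x y : ℝ, ((x, y, t) : ℝ × ℝ × ℝ) + a • eX + b • eY = (x + a, y + b, t) :=
        fun a b x y => by ext <;> simp [eX, eY]
      simp only [ept] at e
      convert e using 1
      rw [sub_sub_sub_cancel_right]
      congr 2
      · congr 1
        push_cast
        ext <;> simp <;> field_simp
      · refine Finset.sum_congr rfl fun i _ => Finset.sum_congr rfl fun j _ => ?_
        congr 3
        push_cast
        ext <;> simp <;> ring
  have node := D.coarse_node_error hτ hNT hM1 hM2 hkt S huc H hn
  rw [hagree, meshInner, h1, h2]
  refine (mul_le_mul_of_nonneg_left key (sq_nonneg _)).trans ?_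
  have e1 : (h / kh) ^ 2 * (kh : ℝ) ^ 2 = h ^ 2 := by field_simp
  rw [← mul_assoc, e1]
  have := mul_le_mul_of_nonneg_left node (by positivity : (0 : ℝ) ≤ h ^ 2 * (512 * 27 ^ 4))
  linear_combination this

end TwoGrid

/-! ### Assembly of the constants. -/

theorem theorem4p3
    (lam L1 L2 T : ℝ) (hlam : 0 < lam) (hL1 : 0 < L1) (hL2 : 0 < L2) (hT : 0 < T)
    (u0 : ℝ → ℝ → ℝ) (u : ℝ → ℝ → ℝ → ℝ)
    (hu : TwoGrid.IsBurgersSolution lam L1 L2 T u0 u)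
    (hreg : TwoGrid.IsC42 T u)
    (kh kt : ℕ) (hkh : 1 ≤ kh) (hkt : 1 ≤ kt) :
    ∃ C : ℝ, 0 < C ∧
      ∀ (M1 M2 N : ℕ) (hc tc hf tf : ℝ),
        1 ≤ M1 → 1 ≤ M2 → 1 ≤ N →
        L1 = hc * M1 → L2 = hc * M2 → tc = T / N → hf = hc / kh → tf = tc / kt →
        ∀ uc vc wc : ℕ → ℤ → ℤ → ℝ,
          TwoGrid.IsCompactSchemeSolution lam hc tc M1 M2 N u0 uc vc wc →
          ∀ uf : ℕ → ℤ → ℤ → ℝ,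
            TwoGrid.IsRoughFineSolution hf M1 M2 N kh kt uc uf →
            ∀ n : ℕ, n ≤ kt * N →
              TwoGrid.meshNorm hf (kh * M1) (kh * M2)
                  (fun i j => u (i * hf) (j * hf) (n * tf) - uf n i j)
                ≤ C * (tf ^ 2 + hf ^ 4) := by
  obtain ⟨K, ux, uy, ut, utt, D⟩ := TwoGrid.exists_smoothData hL1 hL2 hT hu hreg
  obtain ⟨C, hC, H⟩ := D.coarse_error hlam hT hL1 hu.initial
  have hK : 0 ≤ K := D.flow.K_nonneg
  have hkh' : (0 : ℝ) < kh := by exact_mod_cast hkh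
  have hkt' : (0 : ℝ) < kt := by exact_mod_cast hkt
  set Q : ℝ := L1 * L2 * (512 * 27 ^ 4 * (2 * K ^ 2 + 2 * C ^ 2) + 2 * (43600 * K) ^ 2) with hQ
  have hQ0 : 0 ≤ Q := by positivity
  -- The factors kt^2 and kh^4 convert the coarse quantities tc^2 and hc^4 into the fine ones. Q + 1
  -- replaces the square root of Q, as Q ≤ (Q + 1)^2.
  refine ⟨(Q + 1) * ((kt : ℝ) ^ 2 + (kh : ℝ) ^ 4), by positivity, ?_⟩
  intro M1 M2 N hc tc hf tf hM1 hM2 hN h1 h2 htc hhf htf uc vc wc S uf F n hn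
  have hM1' : (0 : ℝ) < M1 := by exact_mod_cast hM1
  have hN' : (0 : ℝ) < N := by exact_mod_cast hN
  have hc0 : 0 < hc := pos_of_mul_pos_left (h1 ▸ hL1) hM1'.le
  have htc0 : 0 < tc := by rw [htc]; positivity
  have hNT : N * tc = T := by rw [htc]; field_simp
  subst hhf htf
  have key := D.fine_error hc0 htc0.le hNT hM1 hM2 hkh hkt h1 h2 F (fun r hr => (S.periodic r hr).1)
    (H hc tc M1 M2 N hM1 hM2 hN h1 h2 htc uc vc wc S) hn
  set ε := tc ^ 2 + hc ^ 4 with hε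
  have hε0 : 0 ≤ ε := by positivity
  have hb1 : (K * tc ^ 2) ^ 2 ≤ (K * ε) ^ 2 := by
    gcongr; rw [hε]; linarith [pow_nonneg hc0.le 4]
  have hb2 : (43600 * K * hc ^ 4) ^ 2 ≤ (43600 * K * ε) ^ 2 := by
    gcongr; rw [hε]; linarith [sq_nonneg tc]
  have hbound : TwoGrid.meshNorm (hc / kh) (kh * M1) (kh * M2)
      (fun i j => u (i * (hc / kh)) (j * (hc / kh)) (n * (tc / kt)) - uf n i j) ≤ (Q + 1) * ε := by
    refine Real.sqrt_le_iff.2 ⟨by positivity, key.trans ?_⟩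
    calc _ ≤ L1 * L2 * (512 * 27 ^ 4 * (2 * (K * ε) ^ 2 + 2 * (C * ε) ^ 2)
            + 2 * (43600 * K * ε) ^ 2) := by gcongr
      _ = Q * ε ^ 2 := by rw [hQ]; ring
      _ ≤ ((Q + 1) * ε) ^ 2 := by rw [mul_pow]; gcongr; nlinarith
  refine hbound.trans ?_
  rw [mul_assoc]
  gcongr
  have e1 : tc ^ 2 = kt ^ 2 * (tc / kt) ^ 2 := by field_simp
  have e2 : hc ^ 4 = kh ^ 4 * (hc / kh) ^ 4 := by field_simp
  rw [hε, e1, e2]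
  have p1 : 0 ≤ (kt : ℝ) ^ 2 * (hc / kh) ^ 4 := by positivity
  have p2 : 0 ≤ (kh : ℝ) ^ 4 * (tc / kt) ^ 2 := by positivity
  linear_combination p1 + p2
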